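/- **Setting.** Let $\mathcal M$ be a Riemannian manifold of dimension $m\ge 1$ with geodesic distance $d_{\mathcal M}$ and Riemannian measure $\mathrm dx$, and let $\mathcal N$ be a Riemannian manifold with geodesic distance $d_{\mathcal N}$. Let $p\in[1,+\infty)$, let $A\subseteq\mathcal M$ be open, and let $u$ be a measurable map from $A$ to $\mathcal N$. For $s\in(0,1)$ put \[ \mathcal E_{s,p}(u,A)=\int_A\int_A\frac{d_{\mathcal N}(u(x),u(y))^p}{d_{\mathcal M}(x,y)^{m+sp}}\,\mathrm dx\,\mathrm dy . \] For $s=1$ fix a smooth isometric embedding $\iota_{\mathcal N}:\mathcal N\to\mathbb R^{\nu}$ and put $\mathcal E_{1,p}(u,A)=\int_A|D(\iota_{\mathcal N}\circ u)|^p\,\mathrm dx$ if the map $\iota_{\mathcal N}\circ u$ is weakly differentiable on $A$ (that is, it is locally integrable and has a locally integrable weak derivative), and $\mathcal E_{1,p}(u,A)=+\infty$ otherwise; here $|\cdot|$ is the Euclidean (Hilbert–Schmidt) norm. For $s\in(0,1]$ put \[ W^{s,p}(\mathcal M,\mathcal N)=\{u:\mathcal M\to\mathcal N \text{ measurable}: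 \mathcal E_{s,p}(u,\mathcal M)<+\infty\}. \] **Theorem.** Let $s,r\in(0,1]$, $p,q\in[1,+\infty)$ and $m\in\mathbb N$ with $m\ge1$. Let $\mathcal M$ be either $\mathbb R^m$ or a nonempty compact $m$-dimensional Riemannian manifold, and let $\mathcal N$ and $\mathcal F$ be Riemannian manifolds, with $\mathcal N$ connected. Assume that $\mathcal N$ is compact if $sp>m$ or if $s=p=m=1$. If $s=1$, fix a smooth isometric embedding of $\mathcal N$ into a Euclidean space, and if $r=1$, fix one of $\mathcal F$. Assume that $rq=sp$ and that $f:\mathcal N\to\mathcal F$ is a Borel measurable map such that \[ f\circ u\in W^{r,q}(\mathcal M,\mathcal F)\qquad\text{for every } u\in W^{s,p}(\mathcal M,\mathcal N). \] Then there exists a constant $C>0$ such that for every measurable map $u:\mathbb B^m\to\mathcal N$ on the unit ball $\mathbb B^m\subset\mathbb R^m$, if either $sp<m$ or $\mathcal E_{s,p}(u,\mathbb B^m)\le 1/C$, then \[ \mathcal E_{r,q}(f\circ u,\mathbb B^m)\le C\,\mathcal E_{s,p}(u,\mathbb B^m). \] -/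

import Mathlib

open MeasureTheory Set Bundle
open scoped Manifold ContDiff ENNReal NNReal Topology

-- Otherwise instance search finds the charted space structure of `ℝ^m` over itself in this wrapper.
attribute [-instance] TopCat.of.chartedSpace

noncomputable section

/-- The Euclidean space `ℝ^m`. -/
abbrev Euc (m : ℕ) : Type := EuclideanSpace ℝ (Fin m)

/-! ### Riemannian measure -/

/-- The normalization for which the `m`-dimensional Hausdorff measure of `ℝ^m` is Lebesgue's. -/
def hausdorffNormalization (m : ℕ) : ℝ≥0∞ :=
  volume (Metric.ball (0 : Euc m) 1) / μH[(m : ℝ)] (Metric.ball (0 : Euc m) 1)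

/-- The Riemannian measure of an `m`-dimensional Riemannian manifold: the normalized
`m`-dimensional Hausdorff measure of its geodesic distance. -/
def riemannianVolume (m : ℕ) (M : Type*) [EMetricSpace M] [MeasurableSpace M] [BorelSpace M] :
    Measure M :=
  hausdorffNormalization m • μH[(m : ℝ)]

/-- On `ℝ^m` the Riemannian measure is Lebesgue measure. -/
theorem riemannianVolume_euc (m : ℕ) : riemannianVolume m (Euc m) = volume := by
  have hH : (μH[(m : ℝ)] : Measure (Euc m)).IsAddHaarMeasure := by
    have h := isAddHaarMeasure_hausdorffMeasure (E := Euc m)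
    rwa [finrank_euclideanSpace_fin] at h
  have e := Measure.isAddLeftInvariant_eq_smul (volume : Measure (Euc m)) μH[(m : ℝ)]
  set c := Measure.addHaarScalarFactor (volume : Measure (Euc m)) μH[(m : ℝ)]
  have h0 : (μH[(m : ℝ)] : Measure (Euc m)) (Metric.ball 0 1) ≠ 0 :=
    (Metric.measure_ball_pos _ _ one_pos).ne'
  have ht : (μH[(m : ℝ)] : Measure (Euc m)) (Metric.ball 0 1) ≠ ⊤ :=
    measure_ball_lt_top.ne
  have hc : hausdorffNormalization m = c := by
    rw [hausdorffNormalization, e, Measure.smul_apply, ENNReal.smul_def, smul_eq_mul,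
      ENNReal.mul_div_cancel_right h0 ht]
  rw [riemannianVolume, hc]
  exact e.symm

/-! ### Weak derivatives -/

/-- `H` is the weak (distributional) derivative on the open set `Ω ⊆ ℝ^m` of the locally
integrable function `h : Ω → ℝ^ν`. -/
def HasWeakDerivOn {m ν : ℕ} (h : Euc m → Euc ν) (H : Euc m → Euc m →L[ℝ] Euc ν)
    (Ω : Set (Euc m)) : Prop :=
  LocallyIntegrableOn h Ω ∧ LocallyIntegrableOn H Ω ∧
    ∀ ψ : Euc m → ℝ, ContDiff ℝ ∞ ψ → HasCompactSupport ψ → tsupport ψ ⊆ Ω →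
      ∀ v : Euc m, ∫ y, (fderiv ℝ ψ y v) • h y = - ∫ y, ψ y • H y v

section Manifold

variable {m : ℕ} {M : Type*} [EMetricSpace M] [ChartedSpace (Euc m) M]

/-- `G` is the weak derivative on the open set `A ⊆ M` of the map `h : A → ℝ^ν`: in every chart
`φ` of `M`, the weak derivative of `h ∘ φ⁻¹` is `(G ∘ φ⁻¹) ∘ D(φ⁻¹)`. -/
def HasWeakMDerivOn {ν : ℕ} (h : M → Euc ν) (G : (x : M) → TangentSpace (𝓡 m) x →L[ℝ] Euc ν)
    (A : Set M) : Prop :=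
  ∀ x₀ : M, HasWeakDerivOn (fun y ↦ h ((chartAt (Euc m) x₀).symm y))
    (fun y ↦ (G ((chartAt (Euc m) x₀).symm y)).comp
      (mfderiv (𝓡 m) (𝓡 m) (chartAt (Euc m) x₀).symm y))
    ((chartAt (Euc m) x₀).target ∩ (chartAt (Euc m) x₀).symm ⁻¹' A)

variable [RiemannianBundle (fun x : M ↦ TangentSpace (𝓡 m) x)]

instance tangentSpace_finiteDimensional (x : M) : FiniteDimensional ℝ (TangentSpace (𝓡 m) x) :=
  inferInstanceAs (FiniteDimensional ℝ (Euc m))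

/-- The Euclidean (Hilbert–Schmidt) norm of a linear map from a tangent space, endowed with the
Riemannian metric, to `ℝ^ν`. -/
def hilbertSchmidtNorm {ν : ℕ} {x : M} (L : TangentSpace (𝓡 m) x →L[ℝ] Euc ν) : ℝ :=
  √(∑ i, ‖L (stdOrthonormalBasis ℝ (TangentSpace (𝓡 m) x) i)‖ ^ 2)

variable [MeasurableSpace M] [BorelSpace M]

/-- The first-order energy `∫_A |Dh|^p` of a map `h : A → ℝ^ν` on the open set `A ⊆ M`. It is
`∞` when `h` is not weakly differentiable on `A`; otherwise the weak derivative is unique almost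
everywhere, and all the terms of the infimum are equal. -/
def dirichletEnergy {ν : ℕ} (p : ℝ) (h : M → Euc ν) (A : Set M) : ℝ≥0∞ :=
  ⨅ (G : (x : M) → TangentSpace (𝓡 m) x →L[ℝ] Euc ν) (_ : HasWeakMDerivOn h G A),
    ∫⁻ x in A, ENNReal.ofReal (hilbertSchmidtNorm (G x) ^ p) ∂(riemannianVolume m M)

end Manifold

/-! ### Sobolev energies of maps between Riemannian manifolds -/

/-- The Gagliardo energy `∫_A ∫_A d(u(x), u(y))^p / d(x, y)^(m + sp) dx dy`. -/
def gagliardoEnergy {M N : Type*} [EMetricSpace M] [MeasurableSpace M] [BorelSpace M]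
    [EMetricSpace N] (m : ℕ) (s p : ℝ) (u : M → N) (A : Set M) : ℝ≥0∞ :=
  ∫⁻ x in A, ∫⁻ y in A, edist (u x) (u y) ^ p / edist x y ^ ((m : ℝ) + s * p)
    ∂(riemannianVolume m M) ∂(riemannianVolume m M)

/-- `ι` embeds the Riemannian manifold `N` smoothly and isometrically, in the Riemannian sense,
into `ℝ^ν`. -/
def IsRiemannianEmbedding {n ν : ℕ} {N : Type*} [EMetricSpace N] [ChartedSpace (Euc n) N]
    [RiemannianBundle (fun x : N ↦ TangentSpace (𝓡 n) x)] (ι : N → Euc ν) : Prop :=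
  Topology.IsEmbedding ι ∧ ContMDiff (𝓡 n) (𝓡 ν) ∞ ι ∧
    ∀ (x : N) (v : TangentSpace (𝓡 n) x), ‖mfderiv (𝓡 n) (𝓡 ν) ι x v‖ = ‖v‖

section Energy

variable (m : ℕ) {M : Type*} [EMetricSpace M] [ChartedSpace (Euc m) M]
  [RiemannianBundle (fun x : M ↦ TangentSpace (𝓡 m) x)] [MeasurableSpace M] [BorelSpace M]
  {N : Type*} [EMetricSpace N] {ν : ℕ}

open Classical in
/-- The Sobolev energy `𝓔_{s,p}(u, A)`, `0 < s ≤ 1`: the Gagliardo energy if `s < 1`, and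
`∫_A |D(ι ∘ u)|^p` if `s = 1`, where `ι` is an isometric embedding of `N` into `ℝ^ν`. -/
def sobolevEnergy (ι : N → Euc ν) (s p : ℝ) (u : M → N) (A : Set M) : ℝ≥0∞ :=
  if s = 1 then dirichletEnergy (m := m) p (fun x ↦ ι (u x)) A else gagliardoEnergy m s p u A

/-- `u ∈ W^{s,p}(M, N)`: the map `u` is measurable and `𝓔_{s,p}(u, M) < ∞`. -/
def MemSobolev [MeasurableSpace N] (ι : N → Euc ν) (s p : ℝ) (u : M → N) : Prop :=
  AEMeasurable u (riemannianVolume m M) ∧ sobolevEnergy m ι s p u univ < ⊤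

end Energy

end

/-! ### Integrals of powers of the distance -/

section Kernel

variable {m : ℕ}

/-! The proof is by contradiction. If no constant works, then for every `Λ` some map on the unit
ball has an image under `f` whose energy exceeds `Λ` times its own. Since `rq = sp`, a dilation by
`ρ` multiplies both energies by the same power of `ρ`, so such a bad ratio survives rescaling and
replication. Bad maps are assembled into a single map of finite energy whose image has infinite
energy, which the hypothesis on `f` forbids.

Opening. A bad map is first made constant outside the ball of radius `16`, by composition with a
Lipschitz retraction of `ℝ^m` onto the unit ball: the inversion in the unit sphere, followed by a
collapse of a neighbourhood of a point `a` onto `a`. For a single `a` the composition may have a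
huge energy; its average over `a` is controlled (`exists_good_openingMap`,
`exists_eucEnergy_opening`, `exists_bad_map`). For `s = 1` the chain rule for weak derivatives also
holds only for good `a`, by an argument of Fuglede type (`HasWeakDerivOn.exists_comp_lipschitz`).

Replication. Packing `k ^ m` shrunken copies in a ball tunes the energy to a prescribed small value
while the energy of the image stays at least `1` (`exists_copies`, `exists_block`).

Common boundary value. The bad maps take different constant values at infinity, and these are
connected to one value `b` at small cost. If `sp < m`, a cutoff function concentrated near a point
is cheap; if `sp = m`, a logarithmic cutoff is, provided that `p > 1`. In the remaining cases `sp >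
m` and `s = p = m = 1`, compactness of `N` yields a cluster value, and close constants are joined
along a short path (`exists_frequently_hasTransition`, `exists_blocks`).

Conclusion. Blocks of energy `2 ^ (-j)` whose images have energy at least `1` are placed in disjoint
balls (`exists_infinite_of_blocks`). The energy of the result is finite because the gluing estimate
`eucEnergy_glue_le` has a constant independent of the number of pieces. On a compact manifold, the
resulting map is transplanted through a chart (`exists_memSobolev_comp_notMem`). -/

theorem volume_closedBall_euc (x : Euc m) {r : ℝ} (hr : 0 ≤ r) :
    volume (Metric.closedBall x r) = ENNReal.ofReal (r ^ m) * volume (Metric.ball (0 : Euc m) 1) :=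
        by
  rw [Measure.addHaar_closedBall _ _ hr, finrank_euclideanSpace_fin]

theorem volume_unitBall_pos : 0 < volume (Metric.ball (0 : Euc m) 1) :=
  Metric.measure_ball_pos _ _ one_pos

theorem volume_unitBall_lt_top : volume (Metric.ball (0 : Euc m) 1) < ⊤ := measure_ball_lt_top

theorem edist_rpow_eq_ofReal {X : Type*} [MetricSpace X] {x y : X} (h : 0 < dist x y) (β : ℝ) :
    edist x y ^ β = ENNReal.ofReal (dist x y ^ β) := by
  rw [edist_dist, ENNReal.ofReal_rpow_of_pos h]

/-- On a dyadic shell a power is constant up to a factor; the absolute value in the exponent treats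
both signs of `β` at once. -/
theorem rpow_le_two_rpow_abs_mul {r s : ℝ} (hs : 0 < s) (h1 : s / 2 ≤ r) (h2 : r ≤ s) (β : ℝ) :
    r ^ β ≤ 2 ^ |β| * s ^ β := by
  have hr : 0 < r := by linarith
  rcases le_total 0 β with hβ | hβ
  · calc r ^ β ≤ s ^ β := Real.rpow_le_rpow hr.le h2 hβ
      _ ≤ 2 ^ |β| * s ^ β := by
        have : (1 : ℝ) ≤ 2 ^ |β| := Real.one_le_rpow (by norm_num) (abs_nonneg _)
        have := Real.rpow_nonneg hs.le β
        nlinarith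
  · calc r ^ β ≤ (s / 2) ^ β := Real.rpow_le_rpow_of_nonpos (by linarith) h1 hβ
      _ = 2 ^ |β| * s ^ β := by
        rw [Real.div_rpow hs.le (by norm_num), abs_of_nonpos hβ, Real.rpow_neg (by norm_num)]
        field_simp

/-- Value `s ^ β` times volume `s ^ m`. Summed over dyadic shells, this gives a geometric series at
infinity or at the origin when `m + β ≠ 0`, and a count of shells when `β = -m`. -/
theorem lintegral_shell_edist_rpow_le (x : Euc m) {s : ℝ} (hs : 0 < s) (β : ℝ) :
    ∫⁻ y in {y | s / 2 ≤ dist x y ∧ dist x y ≤ s}, edist x y ^ β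
      ≤ ENNReal.ofReal (2 ^ |β|) * volume (Metric.ball (0 : Euc m) 1)
        * ENNReal.ofReal (s ^ ((m : ℝ) + β)) := by
  have hms : MeasurableSet {y : Euc m | s / 2 ≤ dist x y ∧ dist x y ≤ s} :=
    measurableSet_Icc.preimage (f := fun y : Euc m ↦ dist x y) (by fun_prop)
  calc ∫⁻ y in {y | s / 2 ≤ dist x y ∧ dist x y ≤ s}, edist x y ^ β
      ≤ ∫⁻ y in {y | s / 2 ≤ dist x y ∧ dist x y ≤ s}, ENNReal.ofReal (2 ^ |β| * s ^ β) := by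
        refine setLIntegral_mono' hms fun y hy ↦ ?_
        rw [edist_rpow_eq_ofReal (by linarith [hy.1])]
        exact ENNReal.ofReal_le_ofReal (rpow_le_two_rpow_abs_mul hs hy.1 hy.2 β)
    _ ≤ ENNReal.ofReal (2 ^ |β| * s ^ β) * volume (Metric.closedBall x s) := by
        rw [setLIntegral_const]
        gcongr
        intro y hy
        rw [Metric.mem_closedBall, dist_comm]
        exact hy.2
    _ = _ := by
        rw [volume_closedBall_euc _ hs.le, ENNReal.ofReal_mul (by positivity),
          Real.rpow_add hs, Real.rpow_natCast, ENNReal.ofReal_mul (by positivity)]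
        ring

theorem tsum_ofReal_geometric_lt_top {q : ℝ} (h1 : q < 1) :
    ∑' k : ℕ, ENNReal.ofReal q ^ k < ⊤ := by
  rw [ENNReal.tsum_geometric]
  refine ENNReal.inv_lt_top.2 (tsub_pos_of_lt ?_)
  rwa [← ENNReal.ofReal_one, ENNReal.ofReal_lt_ofReal_iff one_pos]

/-- Integrability at infinity of `|x - y| ^ (-(m + a))`. -/
theorem exists_lintegral_far_le (m : ℕ) {a : ℝ} (ha : 0 < a) :
    ∃ C : ℝ≥0∞, C < ⊤ ∧ ∀ (x : Euc m) (t : ℝ), 0 < t →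
      ∫⁻ y in {y | t ≤ dist x y}, edist x y ^ (-((m : ℝ) + a)) ≤ C * ENNReal.ofReal (t ^ (-a)) := by
  set c : ℝ≥0∞ := ENNReal.ofReal (2 ^ |(-((m : ℝ) + a))|) * volume (Metric.ball (0 : Euc m) 1)
  set q : ℝ := 2 ^ (-a)
  have hq0 : 0 ≤ q := by positivity
  have hq1 : q < 1 := Real.rpow_lt_one_of_one_lt_of_neg (by norm_num) (by linarith)
  refine ⟨c * ENNReal.ofReal q * ∑' k : ℕ, ENNReal.ofReal q ^ k, ?_, fun x t ht ↦ ?_⟩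
  · exact ENNReal.mul_lt_top (ENNReal.mul_lt_top (ENNReal.mul_lt_top ENNReal.ofReal_lt_top
      volume_unitBall_lt_top) ENNReal.ofReal_lt_top) (tsum_ofReal_geometric_lt_top hq1)
  have hsub : {y : Euc m | t ≤ dist x y} ⊆ ⋃ k : ℕ,
      {y | (2 ^ (k + 1) * t) / 2 ≤ dist x y ∧ dist x y ≤ 2 ^ (k + 1) * t} := by
    intro y hy
    obtain ⟨k, hk1, hk2⟩ := exists_nat_pow_near (x := dist x y / t) (y := 2)
      ((one_le_div ht).2 hy) (by norm_num)
    rw [le_div_iff₀ ht] at hk1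
    rw [div_lt_iff₀ ht] at hk2
    refine mem_iUnion.2 ⟨k, ?_, hk2.le⟩
    rw [pow_succ]
    linarith
  calc ∫⁻ y in {y | t ≤ dist x y}, edist x y ^ (-((m : ℝ) + a))
      ≤ ∫⁻ y in ⋃ k : ℕ, {y | (2 ^ (k + 1) * t) / 2 ≤ dist x y ∧ dist x y ≤ 2 ^ (k + 1) * t},
          edist x y ^ (-((m : ℝ) + a)) := lintegral_mono_set hsub
    _ ≤ ∑' k : ℕ, ∫⁻ y in {y | (2 ^ (k + 1) * t) / 2 ≤ dist x y ∧ dist x y ≤ 2 ^ (k + 1) * t},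
          edist x y ^ (-((m : ℝ) + a)) := lintegral_iUnion_le _ _
    _ ≤ ∑' k : ℕ, c * ENNReal.ofReal ((2 ^ (k + 1) * t) ^ ((m : ℝ) + (-((m : ℝ) + a)))) :=
        ENNReal.tsum_le_tsum fun k ↦ lintegral_shell_edist_rpow_le x (by positivity) _
    _ = ∑' k : ℕ, c * ENNReal.ofReal q * ENNReal.ofReal (t ^ (-a)) * ENNReal.ofReal q ^ k := by
        congr 1 with k
        rw [show (m : ℝ) + (-((m : ℝ) + a)) = -a by ring, Real.mul_rpow (by positivity) ht.le,
          ← Real.rpow_natCast, ← Real.rpow_mul (by norm_num), mul_comm ((k + 1 : ℕ) : ℝ),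
          Real.rpow_mul (by norm_num), Real.rpow_natCast, pow_succ,
          ENNReal.ofReal_mul (by positivity), ENNReal.ofReal_mul (by positivity),
          ENNReal.ofReal_pow hq0]
        ring
    _ = _ := by
        rw [ENNReal.tsum_mul_left]
        ring

/-- Integrability at the origin of `|x - y| ^ (a - m)`. -/
theorem exists_lintegral_near_le (m : ℕ) {a : ℝ} (ha : 0 < a) :
    ∃ C : ℝ≥0∞, C < ⊤ ∧ ∀ (x : Euc m) (t : ℝ), 0 < t →
      ∫⁻ y in {y | y ≠ x ∧ dist x y ≤ t}, edist x y ^ (a - m) ≤ C * ENNReal.ofReal (t ^ a) := by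
  set c : ℝ≥0∞ := ENNReal.ofReal (2 ^ |a - m|) * volume (Metric.ball (0 : Euc m) 1)
  set q : ℝ := 2 ^ (-a)
  have hq0 : 0 ≤ q := by positivity
  have hq1 : q < 1 := Real.rpow_lt_one_of_one_lt_of_neg (by norm_num) (by linarith)
  refine ⟨c * ∑' k : ℕ, ENNReal.ofReal q ^ k, ?_, fun x t ht ↦ ?_⟩
  · exact ENNReal.mul_lt_top (ENNReal.mul_lt_top ENNReal.ofReal_lt_top
      volume_unitBall_lt_top) (tsum_ofReal_geometric_lt_top hq1)
  -- No dyadic shell contains the centre, which is why it is excluded from the domain of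
  -- integration.
  have hsub : {y : Euc m | y ≠ x ∧ dist x y ≤ t} ⊆ ⋃ k : ℕ,
      {y | (t / 2 ^ k) / 2 ≤ dist x y ∧ dist x y ≤ t / 2 ^ k} := by
    intro y hy
    have hd : 0 < dist x y := dist_pos.2 hy.1.symm
    obtain ⟨k, hk1, hk2⟩ := exists_nat_pow_near (x := t / dist x y) (y := 2)
      ((one_le_div hd).2 hy.2) (by norm_num)
    rw [le_div_iff₀ hd] at hk1
    rw [div_lt_iff₀ hd, pow_succ] at hk2
    refine mem_iUnion.2 ⟨k, ?_, ?_⟩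
    · rw [div_div, div_le_iff₀ (by positivity)]
      linarith
    · rw [le_div_iff₀ (by positivity)]
      linarith
  calc ∫⁻ y in {y | y ≠ x ∧ dist x y ≤ t}, edist x y ^ (a - m)
      ≤ ∫⁻ y in ⋃ k : ℕ, {y | (t / 2 ^ k) / 2 ≤ dist x y ∧ dist x y ≤ t / 2 ^ k},
          edist x y ^ (a - m) := lintegral_mono_set hsub
    _ ≤ ∑' k : ℕ, ∫⁻ y in {y | (t / 2 ^ k) / 2 ≤ dist x y ∧ dist x y ≤ t / 2 ^ k},
          edist x y ^ (a - m) := lintegral_iUnion_le _ _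
    _ ≤ ∑' k : ℕ, c * ENNReal.ofReal ((t / 2 ^ k) ^ ((m : ℝ) + (a - m))) :=
        ENNReal.tsum_le_tsum fun k ↦ lintegral_shell_edist_rpow_le x (by positivity) _
    _ = ∑' k : ℕ, c * ENNReal.ofReal (t ^ a) * ENNReal.ofReal q ^ k := by
        congr 1 with k
        rw [show (m : ℝ) + (a - m) = a by ring, Real.div_rpow ht.le (by positivity),
          ← Real.rpow_natCast, ← Real.rpow_mul (by norm_num), mul_comm (k : ℝ),
          div_eq_mul_inv, ← Real.rpow_neg (by norm_num), ← neg_mul,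
          Real.rpow_mul (by norm_num), Real.rpow_natCast,
          ENNReal.ofReal_mul (by positivity), ENNReal.ofReal_pow hq0]
        ring
    _ = _ := by
        rw [ENNReal.tsum_mul_left]
        ring

/-- At the borderline exponent all shells contribute equally, and `k + 1` of them cover the annulus.
This linear growth competes with the factor `k ^ (-p)` coming from the normalization of logarithmic
cutoffs. -/
theorem exists_lintegral_log_le (m : ℕ) :
    ∃ C : ℝ≥0∞, C < ⊤ ∧ ∀ (x : Euc m) (k : ℕ),
      ∫⁻ y in {y | (2 ^ k)⁻¹ ≤ dist x y ∧ dist x y ≤ 1}, edist x y ^ (-(m : ℝ))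
        ≤ C * (k + 1) := by
  set c : ℝ≥0∞ := ENNReal.ofReal (2 ^ |(-(m : ℝ))|) * volume (Metric.ball (0 : Euc m) 1)
  refine ⟨c, ENNReal.mul_lt_top ENNReal.ofReal_lt_top volume_unitBall_lt_top, fun x k ↦ ?_⟩
  have hsub : {y : Euc m | (2 ^ k)⁻¹ ≤ dist x y ∧ dist x y ≤ 1} ⊆ ⋃ i ∈ Finset.range (k + 1),
      {y | ((2 ^ i)⁻¹ : ℝ) / 2 ≤ dist x y ∧ dist x y ≤ (2 ^ i)⁻¹} := by
    intro y hy
    have hd : 0 < dist x y := lt_of_lt_of_le (by positivity) hy.1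
    obtain ⟨i, hi1, hi2⟩ := exists_nat_pow_near (x := (dist x y)⁻¹) (y := 2)
      ((one_le_inv₀ hd).2 hy.2) (by norm_num)
    refine mem_iUnion₂.2 ⟨i, ?_, ?_, ?_⟩
    · have : (2 : ℝ) ^ i ≤ 2 ^ k := hi1.trans ((inv_le_comm₀ (by positivity) hd).1 hy.1)
      have := (pow_le_pow_iff_right₀ (by norm_num : (1 : ℝ) < 2)).1 this
      simp; omega
    · have := (inv_lt_comm₀ hd (by positivity)).1 hi2
      rw [pow_succ, mul_inv] at this
      linarith
    · exact (le_inv_comm₀ hd (by positivity)).2 hi1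
  calc ∫⁻ y in {y | (2 ^ k)⁻¹ ≤ dist x y ∧ dist x y ≤ 1}, edist x y ^ (-(m : ℝ))
      ≤ ∫⁻ y in ⋃ i ∈ Finset.range (k + 1),
          {y | ((2 ^ i)⁻¹ : ℝ) / 2 ≤ dist x y ∧ dist x y ≤ (2 ^ i)⁻¹},
          edist x y ^ (-(m : ℝ)) := lintegral_mono_set hsub
    _ ≤ ∑ i ∈ Finset.range (k + 1),
          ∫⁻ y in {y | ((2 ^ i)⁻¹ : ℝ) / 2 ≤ dist x y ∧ dist x y ≤ (2 ^ i)⁻¹},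
          edist x y ^ (-(m : ℝ)) := by
        rw [← Finset.tsum_subtype (Finset.range (k + 1)) (fun i : ℕ ↦
          ∫⁻ y in {y | ((2 ^ i)⁻¹ : ℝ) / 2 ≤ dist x y ∧ dist x y ≤ (2 ^ i)⁻¹},
          edist x y ^ (-(m : ℝ)))]
        have := lintegral_iUnion_le (μ := volume) (fun i : Finset.range (k + 1) ↦
          {y : Euc m | ((2 ^ (i : ℕ))⁻¹ : ℝ) / 2 ≤ dist x y ∧ dist x y ≤ (2 ^ (i : ℕ))⁻¹})
          (fun y ↦ edist x y ^ (-(m : ℝ)))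
        rwa [iUnion_subtype (fun i ↦ i ∈ Finset.range (k + 1)) (fun i ↦
          {y : Euc m | ((2 ^ (i : ℕ))⁻¹ : ℝ) / 2 ≤ dist x y ∧ dist x y ≤ (2 ^ (i : ℕ))⁻¹})] at this
    _ ≤ ∑ i ∈ Finset.range (k + 1), c := by
        refine Finset.sum_le_sum fun i _ ↦
          (lintegral_shell_edist_rpow_le x (by positivity) _).trans ?_
        simp [c]
    _ = _ := by simp [mul_comm]

end Kernel

/-! ### Images of Lebesgue measure under Lipschitz maps -/

section Pushforward

variable {m : ℕ}

/-- Lebesgue measure is a multiple of Hausdorff measure, for which the bound requires neither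
measurability of the set nor differentiability of the map. -/
theorem volume_image_le_of_lipschitzOnWith {K : ℝ≥0} {f : Euc m → Euc m} {s : Set (Euc m)}
    (hf : LipschitzOnWith K f s) : volume (f '' s) ≤ (K : ℝ≥0∞) ^ m * volume s := by
  rw [← riemannianVolume_euc, riemannianVolume, Measure.smul_apply, Measure.smul_apply,
    smul_eq_mul, smul_eq_mul]
  have := hf.hausdorffMeasure_image_le (d := m) (by positivity)
  rw [ENNReal.rpow_natCast] at this
  calc _ ≤ hausdorffNormalization m * ((K : ℝ≥0∞) ^ m * μH[m] s) := by gcongr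
    _ = _ := by ring

/-- Change of variables inequality along a map with a Lipschitz left inverse. -/
theorem setLIntegral_comp_le_of_lipschitz_leftInvOn {K : ℝ≥0} {R S : Euc m → Euc m}
    {s t : Set (Euc m)} (hR : Measurable R) (hst : MapsTo R s t)
    (hS : LipschitzOnWith K S t) (hSR : ∀ x ∈ s, S (R x) = x) {g : Euc m → ℝ≥0∞}
    (hg : Measurable g) : ∫⁻ x in s, g (R x) ≤ (K : ℝ≥0∞) ^ m * ∫⁻ z in t, g z := by
  have hle : (volume.restrict s).map R ≤ (K : ℝ≥0∞) ^ m • volume.restrict t := by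
    refine Measure.le_iff.2 fun A hA ↦ ?_
    rw [Measure.map_apply hR hA, Measure.restrict_apply (hR hA), Measure.smul_apply,
      Measure.restrict_apply hA, smul_eq_mul]
    refine le_trans (measure_mono ?_)
      (volume_image_le_of_lipschitzOnWith (hS.mono (inter_subset_right (s := A))))
    rintro x ⟨hx, hxs⟩
    exact ⟨R x, ⟨hx, hst hxs⟩, hSR x hxs⟩
  calc ∫⁻ x in s, g (R x) = ∫⁻ z, g z ∂((volume.restrict s).map R) := (lintegral_map hg hR).symm
    _ ≤ ∫⁻ z, g z ∂((K : ℝ≥0∞) ^ m • volume.restrict t) := lintegral_mono' hle le_rfl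
    _ = _ := by rw [lintegral_smul_measure, smul_eq_mul]

end Pushforward

/-! ### Gagliardo energies on `ℝ^m` -/

section Gagliardo

variable {m : ℕ} {N : Type*} [EMetricSpace N]

/-- The integrand of the Gagliardo energy with total order of differentiability `σ = sp`. -/
noncomputable def gagKernel (σ p : ℝ) (u : Euc m → N) (x y : Euc m) : ℝ≥0∞ :=
  edist (u x) (u y) ^ p / edist x y ^ ((m : ℝ) + σ)

/-- The Gagliardo energy on `ℝ^m` with total order of differentiability `σ = sp`. -/
noncomputable def gagEnergy (σ p : ℝ) (u : Euc m → N) (A : Set (Euc m)) : ℝ≥0∞ :=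
  ∫⁻ x in A, ∫⁻ y in A, gagKernel σ p u x y

theorem gagliardoEnergy_euc (s p : ℝ) (u : Euc m → N) (A : Set (Euc m)) :
    gagliardoEnergy m s p u A = gagEnergy (s * p) p u A := by
  rw [gagliardoEnergy, riemannianVolume_euc]
  rfl

theorem gagKernel_comm (σ p : ℝ) (u : Euc m → N) (x y : Euc m) :
    gagKernel σ p u x y = gagKernel σ p u y x := by
  rw [gagKernel, gagKernel, edist_comm, edist_comm x]

theorem gagKernel_eq_zero {σ p : ℝ} (hp : 0 < p) {u : Euc m → N} {x y : Euc m} (h : u x = u y) :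
    gagKernel σ p u x y = 0 := by
  simp [gagKernel, h, hp]

theorem gagKernel_eq_mul (σ p : ℝ) (u : Euc m → N) (x y : Euc m) :
    gagKernel σ p u x y = edist (u x) (u y) ^ p * edist x y ^ (-((m : ℝ) + σ)) := by
  rw [gagKernel, div_eq_mul_inv, ENNReal.rpow_neg]

theorem gagEnergy_mono (σ p : ℝ) (u : Euc m → N) {A B : Set (Euc m)} (h : A ⊆ B) :
    gagEnergy σ p u A ≤ gagEnergy σ p u B :=
  (lintegral_mono fun _ ↦ lintegral_mono_set h).trans (lintegral_mono_set h)

theorem gagEnergy_congr_ae (σ p : ℝ) {u v : Euc m → N} {A : Set (Euc m)}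
    (h : u =ᵐ[volume.restrict A] v) : gagEnergy σ p u A = gagEnergy σ p v A := by
  refine lintegral_congr_ae ?_
  filter_upwards [h] with x hx
  refine lintegral_congr_ae ?_
  filter_upwards [h] with y hy
  simp [gagKernel, hx, hy]

/-- Interactions between different pieces are discarded. This is the direction needed to bound
energies of images from below. -/
theorem tsum_gagEnergy_le {I : Type*} [Countable I] (σ p : ℝ) (u : Euc m → N) {A : Set (Euc m)}
    {B : I → Set (Euc m)} (hB : ∀ i, MeasurableSet (B i)) (hd : Pairwise (Function.onFun Disjoint
        B))
    (hBA : ∀ i, B i ⊆ A) : ∑' i, gagEnergy σ p u (B i) ≤ gagEnergy σ p u A :=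
  calc ∑' i, gagEnergy σ p u (B i)
      ≤ ∑' i, ∫⁻ x in B i, ∫⁻ y in A, gagKernel σ p u x y :=
        ENNReal.tsum_le_tsum fun i ↦ lintegral_mono fun _ ↦ lintegral_mono_set (hBA i)
    _ = ∫⁻ x in ⋃ i, B i, ∫⁻ y in A, gagKernel σ p u x y := (lintegral_iUnion hB hd _).symm
    _ ≤ _ := lintegral_mono_set (iUnion_subset hBA)

/-- The affine similarity `x ↦ c + ρ x`. -/
noncomputable def similarity (c : Euc m) (ρ : ℝ) (x : Euc m) : Euc m := c + ρ • x

theorem continuous_similarity (c : Euc m) (ρ : ℝ) : Continuous (similarity c ρ) := by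
  unfold similarity; fun_prop

theorem edist_similarity (c : Euc m) {ρ : ℝ} (hρ : 0 < ρ) (x y : Euc m) :
    edist (similarity c ρ x) (similarity c ρ y) = ENNReal.ofReal ρ * edist x y := by
  rw [similarity, similarity, edist_add_left, edist_smul₀, ENNReal.smul_def, smul_eq_mul]
  congr 1
  rw [← enorm_eq_nnnorm, Real.enorm_of_nonneg hρ.le]

theorem measurableEmbedding_similarity (c : Euc m) {ρ : ℝ} (hρ : 0 < ρ) :
    MeasurableEmbedding (similarity c ρ) :=
  (((Homeomorph.smulOfNeZero ρ hρ.ne').trans (Homeomorph.addLeft c) :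
    Euc m ≃ₜ Euc m)).measurableEmbedding

theorem map_similarity_volume (c : Euc m) {ρ : ℝ} (hρ : 0 < ρ) :
    (volume : Measure (Euc m)).map (similarity c ρ) = ENNReal.ofReal (ρ ^ (-(m : ℝ))) • volume := by
  have h1 : similarity c ρ = (fun x ↦ c + x) ∘ (fun x ↦ ρ • x) := rfl
  rw [h1, ← Measure.map_map (by fun_prop) (by fun_prop), Measure.map_addHaar_smul _ hρ.ne',
    Measure.map_smul, map_add_left_eq_self, finrank_euclideanSpace_fin, abs_of_pos (by positivity),
    Real.rpow_neg hρ.le, Real.rpow_natCast]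

theorem setLIntegral_comp_similarity (c : Euc m) {ρ : ℝ} (hρ : 0 < ρ) (g : Euc m → ℝ≥0∞)
    (A : Set (Euc m)) : ∫⁻ x in similarity c ρ ⁻¹' A, g (similarity c ρ x)
      = ENNReal.ofReal (ρ ^ (-(m : ℝ))) * ∫⁻ z in A, g z := by
  rw [← (measurableEmbedding_similarity c hρ).lintegral_map,
    ← (measurableEmbedding_similarity c hρ).restrict_map, map_similarity_volume c hρ,
    Measure.restrict_smul, lintegral_smul_measure, smul_eq_mul]

/-- The kernel contributes the exponent `m + σ` and each of the two changes of variables `-m`. Only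
the product `σ = sp` enters, hence the scaling is the same for `(s, p)` and `(r, q)`. -/
theorem gagEnergy_comp_similarity (σ p : ℝ) (u : Euc m → N) (A : Set (Euc m)) (c : Euc m) {ρ : ℝ}
    (hρ : 0 < ρ) : gagEnergy σ p (u ∘ similarity c ρ) (similarity c ρ ⁻¹' A)
      = ENNReal.ofReal (ρ ^ (σ - m)) * gagEnergy σ p u A := by
  have hk : ∀ x y : Euc m, gagKernel σ p (u ∘ similarity c ρ) x y =
      ENNReal.ofReal (ρ ^ ((m : ℝ) + σ)) *
        gagKernel σ p u (similarity c ρ x) (similarity c ρ y) := by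
    intro x y
    rw [gagKernel_eq_mul, gagKernel_eq_mul, edist_similarity c hρ,
      ENNReal.mul_rpow_of_ne_top ENNReal.ofReal_ne_top (edist_ne_top _ _),
      ENNReal.ofReal_rpow_of_pos hρ]
    have h1 : ENNReal.ofReal (ρ ^ ((m : ℝ) + σ)) * ENNReal.ofReal (ρ ^ (-((m : ℝ) + σ))) = 1 := by
      rw [← ENNReal.ofReal_mul (by positivity), ← Real.rpow_add hρ]
      simp
    calc _ = 1 * (edist (u (similarity c ρ x)) (u (similarity c ρ y)) ^ p *
          edist x y ^ (-((m : ℝ) + σ))) := by simp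
      _ = _ := by rw [← h1]; ring
  simp only [gagEnergy, hk]
  have h2 : ∀ x, ∫⁻ y in similarity c ρ ⁻¹' A, ENNReal.ofReal (ρ ^ ((m : ℝ) + σ)) *
      gagKernel σ p u (similarity c ρ x) (similarity c ρ y) =
      ENNReal.ofReal (ρ ^ ((m : ℝ) + σ)) * (ENNReal.ofReal (ρ ^ (-(m : ℝ))) *
        ∫⁻ z in A, gagKernel σ p u (similarity c ρ x) z) := fun x ↦ by
    rw [lintegral_const_mul' _ _ ENNReal.ofReal_ne_top, setLIntegral_comp_similarity c hρ]
  simp only [h2]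
  rw [lintegral_const_mul' _ _ ENNReal.ofReal_ne_top, lintegral_const_mul' _ _
      ENNReal.ofReal_ne_top,
    setLIntegral_comp_similarity c hρ (fun x ↦ ∫⁻ z in A, gagKernel σ p u x z),
    ← mul_assoc, ← mul_assoc, ← ENNReal.ofReal_mul (by positivity), ← Real.rpow_add hρ,
    ← ENNReal.ofReal_mul (by positivity), ← Real.rpow_add hρ]
  congr 3
  ring

variable [SecondCountableTopology N] [MeasurableSpace N] [BorelSpace N]

theorem measurable_gagKernel (σ p : ℝ) {u : Euc m → N} (hu : Measurable u) :
    Measurable (fun z : Euc m × Euc m ↦ gagKernel σ p u z.1 z.2) := by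
  unfold gagKernel
  exact (((hu.comp measurable_fst).edist (hu.comp measurable_snd)).pow_const _).div
    ((measurable_fst.edist measurable_snd).pow_const _)

/-- Monotone convergence in each variable separately; two indices are merged by taking their
maximum. It serves to replace the unit ball by a slightly smaller one. -/
theorem gagEnergy_iUnion_le (σ p : ℝ) {u : Euc m → N} (hu : Measurable u) {A : ℕ → Set (Euc m)}
    (hA : Monotone A) {K : ℝ≥0∞} (hK : ∀ n, gagEnergy σ p u (A n) ≤ K) :
    gagEnergy σ p u (⋃ n, A n) ≤ K := by
  have hd : Directed (· ⊆ ·) A := directed_of_isDirected_le hA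
  have h1 : ∀ x, ∫⁻ y in ⋃ n, A n, gagKernel σ p u x y = ⨆ k, ∫⁻ y in A k, gagKernel σ p u x y :=
    fun x ↦ setLIntegral_iUnion_of_directed _ hd
  rw [gagEnergy, setLIntegral_iUnion_of_directed _ hd]
  refine iSup_le fun n ↦ ?_
  simp only [h1]
  rw [lintegral_iSup (fun k ↦ (measurable_gagKernel σ p hu).lintegral_prod_right')
    (fun i j hij x ↦ lintegral_mono_set (hA hij))]
  exact iSup_le fun k ↦ le_trans ((lintegral_mono_set (hA (le_max_left n k))).trans
    (lintegral_mono fun x ↦ lintegral_mono_set (hA (le_max_right n k)))) (hK (max n k))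

theorem ENNReal.add_three_rpow_le (a b c : ℝ≥0∞) {p : ℝ} (hp : 0 ≤ p) :
    (a + b + c) ^ p ≤ 3 ^ p * (a ^ p + b ^ p + c ^ p) := by
  have key : a + b + c ≤ 3 * max a (max b c) := by
    have h1 : a ≤ max a (max b c) := le_max_left _ _
    have h2 : b ≤ max a (max b c) := (le_max_left _ _).trans (le_max_right _ _)
    have h3 : c ≤ max a (max b c) := (le_max_right _ _).trans (le_max_right _ _)
    calc a + b + c ≤ max a (max b c) + max a (max b c) + max a (max b c) := by gcongr
      _ = _ := by ring
  calc (a + b + c) ^ p ≤ (3 * max a (max b c)) ^ p := ENNReal.rpow_le_rpow key hp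
    _ = 3 ^ p * (max a (max b c)) ^ p := ENNReal.mul_rpow_of_nonneg _ _ hp
    _ ≤ _ := by
      gcongr
      rcases max_cases a (max b c) with ⟨h, -⟩ | ⟨h, -⟩ <;> rw [h]
      · rw [add_assoc]; exact le_self_add
      · rcases max_cases b c with ⟨h, -⟩ | ⟨h, -⟩ <;> rw [h]
        · rw [add_comm (a ^ p), add_assoc]; exact le_self_add
        · exact le_add_self

/-! ### Gluing of maps along disjoint sets -/

open Classical in
/-- The map which is `u i` on `B i`, and `t` outside the `B i`. -/
noncomputable def glue {X Y I : Type*} (t : X → Y) (B : I → Set X) (u : I → X → Y) (x : X) : Y :=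
  if h : ∃ i, x ∈ B i then u h.choose x else t x

theorem glue_of_mem {X Y I : Type*} {t : X → Y} {B : I → Set X} {u : I → X → Y} {x : X} {i : I}
    (hd : Pairwise (Function.onFun Disjoint B)) (hx : x ∈ B i) : glue t B u x = u i x := by
  have h : ∃ i, x ∈ B i := ⟨i, hx⟩
  have : h.choose = i := by
    by_contra hne
    exact (disjoint_left.1 (hd hne)) h.choose_spec hx
  rw [glue, dif_pos h, this]

theorem glue_of_notMem {X Y I : Type*} {t : X → Y} {B : I → Set X} {u : I → X → Y} {x : X}
    (hx : ∀ i, x ∉ B i) : glue t B u x = t x := by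
  rw [glue, dif_neg (by simpa using hx)]

theorem measurable_glue {X Y I : Type*} [MeasurableSpace X] [MeasurableSpace Y] [Countable I]
    {t : X → Y} {B : I → Set X} {u : I → X → Y} (hd : Pairwise (Function.onFun Disjoint B))
    (hB : ∀ i, MeasurableSet (B i)) (ht : Measurable t) (hu : ∀ i, Measurable (u i)) :
    Measurable (glue t B u) := by
  intro s hs
  have : glue t B u ⁻¹' s = (⋃ i, B i ∩ u i ⁻¹' s) ∪ ((⋃ i, B i)ᶜ ∩ t ⁻¹' s) := by
    ext x
    by_cases h : ∃ i, x ∈ B i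
    · obtain ⟨i, hi⟩ := h
      simp only [mem_preimage, glue_of_mem hd hi, mem_union, mem_iUnion, mem_inter_iff,
          mem_compl_iff]
      constructor
      · exact fun h ↦ Or.inl ⟨i, hi, h⟩
      · rintro (⟨j, hj, h⟩ | ⟨h, -⟩)
        · by_cases hij : j = i
          · exact hij ▸ h
          · exact absurd hi (disjoint_left.1 (hd hij) hj)
        · exact absurd ⟨i, hi⟩ h
    · push Not at h
      simp [glue_of_notMem h, h]
  rw [this]
  exact (MeasurableSet.iUnion fun i ↦ (hB i).inter (hu i hs)).union
    ((MeasurableSet.iUnion hB).compl.inter (ht hs))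

/-- For `x ∈ B i` and `y ∈ B j` with `i ≠ j`, one has `u i y = b i = t x` and `u j x = b j = t y`.
The triangle inequality through `b i` and `b j` bounds the increment of the glued map by those of `u
i`, `t` and `u j`. Each pair of points thus involves at most three increments, so the constant `3 ^
p` does not depend on the number of pieces. -/
theorem gagEnergy_glue_le {I : Type*} [Countable I] (σ : ℝ) {p : ℝ} (hp : 0 < p) {t : Euc m → N}
    {B : I → Set (Euc m)} {u : I → Euc m → N} {b : I → N}
    (hd : Pairwise (Function.onFun Disjoint B)) (ht : Measurable t) (hu : ∀ i, Measurable (u i))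
    (htb : ∀ i, ∀ x ∈ B i, t x = b i) (hub : ∀ i, ∀ x ∉ B i, u i x = b i) :
    gagEnergy σ p (glue t B u) univ
      ≤ 3 ^ p * (gagEnergy σ p t univ + ∑' i, gagEnergy σ p (u i) univ) := by
  have hpt : ∀ x y, gagKernel σ p (glue t B u) x y
      ≤ 3 ^ p * (gagKernel σ p t x y + ∑' i, gagKernel σ p (u i) x y) := by
    intro x y
    simp only [gagKernel, div_eq_mul_inv, ENNReal.tsum_mul_right, ← add_mul, ← mul_assoc]
    gcongr
    have h3 : (1 : ℝ≥0∞) ≤ 3 ^ p := ENNReal.one_le_rpow (by norm_num) hp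
    have hle : ∀ i, edist (u i x) (u i y) ^ p ≤ ∑' i, edist (u i x) (u i y) ^ p :=
      fun i ↦ ENNReal.le_tsum i
    have triv : ∀ a : ℝ≥0∞, a ≤ edist (t x) (t y) ^ p + ∑' i, edist (u i x) (u i y) ^ p →
        a ≤ 3 ^ p * (edist (t x) (t y) ^ p + ∑' i, edist (u i x) (u i y) ^ p) := fun a ha ↦
      ha.trans (le_mul_of_one_le_left (by simp) h3)
    by_cases hx : ∃ i, x ∈ B i
    · obtain ⟨i, hi⟩ := hx
      rw [glue_of_mem hd hi]
      by_cases hy : ∃ j, y ∈ B j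
      · obtain ⟨j, hj⟩ := hy
        rw [glue_of_mem hd hj]
        by_cases hij : i = j
        · subst hij
          exact triv _ ((hle i).trans le_add_self)
        · have hyi : y ∉ B i := fun h ↦ disjoint_left.1 (hd hij) h hj
          have hxj : x ∉ B j := fun h ↦ disjoint_left.1 (hd hij) hi h
          have e1 : edist (u i x) (u j y) ≤
              edist (u i x) (u i y) + edist (t x) (t y) + edist (u j x) (u j y) := by
            rw [hub i y hyi, hub j x hxj, htb i x hi, htb j y hj]
            exact (edist_triangle4 _ _ _ _)
          refine (ENNReal.rpow_le_rpow e1 hp.le).trans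
            ((ENNReal.add_three_rpow_le _ _ _ hp.le).trans ?_)
          refine mul_le_mul' le_rfl ?_
          rw [add_comm (edist (u i x) (u i y) ^ p), add_assoc]
          gcongr
          classical
          calc _ = ∑ k ∈ {i, j}, edist (u k x) (u k y) ^ p := by
                rw [Finset.sum_pair hij]
            _ ≤ _ := ENNReal.sum_le_tsum _
      · push Not at hy
        rw [glue_of_notMem hy]
        have e1 : edist (u i x) (t y) ≤ edist (u i x) (u i y) + edist (t x) (t y) + 0 := by
          rw [hub i y (hy i), htb i x hi, add_zero]
          exact edist_triangle _ _ _
        refine (ENNReal.rpow_le_rpow e1 hp.le).trans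
          ((ENNReal.add_three_rpow_le _ _ _ hp.le).trans ?_)
        refine mul_le_mul' le_rfl ?_
        rw [ENNReal.zero_rpow_of_pos hp, add_zero, add_comm]
        gcongr
        exact hle i
    · push Not at hx
      rw [glue_of_notMem hx]
      by_cases hy : ∃ j, y ∈ B j
      · obtain ⟨j, hj⟩ := hy
        rw [glue_of_mem hd hj]
        have e1 : edist (t x) (u j y) ≤ edist (u j x) (u j y) + edist (t x) (t y) + 0 := by
          rw [hub j x (hx j), htb j y hj, add_zero, add_comm]
          exact edist_triangle _ _ _
        refine (ENNReal.rpow_le_rpow e1 hp.le).trans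
          ((ENNReal.add_three_rpow_le _ _ _ hp.le).trans ?_)
        refine mul_le_mul' le_rfl ?_
        rw [ENNReal.zero_rpow_of_pos hp, add_zero, add_comm]
        gcongr
        exact hle j
      · push Not at hy
        rw [glue_of_notMem hy]
        exact triv _ le_self_add
  have hmt : ∀ x, Measurable (gagKernel σ p t x) := fun x ↦
    (measurable_gagKernel σ p ht).of_uncurry_left (x := x)
  have hmu : ∀ i x, Measurable (gagKernel σ p (u i) x) := fun i x ↦
    (measurable_gagKernel σ p (hu i)).of_uncurry_left (x := x)
  have h3 : (3 : ℝ≥0∞) ^ p ≠ ⊤ := ENNReal.rpow_ne_top_of_nonneg hp.le (by norm_num)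
  calc gagEnergy σ p (glue t B u) univ
      ≤ ∫⁻ x in univ, ∫⁻ y in univ,
          3 ^ p * (gagKernel σ p t x y + ∑' i, gagKernel σ p (u i) x y) :=
        lintegral_mono fun x ↦ lintegral_mono fun y ↦ hpt x y
    _ = _ := by
        simp only [lintegral_const_mul' _ _ h3, gagEnergy]
        congr 1
        rw [← lintegral_tsum (fun i ↦
            ((measurable_gagKernel σ p (hu i)).lintegral_prod_right').aemeasurable),
          ← lintegral_add_left ((measurable_gagKernel σ p ht).lintegral_prod_right')]
        refine lintegral_congr fun x ↦ ?_
        rw [lintegral_add_left (hmt x), lintegral_tsum fun i ↦ (hmu i x).aemeasurable]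

end Gagliardo

/-! ### Composition of fractional Sobolev maps with Lipschitz maps -/

section GagliardoComposition

variable {m : ℕ} {N : Type*} [EMetricSpace N]

/-- The ball of radius `ρ / 2` about `(1 - ρ / 2) z`, that is `z` pushed slightly towards the
origin, lies in both balls. -/
theorem volume_unitBall_inter_ge {z : Euc m} (hz : z ∈ Metric.closedBall (0 : Euc m) 1) {ρ : ℝ}
    (h0 : 0 < ρ) (h1 : ρ ≤ 1) :
    ENNReal.ofReal ((ρ / 2) ^ m) * volume (Metric.ball (0 : Euc m) 1)
      ≤ volume (Metric.closedBall (0 : Euc m) 1 ∩ Metric.closedBall z ρ) := by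
  rw [mem_closedBall_zero_iff] at hz
  rw [← volume_closedBall_euc ((1 - ρ / 2) • z) (by positivity)]
  refine measure_mono fun y hy ↦ ?_
  rw [Metric.mem_closedBall] at hy
  have e1 : dist ((1 - ρ / 2) • z) 0 ≤ 1 - ρ / 2 := by
    rw [dist_zero_right, norm_smul, Real.norm_of_nonneg (by linarith)]
    nlinarith
  have e2 : dist ((1 - ρ / 2) • z) z ≤ ρ / 2 := by
    rw [dist_eq_norm, show (1 - ρ / 2) • z - z = (-(ρ / 2)) • z by module, norm_smul, norm_neg,
      Real.norm_of_nonneg (by linarith)]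
    nlinarith
  constructor <;> rw [Metric.mem_closedBall]
  · linarith [dist_triangle y ((1 - ρ / 2) • z) 0]
  · linarith [dist_triangle y ((1 - ρ / 2) • z) z]

/-- The `p`-th power of the oscillation of `u` between `R x` and `z`, divided by
`|x - y| ^ (2m + σ)`, cut off where `|z - R x| > M |x - y|`. -/
noncomputable def threePointKernel (σ p M : ℝ) (u : Euc m → N) (R : Euc m → Euc m)
    (x y z : Euc m) : ℝ≥0∞ :=
  {q : Euc m × Euc m × Euc m | dist q.2.2 (R q.1) ≤ M * dist q.1 q.2.1}.indicator (fun q ↦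
    edist (u (R q.1)) (u q.2.2) ^ p * edist q.1 q.2.1 ^ (-((m : ℝ) + (m + σ)))) (x, y, z)

theorem threePointKernel_of_le {σ p M : ℝ} {u : Euc m → N} {R : Euc m → Euc m} {x y z : Euc m}
    (h : dist z (R x) ≤ M * dist x y) : threePointKernel σ p M u R x y z =
      edist (u (R x)) (u z) ^ p * edist x y ^ (-((m : ℝ) + (m + σ))) := by
  rw [threePointKernel, indicator_of_mem (by exact h)]

variable [SecondCountableTopology N] [MeasurableSpace N] [BorelSpace N]

theorem measurable_threePointKernel (σ p M : ℝ) {u : Euc m → N} {R : Euc m → Euc m}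
    (hu : Measurable u) (hR : Measurable R) :
    Measurable (fun q : Euc m × Euc m × Euc m ↦ threePointKernel σ p M u R q.1 q.2.1 q.2.2) := by
  refine Measurable.indicator ?_ (measurableSet_le (by fun_prop) (by fun_prop))
  exact (((hu.comp (hR.comp measurable_fst)).edist
    (hu.comp (measurable_snd.comp measurable_snd))).pow_const _).mul
    ((measurable_fst.edist (measurable_fst.comp measurable_snd)).pow_const _)

theorem measurable_threePointKernel_yz (σ p M : ℝ) {u : Euc m → N} {R : Euc m → Euc m}
    (hu : Measurable u) (hR : Measurable R) (x : Euc m) :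
    Measurable (fun q : Euc m × Euc m ↦ threePointKernel σ p M u R x q.1 q.2) :=
  (measurable_threePointKernel σ p M hu hR).comp (f := fun q : Euc m × Euc m ↦ (x, q.1, q.2))
    (by fun_prop)

theorem measurable_threePointKernel_z (σ p M : ℝ) {u : Euc m → N} {R : Euc m → Euc m}
    (hu : Measurable u) (hR : Measurable R) (x y : Euc m) :
    Measurable (threePointKernel σ p M u R x y) :=
  (measurable_threePointKernel σ p M hu hR).comp (f := fun z : Euc m ↦ (x, y, z)) (by fun_prop)

theorem measurable_lintegral_threePointKernel (σ p M : ℝ) {u : Euc m → N} {R : Euc m → Euc m}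
    (hu : Measurable u) (hR : Measurable R) (D : Set (Euc m)) :
    Measurable (fun q : Euc m × Euc m ↦ ∫⁻ z in D, threePointKernel σ p M u R q.1 q.2 z) := by
  have : Measurable (fun q : (Euc m × Euc m) × Euc m ↦
      threePointKernel σ p M u R q.1.1 q.1.2 q.2) :=
    (measurable_threePointKernel σ p M hu hR).comp
      (f := fun q : (Euc m × Euc m) × Euc m ↦ (q.1.1, q.1.2, q.2)) (by fun_prop)
  exact this.lintegral_prod_right'

/-- The values at `R x` and `R y` are compared through the value at a third point `z`, and the
inequality is integrated over the `z` within `ρ` of `R x`. These are within `(L + 1)|x - y|` of both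
`R x` and `R y`, so the cutoff in the kernel is inactive. -/
theorem edist_rpow_mul_volume_le {σ p : ℝ} (hp : 1 ≤ p) {L : ℝ≥0} {u : Euc m → N}
    {R : Euc m → Euc m} (hu : Measurable u) (hR : LipschitzWith L R) {x y : Euc m} {ρ : ℝ}
    (hρd : ρ ≤ dist x y) :
    edist (u (R x)) (u (R y)) ^ p * edist x y ^ (-((m : ℝ) + (m + σ))) *
        volume (Metric.closedBall (0 : Euc m) 1 ∩ Metric.closedBall (R x) ρ)
      ≤ 2 ^ (p - 1) *
        ((∫⁻ z in Metric.closedBall 0 1, threePointKernel σ p (L + 1) u R x y z) +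
          ∫⁻ z in Metric.closedBall 0 1, threePointKernel σ p (L + 1) u R y x z) := by
  have hSm : MeasurableSet (Metric.closedBall (0 : Euc m) 1 ∩ Metric.closedBall (R x) ρ) :=
    Metric.isClosed_closedBall.measurableSet.inter Metric.isClosed_closedBall.measurableSet
  rw [← setLIntegral_const,
    ← lintegral_add_left (measurable_threePointKernel_z σ p (L + 1) hu hR.continuous.measurable x
        y),
    ← lintegral_const_mul' _ _ (ENNReal.rpow_ne_top_of_nonneg (by linarith) (by norm_num))]
  refine (setLIntegral_mono' hSm fun z hz ↦ ?_).trans (lintegral_mono_set inter_subset_left)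
  have hzx : dist z (R x) ≤ ρ := hz.2
  have hRxy : dist (R x) (R y) ≤ L * dist x y := hR.dist_le_mul x y
  have m1 : dist z (R x) ≤ (L + 1) * dist x y := by
    have := mul_nonneg L.coe_nonneg (dist_nonneg (x := x) (y := y))
    linarith
  have m2 : dist z (R y) ≤ (L + 1) * dist y x := by
    rw [dist_comm y x]
    linarith [dist_triangle z (R x) (R y)]
  rw [threePointKernel_of_le m1, threePointKernel_of_le m2, edist_comm y x, ← add_mul, ← mul_assoc]
  gcongr
  exact (ENNReal.rpow_le_rpow (edist_triangle_right _ _ (u z)) (by linarith)).trans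
    (ENNReal.rpow_add_le_mul_rpow_add_rpow _ _ hp)

/-- The three-point inequality is used with radius `|x - y| / (2r)`, which is at most `1`. The
volume of the set of admissible `z` is then at least of order `|x - y| ^ m`, which turns the
exponent `2m + σ` of the three-point kernel into `m + σ`. -/
theorem exists_gagKernel_comp_le (m : ℕ) {p σ : ℝ} (hp : 1 ≤ p) (L : ℝ≥0) {r : ℝ} (hr : 1 ≤ r) :
    ∃ K : ℝ≥0∞, K < ⊤ ∧ ∀ (u : Euc m → N) (R : Euc m → Euc m), Measurable u → LipschitzWith L R →
      (∀ x, R x ∈ Metric.closedBall (0 : Euc m) 1) → ∀ x ∈ Metric.closedBall (0 : Euc m) r,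
      ∀ y ∈ Metric.closedBall (0 : Euc m) r, gagKernel σ p (u ∘ R) x y ≤
        K * ((∫⁻ z in Metric.closedBall 0 1, threePointKernel σ p (L + 1) u R x y z) +
          ∫⁻ z in Metric.closedBall 0 1, threePointKernel σ p (L + 1) u R y x z) := by
  have hp0 : 0 < p := by linarith
  have hr0 : 0 < r := by linarith
  set v₁ : ℝ≥0∞ := volume (Metric.ball (0 : Euc m) 1)
  have hv0 : v₁ ≠ 0 := volume_unitBall_pos.ne'
  have hvt : v₁ ≠ ⊤ := volume_unitBall_lt_top.ne
  refine ⟨2 ^ (p - 1) * ENNReal.ofReal ((4 * r) ^ m) * v₁⁻¹, (ENNReal.mul_ne_top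
    (ENNReal.mul_ne_top (ENNReal.rpow_ne_top_of_nonneg (by linarith) (by norm_num))
      ENNReal.ofReal_ne_top) (ENNReal.inv_ne_top.2 hv0)).lt_top, fun u R hu hR hRD x hx y hy ↦ ?_⟩
  rcases eq_or_ne x y with rfl | hxy
  · rw [gagKernel_eq_zero hp0 rfl]; exact zero_le
  have hd : 0 < dist x y := dist_pos.2 hxy
  have hd2 : dist x y ≤ 2 * r := by
    have := dist_triangle_right x y 0
    have h1 := Metric.mem_closedBall.1 hx
    have h2 := Metric.mem_closedBall.1 hy
    linarith
  have hρ0 : 0 < dist x y / (2 * r) := by positivity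
  have hρ1 : dist x y / (2 * r) ≤ 1 := (div_le_one (by positivity)).2 hd2
  have hρd : dist x y / (2 * r) ≤ dist x y := div_le_self hd.le (by linarith)
  have hvS := volume_unitBall_inter_ge (hRD x) hρ0 hρ1
  have key := edist_rpow_mul_volume_le (σ := σ) hp hu hR hρd
  set S := Metric.closedBall (0 : Euc m) 1 ∩ Metric.closedBall (R x) (dist x y / (2 * r))
  generalize (∫⁻ z in Metric.closedBall 0 1, threePointKernel σ p (L + 1) u R x y z) +
    ∫⁻ z in Metric.closedBall 0 1, threePointKernel σ p (L + 1) u R y x z = J at *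
  have hm' : edist x y ^ (-((m : ℝ) + σ)) =
      edist x y ^ (-((m : ℝ) + (m + σ))) * ENNReal.ofReal (dist x y ^ m) := by
    rw [edist_rpow_eq_ofReal hd, edist_rpow_eq_ofReal hd, ← ENNReal.ofReal_mul (by positivity),
      ← Real.rpow_natCast, ← Real.rpow_add hd]
    congr 2
    ring
  have hv' : ENNReal.ofReal (dist x y ^ m) ≤ ENNReal.ofReal ((4 * r) ^ m) * v₁⁻¹ * volume S := by
    calc ENNReal.ofReal (dist x y ^ m)
        = ENNReal.ofReal ((4 * r) ^ m) * (v₁⁻¹ * v₁) *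
            ENNReal.ofReal ((dist x y / (2 * r) / 2) ^ m) := by
          rw [ENNReal.inv_mul_cancel hv0 hvt, mul_one, ← ENNReal.ofReal_mul (by positivity),
            ← mul_pow]
          congr 2
          field_simp
          norm_num
      _ = ENNReal.ofReal ((4 * r) ^ m) * v₁⁻¹ *
            (ENNReal.ofReal ((dist x y / (2 * r) / 2) ^ m) * v₁) := by ring
      _ ≤ _ := by gcongr
  rw [gagKernel_eq_mul, hm']
  calc _ ≤ edist ((u ∘ R) x) ((u ∘ R) y) ^ p * (edist x y ^ (-((m : ℝ) + (m + σ))) *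
        (ENNReal.ofReal ((4 * r) ^ m) * v₁⁻¹ * volume S)) := by gcongr
    _ = ENNReal.ofReal ((4 * r) ^ m) * v₁⁻¹ *
        (edist (u (R x)) (u (R y)) ^ p * edist x y ^ (-((m : ℝ) + (m + σ))) * volume S) := by
      simp only [Function.comp]; ring
    _ ≤ ENNReal.ofReal ((4 * r) ^ m) * v₁⁻¹ * (2 ^ (p - 1) * J) := by gcongr
    _ = _ := by ring

/-- Integration in `y` comes first: the cutoff forces `|x - y| ≥ |z - R x| / M`, and integrating `|x
- y| ^ (-(2m + σ))` over this region yields a multiple of `|z - R x| ^ (-(m + σ))`, the Gagliardo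
kernel between `R x` and `z`. -/
theorem exists_lintegral_threePointKernel_le (m : ℕ) {p σ : ℝ} (hp : 0 < p) (hσ : 0 < σ) {M : ℝ}
    (hM : 0 < M) : ∃ C : ℝ≥0∞, C < ⊤ ∧ ∀ (u : Euc m → N) (R : Euc m → Euc m) (B D : Set (Euc m)),
      Measurable u → Measurable R → ∀ x,
      ∫⁻ y in B, ∫⁻ z in D, threePointKernel σ p M u R x y z
        ≤ C * ∫⁻ z in D, gagKernel σ p u (R x) z := by
  obtain ⟨C₁, hC₁, hfar⟩ := exists_lintegral_far_le m (a := (m : ℝ) + σ) (by positivity)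
  have hC₂ : C₁ * ENNReal.ofReal (M ^ ((m : ℝ) + σ)) < ⊤ :=
    ENNReal.mul_lt_top hC₁ ENNReal.ofReal_lt_top
  refine ⟨C₁ * ENNReal.ofReal (M ^ ((m : ℝ) + σ)), hC₂, fun u R B D hu hR x ↦ ?_⟩
  rw [lintegral_lintegral_swap (measurable_threePointKernel_yz σ p M hu hR x).aemeasurable,
    ← lintegral_const_mul' _ _ hC₂.ne]
  refine lintegral_mono fun z ↦ ?_
  rcases eq_or_ne (R x) z with h | h
  · have : ∀ y, threePointKernel σ p M u R x y z = 0 := fun y ↦ by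
      simp only [threePointKernel, indicator_apply, ← h, edist_self, ENNReal.zero_rpow_of_pos hp,
        zero_mul, ite_self]
    simp [this]
  have hd : 0 < dist (R x) z := dist_pos.2 h
  calc ∫⁻ y in B, threePointKernel σ p M u R x y z
      ≤ ∫⁻ y, {y | dist (R x) z / M ≤ dist x y}.indicator (fun y ↦
          edist (u (R x)) (u z) ^ p * edist x y ^ (-((m : ℝ) + (m + σ)))) y := by
        refine (setLIntegral_le_lintegral _ _).trans (lintegral_mono fun y ↦ ?_)
        by_cases h' : dist z (R x) ≤ M * dist x y
        · rw [threePointKernel_of_le h', indicator_of_mem]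
          rwa [mem_ofPred_eq, div_le_iff₀ hM, mul_comm (dist x y), dist_comm (R x)]
        · rw [threePointKernel, indicator_of_notMem (by exact h')]
          exact zero_le
    _ = ∫⁻ y in {y | dist (R x) z / M ≤ dist x y},
          edist (u (R x)) (u z) ^ p * edist x y ^ (-((m : ℝ) + (m + σ))) :=
        lintegral_indicator (measurableSet_le (by fun_prop) (by fun_prop)) _
    _ = edist (u (R x)) (u z) ^ p * ∫⁻ y in {y | dist (R x) z / M ≤ dist x y},
          edist x y ^ (-((m : ℝ) + (m + σ))) := lintegral_const_mul _ (by fun_prop)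
    _ ≤ edist (u (R x)) (u z) ^ p *
          (C₁ * ENNReal.ofReal ((dist (R x) z / M) ^ (-((m : ℝ) + σ)))) := by
        gcongr
        exact hfar x _ (by positivity)
    _ = _ := by
        rw [gagKernel_eq_mul, edist_rpow_eq_ofReal hd, Real.div_rpow hd.le hM.le, div_eq_mul_inv,
          ← Real.rpow_neg hM.le, neg_neg, ENNReal.ofReal_mul (by positivity)]
        ring

/-- The Gagliardo energy of `u ∘ R` is controlled by the integral of the composition with `R` of the
energy density of `u`. -/
theorem exists_gagEnergy_comp_le (m : ℕ) {p σ : ℝ} (hp : 1 ≤ p) (hσ : 0 < σ) (L : ℝ≥0) {r : ℝ}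
    (hr : 1 ≤ r) :
    ∃ C : ℝ≥0∞, C < ⊤ ∧ ∀ (u : Euc m → N) (R : Euc m → Euc m), Measurable u → LipschitzWith L R →
      (∀ x, R x ∈ Metric.closedBall (0 : Euc m) 1) →
      gagEnergy σ p (u ∘ R) (Metric.closedBall 0 r) ≤
        C * ∫⁻ x in Metric.closedBall 0 r, ∫⁻ z in Metric.closedBall 0 1, gagKernel σ p u (R x) z :=
            by
  obtain ⟨K, hKt, h1⟩ := exists_gagKernel_comp_le (N := N) m (σ := σ) hp L hr
  obtain ⟨C, hC, h2⟩ := exists_lintegral_threePointKernel_le (N := N) m (p := p) (by linarith) hσ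
    (M := L + 1) (by positivity)
  refine ⟨K * (2 * C), ENNReal.mul_lt_top hKt (ENNReal.mul_lt_top (by norm_num) hC),
    fun u R hu hR hRD ↦ ?_⟩
  have h1 := h1 u R hu hR hRD
  have h2 := h2 u R (Metric.closedBall 0 r) (Metric.closedBall 0 1) hu hR.continuous.measurable
  have hJm := measurable_lintegral_threePointKernel σ p (L + 1) hu hR.continuous.measurable
    (Metric.closedBall 0 1)
  have hBm : MeasurableSet (Metric.closedBall (0 : Euc m) r) :=
    Metric.isClosed_closedBall.measurableSet
  generalize hJ : (fun x y ↦ ∫⁻ z in Metric.closedBall 0 1,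
    threePointKernel σ p (L + 1) u R x y z) = J at *
  have hJ' : ∀ x y, ∫⁻ z in Metric.closedBall 0 1,
    threePointKernel σ p (L + 1) u R x y z = J x y := fun x y ↦ by rw [← hJ]
  simp only [hJ'] at h1 h2 hJm
  set B := Metric.closedBall (0 : Euc m) r
  calc gagEnergy σ p (u ∘ R) B ≤ ∫⁻ x in B, ∫⁻ y in B, K * (J x y + J y x) :=
        setLIntegral_mono' hBm fun x hx ↦ setLIntegral_mono' hBm fun y hy ↦ h1 x hx y hy
    _ = K * ∫⁻ x in B, ((∫⁻ y in B, J x y) + ∫⁻ y in B, J y x) := by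
        rw [← lintegral_const_mul' _ _ hKt.ne]
        refine lintegral_congr fun x ↦ ?_
        rw [lintegral_const_mul' _ _ hKt.ne, lintegral_add_left]
        exact hJm.comp (measurable_const.prodMk measurable_id)
    _ = K * (2 * ∫⁻ x in B, ∫⁻ y in B, J x y) := by
        rw [lintegral_add_left hJm.lintegral_prod_right', two_mul,
          lintegral_lintegral_swap (f := fun x y ↦ J y x) (hJm.comp measurable_swap).aemeasurable]
    _ ≤ K * (2 * ∫⁻ x in B, C * ∫⁻ z in Metric.closedBall 0 1, gagKernel σ p u (R x) z) := by
        gcongr with x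
        exact h2 x
    _ = _ := by
        rw [lintegral_const_mul' _ _ hC.ne]
        ring

end GagliardoComposition

/-! ### Fractional energies of maps that are constant outside a ball -/

section GagliardoConst

variable {m : ℕ} {N : Type*} [EMetricSpace N]

theorem volume_annulus_ge (hm : 1 ≤ m) (c : Euc m) {r : ℝ} (hr : 0 < r) :
    ENNReal.ofReal ((r / 4) ^ m) * volume (Metric.ball (0 : Euc m) 1) ≤
      volume (Metric.closedBall c (2 * r) \ Metric.closedBall c r) := by
  obtain ⟨e, he⟩ : ∃ e : Euc m, ‖e‖ = 3 * r / 2 :=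
    ⟨EuclideanSpace.single ⟨0, hm⟩ (3 * r / 2), by simp [abs_of_pos hr]⟩
  rw [← volume_closedBall_euc (c + e) (by positivity)]
  refine measure_mono fun y hy ↦ ?_
  rw [Metric.mem_closedBall] at hy
  have h1 : dist (c + e) c = 3 * r / 2 := by rw [dist_eq_norm]; simpa using he
  rw [mem_sdiff, Metric.mem_closedBall, Metric.mem_closedBall, not_le]
  constructor
  · linarith [dist_triangle y (c + e) c]
  · linarith [dist_triangle_left (c + e) c y]

/-- A fractional Poincaré inequality. Each point of the ball interacts with the surrounding annulus,
where `u = b`, at distances at most `3r`; this interaction alone controls `edist (u x) b ^ p`. -/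
theorem exists_lintegral_edist_const_le (m : ℕ) (hm : 1 ≤ m) (σ p : ℝ) (hσ : 0 < σ) {r : ℝ}
    (hr : 0 < r) : ∃ C : ℝ≥0∞, C < ⊤ ∧ ∀ (u : Euc m → N) (c : Euc m) (b : N),
      (∀ x ∉ Metric.closedBall c r, u x = b) →
      ∫⁻ x in Metric.closedBall c r, edist (u x) b ^ p
        ≤ C * gagEnergy σ p u (Metric.closedBall c (2 * r)) := by
  set K : ℝ≥0∞ := ENNReal.ofReal ((3 * r) ^ (-((m : ℝ) + σ))) *
    (ENNReal.ofReal ((r / 4) ^ m) * volume (Metric.ball (0 : Euc m) 1)) with hK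
  have hK0 : K ≠ 0 := by
    have := (volume_unitBall_pos (m := m)).ne'
    have h1 : 0 < (3 * r) ^ (-((m : ℝ) + σ)) := by positivity
    have h2 : 0 < (r / 4) ^ m := by positivity
    simp only [hK, ne_eq, mul_eq_zero, ENNReal.ofReal_eq_zero, not_or, not_le]
    exact ⟨h1, h2, this⟩
  have hKt : K ≠ ⊤ := ENNReal.mul_ne_top ENNReal.ofReal_ne_top
    (ENNReal.mul_ne_top ENNReal.ofReal_ne_top volume_unitBall_lt_top.ne)
  refine ⟨K⁻¹, ENNReal.inv_lt_top.2 (pos_iff_ne_zero.2 hK0), fun u c b hub ↦ ?_⟩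
  set P := Metric.closedBall c r
  set Q := Metric.closedBall c (2 * r)
  have hPm : MeasurableSet P := Metric.isClosed_closedBall.measurableSet
  have hQm : MeasurableSet Q := Metric.isClosed_closedBall.measurableSet
  have hPQ : P ⊆ Q := Metric.closedBall_subset_closedBall (by linarith)
  have key : ∀ x ∈ P, edist (u x) b ^ p * K ≤ ∫⁻ y in Q, gagKernel σ p u x y := by
    intro x hx
    calc edist (u x) b ^ p * K ≤ edist (u x) b ^ p *
          (ENNReal.ofReal ((3 * r) ^ (-((m : ℝ) + σ))) * volume (Q \ P)) := by
          rw [hK]; gcongr; exact volume_annulus_ge hm c hr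
      _ = ∫⁻ y in Q \ P, edist (u x) b ^ p * ENNReal.ofReal ((3 * r) ^ (-((m : ℝ) + σ))) := by
          rw [setLIntegral_const, mul_assoc]
      _ ≤ ∫⁻ y in Q \ P, gagKernel σ p u x y := by
          refine setLIntegral_mono' (hQm.diff hPm) fun y hy ↦ ?_
          have hxy : x ≠ y := fun h ↦ hy.2 (h ▸ hx)
          have hd : 0 < dist x y := dist_pos.2 hxy
          have hd3 : dist x y ≤ 3 * r := by
            have h1 := Metric.mem_closedBall.1 hx
            have h2 := Metric.mem_closedBall.1 hy.1
            linarith [dist_triangle_right x y c]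
          rw [gagKernel_eq_mul, hub y hy.2, edist_rpow_eq_ofReal hd]
          refine mul_le_mul' le_rfl (ENNReal.ofReal_le_ofReal
            (Real.rpow_le_rpow_of_nonpos hd hd3 ?_))
          have : (0 : ℝ) ≤ m := Nat.cast_nonneg m
          linarith
      _ ≤ _ := lintegral_mono_set sdiff_subset
  calc ∫⁻ x in P, edist (u x) b ^ p = K⁻¹ * ∫⁻ x in P, edist (u x) b ^ p * K := by
        rw [lintegral_mul_const' _ _ hKt, mul_comm _ K, ← mul_assoc, ENNReal.inv_mul_cancel hK0 hKt,
          one_mul]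
    _ ≤ K⁻¹ * ∫⁻ x in P, ∫⁻ y in Q, gagKernel σ p u x y := by
        gcongr 1
        exact setLIntegral_mono' hPm key
    _ ≤ _ := by
        gcongr
        exact lintegral_mono_set hPQ

variable [SecondCountableTopology N] [MeasurableSpace N] [BorelSpace N]

/-- If `u` is constant outside a ball, its energy on the whole space is controlled by the energy on
the ball of twice the radius. -/
theorem exists_gagEnergy_univ_le (m : ℕ) (hm : 1 ≤ m) {σ p : ℝ} (hσ : 0 < σ) (hp : 0 < p) {r : ℝ}
    (hr : 0 < r) : ∃ C : ℝ≥0∞, C < ⊤ ∧ ∀ (u : Euc m → N) (c : Euc m) (b : N), Measurable u →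
      (∀ x ∉ Metric.closedBall c r, u x = b) →
      gagEnergy σ p u univ ≤ C * gagEnergy σ p u (Metric.closedBall c (2 * r)) := by
  obtain ⟨C₁, hC₁, h₁⟩ := exists_lintegral_edist_const_le (N := N) m hm σ p hσ hr
  obtain ⟨C₂, hC₂, h₂⟩ := exists_lintegral_far_le m hσ
  set K := C₂ * ENNReal.ofReal (r ^ (-σ))
  have hKt : K < ⊤ := ENNReal.mul_lt_top hC₂ ENNReal.ofReal_lt_top
  refine ⟨1 + 2 * (K * C₁), ENNReal.add_lt_top.2 ⟨by simp, ENNReal.mul_lt_top (by norm_num)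
    (ENNReal.mul_lt_top hKt hC₁)⟩, fun u c b hu hub ↦ ?_⟩
  set P := Metric.closedBall c r
  set Q := Metric.closedBall c (2 * r)
  have hPm : MeasurableSet P := Metric.isClosed_closedBall.measurableSet
  have hQm : MeasurableSet Q := Metric.isClosed_closedBall.measurableSet
  have hPQ : P ⊆ Q := Metric.closedBall_subset_closedBall (by linarith)
  set f : Euc m × Euc m → ℝ≥0∞ := fun z ↦ gagKernel σ p u z.1 z.2
  have hf : Measurable f := measurable_gagKernel σ p hu
  -- Two points outside `P` do not interact. Outside `Q ×ˢ Q` there remain only the pairs with one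
  -- point in `P` and the other off `Q`, at mutual distance at least `r`.
  have hsplit : ∀ z : Euc m × Euc m, f z ≤ (Q ×ˢ Q).indicator f z +
      ((P ×ˢ Qᶜ).indicator f z + (Qᶜ ×ˢ P).indicator f z) := by
    rintro ⟨x, y⟩
    by_cases hx : x ∈ Q <;> by_cases hy : y ∈ Q
    · simp [indicator, hx, hy]
    · by_cases hxP : x ∈ P
      · simp [indicator, hx, hy, hxP]
      · have : f (x, y) = 0 :=
          gagKernel_eq_zero hp ((hub x hxP).trans (hub y fun h ↦ hy (hPQ h)).symm)
        simp [this]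
    · by_cases hyP : y ∈ P
      · simp [indicator, hx, hy, hyP]
      · have : f (x, y) = 0 :=
          gagKernel_eq_zero hp ((hub x fun h ↦ hx (hPQ h)).trans (hub y hyP).symm)
        simp [this]
    · have : f (x, y) = 0 := gagKernel_eq_zero hp
        ((hub x fun h ↦ hx (hPQ h)).trans (hub y fun h ↦ hy (hPQ h)).symm)
      simp [this]
  have hprod : ∀ {S T : Set (Euc m)}, MeasurableSet S → MeasurableSet T →
      ∫⁻ z, (S ×ˢ T).indicator f z ∂(volume.prod volume) =
        ∫⁻ x in S, ∫⁻ y in T, gagKernel σ p u x y := by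
    intro S T hS hT
    rw [lintegral_indicator (hS.prod hT), ← Measure.prod_restrict, lintegral_prod _ hf.aemeasurable]
  have hcross : ∫⁻ x in P, ∫⁻ y in Qᶜ, gagKernel σ p u x y ≤ K * (C₁ * gagEnergy σ p u Q) := by
    calc ∫⁻ x in P, ∫⁻ y in Qᶜ, gagKernel σ p u x y ≤ ∫⁻ x in P, K * edist (u x) b ^ p := by
          refine setLIntegral_mono' hPm fun x hx ↦ ?_
          calc ∫⁻ y in Qᶜ, gagKernel σ p u x y
              = ∫⁻ y in Qᶜ, edist (u x) b ^ p * edist x y ^ (-((m : ℝ) + σ)) := by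
                refine setLIntegral_congr_fun hQm.compl fun y hy ↦ ?_
                simp only [gagKernel_eq_mul, hub y fun h ↦ hy (hPQ h)]
            _ ≤ ∫⁻ y in {y | r ≤ dist x y}, edist (u x) b ^ p * edist x y ^ (-((m : ℝ) + σ)) := by
                refine lintegral_mono_set fun y hy ↦ ?_
                have h1 := Metric.mem_closedBall.1 hx
                have h2 : ¬ dist y c ≤ 2 * r := hy
                rw [mem_ofPred_eq]
                linarith [dist_triangle_left y c x]
            _ = edist (u x) b ^ p * ∫⁻ y in {y | r ≤ dist x y}, edist x y ^ (-((m : ℝ) + σ)) :=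
                lintegral_const_mul _ (by fun_prop)
            _ ≤ edist (u x) b ^ p * K := by gcongr; exact h₂ x r hr
            _ = _ := mul_comm _ _
      _ = K * ∫⁻ x in P, edist (u x) b ^ p := lintegral_const_mul' _ _ hKt.ne
      _ ≤ _ := by gcongr; exact h₁ u c b hub
  have hcross' : ∫⁻ x in Qᶜ, ∫⁻ y in P, gagKernel σ p u x y ≤ K * (C₁ * gagEnergy σ p u Q) := by
    rw [lintegral_lintegral_swap hf.aemeasurable]
    simpa only [gagKernel_comm σ p u] using hcross
  calc gagEnergy σ p u univ = ∫⁻ z, f z ∂(volume.prod volume) := by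
        rw [gagEnergy, lintegral_prod _ hf.aemeasurable]; simp [f]
    _ ≤ ∫⁻ z, ((Q ×ˢ Q).indicator f z +
      ((P ×ˢ Qᶜ).indicator f z + (Qᶜ ×ˢ P).indicator f z)) ∂(volume.prod volume) :=
        lintegral_mono hsplit
    _ = gagEnergy σ p u Q + ((∫⁻ x in P, ∫⁻ y in Qᶜ, gagKernel σ p u x y) +
          ∫⁻ x in Qᶜ, ∫⁻ y in P, gagKernel σ p u x y) := by
        rw [lintegral_add_left (hf.indicator (hQm.prod hQm)),
          lintegral_add_left (hf.indicator (hPm.prod hQm.compl)), hprod hQm hQm,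
          hprod hPm hQm.compl, hprod hQm.compl hPm]
        rfl
    _ ≤ gagEnergy σ p u Q + (K * (C₁ * gagEnergy σ p u Q) + K * (C₁ * gagEnergy σ p u Q)) := by
        gcongr
    _ = _ := by ring

end GagliardoConst

/-! ### Scalar cutoff functions and their fractional energies -/

section Cutoff

variable {m : ℕ}

theorem gagEnergy_comp_lipschitz_le {N N' : Type*} [EMetricSpace N] [EMetricSpace N'] (σ : ℝ)
    {p : ℝ} (hp : 0 ≤ p) {K : ℝ≥0} {γ : N' → N} (hγ : LipschitzWith K γ) (θ : Euc m → N')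
    (A : Set (Euc m)) :
    gagEnergy σ p (γ ∘ θ) A ≤ (K : ℝ≥0∞) ^ p * gagEnergy σ p θ A := by
  have hK : (K : ℝ≥0∞) ^ p ≠ ⊤ := ENNReal.rpow_ne_top_of_nonneg hp ENNReal.coe_ne_top
  rw [gagEnergy, gagEnergy, ← lintegral_const_mul' _ _ hK]
  refine lintegral_mono fun x ↦ ?_
  rw [← lintegral_const_mul' _ _ hK]
  refine lintegral_mono fun y ↦ ?_
  rw [gagKernel_eq_mul, gagKernel_eq_mul, ← mul_assoc, ← ENNReal.mul_rpow_of_nonneg _ _ hp]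
  gcongr
  exact hγ (θ x) (θ y)

/-- Near the diagonal the kernel is at most `|x - y| ^ (p - σ - m)` up to a constant, which is
integrable because `σ < p`; when `σ = sp` this means `s < 1`. Vanishing off a ball takes care of
infinity. -/
theorem gagEnergy_lipschitz_lt_top (hm : 1 ≤ m) {σ p : ℝ} (hσ : 0 < σ) (hσp : σ < p) {L : ℝ≥0}
    {θ : Euc m → ℝ} (hθ : LipschitzWith L θ) {r : ℝ} (hr : 0 < r)
    (h0 : ∀ x ∉ Metric.closedBall (0 : Euc m) r, θ x = 0) : gagEnergy σ p θ univ < ⊤ := by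
  have hp : 0 < p := hσ.trans hσp
  obtain ⟨C, hC, h⟩ := exists_gagEnergy_univ_le (N := ℝ) m hm hσ hp hr
  obtain ⟨C', hC', h'⟩ := exists_lintegral_near_le m (a := p - σ) (by linarith)
  refine (h θ 0 0 hθ.continuous.measurable h0).trans_lt (ENNReal.mul_lt_top hC ?_)
  set Q := Metric.closedBall (0 : Euc m) (2 * r)
  have hQm : MeasurableSet Q := Metric.isClosed_closedBall.measurableSet
  have hL : (L : ℝ≥0∞) ^ p ≠ ⊤ := ENNReal.rpow_ne_top_of_nonneg hp.le ENNReal.coe_ne_top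
  have key : ∀ x ∈ Q, ∫⁻ y in Q, gagKernel σ p θ x y
      ≤ (L : ℝ≥0∞) ^ p * (C' * ENNReal.ofReal ((4 * r) ^ (p - σ))) := by
    intro x hx
    calc ∫⁻ y in Q, gagKernel σ p θ x y
        ≤ ∫⁻ y in Q, {y | y ≠ x ∧ dist x y ≤ 4 * r}.indicator
            (fun y ↦ (L : ℝ≥0∞) ^ p * edist x y ^ (p - σ - m)) y := by
          refine setLIntegral_mono' hQm fun y hy ↦ ?_
          rcases eq_or_ne y x with rfl | hxy
          · rw [gagKernel_eq_zero hp rfl]; exact zero_le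
          have hd : 0 < dist x y := dist_pos.2 hxy.symm
          have h1 := Metric.mem_closedBall.1 hx
          have h2 := Metric.mem_closedBall.1 hy
          have hmem : y ∈ {y | y ≠ x ∧ dist x y ≤ 4 * r} :=
            ⟨hxy, by linarith [dist_triangle_right x y 0]⟩
          rw [indicator_of_mem hmem, gagKernel_eq_mul]
          calc edist (θ x) (θ y) ^ p * edist x y ^ (-((m : ℝ) + σ))
              ≤ (L * edist x y) ^ p * edist x y ^ (-((m : ℝ) + σ)) := by gcongr; exact hθ x y
            _ = (L : ℝ≥0∞) ^ p * edist x y ^ (p - σ - m) := by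
              rw [ENNReal.mul_rpow_of_nonneg _ _ hp.le, mul_assoc,
                ← ENNReal.rpow_add _ _ (edist_pos.2 hxy.symm).ne' (edist_ne_top _ _)]
              congr 2
              ring
      _ ≤ ∫⁻ y in {y | y ≠ x ∧ dist x y ≤ 4 * r}, (L : ℝ≥0∞) ^ p * edist x y ^ (p - σ - m) :=
          (setLIntegral_le_lintegral _ _).trans (lintegral_indicator_le _ _)
      _ = (L : ℝ≥0∞) ^ p * ∫⁻ y in {y | y ≠ x ∧ dist x y ≤ 4 * r}, edist x y ^ (p - σ - m) :=
          lintegral_const_mul' _ _ hL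
      _ ≤ _ := by gcongr; exact h' x _ (by positivity)
  calc gagEnergy σ p θ Q
      ≤ ∫⁻ x in Q, (L : ℝ≥0∞) ^ p * (C' * ENNReal.ofReal ((4 * r) ^ (p - σ))) :=
        setLIntegral_mono' hQm key
    _ = (L : ℝ≥0∞) ^ p * (C' * ENNReal.ofReal ((4 * r) ^ (p - σ))) * volume Q := by
        rw [setLIntegral_const]
    _ < ⊤ := ENNReal.mul_lt_top (ENNReal.mul_lt_top hL.lt_top
        (ENNReal.mul_lt_top hC' ENNReal.ofReal_lt_top)) measure_closedBall_lt_top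

/-- The cutoff function equal to `1` on the unit ball and to `0` outside the ball of radius `2`. -/
noncomputable def linearCutoff (x : Euc m) : ℝ := max 0 (min 1 (2 - ‖x‖))

theorem lipschitzWith_linearCutoff : LipschitzWith 1 (linearCutoff (m := m)) := by
  have h1 : LipschitzWith 1 (fun x : Euc m ↦ 2 - ‖x‖) := by
    simpa using (LipschitzWith.const (2 : ℝ)).sub (lipschitzWith_one_norm (E := Euc m))
  exact (h1.const_min 1).const_max 0

theorem linearCutoff_eq_one {x : Euc m} (h : ‖x‖ ≤ 1) : linearCutoff x = 1 := by
  rw [linearCutoff, min_eq_left (by linarith), max_eq_right zero_le_one]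

theorem linearCutoff_eq_zero {x : Euc m} (h : 2 ≤ ‖x‖) : linearCutoff x = 0 := by
  rw [linearCutoff, min_eq_right (by linarith), max_eq_left (by linarith)]

/-- The logarithmic cutoff function, equal to `1` on the ball of radius `2 ^ (-k)` and to `0`
outside
the unit ball. -/
noncomputable def logCutoff (k : ℕ) (x : Euc m) : ℝ :=
  -Real.log (max ((2 ^ k)⁻¹) (min 1 ‖x‖)) / (k * Real.log 2)

theorem logCutoff_eq_one {k : ℕ} (hk : 1 ≤ k) {x : Euc m} (h : ‖x‖ ≤ (2 ^ k)⁻¹) :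
    logCutoff k x = 1 := by
  have h1 : ((2 : ℝ) ^ k)⁻¹ ≤ 1 := inv_le_one_of_one_le₀ (one_le_pow₀ (by norm_num))
  have h2 : 0 < Real.log 2 := Real.log_pos (by norm_num)
  have h3 : (0 : ℝ) < k := by exact_mod_cast hk
  rw [logCutoff, min_eq_right (h.trans h1), max_eq_left h, Real.log_inv, Real.log_pow, neg_neg,
    div_self (by positivity)]

theorem logCutoff_eq_zero {k : ℕ} {x : Euc m} (h : 1 ≤ ‖x‖) : logCutoff k x = 0 := by
  have h1 : ((2 : ℝ) ^ k)⁻¹ ≤ 1 := inv_le_one_of_one_le₀ (one_le_pow₀ (by norm_num))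
  rw [logCutoff, min_eq_left h, max_eq_right h1]
  simp

/-- Truncating the norms to the interval from `2 ^ (-k)` to `1` does not increase their ratio. -/
theorem abs_logCutoff_sub_le {k : ℕ} {x y : Euc m} (hx : 0 < ‖x‖) (hxy : ‖x‖ ≤ ‖y‖) :
    |logCutoff k x - logCutoff k y| ≤ Real.log (‖y‖ / ‖x‖) / (k * Real.log 2) := by
  have h2 : 0 < Real.log 2 := Real.log_pos (by norm_num)
  have hy := hx.trans_le hxy
  set e : ℝ := (2 ^ k)⁻¹
  have he : 0 < e := by positivity
  have he1 : e ≤ 1 := inv_le_one_of_one_le₀ (one_le_pow₀ (by norm_num))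
  set a := max e (min 1 ‖x‖)
  set b := max e (min 1 ‖y‖)
  have ha : 0 < a := lt_max_of_lt_left he
  have hab : a ≤ b := max_le_max le_rfl (min_le_min le_rfl hxy)
  have hratio : b / a ≤ ‖y‖ / ‖x‖ := by
    rw [div_le_div_iff₀ ha hx]
    simp only [a, b]
    rcases max_cases e (min 1 ‖x‖) with ⟨h1, h1'⟩ | ⟨h1, h1'⟩ <;>
    rcases max_cases e (min 1 ‖y‖) with ⟨h3, h3'⟩ | ⟨h3, h3'⟩ <;>
    rcases min_cases 1 ‖x‖ with ⟨h5, h5'⟩ | ⟨h5, h5'⟩ <;>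
    rcases min_cases 1 ‖y‖ with ⟨h7, h7'⟩ | ⟨h7, h7'⟩ <;> simp only [h5, h7] at * <;>
    nlinarith
  have e1 : logCutoff k x - logCutoff k y = Real.log (b / a) / (k * Real.log 2) := by
    rw [Real.log_div (ha.trans_le hab).ne' ha.ne']
    simp only [logCutoff, a, b, e]
    ring
  have hn : 0 ≤ Real.log (b / a) := Real.log_nonneg ((one_le_div ha).2 hab)
  rw [e1, abs_of_nonneg (by positivity)]
  gcongr

/-- A qualitative statement: only the existence of a constant is needed, for measurability and
differentiability almost everywhere. The constant produced by the proof grows with `k`. -/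
theorem lipschitzWith_logCutoff (k : ℕ) : ∃ L, LipschitzWith L (logCutoff (m := m) k) := by
  set e : ℝ := (2 ^ k)⁻¹
  have he : 0 < e := by positivity
  have h1 : LipschitzWith 1 (fun x : Euc m ↦ max e (min 1 ‖x‖)) :=
    ((lipschitzWith_one_norm (E := Euc m)).const_min 1).const_max e
  have h2 : LipschitzOnWith (Real.toNNReal e⁻¹) Real.log (Ici e) := by
    refine (convex_Ici e).lipschitzOnWith_of_nnnorm_deriv_le (fun x hx ↦ ?_) fun x hx ↦ ?_
    · exact Real.differentiableAt_log (he.trans_le hx).ne'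
    · rw [Real.deriv_log, ← NNReal.coe_le_coe, coe_nnnorm,
        Real.norm_of_nonneg (inv_nonneg.2 (he.trans_le hx).le), Real.coe_toNNReal _ (by positivity)]
      exact inv_anti₀ he hx
  have h3 : LipschitzOnWith _ (fun x : Euc m ↦ Real.log (max e (min 1 ‖x‖))) univ :=
    h2.comp h1.lipschitzOnWith fun x _ ↦ mem_Ici.2 (le_max_left _ _)
  have h4 := (lipschitzWith_smul (-(k * Real.log 2)⁻¹ : ℝ)).comp (lipschitzOnWith_univ.1 h3)
  refine ⟨‖(-(k * Real.log 2)⁻¹ : ℝ)‖₊ * (e⁻¹.toNNReal * 1), ?_⟩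
  convert! h4 using 1
  ext x
  simp only [logCutoff, Function.comp, smul_eq_mul, e]
  ring

/-- The pointwise bound behind the energy estimate for logarithmic cutoffs. -/
theorem gagKernel_logCutoff_le {k : ℕ} (hk : 1 ≤ k) (hm : 1 ≤ m) {p : ℝ} (hp : (m : ℝ) < p)
    {x y : Euc m} (hx : x ≠ 0) (hxy : ‖x‖ ≤ ‖y‖) :
    gagKernel m p (logCutoff k) x y ≤ ENNReal.ofReal ((k * Real.log 2) ^ (-p)) *
      (ENNReal.ofReal ((2 / ‖y‖) ^ p) * edist y x ^ (p - m - m) +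
        ENNReal.ofReal ((2 * p / m) ^ p * ‖y‖ ^ ((m : ℝ) / 2) * (‖y‖ / 2) ^ (-(2 * m : ℝ))) *
          edist 0 x ^ ((m : ℝ) / 2 - m)) := by
  have hx0 : 0 < ‖x‖ := norm_pos_iff.2 hx
  have hy0 : 0 < ‖y‖ := hx0.trans_le hxy
  have hm0 : (0 : ℝ) < m := by exact_mod_cast hm
  have hp0 : 0 < p := hm0.trans hp
  have hk0 : (0 : ℝ) < k := by exact_mod_cast hk
  have h2 : 0 < Real.log 2 := Real.log_pos (by norm_num)
  rcases eq_or_ne x y with rfl | hne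
  · rw [gagKernel_eq_zero hp0 rfl]; exact zero_le
  have hd : 0 < dist x y := dist_pos.2 hne
  have hd' : 0 < dist y x := dist_pos.2 hne.symm
  have h0x : 0 < dist 0 x := by rwa [dist_zero_left]
  have hlog : 0 ≤ Real.log (‖y‖ / ‖x‖) := Real.log_nonneg ((one_le_div hx0).2 hxy)
  have hE : edist (logCutoff k x) (logCutoff k y) ^ p ≤
      ENNReal.ofReal ((k * Real.log 2) ^ (-p) * Real.log (‖y‖ / ‖x‖) ^ p) := by
    rw [edist_dist, Real.dist_eq, ENNReal.ofReal_rpow_of_nonneg (abs_nonneg _) hp0.le]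
    refine ENNReal.ofReal_le_ofReal ((Real.rpow_le_rpow (abs_nonneg _)
      (abs_logCutoff_sub_le hx0 hxy) hp0.le).trans_eq ?_)
    rw [Real.div_rpow hlog (by positivity), Real.rpow_neg (by positivity)]
    field_simp
  rw [gagKernel_eq_mul, edist_rpow_eq_ofReal hd, edist_rpow_eq_ofReal hd', edist_rpow_eq_ofReal h0x,
    dist_zero_left, dist_comm y x]
  refine (mul_le_mul' hE le_rfl).trans ?_
  rw [← ENNReal.ofReal_mul (by positivity), ← ENNReal.ofReal_mul (by positivity),
    ← ENNReal.ofReal_mul (by positivity), ← ENNReal.ofReal_add (by positivity) (by positivity),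
    ← ENNReal.ofReal_mul (by positivity)]
  refine ENNReal.ofReal_le_ofReal ?_
  rw [mul_assoc]
  refine mul_le_mul_of_nonneg_left ?_ (by positivity)
  -- If `‖x‖ ≥ ‖y‖ / 2`, the logarithm is at most a multiple of `|x - y| / ‖y‖`. Otherwise `|x - y|
  -- ≥ ‖y‖ / 2`, and the logarithm is bounded by the power `m / (2p)` of `‖y‖ / ‖x‖`, whose `p`-th
  -- power has the exponent `m / 2 < m` and is thus integrable in `x` at the origin.
  rcases le_total (‖y‖ / 2) ‖x‖ with hc | hc
  · refine le_add_of_le_of_nonneg ?_ (by positivity)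
    have hl : Real.log (‖y‖ / ‖x‖) ≤ 2 / ‖y‖ * dist x y := by
      have e1 := Real.log_le_sub_one_of_pos (div_pos hy0 hx0)
      have e2 : ‖y‖ / ‖x‖ - 1 = (‖y‖ - ‖x‖) / ‖x‖ := by field_simp
      have e3 : ‖y‖ - ‖x‖ ≤ dist x y := by
        rw [dist_comm, dist_eq_norm]; exact norm_sub_norm_le y x
      calc Real.log (‖y‖ / ‖x‖) ≤ (‖y‖ - ‖x‖) / ‖x‖ := by linarith
        _ ≤ dist x y / (‖y‖ / 2) := by gcongr
        _ = _ := by field_simp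
    calc Real.log (‖y‖ / ‖x‖) ^ p * dist x y ^ (-((m : ℝ) + m))
        ≤ (2 / ‖y‖ * dist x y) ^ p * dist x y ^ (-((m : ℝ) + m)) := by gcongr
      _ = _ := by
        rw [Real.mul_rpow (by positivity) hd.le, mul_assoc, ← Real.rpow_add hd]
        congr 2
        ring
  · refine le_add_of_nonneg_of_le (by positivity) ?_
    have hl : Real.log (‖y‖ / ‖x‖) ≤ (2 * p / m) * (‖y‖ / ‖x‖) ^ ((m : ℝ) / (2 * p)) := by
      have := Real.log_le_rpow_div (div_pos hy0 hx0).le (ε := (m : ℝ) / (2 * p)) (by positivity)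
      calc _ ≤ _ := this
        _ = _ := by field_simp
    have hdy : ‖y‖ / 2 ≤ dist x y := by
      have := norm_sub_norm_le y x
      rw [dist_comm, dist_eq_norm]; linarith
    calc Real.log (‖y‖ / ‖x‖) ^ p * dist x y ^ (-((m : ℝ) + m))
        ≤ ((2 * p / m) * (‖y‖ / ‖x‖) ^ ((m : ℝ) / (2 * p))) ^ p *
            (‖y‖ / 2) ^ (-((m : ℝ) + m)) := by
          refine mul_le_mul (Real.rpow_le_rpow hlog hl hp0.le)
            (Real.rpow_le_rpow_of_nonpos (by positivity) hdy (by linarith)) (by positivity)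
            (by positivity)
      _ = _ := by
        rw [Real.mul_rpow (by positivity) (by positivity), ← Real.rpow_mul (by positivity),
          show (m : ℝ) / (2 * p) * p = m / 2 by field_simp,
          Real.div_rpow hy0.le hx0.le, div_eq_mul_inv _ (‖x‖ ^ _), ← Real.rpow_neg hx0.le,
          show (m : ℝ) / 2 - m = -(m / 2) by ring, show (m : ℝ) + m = 2 * m by ring]
        ring

/-- By symmetry it suffices to integrate over `‖x‖ ≤ ‖y‖`. For fixed `y` the integral in `x` is at
most a multiple of `(k log 2) ^ (-p) ‖y‖ ^ (-m)`, and it vanishes for `‖y‖ < 2 ^ (-k)`, where the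
cutoff is constant. The integral in `y` is then logarithmic and contributes the factor `k + 1`. -/
theorem exists_gagEnergy_logCutoff_le (hm : 1 ≤ m) {p : ℝ} (hp : (m : ℝ) < p) :
    ∃ C : ℝ≥0∞, C < ⊤ ∧ ∀ k : ℕ, 1 ≤ k → gagEnergy m p (logCutoff (m := m) k) univ
      ≤ C * (ENNReal.ofReal ((k * Real.log 2) ^ (-p)) * (k + 1)) := by
  have hm0 : (0 : ℝ) < m := by exact_mod_cast hm
  have hp0 : 0 < p := hm0.trans hp
  obtain ⟨C₀, hC₀, h₀⟩ := exists_gagEnergy_univ_le (N := ℝ) m hm hm0 hp0 one_pos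
  obtain ⟨C₁, hC₁, h₁⟩ := exists_lintegral_near_le m (a := p - m) (by linarith)
  obtain ⟨C₂, hC₂, h₂⟩ := exists_lintegral_near_le m (a := (m : ℝ) / 2) (by positivity)
  obtain ⟨C₃, hC₃, h₃⟩ := exists_lintegral_log_le m
  set C₄ : ℝ≥0∞ := C₁ * ENNReal.ofReal (2 ^ p * 2 ^ (p - m)) +
    C₂ * ENNReal.ofReal ((2 * p / m) ^ p * 2 ^ (2 * m : ℝ))
  have hC₄ : C₄ < ⊤ := ENNReal.add_lt_top.2 ⟨ENNReal.mul_lt_top hC₁ ENNReal.ofReal_lt_top,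
    ENNReal.mul_lt_top hC₂ ENNReal.ofReal_lt_top⟩
  set C₅ : ℝ≥0∞ := ENNReal.ofReal (2 ^ |(-(m : ℝ))|) * volume (Metric.ball (0 : Euc m) 1)
    * ENNReal.ofReal (2 ^ ((m : ℝ) + (-m)))
  have hC₅ : C₅ < ⊤ := ENNReal.mul_lt_top (ENNReal.mul_lt_top ENNReal.ofReal_lt_top
    volume_unitBall_lt_top) ENNReal.ofReal_lt_top
  refine ⟨C₀ * (2 * (C₄ * (C₃ + C₅))), ENNReal.mul_lt_top hC₀ (ENNReal.mul_lt_top (by norm_num)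
    (ENNReal.mul_lt_top hC₄ (ENNReal.add_lt_top.2 ⟨hC₃, hC₅⟩))), fun k hk ↦ ?_⟩
  obtain ⟨L, hL⟩ := lipschitzWith_logCutoff (m := m) k
  have hθm : Measurable (logCutoff (m := m) k) := hL.continuous.measurable
  refine (h₀ (logCutoff k) 0 0 hθm fun x hx ↦ logCutoff_eq_zero ?_).trans ?_
  · rw [mem_closedBall_zero_iff, not_le] at hx; exact hx.le
  rw [mul_assoc]
  gcongr
  rw [mul_one]
  set Q := Metric.closedBall (0 : Euc m) 2
  have hQm : MeasurableSet Q := Metric.isClosed_closedBall.measurableSet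
  set V : Set (Euc m × Euc m) := {z | ‖z.2‖ ≤ ‖z.1‖}
  have hVm : MeasurableSet V := measurableSet_le (by fun_prop) (by fun_prop)
  set f : Euc m × Euc m → ℝ≥0∞ := V.indicator fun z ↦ gagKernel m p (logCutoff k) z.1 z.2
  have hf : Measurable f := (measurable_gagKernel _ _ hθm).indicator hVm
  set c : ℝ≥0∞ := ENNReal.ofReal ((k * Real.log 2) ^ (-p))
  have hc : c ≠ ⊤ := ENNReal.ofReal_ne_top
  have inner : ∀ y : Euc m, (2 ^ k)⁻¹ ≤ ‖y‖ → ∫⁻ x in Q, f (y, x) ≤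
      c * (C₄ * edist 0 y ^ (-(m : ℝ))) := by
    intro y hy
    have hy0 : 0 < ‖y‖ := lt_of_lt_of_le (by positivity) hy
    have h0y : 0 < dist 0 y := by rwa [dist_zero_left]
    calc ∫⁻ x in Q, f (y, x) ≤ ∫⁻ x, f (y, x) := setLIntegral_le_lintegral _ _
      _ ≤ ∫⁻ x, c *
          (ENNReal.ofReal ((2 / ‖y‖) ^ p) * {x | x ≠ y ∧ dist y x ≤ 2 * ‖y‖}.indicator
              (fun x ↦ edist y x ^ (p - m - m)) x +
            ENNReal.ofReal ((2 * p / m) ^ p * ‖y‖ ^ ((m : ℝ) / 2) * (‖y‖ / 2) ^ (-(2 * m : ℝ))) *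
            {x : Euc m | x ≠ 0 ∧ dist 0 x ≤ ‖y‖}.indicator (fun x ↦ edist 0 x ^ ((m : ℝ) / 2 - m))
                x) := by
          have : ∀ᵐ x : Euc m, x ≠ 0 := by
            have : Nonempty (Fin m) := ⟨⟨0, hm⟩⟩
            exact Measure.ae_ne volume 0
          refine lintegral_mono_ae ?_
          filter_upwards [this] with x hx
          by_cases hV : (y, x) ∈ V
          swap
          · simp only [f]
            rw [indicator_of_notMem hV]; exact zero_le
          have hxy : ‖x‖ ≤ ‖y‖ := hV
          simp only [f]
          rw [indicator_of_mem hV]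
          rcases eq_or_ne x y with rfl | hne
          · rw [gagKernel_eq_zero hp0 rfl]; exact zero_le
          have hmem1 : x ∈ {x | x ≠ y ∧ dist y x ≤ 2 * ‖y‖} := by
            refine ⟨hne, ?_⟩
            rw [dist_eq_norm]
            linarith [norm_sub_le y x]
          have hmem2 : x ∈ {x : Euc m | x ≠ 0 ∧ dist 0 x ≤ ‖y‖} := ⟨hx, by simpa using hxy⟩
          rw [indicator_of_mem hmem1, indicator_of_mem hmem2, gagKernel_comm]
          exact gagKernel_logCutoff_le hk hm hp hx hxy
      _ = c * (ENNReal.ofReal ((2 / ‖y‖) ^ p) * (∫⁻ x in {x | x ≠ y ∧ dist y x ≤ 2 * ‖y‖},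
              edist y x ^ (p - m - m)) +
            ENNReal.ofReal ((2 * p / m) ^ p * ‖y‖ ^ ((m : ℝ) / 2) * (‖y‖ / 2) ^ (-(2 * m : ℝ))) *
            ∫⁻ x in {x : Euc m | x ≠ 0 ∧ dist 0 x ≤ ‖y‖}, edist 0 x ^ ((m : ℝ) / 2 - m)) := by
          have m1 : MeasurableSet {x | x ≠ y ∧ dist y x ≤ 2 * ‖y‖} :=
            (measurableSet_singleton y).compl.inter
              (measurableSet_Iic.preimage (f := fun x : Euc m ↦ dist y x) (by fun_prop))
          have m2 : MeasurableSet {x : Euc m | x ≠ 0 ∧ dist 0 x ≤ ‖y‖} :=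
            (measurableSet_singleton 0).compl.inter
              (measurableSet_Iic.preimage (f := fun x : Euc m ↦ dist 0 x) (by fun_prop))
          rw [lintegral_const_mul' _ _ hc, lintegral_add_left,
            lintegral_const_mul' _ _ ENNReal.ofReal_ne_top,
            lintegral_const_mul' _ _ ENNReal.ofReal_ne_top, lintegral_indicator m1,
            lintegral_indicator m2]
          exact (Measurable.indicator (by fun_prop) m1).const_mul _
      _ ≤ c * (ENNReal.ofReal ((2 / ‖y‖) ^ p) * (C₁ * ENNReal.ofReal ((2 * ‖y‖) ^ (p - m))) +
            ENNReal.ofReal ((2 * p / m) ^ p * ‖y‖ ^ ((m : ℝ) / 2) * (‖y‖ / 2) ^ (-(2 * m : ℝ))) *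
            (C₂ * ENNReal.ofReal (‖y‖ ^ ((m : ℝ) / 2)))) := by
          gcongr
          · exact h₁ y _ (by positivity)
          · exact h₂ 0 _ hy0
      _ = _ := by
          congr 1
          rw [edist_rpow_eq_ofReal h0y, dist_zero_left, add_mul, mul_assoc C₁, mul_assoc C₂,
            ← ENNReal.ofReal_mul (by positivity), ← ENNReal.ofReal_mul (by positivity),
            mul_left_comm _ C₁, mul_left_comm _ C₂, ← ENNReal.ofReal_mul (by positivity),
            ← ENNReal.ofReal_mul (by positivity)]
          congr 3
          · rw [Real.div_rpow (by norm_num) hy0.le, Real.mul_rpow (by norm_num) hy0.le,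
              Real.rpow_sub hy0, Real.rpow_neg hy0.le]
            have := (Real.rpow_pos_of_pos hy0 p).ne'
            field_simp
          · rw [Real.div_rpow hy0.le (by norm_num), Real.rpow_neg (by norm_num : (0 : ℝ) ≤ 2)]
            have e1 : ‖y‖ ^ (-(m : ℝ)) =
                ‖y‖ ^ ((m : ℝ) / 2) * ‖y‖ ^ (-(2 * m : ℝ)) * ‖y‖ ^ ((m : ℝ) / 2) := by
              rw [← Real.rpow_add hy0, ← Real.rpow_add hy0]; congr 1; ring
            rw [e1, div_inv_eq_mul]
            ring
  have hzero : ∀ y : Euc m, ‖y‖ < (2 ^ k)⁻¹ → ∀ x, f (y, x) = 0 := by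
    intro y hy x
    by_cases hV : (y, x) ∈ V
    · simp only [f]
      rw [indicator_of_mem hV]
      exact gagKernel_eq_zero hp0 ((logCutoff_eq_one hk hy.le).trans
        (logCutoff_eq_one hk (le_trans hV hy.le)).symm)
    · simp only [f]
      rw [indicator_of_notMem hV]
  have hsum : ∀ x y, gagKernel m p (logCutoff k) x y ≤ f (x, y) + f (y, x) := by
    intro x y
    rcases le_total ‖y‖ ‖x‖ with h | h
    · have : (x, y) ∈ V := h
      simp only [f]
      rw [indicator_of_mem this]
      exact le_self_add
    · have : (y, x) ∈ V := h
      simp only [f]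
      rw [indicator_of_mem this, gagKernel_comm]
      exact le_add_self
  calc gagEnergy m p (logCutoff k) Q ≤ ∫⁻ x in Q, ∫⁻ y in Q, (f (x, y) + f (y, x)) :=
        lintegral_mono fun x ↦ lintegral_mono fun y ↦ hsum x y
    _ = ∫⁻ x in Q, ((∫⁻ y in Q, f (x, y)) + ∫⁻ y in Q, f (y, x)) :=
        lintegral_congr fun x ↦ lintegral_add_left (hf.comp (by fun_prop)) _
    _ = 2 * ∫⁻ x in Q, ∫⁻ y in Q, f (x, y) := by
        rw [lintegral_add_left hf.lintegral_prod_right', two_mul,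
          lintegral_lintegral_swap (f := fun x y ↦ f (y, x)) (hf.comp measurable_swap).aemeasurable]
    _ ≤ 2 * ∫⁻ y in {y : Euc m | (2 ^ k)⁻¹ ≤ dist 0 y ∧ dist 0 y ≤ 1} ∪
            {y | 2 / 2 ≤ dist 0 y ∧ dist 0 y ≤ 2},
          c * (C₄ * edist 0 y ^ (-(m : ℝ))) := by
        gcongr 2 * ?_
        have mU : MeasurableSet ({y : Euc m | (2 ^ k)⁻¹ ≤ dist 0 y ∧ dist 0 y ≤ 1} ∪
            {y | 2 / 2 ≤ dist 0 y ∧ dist 0 y ≤ 2}) :=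
          (measurableSet_Icc.preimage (f := fun y : Euc m ↦ dist 0 y) (by fun_prop)).union
            (measurableSet_Icc.preimage (f := fun y : Euc m ↦ dist 0 y) (by fun_prop))
        rw [← lintegral_indicator hQm, ← lintegral_indicator mU]
        refine lintegral_mono fun y ↦ ?_
        by_cases hyQ : y ∈ Q
        swap
        · rw [indicator_of_notMem hyQ]; exact zero_le
        rw [indicator_of_mem hyQ]
        rcases lt_or_ge ‖y‖ (2 ^ k)⁻¹ with h | h
        · simp [hzero y h]
        · have : ‖y‖ ≤ 2 := by simpa [Q] using hyQ
          rw [indicator_of_mem]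
          · exact inner y h
          · rcases le_total ‖y‖ 1 with h1 | h1
            · left; simp [h, h1]
            · right; simp [this, h1]
    _ ≤ 2 * (c * (C₄ * (C₃ * (k + 1) + C₅))) := by
        rw [lintegral_const_mul' _ _ hc, lintegral_const_mul' _ _ hC₄.ne]
        gcongr
        refine (lintegral_union_le _ _ _).trans ?_
        gcongr
        · exact h₃ 0 k
        · exact lintegral_shell_edist_rpow_le 0 two_pos _
    _ ≤ 2 * (c * (C₄ * (C₃ * (k + 1) + C₅ * (k + 1)))) := by
        gcongr
        exact le_mul_of_one_le_right zero_le (by simp)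
    _ = _ := by ring

end Cutoff

/-! ### Weak derivatives -/

section WeakDeriv

variable {m ν : ℕ}

theorem integrable_smul_of_tsupport_subset {E : Type*} [NormedAddCommGroup E] [NormedSpace ℝ E]
    {Ω : Set (Euc m)} {f : Euc m → E} (hf : LocallyIntegrableOn f Ω) {g : Euc m → ℝ}
    (hg : Continuous g) (hc : HasCompactSupport g) (hs : tsupport g ⊆ Ω) :
    Integrable (fun x ↦ g x • f x) := by
  have h1 : IntegrableOn (fun x ↦ g x • f x) (tsupport g) :=
    (hf.integrableOn_compact_subset hs hc).continuousOn_smul hg.continuousOn hc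
  refine (integrableOn_iff_integrable_of_support_subset fun x hx ↦ ?_).1 h1
  exact subset_tsupport g fun h ↦ hx (by simp [h])

theorem locallyIntegrableOn_congr_ae {E : Type*} [NormedAddCommGroup E] {Ω : Set (Euc m)}
    {f g : Euc m → E} (hf : LocallyIntegrableOn f Ω) (h : f =ᵐ[volume.restrict Ω] g) :
    LocallyIntegrableOn g Ω := by
  intro x hx
  obtain ⟨t, ht, hft⟩ := hf x hx
  refine ⟨t ∩ Ω, Filter.inter_mem ht self_mem_nhdsWithin, ?_⟩
  exact (hft.mono_set inter_subset_left).congr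
    (ae_mono (Measure.restrict_mono inter_subset_right le_rfl) h)

theorem locallyIntegrableOn_add {E : Type*} [NormedAddCommGroup E] {Ω : Set (Euc m)}
    {f g : Euc m → E} (hf : LocallyIntegrableOn f Ω) (hg : LocallyIntegrableOn g Ω) :
    LocallyIntegrableOn (fun x ↦ f x + g x) Ω := hf.add hg

/-- The directional derivative of a test function is a test function. -/
theorem fderiv_apply_test {ψ : Euc m → ℝ} (h1 : ContDiff ℝ ∞ ψ) (h2 : HasCompactSupport ψ)
    (v : Euc m) : Continuous (fun y ↦ fderiv ℝ ψ y v) ∧ HasCompactSupport (fun y ↦ fderiv ℝ ψ y v) ∧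
      tsupport (fun y ↦ fderiv ℝ ψ y v) ⊆ tsupport ψ := by
  have hs : Function.support (fun y ↦ fderiv ℝ ψ y v) ⊆ tsupport ψ := fun y hy ↦
    support_fderiv_subset ℝ fun h : fderiv ℝ ψ y = 0 ↦ hy (by simp [h])
  exact ⟨(h1.continuous_fderiv (by simp)).clm_apply continuous_const,
    h2.mono' hs, closure_minimal hs (isClosed_tsupport ψ)⟩

theorem locallyIntegrableOn_clm_apply {H : Euc m → Euc m →L[ℝ] Euc ν} {Ω : Set (Euc m)}
    (hH : LocallyIntegrableOn H Ω) (v : Euc m) : LocallyIntegrableOn (fun y ↦ H y v) Ω := by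
  intro x hx
  obtain ⟨t, ht, hHt⟩ := hH x hx
  exact ⟨t, ht, hHt.apply_continuousLinearMap v⟩

namespace HasWeakDerivOn

variable {h h' : Euc m → Euc ν} {H H' : Euc m → Euc m →L[ℝ] Euc ν} {Ω Ω' : Set (Euc m)}

theorem mono (hh : HasWeakDerivOn h H Ω) (hs : Ω' ⊆ Ω) : HasWeakDerivOn h H Ω' :=
  ⟨hh.1.mono_set hs, hh.2.1.mono_set hs, fun ψ h1 h2 h3 ↦ hh.2.2 ψ h1 h2 (h3.trans hs)⟩

theorem integrable_fderiv_smul (hh : HasWeakDerivOn h H Ω) {ψ : Euc m → ℝ} (h1 : ContDiff ℝ ∞ ψ)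
    (h2 : HasCompactSupport ψ) (h3 : tsupport ψ ⊆ Ω) (v : Euc m) :
    Integrable (fun y ↦ fderiv ℝ ψ y v • h y) :=
  have := fderiv_apply_test h1 h2 v
  integrable_smul_of_tsupport_subset hh.1 this.1 this.2.1 (this.2.2.trans h3)

theorem integrable_smul_apply (hh : HasWeakDerivOn h H Ω) {ψ : Euc m → ℝ} (h1 : ContDiff ℝ ∞ ψ)
    (h2 : HasCompactSupport ψ) (h3 : tsupport ψ ⊆ Ω) (v : Euc m) :
    Integrable (fun y ↦ ψ y • H y v) :=
  integrable_smul_of_tsupport_subset (locallyIntegrableOn_clm_apply hh.2.1 v) h1.continuous h2 h3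

theorem congr_ae (hh : HasWeakDerivOn h H Ω) (hΩ : MeasurableSet Ω)
    (e : h =ᵐ[volume.restrict Ω] h') (e' : H =ᵐ[volume.restrict Ω] H') :
    HasWeakDerivOn h' H' Ω := by
  refine ⟨locallyIntegrableOn_congr_ae hh.1 e, locallyIntegrableOn_congr_ae hh.2.1 e',
    fun ψ h1 h2 h3 v ↦ ?_⟩
  have e1 := (ae_restrict_iff' hΩ).1 e
  have e2 := (ae_restrict_iff' hΩ).1 e'
  have i1 : ∫ y, fderiv ℝ ψ y v • h' y = ∫ y, fderiv ℝ ψ y v • h y := by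
    refine integral_congr_ae ?_
    filter_upwards [e1] with y hy
    by_cases hyΩ : y ∈ Ω
    · rw [hy hyΩ]
    · have : fderiv ℝ ψ y v = 0 := by
        by_contra hne
        exact hyΩ (h3 ((fderiv_apply_test h1 h2 v).2.2 (subset_tsupport _ hne)))
      simp [this]
  have i2 : ∫ y, ψ y • H' y v = ∫ y, ψ y • H y v := by
    refine integral_congr_ae ?_
    filter_upwards [e2] with y hy
    by_cases hyΩ : y ∈ Ω
    · rw [hy hyΩ]
    · have : ψ y = 0 := by
        by_contra hne
        exact hyΩ (h3 (subset_tsupport _ hne))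
      simp [this]
  rw [i1, i2]
  exact hh.2.2 ψ h1 h2 h3 v

/-- The fundamental lemma of the calculus of variations, applied in each of the finitely many
directions of a basis so that the exceptional null sets can be united. -/
theorem ae_eq (hh : HasWeakDerivOn h H Ω) (hh' : HasWeakDerivOn h H' Ω) (hΩ : IsOpen Ω) :
    H =ᵐ[volume.restrict Ω] H' := by
  have key : ∀ v : Euc m, ∀ᵐ x, x ∈ Ω → H x v = H' x v := by
    intro v
    have l1 := locallyIntegrableOn_clm_apply hh.2.1 v
    have l2 := locallyIntegrableOn_clm_apply hh'.2.1 v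
    have := hΩ.ae_eq_zero_of_integral_contDiff_smul_eq_zero (l1.sub l2) fun ψ h1 h2 h3 ↦ by
      have i1 := hh.integrable_smul_apply h1 h2 h3 v
      have i2 := hh'.integrable_smul_apply h1 h2 h3 v
      have e1 := hh.2.2 ψ h1 h2 h3 v
      have e2 := hh'.2.2 ψ h1 h2 h3 v
      simp only [Pi.sub_apply, smul_sub]
      rw [integral_sub i1 i2, sub_eq_zero]
      exact neg_injective (e1.symm.trans e2)
    filter_upwards [this] with x hx hxΩ
    exact sub_eq_zero.1 (hx hxΩ)
  rw [Filter.EventuallyEq, ae_restrict_iff' hΩ.measurableSet]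
  have := ae_all_iff.2 fun i : Fin m ↦ key (EuclideanSpace.basisFun (Fin m) ℝ i)
  filter_upwards [this] with x hx hxΩ
  refine ContinuousLinearMap.coe_injective
    ((EuclideanSpace.basisFun (Fin m) ℝ).toBasis.ext fun i ↦ ?_)
  simpa using hx i hxΩ

theorem add (hh : HasWeakDerivOn h H Ω) (hh' : HasWeakDerivOn h' H' Ω) :
    HasWeakDerivOn (fun x ↦ h x + h' x) (fun x ↦ H x + H' x) Ω := by
  have l1 := locallyIntegrableOn_add hh.1 hh'.1
  have l2 := locallyIntegrableOn_add hh.2.1 hh'.2.1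
  refine ⟨l1, l2, fun ψ h1 h2 h3 v ↦ ?_⟩
  simp only [smul_add, add_apply]
  rw [integral_add (hh.integrable_fderiv_smul h1 h2 h3 v) (hh'.integrable_fderiv_smul h1 h2 h3 v),
    integral_add (hh.integrable_smul_apply h1 h2 h3 v) (hh'.integrable_smul_apply h1 h2 h3 v),
    hh.2.2 ψ h1 h2 h3 v, hh'.2.2 ψ h1 h2 h3 v, neg_add]

theorem comp_similarity (hh : HasWeakDerivOn h H Ω) (hΩ : IsOpen Ω) (c : Euc m) {ρ : ℝ}
    (hρ : 0 < ρ) : HasWeakDerivOn (h ∘ similarity c ρ) (fun y ↦ ρ • H (similarity c ρ y))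
      (similarity c ρ ⁻¹' Ω) := by
  set T : Euc m ≃ₜ Euc m := (Homeomorph.smulOfNeZero ρ hρ.ne').trans (Homeomorph.addLeft c)
  have hT : ⇑T = similarity c ρ := rfl
  have hTe := measurableEmbedding_similarity c hρ
  have hΩ' : IsOpen (similarity c ρ ⁻¹' Ω) := hΩ.preimage (continuous_similarity c ρ)
  have loc : ∀ {E : Type} [NormedAddCommGroup E] {f : Euc m → E}, LocallyIntegrableOn f Ω →
      LocallyIntegrableOn (f ∘ similarity c ρ) (similarity c ρ ⁻¹' Ω) := by
    intro E _ f hf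
    rw [locallyIntegrableOn_iff hΩ'.isLocallyClosed]
    intro K hK hKc
    have h1 : IntegrableOn f (similarity c ρ '' K) :=
      hf.integrableOn_compact_subset (image_subset_iff.2 hK) (hKc.image (continuous_similarity c ρ))
    have h2 : IntegrableOn f (similarity c ρ '' K) (volume.map (similarity c ρ)) := by
      rw [map_similarity_volume c hρ, IntegrableOn, Measure.restrict_smul]
      exact h1.smul_measure ENNReal.ofReal_ne_top
    rw [hTe.integrableOn_map_iff, preimage_image_eq _ hTe.injective] at h2
    exact h2
  have cov : ∀ F : Euc m → Euc ν, ∫ y, F (similarity c ρ y) =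
      (ENNReal.ofReal (ρ ^ (-(m : ℝ)))).toReal • ∫ z, F z := by
    intro F
    rw [← hTe.integral_map, map_similarity_volume c hρ, integral_smul_measure]
  refine ⟨loc hh.1, (loc hh.2.1).smul ρ, fun ψ h1 h2 h3 v ↦ ?_⟩
  set S : Euc m → Euc m := fun z ↦ ρ⁻¹ • (z - c)
  have hST : ∀ y, S (similarity c ρ y) = y := fun y ↦ by
    simp [S, similarity, smul_smul, inv_mul_cancel₀ hρ.ne']
  have hTS : ∀ z, similarity c ρ (S z) = z := fun z ↦ by
    simp [S, similarity, smul_smul, mul_inv_cancel₀ hρ.ne']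
  have hSd : ContDiff ℝ ∞ S := by fun_prop
  set χ := ψ ∘ S
  have hχT : ∀ y, χ (similarity c ρ y) = ψ y := fun y ↦ by simp [χ, hST]
  have hSsymm : S = ⇑T.symm := by
    ext1 z
    exact (T.injective (by rw [T.apply_symm_apply, hT, hTS]))
  have hχc : HasCompactSupport χ := by
    simp only [χ, hSsymm]
    exact h2.comp_homeomorph T.symm
  have hχs : tsupport χ ⊆ Ω := by
    simp only [χ, hSsymm, tsupport_comp_eq_preimage]
    intro z hz
    have := h3 hz
    rwa [mem_preimage, ← hSsymm, hTS] at this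
  have hfd : ∀ y v, fderiv ℝ ψ y v = ρ * fderiv ℝ χ (similarity c ρ y) v := by
    intro y v
    have e1 : HasFDerivAt S (ρ⁻¹ • ContinuousLinearMap.id ℝ (Euc m)) (similarity c ρ y) :=
      ((hasFDerivAt_id _).sub_const c).const_smul ρ⁻¹
    have e2 : HasFDerivAt ψ (fderiv ℝ ψ y) (S (similarity c ρ y)) := by
      rw [hST]; exact (h1.differentiable (by simp) y).hasFDerivAt
    rw [(e2.comp _ e1).fderiv]
    simp [mul_inv_cancel_left₀ hρ.ne']
  have := hh.2.2 χ (h1.comp hSd) hχc hχs v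
  calc ∫ y, fderiv ℝ ψ y v • (h ∘ similarity c ρ) y
      = ∫ y, (fun z ↦ ρ • (fderiv ℝ χ z v • h z)) (similarity c ρ y) := by
        simp [hfd, mul_smul]
    _ = -∫ y, (fun z ↦ ρ • (χ z • H z v)) (similarity c ρ y) := by
        rw [cov (fun z ↦ ρ • (fderiv ℝ χ z v • h z)), cov (fun z ↦ ρ • (χ z • H z v)),
            integral_smul, this, integral_smul, smul_neg, smul_neg]
    _ = _ := by
        congr 2
        ext1 y
        simp only [hχT, smul_apply]
        rw [smul_comm]

end HasWeakDerivOn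

/-- Integration by parts is known for line derivatives of scalar Lipschitz functions, and by
Rademacher's theorem these coincide almost everywhere with the values of `fderiv`. The value `0` of
`fderiv` at points of non-differentiability is harmless. -/
theorem LipschitzWith.hasWeakDerivOn {L : ℝ≥0} {f : Euc m → Euc ν} (hf : LipschitzWith L f) :
    HasWeakDerivOn f (fderiv ℝ f) univ := by
  have hb : ∀ x, ‖fderiv ℝ f x‖ ≤ L := fun x ↦ norm_fderiv_le_of_lipschitz ℝ hf
  have hloc : LocallyIntegrable (fderiv ℝ f) := by
    refine (locallyIntegrable_const (L : ℝ)).mono (measurable_fderiv ℝ f).aestronglyMeasurable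
      (.of_forall fun x ↦ ?_)
    simpa using hb x
  refine ⟨hf.continuous.locallyIntegrable.locallyIntegrableOn _, hloc.locallyIntegrableOn _,
    fun ψ h1 h2 h3 v ↦ ?_⟩
  have hw : Integrable (fun y ↦ fderiv ℝ ψ y v • f y) :=
    have := fderiv_apply_test h1 h2 v
    integrable_smul_of_tsupport_subset (hf.continuous.locallyIntegrable.locallyIntegrableOn univ)
      this.1 this.2.1 (subset_univ _)
  have hw' : Integrable (fun y ↦ ψ y • fderiv ℝ f y v) :=
    integrable_smul_of_tsupport_subset
      (locallyIntegrableOn_clm_apply (hloc.locallyIntegrableOn univ) v) h1.continuous h2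
      (subset_univ _)
  obtain ⟨D, hD⟩ := h1.lipschitzWith_of_hasCompactSupport h2 (by simp)
  have comp : ∀ (i : Fin ν) {F : Euc m → Euc ν}, Integrable F → (∫ y, F y) i = ∫ y, F y i :=
    fun i F hF ↦ ((EuclideanSpace.proj (𝕜 := ℝ) i).integral_comp_comm hF).symm
  ext i
  rw [comp i hw, PiLp.neg_apply, comp i hw']
  have hfi : LipschitzWith (‖(EuclideanSpace.proj (𝕜 := ℝ) i : Euc ν →L[ℝ] ℝ)‖₊ * L)
      (fun x ↦ f x i) := (EuclideanSpace.proj (𝕜 := ℝ) i).lipschitz.comp hf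
  have key := hfi.integral_lineDeriv_mul_eq (μ := volume) hD h2 v
  have e1 : ∀ x, lineDeriv ℝ ψ x (-v) = -(fderiv ℝ ψ x v) := fun x ↦ by
    rw [(h1.differentiable (by simp) x).lineDeriv_eq_fderiv, map_neg]
  have e2 : ∀ᵐ x, lineDeriv ℝ (fun x ↦ f x i) x v = (fderiv ℝ f x v) i := by
    filter_upwards [hf.ae_differentiableAt] with x hx
    have : HasFDerivAt (fun x ↦ f x i)
        ((EuclideanSpace.proj (𝕜 := ℝ) i : Euc ν →L[ℝ] ℝ).comp (fderiv ℝ f x)) x :=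
      (EuclideanSpace.proj (𝕜 := ℝ) i : Euc ν →L[ℝ] ℝ).hasFDerivAt.comp x hx.hasFDerivAt
    rw [this.differentiableAt.lineDeriv_eq_fderiv, this.fderiv]
    rfl
  simp only [e1] at key
  have e3 : ∫ x, ψ x * (fderiv ℝ f x v) i = ∫ x, lineDeriv ℝ (fun x ↦ f x i) x v * ψ x := by
    refine integral_congr_ae ?_
    filter_upwards [e2] with x hx
    rw [hx, mul_comm]
  simp only [PiLp.smul_apply, smul_eq_mul]
  rw [e3, key, ← integral_neg]
  simp

theorem hasWeakDerivOn_const (b : Euc ν) (Ω : Set (Euc m)) :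
    HasWeakDerivOn (fun _ : Euc m ↦ b) (fun _ ↦ 0) Ω := by
  have := (LipschitzWith.const (α := Euc m) b).hasWeakDerivOn
  have e : fderiv ℝ (fun _ : Euc m ↦ b) = fun _ ↦ 0 := by ext1 x; simp
  rw [e] at this
  exact this.mono (subset_univ _)

/-- The `p`-energy of the weak derivative, infinite if there is none. -/
noncomputable def gradEnergy (p : ℝ) (h : Euc m → Euc ν) (A : Set (Euc m)) : ℝ≥0∞ :=
  ⨅ (H : Euc m → Euc m →L[ℝ] Euc ν) (_ : HasWeakDerivOn h H A), ∫⁻ x in A, ‖H x‖ₑ ^ p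

theorem HasWeakDerivOn.gradEnergy_le {h : Euc m → Euc ν} {H : Euc m → Euc m →L[ℝ] Euc ν}
    {A : Set (Euc m)} (hh : HasWeakDerivOn h H A) (p : ℝ) :
    gradEnergy p h A ≤ ∫⁻ x in A, ‖H x‖ₑ ^ p := iInf₂_le H hh

theorem HasWeakDerivOn.gradEnergy_eq {h : Euc m → Euc ν} {H : Euc m → Euc m →L[ℝ] Euc ν}
    {A : Set (Euc m)} (hA : IsOpen A) (hh : HasWeakDerivOn h H A) (p : ℝ) :
    gradEnergy p h A = ∫⁻ x in A, ‖H x‖ₑ ^ p := by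
  refine le_antisymm (iInf₂_le H hh) (le_iInf₂ fun H' hh' ↦ le_of_eq (lintegral_congr_ae ?_))
  filter_upwards [hh.ae_eq hh' hA] with x hx
  rw [hx]

theorem exists_hasWeakDerivOn_of_gradEnergy_lt_top {p : ℝ} {h : Euc m → Euc ν} {A : Set (Euc m)}
    (hf : gradEnergy p h A < ⊤) : ∃ H, HasWeakDerivOn h H A := by
  by_contra hne
  push Not at hne
  simp [gradEnergy, hne] at hf

theorem gradEnergy_mono (p : ℝ) (h : Euc m → Euc ν) {A B : Set (Euc m)} (hAB : A ⊆ B) :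
    gradEnergy p h A ≤ gradEnergy p h B :=
  le_iInf₂ fun H hH ↦ (iInf₂_le H (hH.mono hAB)).trans (lintegral_mono_set hAB)

theorem gradEnergy_congr_ae (p : ℝ) {h h' : Euc m → Euc ν} {A : Set (Euc m)}
    (hA : MeasurableSet A) (e : h =ᵐ[volume.restrict A] h') :
    gradEnergy p h A = gradEnergy p h' A :=
  le_antisymm (le_iInf₂ fun H hH ↦ iInf₂_le H (hH.congr_ae hA e.symm .rfl))
    (le_iInf₂ fun H hH ↦ iInf₂_le H (hH.congr_ae hA e .rfl))

theorem tsum_gradEnergy_le {I : Type*} [Countable I] (p : ℝ) (h : Euc m → Euc ν) {A : Set (Euc m)}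
    {B : I → Set (Euc m)} (hB : ∀ i, MeasurableSet (B i)) (hd : Pairwise (Function.onFun Disjoint
        B))
    (hBA : ∀ i, B i ⊆ A) : ∑' i, gradEnergy p h (B i) ≤ gradEnergy p h A :=
  le_iInf₂ fun H hH ↦
    calc ∑' i, gradEnergy p h (B i) ≤ ∑' i, ∫⁻ x in B i, ‖H x‖ₑ ^ p :=
          ENNReal.tsum_le_tsum fun i ↦ iInf₂_le H (hH.mono (hBA i))
      _ = ∫⁻ x in ⋃ i, B i, ‖H x‖ₑ ^ p := (lintegral_iUnion hB hd _).symm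
      _ ≤ _ := lintegral_mono_set (iUnion_subset hBA)

theorem gradEnergy_comp_similarity_le {p : ℝ} (hp : 0 ≤ p) (h : Euc m → Euc ν) {A : Set (Euc m)}
    (hA : IsOpen A) (c : Euc m) {ρ : ℝ} (hρ : 0 < ρ) :
    gradEnergy p (h ∘ similarity c ρ) (similarity c ρ ⁻¹' A)
      ≤ ENNReal.ofReal (ρ ^ (p - m)) * gradEnergy p h A := by
  by_cases hf : gradEnergy p h A < ⊤
  swap
  · rw [not_lt, top_le_iff] at hf
    rw [hf, ENNReal.mul_top]
    · exact le_top
    · simpa using Real.rpow_pos_of_pos hρ _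
  obtain ⟨H, hH⟩ := exists_hasWeakDerivOn_of_gradEnergy_lt_top hf
  rw [hH.gradEnergy_eq hA]
  refine ((hH.comp_similarity hA c hρ).gradEnergy_le p).trans_eq ?_
  have : ∀ y, ‖ρ • H (similarity c ρ y)‖ₑ ^ p =
      ENNReal.ofReal (ρ ^ p) * (fun z ↦ ‖H z‖ₑ ^ p) (similarity c ρ y) := fun y ↦ by
    rw [enorm_smul, ENNReal.mul_rpow_of_nonneg _ _ hp, Real.enorm_of_nonneg hρ.le,
      ENNReal.ofReal_rpow_of_pos hρ]
  simp only [this]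
  rw [lintegral_const_mul' _ _ ENNReal.ofReal_ne_top,
    setLIntegral_comp_similarity c hρ (fun z ↦ ‖H z‖ₑ ^ p), ← mul_assoc,
    ← ENNReal.ofReal_mul (by positivity), ← Real.rpow_add hρ, sub_eq_add_neg]

/-- Finiteness of `K` provides a weak derivative on each `A n`. By uniqueness they agree almost
everywhere on overlaps, and at each point the one of the first set containing it is taken. A
compactly supported test function on the union lives on a single `A n`. -/
theorem gradEnergy_iUnion_le (p : ℝ) {h : Euc m → Euc ν} {A : ℕ → Set (Euc m)}
    (hA : Monotone A) (hAo : ∀ n, IsOpen (A n)) {K : ℝ≥0∞} (hKt : K < ⊤)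
    (hK : ∀ n, gradEnergy p h (A n) ≤ K) : gradEnergy p h (⋃ n, A n) ≤ K := by
  choose H hH using fun n ↦ exists_hasWeakDerivOn_of_gradEnergy_lt_top ((hK n).trans_lt hKt)
  classical
  have hex : ∀ x, x ∈ ⋃ n, A n → ∃ n, x ∈ A n := fun x hx ↦ mem_iUnion.1 hx
  set G : Euc m → Euc m →L[ℝ] Euc ν := fun x ↦
    if hx : ∃ n, x ∈ A n then H (Nat.find hx) x else 0
  have hGH : ∀ n, H n =ᵐ[volume.restrict (A n)] G := by
    intro n
    have h1 : ∀ k ≤ n, ∀ᵐ x, x ∈ A k → H k x = H n x := fun k hk ↦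
      (ae_restrict_iff' (hAo k).measurableSet).1 ((hH k).ae_eq ((hH n).mono (hA hk)) (hAo k))
    rw [Filter.EventuallyEq, ae_restrict_iff' (hAo n).measurableSet]
    have h2 : ∀ᵐ x, ∀ k, k ≤ n → x ∈ A k → H k x = H n x := by
      rw [ae_all_iff]
      intro k
      by_cases hk : k ≤ n
      · filter_upwards [h1 k hk] with x hx _ using hx
      · exact .of_forall fun x h ↦ absurd h hk
    filter_upwards [h2] with x hx hxn
    have hx' : ∃ n, x ∈ A n := ⟨n, hxn⟩
    simp only [G, dif_pos hx']
    exact (hx _ (Nat.find_min' hx' hxn) (Nat.find_spec hx')).symm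
  have hG : ∀ n, HasWeakDerivOn h G (A n) := fun n ↦
    (hH n).congr_ae (hAo n).measurableSet .rfl (hGH n)
  have hd : Directed (· ⊆ ·) A := directed_of_isDirected_le hA
  have hcpt : ∀ Q : Set (Euc m), IsCompact Q → Q ⊆ ⋃ n, A n → ∃ n, Q ⊆ A n := fun Q hQ hs ↦
    hQ.elim_directed_cover A hAo hs hd
  have hGU : HasWeakDerivOn h G (⋃ n, A n) := by
    have ho : IsOpen (⋃ n, A n) := isOpen_iUnion hAo
    refine ⟨?_, ?_, fun ψ h1 h2 h3 v ↦ ?_⟩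
    · rw [locallyIntegrableOn_iff ho.isLocallyClosed]
      intro Q hQ hQc
      obtain ⟨n, hn⟩ := hcpt Q hQc hQ
      exact (hG n).1.integrableOn_compact_subset hn hQc
    · rw [locallyIntegrableOn_iff ho.isLocallyClosed]
      intro Q hQ hQc
      obtain ⟨n, hn⟩ := hcpt Q hQc hQ
      exact (hG n).2.1.integrableOn_compact_subset hn hQc
    · obtain ⟨n, hn⟩ := hcpt _ h2 h3
      exact (hG n).2.2 ψ h1 h2 hn v
  refine (hGU.gradEnergy_le p).trans ?_
  rw [setLIntegral_iUnion_of_directed _ hd]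
  exact iSup_le fun n ↦ ((hG n).gradEnergy_eq (hAo n) p).symm.trans_le (hK n)

end WeakDeriv

/-! ### Mollification -/

section Mollification

variable {m ν : ℕ} {E : Type*} [NormedAddCommGroup E] [NormedSpace ℝ E]

/-- Translations are continuous in `L¹`. -/
theorem exists_lintegral_translate_sub_le {g : Euc m → E} (hg : Integrable g) {ε : ℝ≥0∞}
    (hε : ε ≠ 0) : ∃ δ > 0, ∀ t : Euc m, ‖t‖ ≤ δ → ∫⁻ x, ‖g (x - t) - g x‖ₑ ≤ ε := by
  obtain ⟨k, hkc, hkl, hk, hki⟩ := hg.exists_hasCompactSupport_lintegral_sub_le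
    (ε := ε / 3) (ENNReal.div_pos hε (by norm_num)).ne'
  obtain ⟨r, hr⟩ := hkc.isCompact.isBounded.subset_closedBall (0 : Euc m)
  have huc : UniformContinuous k := hk.uniformContinuous_of_tendsto_cocompact
    (hkc.is_zero_at_infty)
  set V := volume (Metric.closedBall (0 : Euc m) (r + 1))
  have hV : V < ⊤ := measure_closedBall_lt_top
  obtain ⟨η, hη, hηV⟩ : ∃ η : ℝ≥0, 0 < η ∧ η * V ≤ ε / 3 := by
    obtain ⟨η, hη, h⟩ := ENNReal.exists_nnreal_pos_mul_lt hV.ne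
      (ENNReal.div_pos hε (by norm_num : (3 : ℝ≥0∞) ≠ ⊤)).ne'
    exact ⟨η, hη, h.le⟩
  obtain ⟨δ, hδ, hδk⟩ := Metric.uniformContinuous_iff.1 huc η hη
  refine ⟨min 1 (δ / 2), by positivity, fun t ht ↦ ?_⟩
  have ht1 : ‖t‖ ≤ 1 := ht.trans (min_le_left _ _)
  have ht2 : ‖t‖ < δ := (ht.trans (min_le_right _ _)).trans_lt (by linarith)
  have h1 : ∫⁻ x, ‖k (x - t) - k x‖ₑ ≤ ε / 3 := by
    refine le_trans ?_ hηV
    rw [← setLIntegral_const, ← lintegral_indicator Metric.isClosed_closedBall.measurableSet]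
    refine lintegral_mono fun x ↦ ?_
    by_cases hx : x ∈ Metric.closedBall (0 : Euc m) (r + 1)
    · rw [indicator_of_mem hx, ← edist_eq_enorm_sub, edist_nndist, ENNReal.coe_le_coe]
      exact (hδk (by simpa using ht2)).le
    · rw [mem_closedBall_zero_iff, not_le] at hx
      have e1 : k x = 0 := image_eq_zero_of_notMem_tsupport fun h ↦ by
        have := mem_closedBall_zero_iff.1 (hr h); linarith
      have e2 : k (x - t) = 0 := image_eq_zero_of_notMem_tsupport fun h ↦ by
        have := mem_closedBall_zero_iff.1 (hr h)
        have := norm_sub_norm_le x t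
        linarith
      simp [e1, e2]
  have h2 : ∫⁻ x, ‖g (x - t) - k (x - t)‖ₑ ≤ ε / 3 := by
    rwa [lintegral_sub_right_eq_self (μ := volume) (fun x ↦ ‖g x - k x‖ₑ) t]
  have h3 : ∫⁻ x, ‖k x - g x‖ₑ ≤ ε / 3 := by
    refine le_trans (le_of_eq ?_) hkl
    exact lintegral_congr fun x ↦ by rw [← edist_eq_enorm_sub, edist_comm, edist_eq_enorm_sub]
  have m1 : AEMeasurable (fun x ↦ ‖g (x - t) - k (x - t)‖ₑ) :=
    ((hg.comp_sub_right t).sub (hki.comp_sub_right t)).aestronglyMeasurable.enorm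
  have m2 : AEMeasurable (fun x ↦ ‖k (x - t) - k x‖ₑ) :=
    ((hki.comp_sub_right t).sub hki).aestronglyMeasurable.enorm
  calc ∫⁻ x, ‖g (x - t) - g x‖ₑ
      ≤ ∫⁻ x, (‖g (x - t) - k (x - t)‖ₑ + ‖k (x - t) - k x‖ₑ) + ‖k x - g x‖ₑ := by
        refine lintegral_mono fun x ↦ ?_
        simp only [← edist_eq_enorm_sub]
        exact edist_triangle4 _ _ _ _
    _ ≤ ε / 3 + ε / 3 + ε / 3 := by
        refine (lintegral_add_left' (m1.add m2) _).trans_le (add_le_add ?_ h3)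
        exact (lintegral_add_left' m1 _).trans_le (add_le_add h2 h1)
    _ = ε := ENNReal.add_thirds ε

open ContinuousLinearMap in
-- The mollifier is a probability density supported in `‖t‖ ≤ δ`, so the difference is an average of
-- the differences `g (x - t) - g x`; Tonelli's theorem concludes.
theorem lintegral_convolution_sub_le [CompleteSpace E] {g : Euc m → E} (hg : Integrable g)
    {ε : ℝ≥0∞} {δ : ℝ} (hδ : ∀ t : Euc m, ‖t‖ ≤ δ → ∫⁻ x, ‖g (x - t) - g x‖ₑ ≤ ε)
    (φ : ContDiffBump (0 : Euc m)) (hφ : φ.rOut ≤ δ) :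
    ∫⁻ x, ‖convolution (φ.normed volume) g (lsmul ℝ ℝ) volume x - g x‖ₑ ≤ ε := by
  have hn : ∫⁻ t, ‖φ.normed volume t‖ₑ = 1 := by
    rw [← ofReal_integral_norm_eq_lintegral_enorm φ.integrable_normed]
    simp [Real.norm_of_nonneg (φ.nonneg_normed _), φ.integral_normed]
  have hex : ∀ x, Integrable (fun t ↦ φ.normed volume t • g (x - t)) := fun x ↦
    (φ.hasCompactSupport_normed.convolutionExists_left (lsmul ℝ ℝ) φ.continuous_normed
      hg.locallyIntegrable x)
  have h1 : ∀ x, convolution (φ.normed volume) g (lsmul ℝ ℝ) volume x - g x =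
      ∫ t, φ.normed volume t • (g (x - t) - g x) := by
    intro x
    have e : g x = ∫ t, φ.normed volume t • g x := by
      rw [integral_smul_const, φ.integral_normed, one_smul]
    simp only [smul_sub]
    rw [integral_sub (hex x) (φ.integrable_normed.smul_const _), ← e]
    rfl
  have m1 : AEMeasurable (fun z : Euc m × Euc m ↦
      ‖φ.normed volume z.2 • (g (z.1 - z.2) - g z.1)‖ₑ) (volume.prod volume) := by
    refine AEStronglyMeasurable.enorm ?_
    refine (φ.continuous_normed.comp continuous_snd).aestronglyMeasurable.smul ?_
    refine AEStronglyMeasurable.sub ?_ hg.aestronglyMeasurable.comp_fst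
    exact hg.aestronglyMeasurable.comp_quasiMeasurePreserving
      (quasiMeasurePreserving_sub_of_right_invariant _ _)
  calc ∫⁻ x, ‖convolution (φ.normed volume) g (lsmul ℝ ℝ) volume x - g x‖ₑ
      ≤ ∫⁻ x, ∫⁻ t, ‖φ.normed volume t • (g (x - t) - g x)‖ₑ :=
        lintegral_mono fun x ↦ by rw [h1]; exact enorm_integral_le_lintegral_enorm _
    _ = ∫⁻ t, ∫⁻ x, ‖φ.normed volume t • (g (x - t) - g x)‖ₑ := lintegral_lintegral_swap m1
    _ ≤ ∫⁻ t, ‖φ.normed volume t‖ₑ * ε := by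
        refine lintegral_mono fun t ↦ ?_
        simp only [enorm_smul]
        rw [lintegral_const_mul' _ _ enorm_ne_top]
        by_cases ht : ‖t‖ ≤ δ
        · exact mul_le_mul' le_rfl (hδ t ht)
        · have : φ.normed volume t = 0 := by
            rw [← Function.notMem_support, φ.support_normed_eq, mem_ball_zero_iff]
            exact fun h ↦ ht (h.le.trans hφ)
          simp [this]
    _ ≤ ε := by
        rw [lintegral_mul_const _ φ.continuous_normed.enorm.measurable, hn, one_mul]

theorem integrable_indicator_of_isCompact {E : Type*} [NormedAddCommGroup E] {f : Euc m → E} {Ω K :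
    Set (Euc m)}
    (hf : LocallyIntegrableOn f Ω) (hK : IsCompact K) (hs : K ⊆ Ω) : Integrable (K.indicator f) :=
  (hf.integrableOn_compact_subset hs hK).integrable_indicator hK.isClosed.measurableSet

theorem integrable_smul_translate {E : Type*} [NormedAddCommGroup E] [NormedSpace ℝ E]
    {g : Euc m → E} (hg : Integrable g) {φ : Euc m → ℝ} (hφ : Continuous φ)
    (hc : HasCompactSupport φ) (x : Euc m) : Integrable (fun t ↦ φ t • g (x - t)) :=
  hc.convolutionExists_left (ContinuousLinearMap.lsmul ℝ ℝ) hφ hg.locallyIntegrable x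

theorem integral_smul_clm_apply {φ : Euc m → ℝ} {g : Euc m → Euc m →L[ℝ] Euc ν}
    (h : Integrable (fun t ↦ φ t • g t)) (v : Euc m) :
    (∫ t, φ t • g t) v = ∫ t, φ t • g t v :=
  ContinuousLinearMap.integral_apply h v

open ContinuousLinearMap in
-- The derivative falls on the kernel. As a function of `y`, the kernel `φ (x - y)` is a test
-- function supported in the ball about `x`, hence in `K`, and the definition of the weak derivative
-- moves the derivative to `h`. Truncation to `K` makes the functions integrable without altering
-- the values at such `x`.
theorem HasWeakDerivOn.fderiv_convolution {h : Euc m → Euc ν} {H : Euc m → Euc m →L[ℝ] Euc ν}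
    {Ω K : Set (Euc m)} (hh : HasWeakDerivOn h H Ω) (hK : IsCompact K) (hKΩ : K ⊆ Ω)
    (φ : ContDiffBump (0 : Euc m)) {x : Euc m} (hx : Metric.closedBall x φ.rOut ⊆ K) :
    fderiv ℝ (convolution (φ.normed volume) (K.indicator h) (lsmul ℝ ℝ) volume) x =
      convolution (φ.normed volume) (K.indicator H) (lsmul ℝ ℝ) volume x := by
  have hms : MeasurableSet K := hK.isClosed.measurableSet
  have hg : Integrable (K.indicator h) :=
    integrable_indicator_of_isCompact hh.1 hK hKΩ
  have hG : Integrable (K.indicator H) :=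
    integrable_indicator_of_isCompact hh.2.1 hK hKΩ
  have hφc : ContDiff ℝ 1 (φ.normed (volume : Measure (Euc m))) := (φ.contDiff_normed (n :=
      ⊤)).of_le (by simp)
  have hφs : HasCompactSupport (φ.normed (volume : Measure (Euc m))) := φ.hasCompactSupport_normed
  rw [(hφs.hasFDerivAt_convolution_left (lsmul ℝ ℝ) hφc hg.locallyIntegrable x).fderiv]
  ext1 v
  have hex1 :=
    (hφs.fderiv ℝ).convolutionExists_left ((lsmul ℝ ℝ).precompL (Euc m))
      (hφc.continuous_fderiv (by simp)) hg.locallyIntegrable x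
  have hex2 := integrable_smul_translate hG φ.continuous_normed hφs x
  have hap : (convolution (φ.normed volume) (K.indicator H) (lsmul ℝ ℝ) volume x) v =
      ∫ t, φ.normed volume t • K.indicator H (x - t) v := integral_smul_clm_apply hex2 v
  rw [convolution_def, ContinuousLinearMap.integral_apply hex1, hap]
  set ψ : Euc m → ℝ := fun y ↦ φ.normed volume (x - y) with hψ_def
  have hψ : ContDiff ℝ ∞ ψ := (φ.contDiff_normed (n := ⊤)).comp (contDiff_const.sub contDiff_id)
  have hts : tsupport ψ ⊆ Metric.closedBall x φ.rOut :=
    closure_minimal (fun y hy ↦ by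
      have : x - y ∈ Function.support (φ.normed (volume : Measure (Euc m))) := hy
      rw [φ.support_normed_eq, mem_ball_zero_iff] at this
      rw [Metric.mem_closedBall, dist_comm, dist_eq_norm]
      exact this.le) Metric.isClosed_closedBall
  have hψc : HasCompactSupport ψ := HasCompactSupport.of_support_subset_isCompact
    (isCompact_closedBall x φ.rOut) ((subset_tsupport ψ).trans hts)
  have key := hh.2.2 ψ hψ hψc (hts.trans (hx.trans hKΩ)) v
  have hfd : ∀ y, fderiv ℝ ψ y v = -fderiv ℝ (φ.normed volume) (x - y) v := fun y ↦ by
    have e1 : HasFDerivAt (fun y ↦ x - y) (-ContinuousLinearMap.id ℝ (Euc m)) y :=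
      (hasFDerivAt_id y).const_sub x
    have e2 := (hφc.differentiable (by simp) (x - y)).hasFDerivAt
    have : fderiv ℝ ψ y = _ := (e2.comp y e1).fderiv
    rw [this]; simp
  have s1 : ∫ t, (((lsmul ℝ ℝ).precompL (Euc m) (fderiv ℝ (φ.normed volume) t))
      (K.indicator h (x - t))) v = ∫ y, -(fderiv ℝ ψ y v • h y) := by
    rw [← integral_sub_left_eq_self _ volume x]
    refine integral_congr_ae (.of_forall fun y ↦ ?_)
    simp only [sub_sub_cancel, precompL_apply, lsmul_apply]
    rw [← neg_smul, hfd, neg_neg]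
    by_cases hy : y ∈ K
    · rw [indicator_of_mem hy]
    · have : fderiv ℝ ψ y v = 0 := by
        by_contra hne
        exact hy (hx (hts ((fderiv_apply_test hψ hψc v).2.2 (subset_tsupport _ hne))))
      rw [hfd, neg_eq_zero] at this
      rw [this, zero_smul, zero_smul]
  have s2 : ∫ t, φ.normed volume t • K.indicator H (x - t) v =
      ∫ y, ψ y • H y v := by
    rw [← integral_sub_left_eq_self _ volume x]
    refine integral_congr_ae (.of_forall fun y ↦ ?_)
    simp only [sub_sub_cancel]
    by_cases hy : y ∈ K
    · rw [indicator_of_mem hy]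
    · have : ψ y = 0 := by
        by_contra hne
        exact hy (hx (hts (subset_tsupport _ hne)))
      rw [this]
      simp only [ψ] at this
      rw [this, zero_smul, zero_smul]
  rw [s1, s2, integral_neg, key, neg_neg]

open ContinuousLinearMap in
/-- A weakly differentiable function is approximated on compact sets by smooth functions. -/
theorem HasWeakDerivOn.exists_contDiff_approx {h : Euc m → Euc ν} {H : Euc m → Euc m →L[ℝ] Euc ν}
    {Ω K : Set (Euc m)} (hh : HasWeakDerivOn h H Ω) (hΩ : IsOpen Ω) (hK : IsCompact K)
    (hKΩ : K ⊆ Ω) {ε : ℝ≥0∞} (hε : ε ≠ 0) :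
    ∃ f : Euc m → Euc ν, ContDiff ℝ 1 f ∧ HasCompactSupport f ∧
      ∫⁻ x in K, ‖f x - h x‖ₑ ≤ ε ∧ ∫⁻ x in K, ‖fderiv ℝ f x - H x‖ₑ ≤ ε := by
  -- On `K` a mollification at scale at most `d` sees only the compact neighbourhood `K'`, on which
  -- `h` and `H` are integrable.
  obtain ⟨d, hd, hdΩ⟩ := hK.exists_cthickening_subset_open hΩ hKΩ
  set K' := Metric.cthickening d K
  have hK'c : IsCompact K' := hK.cthickening
  have hKK' : K ⊆ K' := Metric.self_subset_cthickening K
  have hms : MeasurableSet K' := hK'c.isClosed.measurableSet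
  have hg : Integrable (K'.indicator h) :=
    integrable_indicator_of_isCompact hh.1 hK'c hdΩ
  have hG : Integrable (K'.indicator H) :=
    integrable_indicator_of_isCompact hh.2.1 hK'c hdΩ
  obtain ⟨δ1, hδ1, hg1⟩ := exists_lintegral_translate_sub_le hg hε
  obtain ⟨δ2, hδ2, hG1⟩ := exists_lintegral_translate_sub_le hG hε
  have hδ : 0 < min d (min δ1 δ2) := by positivity
  let φ : ContDiffBump (0 : Euc m) :=
    ⟨min d (min δ1 δ2) / 2, min d (min δ1 δ2), by positivity, by linarith⟩
  have hφd : φ.rOut ≤ d := min_le_left _ _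
  have hφ1 : φ.rOut ≤ δ1 := (min_le_right _ _).trans (min_le_left _ _)
  have hφ2 : φ.rOut ≤ δ2 := (min_le_right _ _).trans (min_le_right _ _)
  have hφc : ContDiff ℝ 1 (φ.normed (volume : Measure (Euc m))) := (φ.contDiff_normed (n :=
      ⊤)).of_le (by simp)
  have hgc : HasCompactSupport (K'.indicator h) :=
    HasCompactSupport.intro hK'c fun x hx ↦ indicator_of_notMem hx _
  refine ⟨convolution (φ.normed volume) (K'.indicator h) (lsmul ℝ ℝ) volume,
    φ.hasCompactSupport_normed.contDiff_convolution_left (n := 1) _ hφc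
    hg.locallyIntegrable, φ.hasCompactSupport_normed.convolution _ hgc, ?_, ?_⟩
  · refine le_trans (le_trans (lintegral_mono_ae ?_) (setLIntegral_le_lintegral K _))
      (lintegral_convolution_sub_le hg hg1 φ hφ1)
    filter_upwards [ae_restrict_mem hK.isClosed.measurableSet] with x hx
    rw [indicator_of_mem (hKK' hx)]
  · refine le_trans (le_trans (lintegral_mono_ae ?_) (setLIntegral_le_lintegral K _))
      (lintegral_convolution_sub_le hG hG1 φ hφ2)
    filter_upwards [ae_restrict_mem hK.isClosed.measurableSet] with x hx
    rw [indicator_of_mem (hKK' hx), hh.fderiv_convolution hK'c hdΩ φ]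
    exact (Metric.closedBall_subset_closedBall hφd).trans
      (Metric.closedBall_subset_cthickening hx d)

end Mollification

/-! ### Composition of weakly differentiable functions with Lipschitz maps -/

section Fuglede

variable {m ν : ℕ}

theorem enorm_integral_smul_le_of_support {E : Type*} [NormedAddCommGroup E] [NormedSpace ℝ E]
    {g : Euc m → ℝ} {f : Euc m → E} {Q : Set (Euc m)} (hQ : MeasurableSet Q) {C : ℝ≥0}
    (hC : ∀ x, ‖g x‖ ≤ C) (hg : ∀ x ∉ Q, g x = 0) :
    ‖∫ x, g x • f x‖ₑ ≤ C * ∫⁻ x in Q, ‖f x‖ₑ := by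
  refine (enorm_integral_le_lintegral_enorm _).trans ?_
  rw [← lintegral_const_mul' _ _ ENNReal.coe_ne_top, ← lintegral_indicator hQ]
  refine lintegral_mono fun x ↦ ?_
  by_cases hx : x ∈ Q
  · rw [indicator_of_mem hx, enorm_smul]
    refine mul_le_mul' ?_ le_rfl
    rw [enorm_eq_nnnorm, ENNReal.coe_le_coe]
    exact hC x
  · simp [hg x hx]

/-- The identity defining weak derivatives passes to limits in `L¹` on the support of the test
function. The approximation may depend on the compact set. -/
theorem HasWeakDerivOn.of_approx {h : Euc m → Euc ν} {H : Euc m → Euc m →L[ℝ] Euc ν}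
    {Ω : Set (Euc m)} (hh : LocallyIntegrableOn h Ω) (hH : LocallyIntegrableOn H Ω)
    (ha : ∀ Q ⊆ Ω, IsCompact Q → ∀ ε : ℝ≥0∞, ε ≠ 0 → ∃ f F, HasWeakDerivOn f F Ω ∧
      ∫⁻ x in Q, ‖h x - f x‖ₑ ≤ ε ∧ ∫⁻ x in Q, ‖H x - F x‖ₑ ≤ ε) :
    HasWeakDerivOn h H Ω := by
  refine ⟨hh, hH, fun ψ h1 h2 h3 v ↦ ?_⟩
  obtain ⟨t1, t2, t3⟩ := fderiv_apply_test h1 h2 v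
  obtain ⟨C1, hC1⟩ := h2.exists_bound_of_continuous h1.continuous
  obtain ⟨C2, hC2⟩ := t2.exists_bound_of_continuous t1
  have hQm : MeasurableSet (tsupport ψ) := (isClosed_tsupport ψ).measurableSet
  rw [eq_neg_iff_add_eq_zero, ← enorm_eq_zero]
  set K : ℝ≥0 := C2.toNNReal + C1.toNNReal * ‖v‖₊
  have key : ∀ ε : ℝ≥0, 0 < ε → ‖(∫ y, fderiv ℝ ψ y v • h y) + ∫ y, ψ y • H y v‖ₑ ≤ K * ε := by
    intro ε hε
    obtain ⟨f, F, hfF, e1, e2⟩ := ha _ h3 h2 ε (by simpa using hε.ne')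
    have i1 := integrable_smul_of_tsupport_subset hh t1 t2 (t3.trans h3)
    have i2 := integrable_smul_of_tsupport_subset (locallyIntegrableOn_clm_apply hH v)
      h1.continuous h2 h3
    have i3 := hfF.integrable_fderiv_smul h1 h2 h3 v
    have i4 := hfF.integrable_smul_apply h1 h2 h3 v
    have e : (∫ y, fderiv ℝ ψ y v • h y) + ∫ y, ψ y • H y v =
        (∫ y, fderiv ℝ ψ y v • (h y - f y)) + ∫ y, ψ y • (H y v - F y v) := by
      simp only [smul_sub]
      rw [integral_sub i1 i3, integral_sub i2 i4, hfF.2.2 ψ h1 h2 h3 v]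
      abel
    rw [e]
    refine (enorm_add_le _ _).trans ?_
    have b1 : ‖∫ y, fderiv ℝ ψ y v • (h y - f y)‖ₑ ≤ C2.toNNReal * ε :=
      (enorm_integral_smul_le_of_support hQm (fun x ↦ (hC2 x).trans (Real.le_coe_toNNReal _))
        fun x hx ↦ image_eq_zero_of_notMem_tsupport (f := fun y ↦ fderiv ℝ ψ y v)
        fun h ↦ hx (t3 h)).trans
        (mul_le_mul' le_rfl e1)
    have b2 : ‖∫ y, ψ y • (H y v - F y v)‖ₑ ≤ C1.toNNReal * (‖v‖ₑ * ε) := by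
      refine (enorm_integral_smul_le_of_support hQm
        (fun x ↦ (hC1 x).trans (Real.le_coe_toNNReal _))
        fun x hx ↦ image_eq_zero_of_notMem_tsupport hx).trans (mul_le_mul' le_rfl ?_)
      refine le_trans ?_ (mul_le_mul' le_rfl e2)
      rw [← lintegral_const_mul' _ _ enorm_ne_top]
      refine lintegral_mono fun x ↦ ?_
      rw [mul_comm]
      exact (H x - F x).le_opENorm v
    refine (add_le_add b1 b2).trans_eq ?_
    rw [← mul_assoc, ← add_mul]
    simp [K, enorm_eq_nnnorm]
  by_contra hne
  have hK : (K : ℝ≥0∞) ≠ ⊤ := ENNReal.coe_ne_top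
  obtain ⟨ε, hε, hlt⟩ := ENNReal.exists_nnreal_pos_mul_lt hK hne
  exact absurd (key ε hε) (not_le.2 (by rwa [mul_comm]))

theorem integrableOn_of_sub {E : Type*} [NormedAddCommGroup E] {f g : Euc m → E} {Q : Set (Euc m)}
    (h : IntegrableOn (fun x ↦ f x - g x) Q) (hg : IntegrableOn g Q) : IntegrableOn f Q :=
  (h.add hg).congr (.of_forall fun x ↦ by simp)

theorem lintegral_clm_comp_le {A B : Euc m → Euc m →L[ℝ] Euc ν} {D : Euc m → Euc m →L[ℝ] Euc m}
    {L : ℝ≥0} (hD : ∀ x, ‖D x‖ ≤ L) (Q : Set (Euc m)) :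
    ∫⁻ x in Q, ‖(A x).comp (D x) - (B x).comp (D x)‖ₑ ≤ L * ∫⁻ x in Q, ‖A x - B x‖ₑ := by
  rw [← lintegral_const_mul' _ _ ENNReal.coe_ne_top]
  refine lintegral_mono fun x ↦ ?_
  rw [← ContinuousLinearMap.sub_comp]
  calc ‖(A x - B x).comp (D x)‖ₑ ≤ ‖A x - B x‖ₑ * ‖D x‖ₑ := by
        simp only [enorm_eq_nnnorm]
        exact_mod_cast ContinuousLinearMap.opNorm_comp_le (A x - B x) (D x)
    _ ≤ ‖A x - B x‖ₑ * L := by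
        refine mul_le_mul' le_rfl ?_
        rw [enorm_eq_nnnorm, ENNReal.coe_le_coe]
        exact hD x
    _ = _ := mul_comm _ _

/-- There is a weight `W`, integrable on a given compact set, such that the chain rule for weak
derivatives holds for all Lipschitz maps `R` for which `W ∘ R` is locally integrable. -/
theorem HasWeakDerivOn.exists_comp_lipschitz {h : Euc m → Euc ν} {H : Euc m → Euc m →L[ℝ] Euc ν}
    {Ω K : Set (Euc m)} (hh : HasWeakDerivOn h H Ω) (hΩ : IsOpen Ω) (hK : IsCompact K)
    (hKΩ : K ⊆ Ω) (hhm : StronglyMeasurable h) (hHm : StronglyMeasurable H) :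
    ∃ W : Euc m → ℝ≥0∞, Measurable W ∧ ∫⁻ x in K, W x < ⊤ ∧
      ∀ (R : Euc m → Euc m) (L : ℝ≥0) (Ω' : Set (Euc m)), LipschitzWith L R → IsOpen Ω' →
        (∀ Q ⊆ Ω', IsCompact Q → ∫⁻ x in Q, W (R x) < ⊤) →
        HasWeakDerivOn (fun x ↦ h (R x)) (fun x ↦ (H (R x)).comp (fderiv ℝ R x)) Ω' := by
  -- Fuglede's argument: `f k` approximates `h` and its derivative on `K` up to `2 ^ (-k)` in `L¹`,
  -- and `W` is the sum of the pointwise errors. If `W ∘ R` is integrable on a compact set, then the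
  -- errors composed with `R` tend to `0` in `L¹` there, and the chain rule for the smooth `f k`
  -- passes to the limit.
  have hε : ∀ k : ℕ, ENNReal.ofReal ((1 / 2) ^ k) ≠ 0 := fun k ↦ by simp
  choose f hf hfc hf1 hf2 using fun k ↦ hh.exists_contDiff_approx hΩ hK hKΩ (hε k)
  set a : ℕ → Euc m → ℝ≥0∞ := fun k x ↦ ‖f k x - h x‖ₑ + ‖fderiv ℝ (f k) x - H x‖ₑ with ha
  have hfm : ∀ k, StronglyMeasurable (f k) := fun k ↦ (hf k).continuous.stronglyMeasurable
  have hfm' : ∀ k, StronglyMeasurable (fderiv ℝ (f k)) := fun k ↦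
    ((hf k).continuous_fderiv (by simp)).stronglyMeasurable
  have ham : ∀ k, Measurable (a k) := fun k ↦
    ((hfm k).sub hhm).enorm.add ((hfm' k).sub hHm).enorm
  refine ⟨fun x ↦ ∑' k, a k x, .tsum ham, ?_, fun R L Ω' hR hΩ' hW ↦ ?_⟩
  · rw [lintegral_tsum fun k ↦ (ham k).aemeasurable]
    have : ∀ k, ∫⁻ x in K, a k x ≤ 2 * ENNReal.ofReal ((1 / 2) ^ k) := fun k ↦ by
      rw [two_mul]
      exact (lintegral_add_left ((hfm k).sub hhm).enorm _).trans_le (add_le_add (hf1 k) (hf2 k))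
    refine (ENNReal.tsum_le_tsum this).trans_lt ?_
    rw [ENNReal.tsum_mul_left]
    refine ENNReal.mul_lt_top (by simp) ?_
    rw [← ENNReal.ofReal_tsum_of_nonneg (fun k ↦ by positivity) summable_geometric_two]
    exact ENNReal.ofReal_lt_top
  · have hRm : Measurable R := hR.continuous.measurable
    have hDm : StronglyMeasurable (fderiv ℝ R) := (measurable_fderiv ℝ R).stronglyMeasurable
    have hD : ∀ x, ‖fderiv ℝ R x‖ ≤ L := fun x ↦ norm_fderiv_le_of_lipschitz ℝ hR
    have hcomp : ∀ {G : Euc m → Euc m →L[ℝ] Euc ν}, StronglyMeasurable G →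
        StronglyMeasurable fun x ↦ (G (R x)).comp (fderiv ℝ R x) := fun {G} hG ↦
      isBoundedBilinearMap_comp.continuous.comp_stronglyMeasurable
        ((hG.comp_measurable hRm).prodMk hDm)
    have hfw : ∀ k, HasWeakDerivOn (fun x ↦ f k (R x))
        (fun x ↦ (fderiv ℝ (f k) (R x)).comp (fderiv ℝ R x)) univ := by
      intro k
      obtain ⟨C, hC⟩ := (hf k).lipschitzWith_of_hasCompactSupport (hfc k) (by simp)
      refine (hC.comp hR).hasWeakDerivOn.congr_ae .univ .rfl ?_
      rw [Measure.restrict_univ]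
      filter_upwards [hR.ae_differentiableAt] with x hx
      exact (((hf k).differentiable (by simp) (R x)).hasFDerivAt.comp x hx.hasFDerivAt).fderiv
    have hax : ∀ Q ⊆ Ω', IsCompact Q → ∑' k, ∫⁻ x in Q, a k (R x) < ⊤ := fun Q hQ hQc ↦ by
      refine (lintegral_tsum fun k ↦ ((ham k).comp hRm).aemeasurable).symm.trans_lt ?_
      exact hW Q hQ hQc
    have b1 : ∀ k Q, ∫⁻ x in Q, ‖h (R x) - f k (R x)‖ₑ ≤ ∫⁻ x in Q, a k (R x) := fun k Q ↦
      lintegral_mono fun x ↦ by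
        rw [← edist_eq_enorm_sub, edist_comm, edist_eq_enorm_sub]; exact le_self_add
    have b2 : ∀ k Q, ∫⁻ x in Q, ‖(H (R x)).comp (fderiv ℝ R x) -
        (fderiv ℝ (f k) (R x)).comp (fderiv ℝ R x)‖ₑ ≤ L * ∫⁻ x in Q, a k (R x) := fun k Q ↦ by
      refine (lintegral_clm_comp_le hD Q).trans (mul_le_mul' le_rfl (lintegral_mono fun x ↦ ?_))
      rw [← edist_eq_enorm_sub, edist_comm, edist_eq_enorm_sub]; exact le_add_self
    refine HasWeakDerivOn.of_approx ?_ ?_ fun Q hQ hQc ε hε ↦ ?_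
    · rw [locallyIntegrableOn_iff hΩ'.isLocallyClosed]
      intro Q hQ hQc
      have i1 : IntegrableOn (fun x ↦ h (R x) - f 0 (R x)) Q :=
        ⟨((hhm.comp_measurable hRm).sub ((hfm 0).comp_measurable hRm)).aestronglyMeasurable,
          (b1 0 Q).trans_lt ((ENNReal.le_tsum 0).trans_lt (hax Q hQ hQc))⟩
      have i2 := (hfw 0).1.integrableOn_compact_subset (subset_univ Q) hQc
      exact integrableOn_of_sub i1 i2
    · rw [locallyIntegrableOn_iff hΩ'.isLocallyClosed]
      intro Q hQ hQc
      have i1 : IntegrableOn (fun x ↦ (H (R x)).comp (fderiv ℝ R x) -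
          (fderiv ℝ (f 0) (R x)).comp (fderiv ℝ R x)) Q :=
        ⟨((hcomp hHm).sub (hcomp (hfm' 0))).aestronglyMeasurable,
          (b2 0 Q).trans_lt (ENNReal.mul_lt_top ENNReal.coe_lt_top
            ((ENNReal.le_tsum 0).trans_lt (hax Q hQ hQc)))⟩
      have i2 := (hfw 0).2.1.integrableOn_compact_subset (subset_univ Q) hQc
      exact integrableOn_of_sub i1 i2
    · have ht := ENNReal.tendsto_atTop_zero_of_tsum_ne_top (hax Q hQ hQc).ne
      have hpos : 0 < ε / (1 + L) := ENNReal.div_pos hε (by finiteness)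
      obtain ⟨k, hk⟩ := (ht.eventually_le_const hpos).exists
      have hmul : (1 + L : ℝ≥0∞) * (ε / (1 + L)) = ε :=
        ENNReal.mul_div_cancel (by simp) (by finiteness)
      refine ⟨_, _, (hfw k).mono (subset_univ _), (b1 k Q).trans (hk.trans ?_),
        (b2 k Q).trans ((mul_le_mul' le_rfl hk).trans ?_)⟩
      · refine le_trans ?_ hmul.le
        exact le_mul_of_one_le_left' le_self_add
      · refine le_trans (mul_le_mul' le_add_self le_rfl) hmul.le

end Fuglede

/-! ### Gluing and localization of weak derivatives -/

section WeakGlue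

variable {m ν : ℕ}

theorem setLIntegral_translate_le {A B : Set (Euc m)} (hA : MeasurableSet A) (hB : MeasurableSet B)
    {v : Euc m} (h : ∀ x ∈ A, x + v ∈ B) (g : Euc m → ℝ≥0∞) :
    ∫⁻ x in A, g (x + v) ≤ ∫⁻ x in B, g x := by
  rw [← lintegral_indicator hA, ← lintegral_indicator hB,
    ← lintegral_add_right_eq_self (B.indicator g) v]
  refine lintegral_mono fun x ↦ ?_
  by_cases hx : x ∈ A
  · rw [indicator_of_mem hx, indicator_of_mem (h x hx)]
  · simp [hx]

theorem enorm_le_add_enorm_sub {E : Type*} [NormedAddCommGroup E] (a b : E) :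
    ‖a‖ₑ ≤ ‖b‖ₑ + ‖a - b‖ₑ := by
  conv_lhs => rw [← add_sub_cancel b a]
  exact enorm_add_le _ _

theorem enorm_indicator_apply {X E : Type*} [NormedAddCommGroup E] (B : Set X) (f : X → E) (x : X) :
    ‖B.indicator f x‖ₑ = B.indicator (fun x ↦ ‖f x‖ₑ) x := by
  by_cases hx : x ∈ B <;> simp [hx]

/-- The derivative is integrated along the segments of direction `v`, and Tonelli's theorem
exchanges the time and space integrals. -/
theorem lintegral_translate_le_of_contDiff {f : Euc m → Euc ν} (hf : ContDiff ℝ 1 f)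
    (A : Set (Euc m)) (v : Euc m) {B : Set (Euc m)}
    (hB : ∀ x ∈ A, ∀ t ∈ Icc (0 : ℝ) 1, x + t • v ∈ B) (hA : MeasurableSet A)
    (hBm : MeasurableSet B) :
    ∫⁻ x in A, ‖f x‖ₑ ≤ (∫⁻ x in A, ‖f (x + v)‖ₑ) + ‖v‖ₑ * ∫⁻ x in B, ‖fderiv ℝ f x‖ₑ := by
  have hfd : Continuous (fderiv ℝ f) := hf.continuous_fderiv (by simp)
  have hm : Measurable fun z : Euc m × ℝ ↦ ‖fderiv ℝ f (z.1 + z.2 • v)‖ₑ :=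
    (hfd.comp (by fun_prop)).enorm.measurable
  have h1 : ∀ x, ‖f x‖ₑ ≤ ‖f (x + v)‖ₑ +
      ‖v‖ₑ * ∫⁻ t in Icc (0 : ℝ) 1, ‖fderiv ℝ f (x + t • v)‖ₑ := by
    intro x
    have hd : ∀ t ∈ uIcc (0 : ℝ) 1, HasDerivAt (fun t : ℝ ↦ f (x + t • v))
        (fderiv ℝ f (x + t • v) v) t := fun t _ ↦ by
      have e1 : HasDerivAt (fun t : ℝ ↦ x + t • v) v t := by
        simpa using ((hasDerivAt_id t).smul_const v).const_add x
      exact ((hf.differentiable (by simp) _).hasFDerivAt.comp_hasDerivAt t e1)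
    have hc : Continuous fun t : ℝ ↦ fderiv ℝ f (x + t • v) v :=
      (hfd.comp (by fun_prop)).clm_apply continuous_const
    have e := intervalIntegral.integral_eq_sub_of_hasDerivAt hd (hc.intervalIntegrable _ _)
    simp only [one_smul, zero_smul, add_zero] at e
    have e2 : f x = f (x + v) - ∫ t in (0 : ℝ)..1, fderiv ℝ f (x + t • v) v := by rw [e]; abel
    calc ‖f x‖ₑ ≤ ‖f (x + v)‖ₑ + ‖∫ t in (0 : ℝ)..1, fderiv ℝ f (x + t • v) v‖ₑ := by
          conv_lhs => rw [e2]
          exact enorm_sub_le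
      _ ≤ _ := by
          refine add_le_add le_rfl ?_
          rw [intervalIntegral.integral_of_le zero_le_one]
          refine (enorm_integral_le_lintegral_enorm _).trans ?_
          rw [← lintegral_const_mul' _ _ enorm_ne_top]
          refine (lintegral_mono_set Ioc_subset_Icc_self).trans (lintegral_mono fun t ↦ ?_)
          rw [mul_comm]
          exact (fderiv ℝ f (x + t • v)).le_opENorm v
  calc ∫⁻ x in A, ‖f x‖ₑ
      ≤ ∫⁻ x in A, (‖f (x + v)‖ₑ + ‖v‖ₑ * ∫⁻ t in Icc (0 : ℝ) 1, ‖fderiv ℝ f (x + t • v)‖ₑ) :=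
        lintegral_mono fun x ↦ h1 x
    _ = (∫⁻ x in A, ‖f (x + v)‖ₑ) +
        ‖v‖ₑ * ∫⁻ x in A, ∫⁻ t in Icc (0 : ℝ) 1, ‖fderiv ℝ f (x + t • v)‖ₑ := by
        have : Measurable fun x ↦ ‖f (x + v)‖ₑ :=
          (hf.continuous.comp (continuous_add_const v)).enorm.measurable
        rw [lintegral_add_left this, lintegral_const_mul' _ _ enorm_ne_top]
    _ ≤ _ := by
        refine add_le_add le_rfl (mul_le_mul' le_rfl ?_)
        rw [lintegral_lintegral_swap hm.aemeasurable]
        calc ∫⁻ t in Icc (0 : ℝ) 1, ∫⁻ x in A, ‖fderiv ℝ f (x + t • v)‖ₑ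
            ≤ ∫⁻ t in Icc (0 : ℝ) 1, ∫⁻ x in B, ‖fderiv ℝ f x‖ₑ := by
              refine lintegral_mono_ae ?_
              filter_upwards [ae_restrict_mem measurableSet_Icc] with t ht
              exact setLIntegral_translate_le hA hBm (fun x hx ↦ hB x hx t ht) _
          _ = _ := by simp

/-- A Poincaré inequality. -/
theorem HasWeakDerivOn.lintegral_le (hm : 1 ≤ m) {h : Euc m → Euc ν}
    {H : Euc m → Euc m →L[ℝ] Euc ν} (hh : HasWeakDerivOn h H univ) {c : Euc m} {r : ℝ} (hr : 0 < r)
    (h0 : ∀ x ∉ Metric.closedBall c r, h x = 0) :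
    ∫⁻ x in Metric.closedBall c r, ‖h x‖ₑ ≤ ENNReal.ofReal (3 * r) * ∫⁻ x, ‖H x‖ₑ := by
  have : Nonempty (Fin m) := ⟨⟨0, hm⟩⟩
  -- A translation by a vector of length `3r` moves the ball of radius `r` off itself, to where `h`
  -- vanishes, and the segments travelled stay in the ball of radius `4r`.
  obtain ⟨v, hv⟩ := exists_norm_eq (Euc m) (by positivity : (0 : ℝ) ≤ 3 * r)
  have hve : ‖v‖ₑ = ENNReal.ofReal (3 * r) := by rw [← ofReal_norm, hv]
  set A := Metric.closedBall c r
  set B := Metric.closedBall c (4 * r)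
  have hA : MeasurableSet A := Metric.isClosed_closedBall.measurableSet
  have hBm : MeasurableSet B := Metric.isClosed_closedBall.measurableSet
  have hB : ∀ x ∈ A, ∀ t ∈ Icc (0 : ℝ) 1, x + t • v ∈ B := fun x hx t ht ↦ by
    rw [Metric.mem_closedBall, dist_eq_norm] at hx ⊢
    have e : x + t • v - c = (x - c) + t • v := by abel
    have h2 : ‖t • v‖ ≤ 3 * r := by
      rw [norm_smul, hv, Real.norm_of_nonneg ht.1]
      exact mul_le_of_le_one_left (by positivity) ht.2
    rw [e]
    linarith [norm_add_le (x - c) (t • v)]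
  have hAB : A ⊆ B := Metric.closedBall_subset_closedBall (by linarith)
  have hv0 : ∀ x ∈ A, h (x + v) = 0 := fun x hx ↦ h0 _ fun hx' ↦ by
    rw [Metric.mem_closedBall, dist_eq_norm] at hx hx'
    have e : v = (x + v - c) - (x - c) := by abel
    have := norm_sub_le (x + v - c) (x - c)
    rw [← e, hv] at this
    linarith
  have key : ∀ ε : ℝ≥0, 0 < ε → ∫⁻ x in A, ‖h x‖ₑ ≤
      ENNReal.ofReal (3 * r) * (∫⁻ x, ‖H x‖ₑ) + (2 + ENNReal.ofReal (3 * r)) * ε := by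
    intro ε hε
    obtain ⟨f, hf, -, hf1, hf2⟩ := hh.exists_contDiff_approx isOpen_univ
      (isCompact_closedBall c (4 * r)) (subset_univ _) (ε := ε) (by simpa using hε.ne')
    have hmf : Measurable fun x ↦ ‖f x‖ₑ := hf.continuous.enorm.measurable
    have hB' : ∫⁻ x in A, ‖f (x + v)‖ₑ ≤ ε := by
      have h2 : ∫⁻ x in A, ‖f (x + v)‖ₑ = ∫⁻ x in A, ‖f (x + v) - h (x + v)‖ₑ := by
        refine setLIntegral_congr_fun hA fun x hx ↦ ?_
        rw [hv0 x hx, sub_zero]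
      rw [h2]
      refine (setLIntegral_translate_le hA hBm (fun x hx ↦ ?_) fun x ↦ ‖f x - h x‖ₑ).trans hf1
      simpa using hB x hx 1 (by simp)
    have h1 : ∫⁻ x in A, ‖h x‖ₑ ≤ (∫⁻ x in A, ‖f x‖ₑ) + ε := by
      refine le_trans ?_ (add_le_add le_rfl ((lintegral_mono_set hAB).trans hf1))
      rw [← lintegral_add_left hmf]
      refine lintegral_mono fun x ↦ ?_
      rw [← edist_eq_enorm_sub, edist_comm, edist_eq_enorm_sub]
      exact enorm_le_add_enorm_sub _ _
    have h2 : ∫⁻ x in B, ‖fderiv ℝ f x‖ₑ ≤ (∫⁻ x, ‖H x‖ₑ) + ε := by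
      refine le_trans ?_ (add_le_add (setLIntegral_le_lintegral B _) hf2)
      have hHm : AEMeasurable (fun x ↦ ‖H x‖ₑ) (volume.restrict B) :=
        (hh.2.1.integrableOn_compact_subset (subset_univ _)
          (isCompact_closedBall c (4 * r))).aestronglyMeasurable.enorm
      rw [← lintegral_add_left' hHm]
      exact lintegral_mono fun x ↦ enorm_le_add_enorm_sub _ _
    calc ∫⁻ x in A, ‖h x‖ₑ ≤ (∫⁻ x in A, ‖f x‖ₑ) + ε := h1
      _ ≤ ((∫⁻ x in A, ‖f (x + v)‖ₑ) + ‖v‖ₑ * ∫⁻ x in B, ‖fderiv ℝ f x‖ₑ) + ε :=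
          add_le_add (lintegral_translate_le_of_contDiff hf A v hB hA hBm) le_rfl
      _ ≤ (ε + ENNReal.ofReal (3 * r) * ((∫⁻ x, ‖H x‖ₑ) + ε)) + ε := by
          rw [hve]
          exact add_le_add (add_le_add hB' (mul_le_mul' le_rfl h2)) le_rfl
      _ = _ := by ring
  refine ENNReal.le_of_forall_pos_le_add fun η hη _ ↦ ?_
  obtain ⟨ε, hε, hlt⟩ := ENNReal.exists_nnreal_pos_mul_lt
    (a := 2 + ENNReal.ofReal (3 * r)) (b := (η : ℝ≥0∞)) (by finiteness) (by simpa using hη.ne')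
  refine (key ε hε).trans (add_le_add le_rfl ?_)
  rw [mul_comm]
  exact hlt.le

theorem HasWeakDerivOn.ae_eq_zero_of_const {h : Euc m → Euc ν} {H : Euc m → Euc m →L[ℝ] Euc ν}
    {U : Set (Euc m)} {b : Euc ν} (hh : HasWeakDerivOn h H univ) (hU : IsOpen U)
    (hb : ∀ x ∈ U, h x = b) : ∀ᵐ x, x ∈ U → H x = 0 := by
  rw [← ae_restrict_iff' hU.measurableSet]
  refine (hh.mono (subset_univ U)).ae_eq ((hasWeakDerivOn_const b U).congr_ae hU.measurableSet
    ?_ .rfl) hU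
  filter_upwards [ae_restrict_mem hU.measurableSet] with x hx using (hb x hx).symm

theorem integrable_tsum_of_lintegral {I E : Type*} [Countable I] [NormedAddCommGroup E]
    [CompleteSpace E] {f : I → Euc m → E} (hf : ∀ i, AEStronglyMeasurable (f i))
    (hs : ∑' i, ∫⁻ x, ‖f i x‖ₑ ≠ ⊤) (hsum : ∀ x, Summable fun i ↦ f i x) :
    Integrable fun x ↦ ∑' i, f i x := by
  refine ⟨aestronglyMeasurable_of_tendsto_ae Filter.atTop
    (f := fun (s : Finset I) x ↦ ∑ i ∈ s, f i x) (fun s ↦ ?_) (.of_forall fun x ↦ (hsum x).hasSum),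
        ?_⟩
  · exact Finset.aestronglyMeasurable_fun_sum s fun i _ ↦ hf i
  · refine lt_of_le_of_lt ?_ (lt_top_iff_ne_top.2 hs)
    rw [← lintegral_tsum fun i ↦ (hf i).enorm]
    exact lintegral_mono fun x ↦ enorm_tsum_le_tsum_enorm

/-- Against a bounded test function, summability of the `L¹` norms of the functions and of their
derivatives permits the exchange of sum and integral. -/
theorem hasWeakDerivOn_tsum {I : Type*} [Countable I] {h : I → Euc m → Euc ν}
    {H : I → Euc m → Euc m →L[ℝ] Euc ν} (hh : ∀ i, HasWeakDerivOn (h i) (H i) univ)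
    (hs : ∑' i, ∫⁻ x, ‖h i x‖ₑ ≠ ⊤) (hS : ∑' i, ∫⁻ x, ‖H i x‖ₑ ≠ ⊤)
    (hsum : ∀ x, Summable fun i ↦ h i x) (hSum : ∀ x, Summable fun i ↦ H i x) :
    HasWeakDerivOn (fun x ↦ ∑' i, h i x) (fun x ↦ ∑' i, H i x) univ := by
  have m1 : ∀ i, AEStronglyMeasurable (h i) := fun i ↦
    (locallyIntegrableOn_univ.1 (hh i).1).aestronglyMeasurable
  have m2 : ∀ i, AEStronglyMeasurable (H i) := fun i ↦
    (locallyIntegrableOn_univ.1 (hh i).2.1).aestronglyMeasurable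
  refine ⟨(integrable_tsum_of_lintegral m1 hs hsum).locallyIntegrable.locallyIntegrableOn _,
    (integrable_tsum_of_lintegral m2 hS hSum).locallyIntegrable.locallyIntegrableOn _,
    fun ψ h1 h2 h3 v ↦ ?_⟩
  obtain ⟨t1, t2, t3⟩ := fderiv_apply_test h1 h2 v
  have bound : ∀ {g : Euc m → ℝ}, Continuous g → HasCompactSupport g →
      ∀ {f : I → Euc m → Euc ν}, ∑' i, ∫⁻ x, ‖f i x‖ₑ ≠ ⊤ →
      ∑' i, ∫⁻ x, ‖g x • f i x‖ₑ ≠ ⊤ := by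
    intro g hg hgc f hf
    obtain ⟨C, hC⟩ := hgc.exists_bound_of_continuous hg
    have : ∀ i, ∫⁻ x, ‖g x • f i x‖ₑ ≤ C.toNNReal * ∫⁻ x, ‖f i x‖ₑ := fun i ↦ by
      rw [← lintegral_const_mul' _ _ ENNReal.coe_ne_top]
      refine lintegral_mono fun x ↦ ?_
      rw [enorm_smul]
      refine mul_le_mul' ?_ le_rfl
      rw [enorm_eq_nnnorm, ENNReal.coe_le_coe]
      exact (hC x).trans (Real.le_coe_toNNReal _)
    refine ne_top_of_le_ne_top ?_ (ENNReal.tsum_le_tsum this)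
    rw [ENNReal.tsum_mul_left]
    finiteness
  have hSv : ∑' i, ∫⁻ x, ‖H i x v‖ₑ ≠ ⊤ := by
    have : ∀ i, ∫⁻ x, ‖H i x v‖ₑ ≤ ‖v‖ₑ * ∫⁻ x, ‖H i x‖ₑ := fun i ↦ by
      rw [← lintegral_const_mul' _ _ enorm_ne_top]
      refine lintegral_mono fun x ↦ ?_
      rw [mul_comm]
      exact (H i x).le_opENorm v
    refine ne_top_of_le_ne_top ?_ (ENNReal.tsum_le_tsum this)
    rw [ENNReal.tsum_mul_left]
    finiteness
  have e1 : ∫ y, fderiv ℝ ψ y v • ∑' i, h i y = ∑' i, ∫ y, fderiv ℝ ψ y v • h i y := by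
    rw [← integral_tsum (fun i ↦ ((hh i).integrable_fderiv_smul h1 h2 h3 v).aestronglyMeasurable)
      (bound t1 t2 hs)]
    exact integral_congr_ae (.of_forall fun y ↦ ((hsum y).tsum_const_smul _).symm)
  have e2 : ∫ y, ψ y • (∑' i, H i y) v = ∑' i, ∫ y, ψ y • H i y v := by
    rw [← integral_tsum (fun i ↦ ((hh i).integrable_smul_apply h1 h2 h3 v).aestronglyMeasurable)
      (bound h1.continuous h2 hSv)]
    refine integral_congr_ae (.of_forall fun y ↦ ?_)
    have := (ContinuousLinearMap.apply ℝ (Euc ν) v).hasSum (hSum y).hasSum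
    simp only [ContinuousLinearMap.apply_apply] at this
    simp only
    rw [← this.tsum_eq, this.summable.tsum_const_smul]
  rw [e1, e2, ← tsum_neg]
  exact tsum_congr fun i ↦ (hh i).2.2 ψ h1 h2 h3 v

theorem hasSum_indicator_of_disjoint {I X E : Type*} [NormedAddCommGroup E] {B : I → Set X}
    (hd : Pairwise (Function.onFun Disjoint B)) (f : I → X → E) {i : I} {x : X} (hx : x ∈ B i) :
    HasSum (fun j ↦ (B j).indicator (f j) x) (f i x) := by
  have h1 : (B i).indicator (f i) x = f i x := indicator_of_mem hx _
  rw [← h1]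
  refine hasSum_single i fun j hj ↦ indicator_of_notMem (fun hxj ↦ ?_) _
  exact (disjoint_left.1 (hd hj) hxj) hx

/-- The glued map is `t` plus the sum of the `u i - β i`, each supported in its ball. The derivative
of `t` vanishes almost everywhere in the balls, spheres being null sets, so the derivatives live on
disjoint sets and the energies add up. As to convergence, `‖H i‖ ≤ 1 + ‖H i‖ ^ p` and the finite
total volume make the derivatives summable in `L¹`; Poincaré's inequality transfers this to the
functions, uniformly because the radii are at most `1`. -/
theorem gradEnergy_glue_le (hm : 1 ≤ m) {I : Type*} [Countable I] {p : ℝ} (hp : 1 ≤ p)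
    {t : Euc m → Euc ν} {c : I → Euc m} {r : I → ℝ} (hr : ∀ i, 0 < r i) (hr1 : ∀ i, r i ≤ 1)
    {u : I → Euc m → Euc ν} {β : I → Euc ν}
    (hd : Pairwise (Function.onFun Disjoint fun i ↦ Metric.closedBall (c i) (r i)))
    (hV : ∑' i, volume (Metric.closedBall (c i) (r i)) ≠ ⊤)
    (htb : ∀ i, ∀ x ∈ Metric.closedBall (c i) (r i), t x = β i)
    (hub : ∀ i, ∀ x ∉ Metric.closedBall (c i) (r i), u i x = β i) :
    gradEnergy p (glue t (fun i ↦ Metric.closedBall (c i) (r i)) u) univ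
      ≤ gradEnergy p t univ + ∑' i, gradEnergy p (u i) univ := by
  by_cases hfin : gradEnergy p t univ + ∑' i, gradEnergy p (u i) univ = ⊤
  · rw [hfin]; exact le_top
  have hp0 : 0 < p := by linarith
  obtain ⟨hft, hfs⟩ := ENNReal.add_ne_top.1 hfin
  obtain ⟨Ht, hHt⟩ := exists_hasWeakDerivOn_of_gradEnergy_lt_top (lt_top_iff_ne_top.2 hft)
  choose H hH using fun i ↦ exists_hasWeakDerivOn_of_gradEnergy_lt_top
    (lt_top_iff_ne_top.2 (ENNReal.ne_top_of_tsum_ne_top hfs i))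
  set B : I → Set (Euc m) := fun i ↦ Metric.closedBall (c i) (r i) with hB_def
  have hBm : ∀ i, MeasurableSet (B i) := fun i ↦ Metric.isClosed_closedBall.measurableSet
  have ht0 : ∀ᵐ x, ∀ i, x ∈ B i → Ht x = 0 := by
    rw [ae_all_iff]
    intro i
    have h1 := hHt.ae_eq_zero_of_const Metric.isOpen_ball
      fun x hx ↦ htb i x (Metric.ball_subset_closedBall hx)
    have h2 : ∀ᵐ x, x ∉ Metric.sphere (c i) (r i) :=
      measure_eq_zero_iff_ae_notMem.1 (Measure.addHaar_sphere_of_ne_zero _ _ (hr i).ne')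
    filter_upwards [h1, h2] with x hx hx' hxB
    refine hx (lt_of_le_of_ne hxB fun e ↦ hx' e)
  have hi0 : ∀ i, ∀ᵐ x, x ∉ B i → H i x = 0 := fun i ↦
    (hH i).ae_eq_zero_of_const Metric.isClosed_closedBall.isOpen_compl fun x hx ↦ hub i x hx
  have hw : ∀ i, HasWeakDerivOn ((B i).indicator fun x ↦ u i x - β i) ((B i).indicator (H i))
      univ := by
    intro i
    refine ((hH i).add (hasWeakDerivOn_const (-β i) univ)).congr_ae .univ ?_ ?_
    · refine .of_forall fun x ↦ ?_
      by_cases hx : x ∈ B i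
      · simp [indicator_of_mem hx, sub_eq_add_neg]
      · simp [indicator_of_notMem hx, hub i x hx]
    · rw [Measure.restrict_univ]
      filter_upwards [hi0 i] with x hx
      by_cases hxB : x ∈ B i
      · simp [indicator_of_mem hxB]
      · simp [indicator_of_notMem hxB, hx hxB]
  have hEi : ∀ i, gradEnergy p (u i) univ = ∫⁻ x, ‖H i x‖ₑ ^ p := fun i ↦ by
    rw [(hH i).gradEnergy_eq isOpen_univ, Measure.restrict_univ]
  have hSi : ∀ i, ∫⁻ x, ‖(B i).indicator (H i) x‖ₑ ≤ volume (B i) + gradEnergy p (u i) univ := by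
    intro i
    simp only [enorm_indicator_apply]
    rw [lintegral_indicator (hBm i), hEi i]
    calc ∫⁻ x in B i, ‖H i x‖ₑ ≤ ∫⁻ x in B i, (1 + ‖H i x‖ₑ ^ p) := lintegral_mono fun x ↦ by
          rcases le_total ‖H i x‖ₑ 1 with h | h
          · exact h.trans le_self_add
          · refine le_trans ?_ le_add_self
            simpa using ENNReal.rpow_le_rpow_of_exponent_le h hp
      _ = volume (B i) + ∫⁻ x in B i, ‖H i x‖ₑ ^ p := by
          rw [lintegral_add_left measurable_const]; simp
      _ ≤ _ := add_le_add le_rfl (setLIntegral_le_lintegral _ _)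
  have hS : ∑' i, ∫⁻ x, ‖(B i).indicator (H i) x‖ₑ ≠ ⊤ := by
    refine ne_top_of_le_ne_top ?_ (ENNReal.tsum_le_tsum hSi)
    rw [ENNReal.tsum_add]
    exact ENNReal.add_ne_top.2 ⟨hV, hfs⟩
  have hs : ∑' i, ∫⁻ x, ‖(B i).indicator (fun x ↦ u i x - β i) x‖ₑ ≠ ⊤ := by
    have h1 : ∀ i, ∫⁻ x, ‖(B i).indicator (fun x ↦ u i x - β i) x‖ₑ ≤
        ENNReal.ofReal 3 * ∫⁻ x, ‖(B i).indicator (H i) x‖ₑ := fun i ↦ by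
      have h2 := (hw i).lintegral_le hm (c := c i) (hr i) fun x hx ↦ indicator_of_notMem hx _
      rw [← lintegral_indicator (hBm i)] at h2
      refine le_trans (le_of_eq ?_) (h2.trans (mul_le_mul' (ENNReal.ofReal_le_ofReal ?_) le_rfl))
      · refine lintegral_congr fun x ↦ ?_
        by_cases hx : x ∈ B i <;> simp [hx]
      · linarith [hr1 i]
    refine ne_top_of_le_ne_top ?_ (ENNReal.tsum_le_tsum h1)
    rw [ENNReal.tsum_mul_left]
    exact ENNReal.mul_ne_top ENNReal.ofReal_ne_top hS
  have hsummable : ∀ {E : Type} [NormedAddCommGroup E] (f : I → Euc m → E) (x : Euc m),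
      Summable fun i ↦ (B i).indicator (f i) x := by
    intro E _ f x
    by_cases hx : ∃ i, x ∈ B i
    · obtain ⟨i, hi⟩ := hx
      exact (hasSum_indicator_of_disjoint hd f hi).summable
    · push Not at hx
      have : (fun i ↦ (B i).indicator (f i) x) = fun _ ↦ 0 := by
        ext1 i; exact indicator_of_notMem (hx i) _
      rw [this]; exact summable_zero
  have htsum : ∀ {E : Type} [NormedAddCommGroup E] (f : I → Euc m → E) (x : Euc m),
      (∀ i, x ∉ B i) → ∑' i, (B i).indicator (f i) x = 0 := by
    intro E _ f x hx
    have : (fun i ↦ (B i).indicator (f i) x) = fun _ ↦ 0 := by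
      ext1 i; exact indicator_of_notMem (hx i) _
    rw [this, tsum_zero]
  have hG := hHt.add (hasWeakDerivOn_tsum hw hs hS (hsummable _) (hsummable _))
  have hG' : HasWeakDerivOn (glue t B u) (glue Ht B H) univ := by
    refine hG.congr_ae .univ ?_ ?_
    · refine .of_forall fun x ↦ ?_
      by_cases hx : ∃ i, x ∈ B i
      · obtain ⟨i, hi⟩ := hx
        simp only
        rw [glue_of_mem hd hi, (hasSum_indicator_of_disjoint hd _ hi).tsum_eq, htb i x hi]
        abel
      · push Not at hx
        simp only
        rw [glue_of_notMem hx, htsum _ x hx, add_zero]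
    · rw [Measure.restrict_univ]
      filter_upwards [ht0] with x h0
      by_cases hx : ∃ i, x ∈ B i
      · obtain ⟨i, hi⟩ := hx
        rw [glue_of_mem hd hi, (hasSum_indicator_of_disjoint hd _ hi).tsum_eq, h0 i hi, zero_add]
      · push Not at hx
        rw [glue_of_notMem hx, htsum _ x hx, add_zero]
  refine (hG'.gradEnergy_le p).trans ?_
  have hm2 : ∀ i, AEMeasurable (fun x ↦ (B i).indicator (fun x ↦ ‖H i x‖ₑ ^ p) x) := fun i ↦
    ((locallyIntegrableOn_univ.1 (hH i).2.1).aestronglyMeasurable.enorm.pow_const p).indicator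
      (hBm i)
  have hm1 : AEMeasurable fun x ↦ ‖Ht x‖ₑ ^ p :=
    (locallyIntegrableOn_univ.1 hHt.2.1).aestronglyMeasurable.enorm.pow_const p
  rw [hHt.gradEnergy_eq isOpen_univ, Measure.restrict_univ]
  calc ∫⁻ x, ‖glue Ht B H x‖ₑ ^ p
      ≤ ∫⁻ x, (‖Ht x‖ₑ ^ p + ∑' i, (B i).indicator (fun x ↦ ‖H i x‖ₑ ^ p) x) := by
        refine lintegral_mono fun x ↦ ?_
        by_cases hx : ∃ i, x ∈ B i
        · obtain ⟨i, hi⟩ := hx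
          rw [glue_of_mem hd hi]
          refine le_trans ?_ (le_add_left (ENNReal.le_tsum i))
          rw [indicator_of_mem hi]
        · push Not at hx
          rw [glue_of_notMem hx]
          exact le_self_add
    _ = (∫⁻ x, ‖Ht x‖ₑ ^ p) + ∑' i, ∫⁻ x in B i, ‖H i x‖ₑ ^ p := by
        rw [lintegral_add_left' hm1, lintegral_tsum hm2]
        simp only [lintegral_indicator (hBm _)]
    _ ≤ _ := by
        refine add_le_add le_rfl (ENNReal.tsum_le_tsum fun i ↦ ?_)
        rw [hEi i]
        exact setLIntegral_le_lintegral _ _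

/-- Weak differentiability is a local property. -/
theorem HasWeakDerivOn.of_local {h : Euc m → Euc ν} {H : Euc m → Euc m →L[ℝ] Euc ν}
    {Ω : Set (Euc m)} (hloc : ∀ x ∈ Ω, ∃ U, IsOpen U ∧ x ∈ U ∧ HasWeakDerivOn h H (U ∩ Ω))
    (hΩ : IsOpen Ω) : HasWeakDerivOn h H Ω := by
  have loc : ∀ {E : Type} [NormedAddCommGroup E] (f : Euc m → E),
      (∀ x ∈ Ω, ∃ U, IsOpen U ∧ x ∈ U ∧ LocallyIntegrableOn f (U ∩ Ω)) →
      LocallyIntegrableOn f Ω := by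
    intro E _ f hf x hx
    obtain ⟨U, hU, hxU, hfU⟩ := hf x hx
    obtain ⟨t, ht, hft⟩ := hfU x ⟨hxU, hx⟩
    rw [(hU.inter hΩ).nhdsWithin_eq ⟨hxU, hx⟩] at ht
    exact ⟨t, mem_nhdsWithin_of_mem_nhds ht, hft⟩
  refine ⟨loc h fun x hx ↦ ?_, loc H fun x hx ↦ ?_, fun ψ h1 h2 h3 v ↦ ?_⟩
  · obtain ⟨U, a, b, hU⟩ := hloc x hx; exact ⟨U, a, b, hU.1⟩
  · obtain ⟨U, a, b, hU⟩ := hloc x hx; exact ⟨U, a, b, hU.2.1⟩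
  choose! U hUo hxU hU using hloc
  obtain ⟨T, hT⟩ := h2.isCompact.elim_finite_subcover (fun x : Ω ↦ U x ∩ Ω)
    (fun x ↦ (hUo x x.2).inter hΩ) fun x hx ↦ mem_iUnion.2 ⟨⟨x, h3 hx⟩, hxU x (h3 hx), h3 hx⟩
  have hT' : tsupport ψ ⊆ ⋃ i : T, U i ∩ Ω := by
    intro x hx
    obtain ⟨i, hi, hxi⟩ := mem_iUnion₂.1 (hT hx)
    exact mem_iUnion.2 ⟨⟨i, hi⟩, hxi⟩
  obtain ⟨χ, hχ⟩ := SmoothPartitionOfUnity.exists_isSubordinate 𝓘(ℝ, Euc m)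
    (isClosed_tsupport ψ) (fun i : T ↦ U i ∩ Ω) (fun i ↦ (hUo i i.1.2).inter hΩ) hT'
  have hχd : ∀ i, ContDiff ℝ ∞ (χ i) := fun i ↦ (χ i).contMDiff.contDiff
  have hd : ∀ i, ContDiff ℝ ∞ fun y ↦ χ i y * ψ y := fun i ↦ (hχd i).mul h1
  have hc : ∀ i, HasCompactSupport fun y ↦ χ i y * ψ y := fun i ↦ h2.mul_left
  have hsub : ∀ i, tsupport (fun y ↦ χ i y * ψ y) ⊆ U i ∩ Ω := fun i ↦
    (closure_mono (Function.support_mul_subset_left _ _)).trans (hχ i)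
  have hsum : ψ = fun y ↦ ∑ i, χ i y * ψ y := by
    ext1 y
    rw [← Finset.sum_mul]
    by_cases hy : y ∈ tsupport ψ
    · have := χ.sum_eq_one hy
      rw [finsum_eq_sum_of_fintype] at this
      rw [this, one_mul]
    · rw [image_eq_zero_of_notMem_tsupport hy, mul_zero]
  have hfd : ∀ y, fderiv ℝ ψ y v = ∑ i, fderiv ℝ (fun y ↦ χ i y * ψ y) y v := by
    intro y
    conv_lhs => rw [hsum]
    rw [fderiv_fun_sum fun i _ ↦ (hd i).differentiable (by simp) y]
    simp
  have k1 : ∫ y, fderiv ℝ ψ y v • h y = ∑ i : T, ∫ y, fderiv ℝ (fun y ↦ χ i y * ψ y) y v • h y := by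
    rw [← integral_finsetSum _ fun (i : T) _ ↦
      (hU i i.1.2).integrable_fderiv_smul (hd i) (hc i) (hsub i) v]
    simp only [hfd, Finset.sum_smul]
  have k2 : ∫ y, ψ y • H y v = ∑ i : T, ∫ y, (χ i y * ψ y) • H y v := by
    rw [← integral_finsetSum _ fun (i : T) _ ↦
      (hU i i.1.2).integrable_smul_apply (hd i) (hc i) (hsub i) v]
    refine integral_congr_ae (.of_forall fun y ↦ ?_)
    simp only
    rw [← Finset.sum_smul]
    congr 1
    exact congrFun hsum y
  rw [k1, k2, ← Finset.sum_neg_distrib]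
  exact Finset.sum_congr rfl fun i _ ↦ (hU i i.1.2).2.2 _ (hd i) (hc i) (hsub i) v

end WeakGlue

/-! ### Opening of maps -/

section Opening

variable {m : ℕ}

/-- Maps that are Lipschitz inside and outside a ball are Lipschitz. -/
theorem lipschitzWith_of_unit_sphere {E F : Type*} [NormedAddCommGroup E] [NormedSpace ℝ E]
    [PseudoMetricSpace F] {f : E → F} {K : ℝ≥0}
    (h1 : LipschitzOnWith K f {x | ‖x‖ ≤ 1}) (h2 : LipschitzOnWith K f {x | 1 ≤ ‖x‖}) :
    LipschitzWith K f := by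
  have cross : ∀ x y : E, ‖x‖ ≤ 1 → 1 ≤ ‖y‖ → dist (f x) (f y) ≤ K * dist x y := by
    intro x y hx hy
    have hc : ContinuousOn (fun t : ℝ ↦ ‖AffineMap.lineMap x y t‖) (Icc 0 1) :=
      (by fun_prop : Continuous fun t : ℝ ↦ ‖AffineMap.lineMap x y t‖).continuousOn
    obtain ⟨t, ht, hte⟩ := intermediate_value_Icc zero_le_one hc
      (show (1 : ℝ) ∈ Icc _ _ by simpa using ⟨hx, hy⟩)
    set w := AffineMap.lineMap x y t
    have hw : ‖w‖ = 1 := hte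
    have e1 : dist x w = t * dist x y := by
      rw [dist_left_lineMap, Real.norm_of_nonneg ht.1]
    have e2 : dist w y = (1 - t) * dist x y := by
      rw [dist_lineMap_right, Real.norm_of_nonneg (by linarith [ht.2])]
    calc dist (f x) (f y) ≤ dist (f x) (f w) + dist (f w) (f y) := dist_triangle _ _ _
      _ ≤ K * dist x w + K * dist w y :=
          add_le_add (h1.dist_le_mul x hx w hw.le) (h2.dist_le_mul w hw.ge y hy)
      _ = K * dist x y := by rw [e1, e2]; ring
  refine LipschitzWith.of_dist_le_mul fun x y ↦ ?_
  rcases le_total ‖x‖ 1 with hx | hx <;> rcases le_total ‖y‖ 1 with hy | hy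
  · exact h1.dist_le_mul x hx y hy
  · exact cross x y hx hy
  · rw [dist_comm, dist_comm x]; exact cross y x hy hx
  · exact h2.dist_le_mul x hx y hy

/-- The inversion in the unit sphere. -/
noncomputable def unitInversion (x : Euc m) : Euc m := (‖x‖ ^ 2)⁻¹ • x

theorem unitInversion_eq (x : Euc m) : unitInversion x = EuclideanGeometry.inversion 0 1 x := by
  simp [unitInversion, EuclideanGeometry.inversion]

theorem norm_unitInversion (x : Euc m) : ‖unitInversion x‖ = ‖x‖⁻¹ := by
  rw [unitInversion, norm_smul, norm_inv, norm_pow, norm_norm]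
  by_cases hx : ‖x‖ = 0
  · simp [hx]
  · field_simp

theorem unitInversion_unitInversion (x : Euc m) : unitInversion (unitInversion x) = x := by
  by_cases hx : x = 0
  · simp [hx, unitInversion]
  · have : ‖x‖ ≠ 0 := norm_ne_zero_iff.2 hx
    rw [unitInversion, norm_unitInversion, unitInversion, smul_smul]
    field_simp
    simp

theorem measurable_unitInversion : Measurable (unitInversion (m := m)) := by
  unfold unitInversion
  exact (measurable_norm.pow_const 2).inv.smul measurable_id

theorem lipschitzOnWith_unitInversion {ρ : ℝ≥0} (hρ : 0 < ρ) :
    LipschitzOnWith (ρ⁻¹ ^ 2) (unitInversion (m := m)) {x | ρ ≤ ‖x‖} := by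
  refine LipschitzOnWith.of_dist_le_mul fun x (hx : (ρ : ℝ) ≤ ‖x‖) y (hy : (ρ : ℝ) ≤ ‖y‖) ↦ ?_
  have hρ' : (0 : ℝ) < ρ := hρ
  have hx0 : 0 < ‖x‖ := hρ'.trans_le hx
  have hy0 : 0 < ‖y‖ := hρ'.trans_le hy
  rw [unitInversion_eq, unitInversion_eq, EuclideanGeometry.dist_inversion_inversion
    (norm_pos_iff.1 hx0) (norm_pos_iff.1 hy0), dist_zero_right, dist_zero_right]
  refine mul_le_mul_of_nonneg_right ?_ dist_nonneg
  push_cast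
  rw [inv_pow, one_pow, one_div]
  refine inv_anti₀ (by positivity) ?_
  rw [sq]
  exact mul_le_mul hx hy hρ'.le hx0.le

/-- A Lipschitz map that vanishes near `0` and is the identity away from `0`. -/
noncomputable def collapse (z : Euc m) : Euc m := (max 0 (min 1 (8 * ‖z‖ - 1))) • z

theorem collapse_of_le {z : Euc m} (h : ‖z‖ ≤ 1 / 8) : collapse z = 0 := by
  rw [collapse, max_eq_left, zero_smul]
  exact (min_le_right _ _).trans (by linarith)

theorem collapse_of_ge {z : Euc m} (h : 1 / 4 ≤ ‖z‖) : collapse z = z := by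
  rw [collapse, min_eq_left (by linarith), max_eq_right zero_le_one, one_smul]

/-- The constant is `1 + 8 / 4`: the scalar factor is `8`-Lipschitz, and its variation only matters
when the shorter vector has norm below `1 / 4`. -/
theorem lipschitzWith_collapse : LipschitzWith 3 (collapse (m := m)) := by
  have key : ∀ z w : Euc m, ‖w‖ ≤ ‖z‖ → dist (collapse z) (collapse w) ≤ 3 * dist z w := by
    intro z w hwz
    by_cases hw : 1 / 4 ≤ ‖w‖
    · rw [collapse_of_ge hw, collapse_of_ge (hw.trans hwz)]
      linarith [dist_nonneg (x := z) (y := w)]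
    push Not at hw
    set l : Euc m → ℝ := fun z ↦ max 0 (min 1 (8 * ‖z‖ - 1)) with hl
    have h0 : ∀ z, 0 ≤ l z := fun z ↦ le_max_left _ _
    have h1 : ∀ z, l z ≤ 1 := fun z ↦ max_le zero_le_one (min_le_left _ _)
    have h2 : |l z - l w| ≤ 8 * ‖z - w‖ := by
      calc |l z - l w| ≤ |min 1 (8 * ‖z‖ - 1) - min 1 (8 * ‖w‖ - 1)| := by
            simpa [hl] using abs_max_sub_max_le_max 0 (min 1 (8 * ‖z‖ - 1)) 0 (min 1 (8 * ‖w‖ - 1))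
        _ ≤ |(8 * ‖z‖ - 1) - (8 * ‖w‖ - 1)| := by
            simpa using abs_min_sub_min_le_max 1 (8 * ‖z‖ - 1) 1 (8 * ‖w‖ - 1)
        _ = 8 * |‖z‖ - ‖w‖| := by
            rw [show (8 * ‖z‖ - 1) - (8 * ‖w‖ - 1) = 8 * (‖z‖ - ‖w‖) by ring, abs_mul]; norm_num
        _ ≤ 8 * ‖z - w‖ := by linarith [abs_norm_sub_norm_le z w]
    have e : collapse z - collapse w = l z • (z - w) + (l z - l w) • w := by
      simp only [collapse, hl]; module
    rw [dist_eq_norm, dist_eq_norm, e]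
    refine (norm_add_le _ _).trans ?_
    rw [norm_smul, norm_smul, Real.norm_of_nonneg (h0 z), Real.norm_eq_abs]
    nlinarith [norm_nonneg (z - w), norm_nonneg w, h1 z, abs_nonneg (l z - l w)]
  refine LipschitzWith.of_dist_le_mul fun z w ↦ ?_
  rcases le_total ‖w‖ ‖z‖ with h | h
  · exact key z w h
  · rw [dist_comm, dist_comm z]; exact key w z h

/-- A Lipschitz map onto the unit ball, which is the identity on that ball and the constant `a`
far away from it. -/
noncomputable def openingMap (a x : Euc m) : Euc m :=
  if ‖x‖ ≤ 1 then x else a + collapse (unitInversion x - a)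

theorem openingMap_of_le (a : Euc m) {x : Euc m} (h : ‖x‖ ≤ 1) : openingMap a x = x := if_pos h

/-- The two formulas agree on the unit sphere, which the inversion fixes and which lies farther than
`1 / 4` from `a`, where `collapse` is the identity. -/
theorem openingMap_of_ge {a : Euc m} (ha : ‖a‖ < 1 / 16) {x : Euc m} (h : 1 ≤ ‖x‖) :
    openingMap a x = a + collapse (unitInversion x - a) := by
  rcases h.eq_or_lt with h | h
  · have e : unitInversion x = x := by simp [unitInversion, ← h]
    rw [openingMap_of_le a h.ge, e, collapse_of_ge, add_sub_cancel]
    linarith [norm_sub_norm_le x a]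
  · exact if_neg (not_le.2 h)

/-- Beyond radius `16` the inversion lands within `1 / 16` of the origin, hence within `1 / 8` of
`a`, in the region that is collapsed. -/
theorem openingMap_eq_const {a : Euc m} (ha : ‖a‖ < 1 / 16) {x : Euc m}
    (h : x ∉ Metric.closedBall (0 : Euc m) 16) : openingMap a x = a := by
  rw [mem_closedBall_zero_iff, not_le] at h
  rw [openingMap_of_ge ha (by linarith), collapse_of_le, add_zero]
  have : ‖unitInversion x‖ ≤ 1 / 16 := by
    rw [norm_unitInversion, one_div]
    exact inv_anti₀ (by norm_num) h.le
  linarith [norm_sub_le (unitInversion x) a]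

theorem add_collapse_mem {a y : Euc m} (ha : ‖a‖ ≤ 1) (hy : ‖y‖ ≤ 1) :
    a + collapse (y - a) ∈ Metric.closedBall (0 : Euc m) 1 := by
  have h0 : 0 ≤ max 0 (min 1 (8 * ‖y - a‖ - 1)) := le_max_left _ _
  have h1 : max 0 (min 1 (8 * ‖y - a‖ - 1)) ≤ 1 := max_le zero_le_one (min_le_left _ _)
  exact (convex_closedBall (0 : Euc m) 1).add_smul_sub_mem (by simpa using ha) (by simpa using hy)
    ⟨h0, h1⟩

theorem openingMap_mem {a : Euc m} (ha : ‖a‖ < 1 / 16) (x : Euc m) :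
    openingMap a x ∈ Metric.closedBall (0 : Euc m) 1 := by
  rcases le_total ‖x‖ 1 with h | h
  · rw [openingMap_of_le a h]; simpa using h
  · rw [openingMap_of_ge ha h]
    refine add_collapse_mem (by linarith) ?_
    rw [norm_unitInversion]
    exact inv_le_one_of_one_le₀ h

theorem lipschitzWith_openingMap {a : Euc m} (ha : ‖a‖ < 1 / 16) :
    LipschitzWith 3 (openingMap a) := by
  refine lipschitzWith_of_unit_sphere ?_ ?_
  · refine (LipschitzOnWith.of_dist_le_mul fun x hx y hy ↦ ?_)
    rw [openingMap_of_le a hx, openingMap_of_le a hy]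
    have := dist_nonneg (x := x) (y := y)
    push_cast
    linarith
  · refine LipschitzOnWith.of_dist_le_mul fun x hx y hy ↦ ?_
    rw [openingMap_of_ge ha hx, openingMap_of_ge ha hy, dist_add_left]
    refine (lipschitzWith_collapse.dist_le_mul _ _).trans ?_
    rw [dist_sub_right]
    have := (lipschitzOnWith_unitInversion (m := m) (ρ := 1) one_pos).dist_le_mul x
      (by simpa using hx) y (by simpa using hy)
    simp only [inv_one, one_pow, NNReal.coe_one, one_mul] at this
    gcongr

theorem measurable_openingMap : Measurable fun z : Euc m × Euc m ↦ openingMap z.1 z.2 := by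
  unfold openingMap
  refine Measurable.ite (measurableSet_Iic.preimage (f := fun z : Euc m × Euc m ↦ ‖z.2‖)
    (by fun_prop)) measurable_snd ?_
  exact measurable_fst.add (lipschitzWith_collapse.continuous.measurable.comp
    ((measurable_unitInversion.comp measurable_snd).sub measurable_fst))

/-- The average over `a` of the composition with `openingMap a`. -/
theorem exists_lintegral_openingMap_le (m : ℕ) : ∃ K : ℝ≥0∞, K < ⊤ ∧ ∀ g : Euc m → ℝ≥0∞,
    Measurable g → ∫⁻ a in Metric.ball (0 : Euc m) (1 / 16),
      ∫⁻ x in Metric.closedBall (0 : Euc m) 32, g (openingMap a x)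
        ≤ K * ∫⁻ x in Metric.closedBall (0 : Euc m) 1, g x := by
  set A := Metric.ball (0 : Euc m) (1 / 16)
  set D := Metric.closedBall (0 : Euc m) 1
  have hA : MeasurableSet A := Metric.isOpen_ball.measurableSet
  have hD : MeasurableSet D := Metric.isClosed_closedBall.measurableSet
  -- The inversion of `1 < ‖x‖ ≤ 32` lies in `‖y‖ ≥ 1 / 32`, where the inversion, its own inverse,
  -- has Lipschitz constant `32 ^ 2`; hence the volume factor `(32 ^ 2) ^ m`.
  set K1 : ℝ≥0 := ((1 / 32 : ℝ≥0)⁻¹ ^ 2) ^ m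
  refine ⟨volume A + K1 * volume (Metric.closedBall (0 : Euc m) 2), ENNReal.add_lt_top.2
    ⟨measure_ball_lt_top, ENNReal.mul_lt_top ENNReal.coe_lt_top measure_closedBall_lt_top⟩,
    fun g hg ↦ ?_⟩
  have hgD : Measurable (D.indicator g) := hg.indicator hD
  set s := Metric.closedBall (0 : Euc m) 32 \ D
  have hs : MeasurableSet s := Metric.isClosed_closedBall.measurableSet.diff hD
  have h1 : ∀ a ∈ A, ∫⁻ x in s, g (openingMap a x) ≤
      K1 * ∫⁻ y in D, g (a + collapse (y - a)) := by
    intro a ha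
    have hma : Measurable fun y : Euc m ↦ g (a + collapse (y - a)) :=
      hg.comp (measurable_const.add (lipschitzWith_collapse.continuous.measurable.comp
        (measurable_id.sub_const a)))
    have hmem : ∀ x ∈ s, 1 < ‖x‖ ∧ ‖x‖ ≤ 32 := fun x hx ↦
      ⟨by simpa [D] using hx.2, by simpa using hx.1⟩
    set t : Set (Euc m) := {y | ((1 / 32 : ℝ≥0) : ℝ) ≤ ‖y‖} ∩ D
    have hst : MapsTo unitInversion s t := fun x hx ↦ by
      obtain ⟨h1, h2⟩ := hmem x hx
      have e1 : ((1 / 32 : ℝ≥0) : ℝ) ≤ ‖unitInversion x‖ := by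
        rw [norm_unitInversion]
        push_cast
        rw [one_div]
        exact inv_anti₀ (by linarith) h2
      have e2 : unitInversion x ∈ D := by
        rw [mem_closedBall_zero_iff, norm_unitInversion]
        exact inv_le_one_of_one_le₀ h1.le
      exact ⟨e1, e2⟩
    have := setLIntegral_comp_le_of_lipschitz_leftInvOn measurable_unitInversion hst
      ((lipschitzOnWith_unitInversion (m := m) (ρ := 1 / 32) (by norm_num)).mono inter_subset_left)
      (fun x _ ↦ unitInversion_unitInversion x) hma
    calc ∫⁻ x in s, g (openingMap a x)
        = ∫⁻ x in s, g (a + collapse (unitInversion x - a)) := by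
          refine setLIntegral_congr_fun hs fun x hx ↦ ?_
          rw [openingMap_of_ge (by simpa [A] using ha) (hmem x hx).1.le]
      _ ≤ _ := this
      _ ≤ _ := by
          rw [show (K1 : ℝ≥0∞) = (((1 / 32 : ℝ≥0)⁻¹ ^ 2 : ℝ≥0) : ℝ≥0∞) ^ m by
            simp only [K1]; push_cast; rfl]
          exact mul_le_mul' le_rfl (lintegral_mono_set inter_subset_right)
  -- For fixed `a` a whole ball is crushed to the point `a`, and no bound can hold. For fixed `z = y
  -- - a`, however, `a ↦ a + collapse z` is a translation and preserves measure; exchanging the two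
  -- integrals exploits this.
  have h2 : ∫⁻ a in A, ∫⁻ y in D, g (a + collapse (y - a)) ≤
      volume (Metric.closedBall (0 : Euc m) 2) * ∫⁻ x in D, g x := by
    have hB2 : MeasurableSet (Metric.closedBall (0 : Euc m) 2) :=
      Metric.isClosed_closedBall.measurableSet
    calc ∫⁻ a in A, ∫⁻ y in D, g (a + collapse (y - a))
        ≤ ∫⁻ a in A, ∫⁻ z in Metric.closedBall (0 : Euc m) 2,
            D.indicator g (a + collapse z) := by
          refine lintegral_mono_ae ?_
          filter_upwards [ae_restrict_mem hA] with a ha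
          have ha' : ‖a‖ < 1 / 16 := by simpa [A] using ha
          have e : ∫⁻ y in D, g (a + collapse (y - a)) =
              ∫⁻ y in D, (fun z ↦ D.indicator g (a + collapse z)) (y + -a) := by
            refine setLIntegral_congr_fun hD fun y hy ↦ ?_
            simp only
            rw [← sub_eq_add_neg, indicator_of_mem]
            exact add_collapse_mem (by linarith) (by simpa [D] using hy)
          rw [e]
          refine setLIntegral_translate_le hD hB2 (fun y hy ↦ ?_) _
          have : ‖y‖ ≤ 1 := by simpa [D] using hy
          rw [mem_closedBall_zero_iff, ← sub_eq_add_neg]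
          linarith [norm_sub_le y a]
      _ = ∫⁻ z in Metric.closedBall (0 : Euc m) 2, ∫⁻ a in A, D.indicator g (a + collapse z) := by
          refine lintegral_lintegral_swap (Measurable.aemeasurable ?_)
          exact hgD.comp (measurable_fst.add
            (lipschitzWith_collapse.continuous.measurable.comp measurable_snd))
      _ ≤ ∫⁻ z in Metric.closedBall (0 : Euc m) 2, ∫⁻ x in D, g x := by
          refine lintegral_mono fun z ↦ (setLIntegral_le_lintegral _ _).trans ?_
          rw [lintegral_add_right_eq_self (D.indicator g), lintegral_indicator hD]
      _ = _ := by rw [setLIntegral_const, mul_comm]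
  have hmeas : Measurable fun a : Euc m ↦ ∫⁻ x in D, g (openingMap a x) :=
    (hg.comp measurable_openingMap).lintegral_prod_right'
  have hunion : Metric.closedBall (0 : Euc m) 32 = D ∪ s :=
    (union_sdiff_cancel (Metric.closedBall_subset_closedBall (by norm_num))).symm
  calc ∫⁻ a in A, ∫⁻ x in Metric.closedBall (0 : Euc m) 32, g (openingMap a x)
      ≤ ∫⁻ a in A, ((∫⁻ x in D, g x) + K1 * ∫⁻ y in D, g (a + collapse (y - a))) := by
        refine lintegral_mono_ae ?_
        filter_upwards [ae_restrict_mem hA] with a ha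
        rw [hunion, lintegral_union hs disjoint_sdiff_right]
        refine add_le_add (le_of_eq ?_) (h1 a ha)
        refine setLIntegral_congr_fun hD fun x hx ↦ ?_
        rw [openingMap_of_le a (by simpa [D] using hx)]
    _ = (∫⁻ x in D, g x) * volume A + K1 * ∫⁻ a in A, ∫⁻ y in D, g (a + collapse (y - a)) := by
        rw [lintegral_add_left measurable_const, setLIntegral_const,
          lintegral_const_mul' _ _ ENNReal.coe_ne_top]
    _ ≤ (∫⁻ x in D, g x) * volume A +
          K1 * (volume (Metric.closedBall (0 : Euc m) 2) * ∫⁻ x in D, g x) :=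
        add_le_add le_rfl (mul_le_mul' le_rfl h2)
    _ = _ := by ring

/-- Some `a` does no worse than the average for `g`, and it can be chosen outside the null set where
the integral of `W` is infinite. The control is quantitative for the energy density `g` and only
qualitative for the weight `W`. -/
theorem exists_good_openingMap (m : ℕ) : ∃ K : ℝ≥0∞, K < ⊤ ∧ ∀ g W : Euc m → ℝ≥0∞,
    Measurable g → Measurable W → ∫⁻ x in Metric.closedBall (0 : Euc m) 1, W x < ⊤ →
    ∃ a : Euc m, ‖a‖ < 1 / 16 ∧ ∫⁻ x in Metric.closedBall (0 : Euc m) 32, g (openingMap a x)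
        ≤ K * ∫⁻ x in Metric.closedBall (0 : Euc m) 1, g x ∧
      ∫⁻ x in Metric.closedBall (0 : Euc m) 32, W (openingMap a x) < ⊤ := by
  obtain ⟨K, hK, h⟩ := exists_lintegral_openingMap_le m
  set A := Metric.ball (0 : Euc m) (1 / 16)
  have hA0 : volume A ≠ 0 := (Metric.measure_ball_pos _ _ (by norm_num)).ne'
  have hAt : volume A ≠ ⊤ := measure_ball_lt_top.ne
  refine ⟨(volume A)⁻¹ * K, by finiteness, fun g W hg hW hWf ↦ ?_⟩
  have hm : ∀ {f : Euc m → ℝ≥0∞}, Measurable f → Measurable fun a : Euc m ↦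
      ∫⁻ x in Metric.closedBall (0 : Euc m) 32, f (openingMap a x) := fun hf ↦
    (hf.comp measurable_openingMap).lintegral_prod_right'
  have hN : ∀ᵐ a ∂(volume.restrict A), a ∈ A ∧
      ∫⁻ x in Metric.closedBall (0 : Euc m) 32, W (openingMap a x) < ⊤ := by
    have h1 := ae_lt_top (hm hW) ((h W hW).trans_lt (ENNReal.mul_lt_top hK hWf)).ne
    filter_upwards [h1, ae_restrict_mem Metric.isOpen_ball.measurableSet] with a h1 h2
    exact ⟨h2, h1⟩
  have : IsFiniteMeasure (volume.restrict A) := ⟨by simpa using hAt.lt_top⟩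
  obtain ⟨a, ha, hle⟩ := exists_notMem_null_le_laverage (μ := volume.restrict A)
    (by simpa [Measure.restrict_eq_zero] using hA0) (hm hg).aemeasurable (ae_iff.1 hN)
  simp only [mem_ofPred_eq, not_not] at ha
  refine ⟨a, by simpa [A] using ha.1, hle.trans ?_, ha.2⟩
  rw [setLAverage_eq, ENNReal.div_eq_inv_mul, mul_assoc]
  exact mul_le_mul' le_rfl (h g hg)

end Opening

/-! ### Sobolev energies on `ℝ^m` -/

section HilbertSchmidt

variable {m ν : ℕ} {M : Type*} [EMetricSpace M] [ChartedSpace (Euc m) M]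
  [RiemannianBundle (fun x : M ↦ TangentSpace (𝓡 m) x)]

theorem hilbertSchmidtNorm_nonneg {x : M} (L : TangentSpace (𝓡 m) x →L[ℝ] Euc ν) :
    0 ≤ hilbertSchmidtNorm L := Real.sqrt_nonneg _

theorem finrank_tangentSpace_euc {m : ℕ} {M : Type*} [TopologicalSpace M] [ChartedSpace (Euc m) M]
    (x : M) : Module.finrank ℝ (TangentSpace (𝓡 m) x) = m :=
  finrank_euclideanSpace_fin (𝕜 := ℝ) (n := m)

theorem hilbertSchmidtNorm_le {x : M} (L : TangentSpace (𝓡 m) x →L[ℝ] Euc ν) {c : ℝ} (hc : 0 ≤ c)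
    (h : ∀ v, ‖L v‖ ≤ c * ‖v‖) : hilbertSchmidtNorm L ≤ √m * c := by
  rw [hilbertSchmidtNorm, Real.sqrt_le_left (by positivity), mul_pow, Real.sq_sqrt (by positivity)]
  have h1 : ∀ i, ‖L (stdOrthonormalBasis ℝ (TangentSpace (𝓡 m) x) i)‖ ^ 2 ≤ c ^ 2 := fun i ↦ by
    have := h (stdOrthonormalBasis ℝ (TangentSpace (𝓡 m) x) i)
    rw [OrthonormalBasis.norm_eq_one, mul_one] at this
    gcongr
  refine (Finset.sum_le_sum fun i _ ↦ h1 i).trans_eq ?_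
  simp [finrank_tangentSpace_euc]

theorem norm_le_hilbertSchmidtNorm_mul {x : M} (L : TangentSpace (𝓡 m) x →L[ℝ] Euc ν)
    (v : TangentSpace (𝓡 m) x) : ‖L v‖ ≤ hilbertSchmidtNorm L * ‖v‖ := by
  set b := stdOrthonormalBasis ℝ (TangentSpace (𝓡 m) x)
  have e : L v = ∑ i, inner ℝ (b i) v • L (b i) := by
    conv_lhs => rw [← b.sum_repr' v, map_sum]
    simp
  rw [e]
  refine (norm_sum_le _ _).trans ?_
  simp only [norm_smul]
  have h1 := Finset.sum_mul_sq_le_sq_mul_sq Finset.univ (fun i ↦ ‖inner ℝ (b i) v‖)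
    (fun i ↦ ‖L (b i)‖)
  have h2 : ∑ i, ‖inner ℝ (b i) v‖ ^ 2 = ‖v‖ ^ 2 := b.sum_sq_norm_inner_right v
  rw [h2] at h1
  refine Real.le_sqrt_of_sq_le h1 |>.trans_eq ?_
  rw [Real.sqrt_mul (by positivity), Real.sqrt_sq (norm_nonneg _), mul_comm]
  rfl

end HilbertSchmidt

/-! ### Comparison of first-order energies on `ℝ^m` -/

section Euclidean

variable {m ν : ℕ}

theorem mfderiv_chartAt_euc_symm (x y : Euc m) :
    mfderiv (𝓡 m) (𝓡 m) (chartAt (Euc m) x).symm y = ContinuousLinearMap.id ℝ _ := by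
  have : ((chartAt (Euc m) x).symm : Euc m → Euc m) = id := by
    rw [chartAt_self_eq]; rfl
  rw [this]
  exact mfderiv_id

theorem HasWeakDerivOn.of_eq {h h' : Euc m → Euc ν} {H H' : Euc m → Euc m →L[ℝ] Euc ν}
    {Ω Ω' : Set (Euc m)} (hh : HasWeakDerivOn h H Ω) (e1 : h = h') (e2 : H = H') (e3 : Ω = Ω') :
    HasWeakDerivOn h' H' Ω' := by
  rwa [← e1, ← e2, ← e3]

theorem enorm_clm_le {L : Euc m →L[ℝ] Euc ν} {c : ℝ} (hc : 0 ≤ c) (h : ∀ v, ‖L v‖ ≤ c * ‖v‖) :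
    ‖L‖ₑ ≤ ENNReal.ofReal c := by
  rw [← ofReal_norm]
  exact ENNReal.ofReal_le_ofReal (L.opNorm_le_bound hc h)

theorem hasWeakMDerivOn_euc_iff {h : Euc m → Euc ν}
    {G : (x : Euc m) → TangentSpace (𝓡 m) x →L[ℝ] Euc ν} {A : Set (Euc m)} :
    HasWeakMDerivOn h G A ↔ HasWeakDerivOn h G A := by
  have e : ∀ x₀ : Euc m, (chartAt (Euc m) x₀).target ∩ (chartAt (Euc m) x₀).symm ⁻¹' A = A := by
    intro x₀
    simp [chartAt_self_eq]
  have es : ∀ x₀ y : Euc m, (chartAt (Euc m) x₀).symm y = y := by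
    intro x₀ y
    rw [chartAt_self_eq]; rfl
  have e2 : ∀ x₀ : Euc m, (fun y ↦ (G ((chartAt (Euc m) x₀).symm y)).comp
      (mfderiv (𝓡 m) (𝓡 m) (chartAt (Euc m) x₀).symm y) :
      Euc m → Euc m →L[ℝ] Euc ν) = G := by
    intro x₀
    ext1 y
    refine ContinuousLinearMap.ext fun v ↦ ?_
    change (G ((chartAt (Euc m) x₀).symm y)) (mfderiv (𝓡 m) (𝓡 m) (chartAt (Euc m) x₀).symm y v)
      = G y v
    rw [mfderiv_chartAt_euc_symm]
    exact congrArg (fun z ↦ (G z : Euc m →L[ℝ] Euc ν) v) (es x₀ y)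
  have e3 : ∀ x₀ : Euc m, (fun y ↦ h ((chartAt (Euc m) x₀).symm y)) = h := fun x₀ ↦
    funext fun y ↦ congrArg h (es x₀ y)
  exact ⟨fun hh ↦ (hh 0).of_eq (e3 0) (e2 0) (e 0),
    fun hh x₀ ↦ hh.of_eq (e3 x₀).symm (e2 x₀).symm (e x₀).symm⟩

theorem norm_tangentSpace_euc (x : Euc m) (v : TangentSpace (𝓡 m) x) :
    ‖v‖ = @norm (Euc m) _ v := norm_tangentSpace_vectorSpace

theorem gradEnergy_le_dirichletEnergy {p : ℝ} (hp : 0 ≤ p) (h : Euc m → Euc ν) (A : Set (Euc m)) :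
    gradEnergy p h A ≤ dirichletEnergy (m := m) p h A := by
  refine le_iInf₂ fun G hG ↦ ?_
  refine ((hasWeakMDerivOn_euc_iff.1 hG).gradEnergy_le p).trans ?_
  rw [riemannianVolume_euc]
  refine lintegral_mono fun x ↦ ?_
  rw [← ENNReal.ofReal_rpow_of_nonneg (hilbertSchmidtNorm_nonneg _) hp]
  refine ENNReal.rpow_le_rpow (enorm_clm_le (hilbertSchmidtNorm_nonneg _) fun v ↦ ?_) hp
  exact (norm_le_hilbertSchmidtNorm_mul (G x) v).trans_eq
    (congrArg _ (norm_tangentSpace_euc x v))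

theorem dirichletEnergy_le_gradEnergy (hm : 1 ≤ m) {p : ℝ} (hp : 0 ≤ p) (h : Euc m → Euc ν)
    {A : Set (Euc m)} (hA : IsOpen A) :
    dirichletEnergy (m := m) p h A ≤ ENNReal.ofReal (√m ^ p) * gradEnergy p h A := by
  have hm' : (0 : ℝ) < √m := Real.sqrt_pos.2 (by positivity)
  by_cases hfin : gradEnergy p h A = ⊤
  · rw [hfin, ENNReal.mul_top (by simpa using Real.rpow_pos_of_pos hm' p)]
    exact le_top
  obtain ⟨H, hH⟩ := exists_hasWeakDerivOn_of_gradEnergy_lt_top (lt_top_iff_ne_top.2 hfin)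
  rw [hH.gradEnergy_eq hA, ← lintegral_const_mul' _ _ ENNReal.ofReal_ne_top]
  refine (iInf₂_le H (hasWeakMDerivOn_euc_iff.2 hH)).trans ?_
  rw [riemannianVolume_euc]
  refine lintegral_mono fun x ↦ ?_
  refine (ENNReal.ofReal_rpow_of_nonneg (hilbertSchmidtNorm_nonneg (x := x) (H x)) hp).symm.trans_le
    ?_
  rw [← ENNReal.ofReal_rpow_of_nonneg hm'.le hp, ← ENNReal.mul_rpow_of_nonneg _ _ hp]
  refine ENNReal.rpow_le_rpow ?_ hp
  rw [← ofReal_norm (H x), ← ENNReal.ofReal_mul hm'.le]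
  refine ENNReal.ofReal_le_ofReal (hilbertSchmidtNorm_le _ (norm_nonneg _) fun v ↦ ?_)
  exact ((H x).le_opNorm v).trans_eq (congrArg _ (norm_tangentSpace_euc x v).symm)

end Euclidean

/-! ### The energy used in the sequel -/

section Energy

variable {m ν : ℕ} {N : Type*} [EMetricSpace N]

open Classical in
/-- The Sobolev energy on `ℝ^m`, with the operator norm instead of the Hilbert–Schmidt norm. -/
noncomputable def eucEnergy (ι : N → Euc ν) (s p : ℝ) (u : Euc m → N) (A : Set (Euc m)) : ℝ≥0∞ :=
  if s = 1 then gradEnergy p (ι ∘ u) A else gagEnergy (s * p) p u A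

theorem eucEnergy_one (ι : N → Euc ν) (p : ℝ) (u : Euc m → N) (A : Set (Euc m)) :
    eucEnergy ι 1 p u A = gradEnergy p (ι ∘ u) A := if_pos rfl

theorem eucEnergy_of_ne (ι : N → Euc ν) {s : ℝ} (hs : s ≠ 1) (p : ℝ) (u : Euc m → N)
    (A : Set (Euc m)) : eucEnergy ι s p u A = gagEnergy (s * p) p u A := if_neg hs

theorem eucEnergy_le_sobolevEnergy (ι : N → Euc ν) (s : ℝ) {p : ℝ} (hp : 0 ≤ p) (u : Euc m → N)
    (A : Set (Euc m)) : eucEnergy ι s p u A ≤ sobolevEnergy m ι s p u A := by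
  by_cases hs : s = 1
  · subst hs
    rw [eucEnergy_one, sobolevEnergy, if_pos rfl]
    exact gradEnergy_le_dirichletEnergy hp _ _
  · rw [eucEnergy_of_ne ι hs, sobolevEnergy, if_neg hs, gagliardoEnergy_euc]

theorem exists_sobolevEnergy_le (m : ℕ) (hm : 1 ≤ m) {p : ℝ} (hp : 0 ≤ p) :
    ∃ K : ℝ≥0, 0 < K ∧ ∀ (ν : ℕ) (N : Type*) [EMetricSpace N] (ι : N → Euc ν) (s : ℝ)
      (u : Euc m → N) (A : Set (Euc m)), IsOpen A →
      sobolevEnergy m ι s p u A ≤ K * eucEnergy ι s p u A := by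
  refine ⟨(√m ^ p).toNNReal + 1, by positivity, fun ν N _ ι s u A hA ↦ ?_⟩
  by_cases hs : s = 1
  · subst hs
    rw [eucEnergy_one, sobolevEnergy, if_pos rfl]
    refine (dirichletEnergy_le_gradEnergy hm hp _ hA).trans (mul_le_mul' ?_ le_rfl)
    push_cast
    exact le_self_add
  · rw [eucEnergy_of_ne ι hs, sobolevEnergy, if_neg hs, gagliardoEnergy_euc]
    push_cast
    exact le_mul_of_one_le_left' le_add_self

theorem eucEnergy_mono (ι : N → Euc ν) (s p : ℝ) (u : Euc m → N) {A B : Set (Euc m)} (h : A ⊆ B) :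
    eucEnergy ι s p u A ≤ eucEnergy ι s p u B := by
  unfold eucEnergy
  split_ifs
  exacts [gradEnergy_mono p _ h, gagEnergy_mono _ p u h]

theorem eucEnergy_congr_ae (ι : N → Euc ν) (s p : ℝ) {u v : Euc m → N} {A : Set (Euc m)}
    (hA : MeasurableSet A) (h : u =ᵐ[volume.restrict A] v) :
    eucEnergy ι s p u A = eucEnergy ι s p v A := by
  unfold eucEnergy
  split_ifs
  · refine gradEnergy_congr_ae p hA ?_
    filter_upwards [h] with x hx
    simp [hx]
  · exact gagEnergy_congr_ae _ p h

theorem tsum_eucEnergy_le {I : Type*} [Countable I] (ι : N → Euc ν) (s p : ℝ) (u : Euc m → N)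
    {A : Set (Euc m)} {B : I → Set (Euc m)} (hB : ∀ i, MeasurableSet (B i))
    (hd : Pairwise (Function.onFun Disjoint B)) (hBA : ∀ i, B i ⊆ A) :
    ∑' i, eucEnergy ι s p u (B i) ≤ eucEnergy ι s p u A := by
  unfold eucEnergy
  split_ifs
  exacts [tsum_gradEnergy_le p _ hB hd hBA, tsum_gagEnergy_le _ p u hB hd hBA]

theorem eucEnergy_comp_similarity_le (ι : N → Euc ν) (s : ℝ) {p : ℝ} (hp : 0 ≤ p) (u : Euc m → N)
    {A : Set (Euc m)} (hA : IsOpen A) (c : Euc m) {ρ : ℝ} (hρ : 0 < ρ) :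
    eucEnergy ι s p (u ∘ similarity c ρ) (similarity c ρ ⁻¹' A)
      ≤ ENNReal.ofReal (ρ ^ (s * p - m)) * eucEnergy ι s p u A := by
  by_cases hs : s = 1
  · subst hs
    rw [eucEnergy_one, eucEnergy_one, one_mul]
    exact gradEnergy_comp_similarity_le hp (ι ∘ u) hA c hρ
  · rw [eucEnergy_of_ne ι hs, eucEnergy_of_ne ι hs]
    exact (gagEnergy_comp_similarity _ p u A c hρ).le

theorem similarity_similarity_inv (c : Euc m) {ρ : ℝ} (hρ : 0 < ρ) (x : Euc m) :
    similarity c ρ (similarity (-(ρ⁻¹ • c)) ρ⁻¹ x) = x := by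
  simp only [similarity, smul_add, smul_neg, smul_smul, mul_inv_cancel₀ hρ.ne', one_smul]
  abel

/-- The reverse inequality is the one-sided bound applied to the inverse similarity, whose scaling
factor is the inverse one. -/
theorem eucEnergy_comp_similarity (ι : N → Euc ν) (s : ℝ) {p : ℝ} (hp : 0 ≤ p) (u : Euc m → N)
    {A : Set (Euc m)} (hA : IsOpen A) (c : Euc m) {ρ : ℝ} (hρ : 0 < ρ) :
    eucEnergy ι s p (u ∘ similarity c ρ) (similarity c ρ ⁻¹' A)
      = ENNReal.ofReal (ρ ^ (s * p - m)) * eucEnergy ι s p u A := by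
  refine le_antisymm (eucEnergy_comp_similarity_le ι s hp u hA c hρ) ?_
  have hA' : IsOpen (similarity c ρ ⁻¹' A) := hA.preimage (continuous_similarity c ρ)
  have := eucEnergy_comp_similarity_le ι s hp (u ∘ similarity c ρ) hA' (-(ρ⁻¹ • c))
    (inv_pos.2 hρ)
  have e1 : (u ∘ similarity c ρ) ∘ similarity (-(ρ⁻¹ • c)) ρ⁻¹ = u := by
    ext1 x; simp [similarity_similarity_inv c hρ]
  have e2 : similarity (-(ρ⁻¹ • c)) ρ⁻¹ ⁻¹' (similarity c ρ ⁻¹' A) = A := by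
    ext1 x; simp [similarity_similarity_inv c hρ]
  rw [e1, e2] at this
  refine (mul_le_mul' le_rfl this).trans_eq ?_
  rw [← mul_assoc, ← ENNReal.ofReal_mul (by positivity), ← Real.mul_rpow hρ.le (by positivity),
    mul_inv_cancel₀ hρ.ne', Real.one_rpow, ENNReal.ofReal_one, one_mul]

theorem eucEnergy_iUnion_le [MeasurableSpace N] [BorelSpace N] [SecondCountableTopology N]
    (ι : N → Euc ν) (s p : ℝ) {u : Euc m → N} (hu : Measurable u) {A : ℕ → Set (Euc m)}
    (hA : Monotone A) (hAo : ∀ n, IsOpen (A n)) {K : ℝ≥0∞} (hKt : K < ⊤)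
    (hK : ∀ n, eucEnergy ι s p u (A n) ≤ K) : eucEnergy ι s p u (⋃ n, A n) ≤ K := by
  unfold eucEnergy at hK ⊢
  split_ifs at hK ⊢
  · exact gradEnergy_iUnion_le p hA hAo hKt hK
  · exact gagEnergy_iUnion_le _ p hu hA hK

theorem comp_glue {X Y Z I : Type*} (g : Y → Z) (t : X → Y) (B : I → Set X) (u : I → X → Y) :
    g ∘ glue t B u = glue (g ∘ t) B fun i ↦ g ∘ u i := by
  ext1 x
  simp only [Function.comp_apply, glue]
  split_ifs <;> rfl

/-- Gluing countably many maps that are constant off disjoint balls. -/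
theorem eucEnergy_glue_le [MeasurableSpace N] [BorelSpace N] [SecondCountableTopology N]
    (hm : 1 ≤ m) {I : Type*} [Countable I] (ι : N → Euc ν) (s : ℝ) {p : ℝ}
    (hp : 1 ≤ p) {t : Euc m → N} {c : I → Euc m} {r : I → ℝ} (hr : ∀ i, 0 < r i)
    (hr1 : ∀ i, r i ≤ 1) {u : I → Euc m → N} {b : I → N}
    (hd : Pairwise (Function.onFun Disjoint fun i ↦ Metric.closedBall (c i) (r i)))
    (hV : ∑' i, volume (Metric.closedBall (c i) (r i)) ≠ ⊤)
    (ht : Measurable t) (hu : ∀ i, Measurable (u i))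
    (htb : ∀ i, ∀ x ∈ Metric.closedBall (c i) (r i), t x = b i)
    (hub : ∀ i, ∀ x ∉ Metric.closedBall (c i) (r i), u i x = b i) :
    eucEnergy ι s p (glue t (fun i ↦ Metric.closedBall (c i) (r i)) u) univ
      ≤ 3 ^ p * (eucEnergy ι s p t univ + ∑' i, eucEnergy ι s p (u i) univ) := by
  unfold eucEnergy
  split_ifs
  · rw [comp_glue]
    refine (gradEnergy_glue_le hm hp hr hr1 hd hV (β := fun i ↦ ι (b i))
      (fun i x hx ↦ congrArg ι (htb i x hx)) (fun i x hx ↦ congrArg ι (hub i x hx))).trans ?_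
    exact le_mul_of_one_le_left' (ENNReal.one_le_rpow (by norm_num) (by linarith))
  · exact gagEnergy_glue_le _ (by linarith) hd ht hu htb hub

end Energy

/-! ### Extension of maps by opening -/

section OpeningEnergy

variable {N : Type*} [EMetricSpace N] [MeasurableSpace N] [BorelSpace N]

/-- The function averaged over `a` is the energy density of `u`. It is controlled on the ball of
radius `32`, twice the radius `16` beyond which the opened map is constant, as the estimate on the
whole space requires. -/
theorem exists_gagEnergy_opening [SecondCountableTopology N] (m : ℕ) (hm : 1 ≤ m) {σ p : ℝ}
    (hσ : 0 < σ) (hp : 1 ≤ p) : ∃ C : ℝ≥0∞, C < ⊤ ∧ ∀ u : Euc m → N, Measurable u →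
      ∃ (v : Euc m → N) (b : N), Measurable v ∧ (∀ x ∈ Metric.closedBall (0 : Euc m) 1, v x = u x) ∧
        (∀ x ∉ Metric.closedBall (0 : Euc m) 16, v x = b) ∧
        gagEnergy σ p v univ ≤ C * gagEnergy σ p u (Metric.closedBall 0 1) := by
  obtain ⟨K, hK, hgood⟩ := exists_good_openingMap m
  obtain ⟨C1, hC1, h1⟩ := exists_gagEnergy_comp_le (N := N) m hp hσ 3 (r := 32) (by norm_num)
  obtain ⟨C2, hC2, h2⟩ := exists_gagEnergy_univ_le (N := N) m hm hσ (p := p) (by linarith) (r := 16)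
    (by norm_num)
  refine ⟨C2 * (C1 * K), by finiteness, fun u hu ↦ ?_⟩
  have hgm : Measurable fun y : Euc m ↦
      ∫⁻ z in Metric.closedBall (0 : Euc m) 1, gagKernel σ p u y z :=
    (measurable_gagKernel σ p hu).lintegral_prod_right'
  obtain ⟨a, ha, hle, -⟩ := hgood _ (fun _ ↦ 0) hgm measurable_const (by simp)
  have hL := lipschitzWith_openingMap ha
  have hv : Measurable (u ∘ openingMap a) := hu.comp hL.continuous.measurable
  have hconst : ∀ x ∉ Metric.closedBall (0 : Euc m) 16, (u ∘ openingMap a) x = u a := fun x hx ↦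
    congrArg u (openingMap_eq_const ha hx)
  refine ⟨u ∘ openingMap a, u a, hv, fun x hx ↦ ?_, hconst, ?_⟩
  · exact congrArg u (openingMap_of_le a (by simpa using hx))
  · refine (h2 _ 0 (u a) hv hconst).trans ?_
    rw [show (2 : ℝ) * 16 = 32 by norm_num, mul_assoc]
    refine mul_le_mul' le_rfl ((h1 u _ hu hL (openingMap_mem ha)).trans ?_)
    rw [mul_assoc]
    exact mul_le_mul' le_rfl hle

/-- The parameter `a` is good both for the density `‖H‖ ^ p` and for the weight governing the chain
rule. The chain rule then holds on the ball of radius `32`, the opened map is constant beyond `16`,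
and weak differentiability is local. The condition `ρ > 1` puts the closed unit ball inside an open
set where `u` has a weak derivative. -/
theorem exists_gradEnergy_opening (m ν : ℕ) {p : ℝ} (hp : 1 ≤ p) :
    ∃ C : ℝ≥0∞, C < ⊤ ∧ ∀ (ι : N → Euc ν), Continuous ι → ∀ u : Euc m → N, Measurable u →
      ∀ ρ : ℝ, 1 < ρ → gradEnergy p (ι ∘ u) (Metric.ball 0 ρ) < ⊤ →
      ∃ (v : Euc m → N) (b : N), Measurable v ∧ (∀ x ∈ Metric.closedBall (0 : Euc m) 1, v x = u x) ∧
        (∀ x ∉ Metric.closedBall (0 : Euc m) 16, v x = b) ∧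
        gradEnergy p (ι ∘ v) univ ≤ C * gradEnergy p (ι ∘ u) (Metric.ball 0 ρ) := by
  obtain ⟨K, hK, hgood⟩ := exists_good_openingMap m
  refine ⟨3 ^ p * K, by
    have := ENNReal.rpow_lt_top_of_nonneg (y := p) (by linarith) (by simp : (3 : ℝ≥0∞) ≠ ⊤)
    finiteness, fun ι hι u hu ρ hρ hfin ↦ ?_⟩
  obtain ⟨H₀, hH₀⟩ := exists_hasWeakDerivOn_of_gradEnergy_lt_top hfin
  have hms : MeasurableSet (Metric.ball (0 : Euc m) ρ) := Metric.isOpen_ball.measurableSet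
  have hae := hH₀.2.1.aestronglyMeasurable
  set H := hae.mk H₀
  have hHm : StronglyMeasurable H := hae.stronglyMeasurable_mk
  have hH : HasWeakDerivOn (ι ∘ u) H (Metric.ball 0 ρ) := hH₀.congr_ae hms .rfl hae.ae_eq_mk
  have hιm : StronglyMeasurable (ι ∘ u) := (hι.measurable.comp hu).stronglyMeasurable
  have hD : Metric.closedBall (0 : Euc m) 1 ⊆ Metric.ball 0 ρ := Metric.closedBall_subset_ball hρ
  obtain ⟨W, hW, hWf, hchain⟩ := hH.exists_comp_lipschitz Metric.isOpen_ball
    (isCompact_closedBall (0 : Euc m) 1) hD hιm hHm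
  have hgm : Measurable fun y : Euc m ↦ ‖H y‖ₑ ^ p := hHm.enorm.pow_const p
  obtain ⟨a, ha, hle, hWa⟩ := hgood _ W hgm hW hWf
  have hL := lipschitzWith_openingMap ha
  have hconst : ∀ x ∉ Metric.closedBall (0 : Euc m) 16, openingMap a x = a := fun x hx ↦
    openingMap_eq_const ha hx
  set G : Euc m → Euc m →L[ℝ] Euc ν := fun x ↦
    (H (openingMap a x)).comp (fderiv ℝ (openingMap a) x) with hG_def
  have hG1 : HasWeakDerivOn (fun x ↦ ι (u (openingMap a x))) G (Metric.ball 0 32) :=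
    hchain _ 3 _ hL Metric.isOpen_ball fun Q hQ _ ↦ lt_of_le_of_lt
      (lintegral_mono_set (hQ.trans Metric.ball_subset_closedBall)) hWa
  have hGout : ∀ x ∉ Metric.closedBall (0 : Euc m) 16, G x = 0 := by
    intro x hx
    have : openingMap a =ᶠ[𝓝 x] fun _ ↦ a := by
      filter_upwards [Metric.isClosed_closedBall.isOpen_compl.mem_nhds hx] with y hy
        using hconst y hy
    simp only [G]
    rw [this.fderiv_eq]
    simp
  have hG2 : HasWeakDerivOn (fun x ↦ ι (u (openingMap a x))) G (Metric.closedBall 0 16)ᶜ := by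
    have hmc : MeasurableSet (Metric.closedBall (0 : Euc m) 16)ᶜ :=
      Metric.isClosed_closedBall.measurableSet.compl
    refine (hasWeakDerivOn_const (ι (u a)) _).congr_ae hmc ?_ ?_
    · filter_upwards [ae_restrict_mem hmc] with x hx
      rw [hconst x hx]
    · filter_upwards [ae_restrict_mem hmc] with x hx
      rw [hGout x hx]
  have hG : HasWeakDerivOn (fun x ↦ ι (u (openingMap a x))) G univ := by
    refine HasWeakDerivOn.of_local (fun x _ ↦ ?_) isOpen_univ
    by_cases hx : x ∈ Metric.closedBall (0 : Euc m) 16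
    · exact ⟨_, Metric.isOpen_ball, Metric.closedBall_subset_ball (by norm_num) hx,
        hG1.mono inter_subset_left⟩
    · exact ⟨_, Metric.isClosed_closedBall.isOpen_compl, hx, hG2.mono inter_subset_left⟩
  refine ⟨u ∘ openingMap a, u a, hu.comp hL.continuous.measurable, fun x hx ↦ ?_, fun x hx ↦ ?_, ?_⟩
  · exact congrArg u (openingMap_of_le a (by simpa using hx))
  · exact congrArg u (hconst x hx)
  · refine (hG.gradEnergy_le p).trans ?_
    have hGn : ∀ x, ‖G x‖ₑ ^ p ≤ (Metric.closedBall (0 : Euc m) 32).indicator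
        (fun x ↦ 3 ^ p * ‖H (openingMap a x)‖ₑ ^ p) x := by
      intro x
      by_cases hx : x ∈ Metric.closedBall (0 : Euc m) 32
      · rw [indicator_of_mem hx, ← ENNReal.mul_rpow_of_nonneg _ _ (by linarith)]
        refine ENNReal.rpow_le_rpow ?_ (by linarith)
        have h1 : ‖fderiv ℝ (openingMap a) x‖₊ ≤ 3 := norm_fderiv_le_of_lipschitz ℝ hL
        have h2 : ‖G x‖₊ ≤ ‖H (openingMap a x)‖₊ * ‖fderiv ℝ (openingMap a) x‖₊ :=
          ContinuousLinearMap.opNorm_comp_le _ _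
        have h3 : ‖G x‖₊ ≤ 3 * ‖H (openingMap a x)‖₊ := by
          rw [mul_comm]
          exact h2.trans (mul_le_mul' le_rfl h1)
        simp only [enorm_eq_nnnorm]
        exact_mod_cast h3
      · rw [hGout x fun h ↦ hx (Metric.closedBall_subset_closedBall (by norm_num) h)]
        have h0 : ‖(0 : Euc m →L[ℝ] Euc ν)‖ₑ = 0 := by
          rw [enorm_eq_nnnorm, nnnorm_zero, ENNReal.coe_zero]
        rw [h0, ENNReal.zero_rpow_of_pos (by linarith)]
        exact zero_le
    rw [hH.gradEnergy_eq Metric.isOpen_ball, Measure.restrict_univ, mul_assoc]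
    refine (lintegral_mono hGn).trans ?_
    rw [lintegral_indicator Metric.isClosed_closedBall.measurableSet,
      lintegral_const_mul' _ _ (ENNReal.rpow_ne_top_of_nonneg (by linarith) (by simp))]
    exact mul_le_mul' le_rfl (hle.trans (mul_le_mul' le_rfl (lintegral_mono_set hD)))

/-- A map of finite energy on a ball slightly larger than the unit ball can be modified outside of
the unit ball into a map that is constant far away. -/
theorem exists_eucEnergy_opening [SecondCountableTopology N] (m : ℕ) (hm : 1 ≤ m) {ν : ℕ}
    (ι : N → Euc ν) {s p : ℝ} (hs : 0 < s) (hp : 1 ≤ p) (hι : s = 1 → Continuous ι) :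
    ∃ C : ℝ≥0∞, C < ⊤ ∧ ∀ u : Euc m → N, Measurable u →
      ∀ ρ : ℝ, 1 < ρ → eucEnergy ι s p u (Metric.ball 0 ρ) < ⊤ →
      ∃ (v : Euc m → N) (b : N), Measurable v ∧ (∀ x ∈ Metric.closedBall (0 : Euc m) 1, v x = u x) ∧
        (∀ x ∉ Metric.closedBall (0 : Euc m) 16, v x = b) ∧
        eucEnergy ι s p v univ ≤ C * eucEnergy ι s p u (Metric.ball 0 ρ) := by
  by_cases h1 : s = 1
  · subst h1
    obtain ⟨C, hC, h⟩ := exists_gradEnergy_opening (N := N) m ν hp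
    refine ⟨C, hC, fun u hu ρ hρ hfin ↦ ?_⟩
    simp only [eucEnergy_one] at hfin ⊢
    exact h ι (hι rfl) u hu ρ hρ hfin
  · obtain ⟨C, hC, h⟩ := exists_gagEnergy_opening (N := N) m hm (σ := s * p) (by positivity) hp
    refine ⟨C, hC, fun u hu ρ hρ _ ↦ ?_⟩
    simp only [eucEnergy_of_ne ι h1]
    obtain ⟨v, b, a1, a2, a3, a4⟩ := h u hu
    exact ⟨v, b, a1, a2, a3, a4.trans (mul_le_mul' le_rfl
      (gagEnergy_mono _ p u (Metric.closedBall_subset_ball hρ)))⟩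

end OpeningEnergy

/-! ### Lipschitz bounds on Riemannian manifolds -/

section
variable {m n : ℕ} {M : Type*} [EMetricSpace M] [ChartedSpace (Euc m) M]
  [RiemannianBundle (fun x : M ↦ TangentSpace (𝓡 m) x)]
  {N : Type*} [EMetricSpace N] [ChartedSpace (Euc n) N]
  [RiemannianBundle (fun x : N ↦ TangentSpace (𝓡 n) x)]

/-- Lengths of curves are multiplied by at most `C` by a map whose derivative is bounded by `C`. -/
theorem pathELength_comp_le {g : M → N} {U : Set M} {C : ℝ≥0} {γ : ℝ → M}
    (hg : ∀ x ∈ U, MDifferentiableAt (𝓡 m) (𝓡 n) g x)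
    (hC : ∀ x ∈ U, ∀ v : TangentSpace (𝓡 m) x, ‖mfderiv (𝓡 m) (𝓡 n) g x v‖ₑ ≤ C * ‖v‖ₑ)
    (hγ : ContMDiffOn 𝓘(ℝ, ℝ) (𝓡 m) 1 γ (Icc 0 1)) (hγU : ∀ t ∈ Icc (0 : ℝ) 1, γ t ∈ U) :
    Manifold.pathELength (𝓡 n) (g ∘ γ) 0 1 ≤ C * Manifold.pathELength (𝓡 m) γ 0 1 := by
  rw [Manifold.pathELength_eq_lintegral_mfderivWithin_Icc,
    Manifold.pathELength_eq_lintegral_mfderivWithin_Icc, ← lintegral_const_mul' _ _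
        ENNReal.coe_ne_top]
  refine setLIntegral_mono' measurableSet_Icc fun t ht ↦ ?_
  have e : mfderivWithin 𝓘(ℝ, ℝ) (𝓡 n) (g ∘ γ) (Icc 0 1) t =
      (mfderiv (𝓡 m) (𝓡 n) g (γ t)).comp (mfderivWithin 𝓘(ℝ, ℝ) (𝓡 m) γ (Icc 0 1) t) := by
    refine mfderiv_comp_mfderivWithin _ (hg _ (hγU t ht)) (hγ.mdifferentiableOn one_ne_zero t ht) ?_
    rw [uniqueMDiffWithinAt_iff_uniqueDiffWithinAt]
    exact uniqueDiffOn_Icc zero_lt_one t ht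
  rw [e]
  exact hC _ (hγU t ht) _

variable [IsRiemannianManifold (𝓡 m) M] [IsRiemannianManifold (𝓡 n) N]

theorem edist_le_pathELength {x y : M} {γ : ℝ → M}
    (hγ : ContMDiffOn 𝓘(ℝ, ℝ) (𝓡 m) 1 γ (Icc 0 1)) (h0 : γ 0 = x) (h1 : γ 1 = y) :
    edist x y ≤ Manifold.pathELength (𝓡 m) γ 0 1 := by
  rw [IsRiemannianManifold.out (I := 𝓡 m) x y]
  exact Manifold.riemannianEDist_le_pathELength hγ h0 h1 zero_le_one

theorem exists_path_lt {x y : M} {r : ℝ≥0∞} (h : edist x y < r) :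
    ∃ γ : ℝ → M, γ 0 = x ∧ γ 1 = y ∧ ContMDiffOn 𝓘(ℝ, ℝ) (𝓡 m) 1 γ (Icc 0 1) ∧
      Manifold.pathELength (𝓡 m) γ 0 1 < r := by
  rw [IsRiemannianManifold.out (I := 𝓡 m) x y] at h
  exact Manifold.exists_lt_of_riemannianEDist_lt h

/-- A `C¹` map with bounded derivative near `x₀` is Lipschitz near `x₀`. -/
theorem edist_comp_le_of_mfderiv_le {g : M → N} {x₀ : M} {δ : ℝ≥0∞} {C : ℝ≥0}
    (hg : ContMDiffOn (𝓡 m) (𝓡 n) 1 g (Metric.eball x₀ (3 * δ)))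
    (hC : ∀ x ∈ Metric.eball x₀ (3 * δ), ∀ v : TangentSpace (𝓡 m) x,
      ‖mfderiv (𝓡 m) (𝓡 n) g x v‖ₑ ≤ C * ‖v‖ₑ) {x y : M} (hx : x ∈ Metric.eball x₀ δ)
    (hy : y ∈ Metric.eball x₀ δ) : edist (g x) (g y) ≤ C * edist x y := by
  have hxy : edist x y < 2 * δ := by
    rw [two_mul]
    exact (edist_triangle_right _ _ x₀).trans_lt (ENNReal.add_lt_add hx hy)
  have hlen : ∀ r, edist x y < r → r ≤ 2 * δ → edist (g x) (g y) ≤ C * r := by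
    intro r hr hrδ
    obtain ⟨γ, h0, h1, hγ, hl⟩ := exists_path_lt (m := m) hr
    -- A path from `x` of length below `2δ` stays within `2δ + δ` of `x₀`; this is the origin of the
    -- factor `3`.
    have hU : ∀ t ∈ Icc (0 : ℝ) 1, γ t ∈ Metric.eball x₀ (3 * δ) := by
      intro t ht
      have hd : edist x (γ t) ≤ Manifold.pathELength (𝓡 m) γ 0 1 := by
        rw [IsRiemannianManifold.out (I := 𝓡 m)]
        refine (Manifold.riemannianEDist_le_pathELength (hγ.mono (Icc_subset_Icc_right ht.2)) h0 rfl
          ht.1).trans (Manifold.pathELength_mono le_rfl ht.2)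
      rw [Metric.mem_eball]
      calc edist (γ t) x₀ ≤ edist x (γ t) + edist x x₀ := edist_triangle_left _ _ _
        _ < 2 * δ + δ := ENNReal.add_lt_add ((hd.trans_lt hl).trans_le hrδ) hx
        _ = 3 * δ := by ring
    have ho : IsOpen (Metric.eball x₀ (3 * δ)) := Metric.isOpen_eball
    refine (edist_le_pathELength (hg.comp hγ hU) (congrArg g h0) (congrArg g h1)).trans ?_
    refine (pathELength_comp_le (fun z hz ↦ ?_) hC hγ hU).trans (mul_le_mul' le_rfl hl.le)
    exact ((hg z hz).contMDiffAt (ho.mem_nhds hz)).mdifferentiableAt one_ne_zero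
  have hlim : Filter.Tendsto (fun r ↦ (C : ℝ≥0∞) * r) (𝓝[>] edist x y) (𝓝 (C * edist x y)) :=
    (ENNReal.continuous_const_mul ENNReal.coe_ne_top).continuousAt.mono_left nhdsWithin_le_nhds
  have : (𝓝[>] edist x y).NeBot := nhdsGT_neBot_of_exists_gt ⟨_, hxy⟩
  refine ge_of_tendsto hlim ?_
  filter_upwards [Ioo_mem_nhdsGT hxy] with r hr using hlen r hr.1 hr.2.le

/-- The derivative is isometric, so lengths of curves are not increased. With `δ = ⊤` the local
estimate is global; points at infinite distance are trivial. -/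
theorem IsRiemannianEmbedding.lipschitzWith {ν : ℕ} {ι : N → Euc ν}
    (hι : IsRiemannianEmbedding (n := n) ι) : LipschitzWith 1 ι := by
  intro x y
  by_cases hxy : edist x y = ⊤
  · simp [hxy]
  refine edist_comp_le_of_mfderiv_le (x₀ := x) (δ := ⊤) (hι.2.1.of_le (by simp)).contMDiffOn
    (fun z _ v ↦ ?_) (by simp) (by rw [Metric.mem_eball, edist_comm]; exact lt_top_iff_ne_top.2 hxy)
  rw [ENNReal.coe_one, one_mul, ← ofReal_norm, ← ofReal_norm]
  refine ENNReal.ofReal_le_ofReal (le_of_eq ?_)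
  exact hι.2.2 z v

theorem enorm_apply_le_of_opNorm_lt {E F : Type*} {_ : SeminormedAddCommGroup E} {_ : NormedSpace ℝ
    E}
    {_ : SeminormedAddCommGroup F} {_ : NormedSpace ℝ F} {L : E →L[ℝ] F} {C : ℝ} (h : ‖L‖ < C) (v :
        E) :
    ‖L v‖ₑ ≤ C.toNNReal * ‖v‖ₑ := by
  rw [← ofReal_norm, ← ofReal_norm, ← ENNReal.ofReal, ← ENNReal.ofReal_mul ((norm_nonneg L).trans
      h.le)]
  refine ENNReal.ofReal_le_ofReal ((L.le_opNorm v).trans ?_)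
  exact mul_le_mul_of_nonneg_right h.le (norm_nonneg v)

theorem enorm_tangentSpace_euc (x : Euc m) (v : TangentSpace (𝓡 m) x) :
    ‖v‖ₑ = @enorm (Euc m) _ v := enorm_tangentSpace_vectorSpace

end

/-! ### Bi-Lipschitz charts and short paths -/

section
variable {m : ℕ} {M : Type*} [EMetricSpace M] [ChartedSpace (Euc m) M] [IsManifold (𝓡 m) ∞ M]
  [RiemannianBundle (fun x : M ↦ TangentSpace (𝓡 m) x)]
  [IsContMDiffRiemannianBundle (𝓡 m) ∞ (Euc m) (fun x : M ↦ TangentSpace (𝓡 m) x)]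

instance tangentSpace_isContinuousRiemannianBundle :
    IsContinuousRiemannianBundle (Euc m) (fun x : M ↦ TangentSpace (𝓡 m) x) := by
  obtain ⟨g, hg, h⟩ := IsContMDiffRiemannianBundle.exists_contMDiff (IB := 𝓡 m) (n := ∞)
    (F := Euc m) (E := fun x : M ↦ TangentSpace (𝓡 m) x)
  exact ⟨g, hg.continuous, h⟩

theorem eventually_enorm_mfderiv_chartAt_le (x₀ : M) :
    ∃ C : ℝ≥0, ∀ᶠ y in 𝓝 x₀, ∀ v : TangentSpace (𝓡 m) y,
      ‖mfderiv (𝓡 m) (𝓡 m) (chartAt (Euc m) x₀) y v‖ₑ ≤ C * ‖v‖ₑ := by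
  obtain ⟨C, hC, h⟩ := eventually_norm_mfderiv_extChartAt_lt (𝓡 m) x₀
  refine ⟨C.toNNReal, ?_⟩
  filter_upwards [h] with y hy v
  exact (enorm_tangentSpace_euc _ _).trans_le (enorm_apply_le_of_opNorm_lt hy v)

theorem eventually_enorm_mfderiv_chartAt_symm_le (x₀ : M) :
    ∃ C : ℝ≥0, ∀ᶠ y in 𝓝 (chartAt (Euc m) x₀ x₀), ∀ v : TangentSpace (𝓡 m) y,
      ‖mfderiv (𝓡 m) (𝓡 m) (chartAt (Euc m) x₀).symm y v‖ₑ ≤ C * ‖v‖ₑ := by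
  obtain ⟨C, hC, h⟩ := eventually_norm_mfderivWithin_symm_extChartAt_lt (𝓡 m) x₀
  refine ⟨C.toNNReal, ?_⟩
  rw [ModelWithCorners.range_eq_univ, nhdsWithin_univ] at h
  filter_upwards [h] with y hy v
  rw [mfderivWithin_univ] at hy
  exact (enorm_apply_le_of_opNorm_lt hy v).trans_eq (congrArg _ (enorm_tangentSpace_euc _ _).symm)

variable [IsRiemannianManifold (𝓡 m) M]

theorem exists_eball_three_subset {X : Type*} [PseudoEMetricSpace X] {x : X} {s : Set X} (hs : s ∈ 𝓝
    x) :
    ∃ δ : ℝ, 0 < δ ∧ Metric.eball x (3 * ENNReal.ofReal δ) ⊆ s := by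
  obtain ⟨ε, hε, h⟩ := EMetric.mem_nhds_iff.1 hs
  obtain ⟨c, hc, hcε⟩ := ENNReal.lt_iff_exists_nnreal_btwn.1 hε
  have hc' : (0 : ℝ) < c := by exact_mod_cast hc
  refine ⟨c / 3, by positivity, (Metric.eball_subset_eball ?_).trans h⟩
  rw [← ENNReal.ofReal_ofNat 3, ← ENNReal.ofReal_mul (by norm_num), mul_div_cancel₀ _ (by norm_num),
    ENNReal.ofReal_coe_nnreal]
  exact hcε.le

/-- Charts are Lipschitz near their base point. -/
theorem exists_edist_chartAt_le (x₀ : M) : ∃ (C : ℝ≥0) (δ : ℝ), 0 < δ ∧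
    ∀ x ∈ Metric.eball x₀ (ENNReal.ofReal δ), ∀ y ∈ Metric.eball x₀ (ENNReal.ofReal δ),
      edist (chartAt (Euc m) x₀ x) (chartAt (Euc m) x₀ y) ≤ C * edist x y := by
  obtain ⟨C, hC⟩ := eventually_enorm_mfderiv_chartAt_le (m := m) x₀
  obtain ⟨δ, hδ, h⟩ := exists_eball_three_subset (Filter.inter_mem hC
    ((chartAt (Euc m) x₀).open_source.mem_nhds (mem_chart_source _ x₀)))
  refine ⟨C, δ, hδ, fun x hx y hy ↦ edist_comp_le_of_mfderiv_le
    ((contMDiffOn_chart (n := 1)).mono fun z hz ↦ (h hz).2) (fun z hz ↦ (h hz).1) hx hy⟩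

/-- Inverse charts are Lipschitz near the image of their base point. -/
theorem exists_edist_chartAt_symm_le (x₀ : M) : ∃ (C : ℝ≥0) (δ : ℝ), 0 < δ ∧
    Metric.ball (chartAt (Euc m) x₀ x₀) δ ⊆ (chartAt (Euc m) x₀).target ∧
    ∀ x ∈ Metric.ball (chartAt (Euc m) x₀ x₀) δ, ∀ y ∈ Metric.ball (chartAt (Euc m) x₀ x₀) δ,
      edist ((chartAt (Euc m) x₀).symm x) ((chartAt (Euc m) x₀).symm y) ≤ C * edist x y := by
  obtain ⟨C, hC⟩ := eventually_enorm_mfderiv_chartAt_symm_le (m := m) x₀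
  obtain ⟨δ, hδ, h⟩ := exists_eball_three_subset (Filter.inter_mem hC
    ((chartAt (Euc m) x₀).open_target.mem_nhds (mem_chart_target _ x₀)))
  refine ⟨C, δ, hδ, fun x hx ↦ (h ?_).2, fun x hx y hy ↦ edist_comp_le_of_mfderiv_le
    ((contMDiffOn_chart_symm (n := 1)).mono fun z hz ↦ (h hz).2) (fun z hz ↦ (h hz).1)
    (δ := ENNReal.ofReal δ) (by rwa [Metric.eball_ofReal]) (by rwa [Metric.eball_ofReal])⟩
  rw [← Metric.eball_ofReal] at hx
  exact Metric.eball_subset_eball (le_mul_of_one_le_left' (by norm_num)) hx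

/-- Nearby points are joined by Lipschitz paths with small Lipschitz constant. -/
theorem eventually_exists_lipschitz_path (m : ℕ) {M : Type*} [EMetricSpace M]
    [ChartedSpace (Euc m) M] [IsManifold (𝓡 m) ∞ M]
    [RiemannianBundle (fun x : M ↦ TangentSpace (𝓡 m) x)]
    [IsContMDiffRiemannianBundle (𝓡 m) ∞ (Euc m) (fun x : M ↦ TangentSpace (𝓡 m) x)]
    [IsRiemannianManifold (𝓡 m) M] (x₀ : M) {η : ℝ≥0} (hη : 0 < η) :
    ∀ᶠ y in 𝓝 x₀, ∃ γ : ℝ → M, LipschitzWith η γ ∧ γ 0 = x₀ ∧ γ 1 = y := by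
  obtain ⟨C, δ, hδ, -, hL⟩ := exists_edist_chartAt_symm_le (m := m) x₀
  set φ : OpenPartialHomeomorph M (Euc m) := chartAt (Euc m) x₀
  have hc : ContinuousAt φ x₀ := φ.continuousAt (mem_chart_source _ x₀)
  -- The path is the image under the inverse chart of a segment of length below `η / (C + 1)`; the
  -- `1` prevents a division by zero.
  have hpos : 0 < min δ (η / (C + 1)) := lt_min hδ (by positivity)
  filter_upwards [hc (Metric.ball_mem_nhds _ hpos), chart_source_mem_nhds (Euc m) x₀] with y hy hys
  rw [mem_preimage, Metric.mem_ball, lt_min_iff] at hy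
  set g : ℝ → Euc m := fun t ↦ AffineMap.lineMap (φ x₀) (φ y) (projIcc (0 : ℝ) 1 zero_le_one t : ℝ)
  have hg : LipschitzWith (nndist (φ x₀) (φ y)) g := by
    have h1 : LipschitzWith 1 fun t : ℝ ↦ (projIcc (0 : ℝ) 1 zero_le_one t : ℝ) := by
      have := (LipschitzWith.subtype_val _).comp (LipschitzWith.projIcc (zero_le_one' ℝ))
      rwa [one_mul] at this
    have := (lipschitzWith_lineMap (𝕜 := ℝ) (φ x₀) (φ y)).comp h1
    rwa [mul_one] at this
  have hgb : ∀ t, g t ∈ Metric.ball (φ x₀) δ := fun t ↦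
    (convex_ball (φ x₀) δ).lineMap_mem (Metric.mem_ball_self hδ) hy.1 (projIcc 0 1 zero_le_one t).2
  refine ⟨fun t ↦ φ.symm (g t), fun s t ↦ (hL _ (hgb s) _ (hgb t)).trans ?_, ?_, ?_⟩
  · refine (mul_le_mul' le_rfl (hg s t)).trans ?_
    rw [← mul_assoc, ← ENNReal.coe_mul]
    refine mul_le_mul' (ENNReal.coe_le_coe.2 ?_) le_rfl
    have h2 : (C + 1) * dist (φ y) (φ x₀) ≤ η := by
      have := (lt_div_iff₀ (by positivity)).1 hy.2
      linarith
    rw [← NNReal.coe_le_coe, NNReal.coe_mul, coe_nndist, dist_comm]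
    nlinarith [dist_nonneg (x := φ y) (y := φ x₀)]
  · simp [g, φ]
  · simp [g, φ.left_inv hys]

end

/-! ### Energies of cutoff functions -/

section
variable {m ν : ℕ}

open Classical in
/-- The energy of a real-valued cutoff function. -/
noncomputable def cutoffEnergy (s p : ℝ) (θ : Euc m → ℝ) : ℝ≥0∞ :=
  if s = 1 then ∫⁻ x, ‖fderiv ℝ θ x‖ₑ ^ p else gagEnergy (s * p) p θ univ

/-- No differentiability of `g` is available at `θ x`, hence no chain rule. Instead `g ∘ θ`
satisfies near `x` a Lipschitz estimate with constant `K (‖fderiv ℝ θ x‖ + ε)`, which bounds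
`fderiv` whether or not the composition is differentiable. -/
theorem enorm_fderiv_comp_le {E F : Type*} [NormedAddCommGroup E] [NormedSpace ℝ E]
    [NormedAddCommGroup F] [NormedSpace ℝ F] {K : ℝ≥0} {g : ℝ → F} (hg : LipschitzWith K g)
    {θ : E → ℝ} {x : E} (hθ : DifferentiableAt ℝ θ x) :
    ‖fderiv ℝ (g ∘ θ) x‖ₑ ≤ K * ‖fderiv ℝ θ x‖ₑ := by
  have key : ∀ ε > 0, ‖fderiv ℝ (g ∘ θ) x‖ ≤ K * (‖fderiv ℝ θ x‖ + ε) := by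
    intro ε hε
    refine norm_fderiv_le_of_lip' ℝ (by positivity) ?_
    filter_upwards [hθ.hasFDerivAt.isLittleO.def hε] with y hy
    have h1 := hg.dist_le_mul (θ y) (θ x)
    rw [dist_eq_norm, dist_eq_norm] at h1
    refine h1.trans ?_
    rw [mul_assoc]
    refine mul_le_mul_of_nonneg_left ?_ K.2
    have h2 := (fderiv ℝ θ x).le_opNorm (y - x)
    have h3 := norm_add_le (θ y - θ x - fderiv ℝ θ x (y - x)) (fderiv ℝ θ x (y - x))
    rw [sub_add_cancel] at h3
    linarith
  have h : ‖fderiv ℝ (g ∘ θ) x‖ ≤ K * ‖fderiv ℝ θ x‖ := by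
    have hlim : Filter.Tendsto (fun ε : ℝ ↦ K * (‖fderiv ℝ θ x‖ + ε)) (𝓝[>] 0)
        (𝓝 (K * (‖fderiv ℝ θ x‖ + 0))) :=
      (Continuous.tendsto (by fun_prop) _).mono_left nhdsWithin_le_nhds
    rw [add_zero] at hlim
    exact ge_of_tendsto hlim (eventually_nhdsWithin_of_forall key)
  rw [← ofReal_norm, ← ofReal_norm, ← ENNReal.ofReal_coe_nnreal, ← ENNReal.ofReal_mul K.coe_nonneg]
  exact ENNReal.ofReal_le_ofReal h

/-- The homogeneity `η ^ p` is what matters: a transition along a path with a small Lipschitz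
constant is cheap. -/
theorem eucEnergy_comp_cutoff_le {N : Type*} [EMetricSpace N] {ι : N → Euc ν} {s p : ℝ} (hp : 0 ≤ p)
    (hι : s = 1 → LipschitzWith 1 ι) {η L : ℝ≥0} {γ : ℝ → N} (hγ : LipschitzWith η γ)
    {θ : Euc m → ℝ} (hθ : LipschitzWith L θ) :
    eucEnergy ι s p (γ ∘ θ) univ ≤ (η : ℝ≥0∞) ^ p * cutoffEnergy s p θ := by
  unfold eucEnergy cutoffEnergy
  split_ifs with h
  · have hg : LipschitzWith η (ι ∘ γ) := by simpa using (hι h).comp hγ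
    refine ((hg.comp hθ).hasWeakDerivOn.gradEnergy_le p).trans ?_
    rw [Measure.restrict_univ, ← lintegral_const_mul' _ _
      (ENNReal.rpow_ne_top_of_nonneg hp ENNReal.coe_ne_top)]
    refine lintegral_mono_ae ?_
    filter_upwards [hθ.ae_differentiableAt] with x hx
    rw [← ENNReal.mul_rpow_of_nonneg _ _ hp]
    exact ENNReal.rpow_le_rpow (enorm_fderiv_comp_le hg hx) hp
  · exact gagEnergy_comp_lipschitz_le _ hp hγ θ univ

theorem cutoffEnergy_linearCutoff_lt_top (hm : 1 ≤ m) {s p : ℝ} (hs : 0 < s) (hs1 : s ≤ 1) (hp : 1 ≤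
    p) :
    cutoffEnergy s p (linearCutoff (m := m)) < ⊤ := by
  unfold cutoffEnergy
  have h2 : ∀ x ∉ Metric.closedBall (0 : Euc m) 2, linearCutoff x = 0 := fun x hx ↦
    linearCutoff_eq_zero (by simpa using (not_le.1 (mt mem_closedBall_zero_iff.2 hx)).le)
  split_ifs with h
  · have hz : ∀ x ∉ Metric.closedBall (0 : Euc m) 2, fderiv ℝ (linearCutoff (m := m)) x = 0 := by
      intro x hx
      have : linearCutoff (m := m) =ᶠ[𝓝 x] fun _ ↦ 0 := by
        filter_upwards [Metric.isClosed_closedBall.isOpen_compl.mem_nhds hx] with y hy using h2 y hy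
      rw [this.fderiv_eq, fderiv_fun_const, Pi.zero_apply]
    have hle : ∀ x, ‖fderiv ℝ (linearCutoff (m := m)) x‖ₑ ^ p ≤
        (Metric.closedBall (0 : Euc m) 2).indicator 1 x := by
      intro x
      by_cases hx : x ∈ Metric.closedBall (0 : Euc m) 2
      · rw [indicator_of_mem hx, Pi.one_apply]
        refine ENNReal.rpow_le_one ?_ (by linarith)
        have := norm_fderiv_le_of_lipschitz ℝ (lipschitzWith_linearCutoff (m := m)) (x₀ := x)
        rw [← ofReal_norm]
        exact ENNReal.ofReal_le_one.2 (by simpa using this)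
      · rw [hz x hx, enorm_eq_nnnorm, nnnorm_zero, ENNReal.coe_zero, ENNReal.zero_rpow_of_pos (by
            linarith)]
        exact zero_le
    refine (lintegral_mono hle).trans_lt ?_
    rw [lintegral_indicator_one Metric.isClosed_closedBall.measurableSet]
    exact measure_closedBall_lt_top
  · exact gagEnergy_lipschitz_lt_top hm (by positivity)
      (by nlinarith [lt_of_le_of_ne hs1 h]) lipschitzWith_linearCutoff two_pos h2

/-- The oscillation bound for the logarithm gives a Lipschitz estimate near `x`, with no need to
differentiate the norm or the truncations. The factor `2` comes from neighbours `y` with `‖y‖ ≥ ‖x‖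
/ 2`. -/
theorem norm_fderiv_logCutoff_le {k : ℕ} {x : Euc m} (hx : x ≠ 0) :
    ‖fderiv ℝ (logCutoff (m := m) k) x‖ ≤ 2 / (k * Real.log 2) * ‖x‖⁻¹ := by
  have h2 : 0 < Real.log 2 := Real.log_pos (by norm_num)
  have hx0 : 0 < ‖x‖ := norm_pos_iff.2 hx
  refine norm_fderiv_le_of_lip' ℝ (by positivity) ?_
  filter_upwards [Metric.ball_mem_nhds x (half_pos hx0)] with y hy
  rw [Metric.mem_ball, dist_eq_norm] at hy
  have ha := abs_le.1 (abs_norm_sub_norm_le y x)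
  have hy0 : ‖x‖ / 2 < ‖y‖ := by linarith
  have hlog : ∀ a b : ℝ, ‖x‖ / 2 ≤ a → a ≤ b → b - a ≤ ‖y - x‖ → Real.log (b / a) / (k * Real.log 2)
      ≤
      2 / (k * Real.log 2) * ‖x‖⁻¹ * ‖y - x‖ := by
    intro a b h1 h3 h4
    have ha0 : 0 < a := by linarith
    have e : 2 / (k * Real.log 2) * ‖x‖⁻¹ * ‖y - x‖ = (‖y - x‖ / (‖x‖ / 2)) / (k * Real.log 2) := by
      field_simp
    rw [e]
    refine div_le_div_of_nonneg_right ?_ (by positivity)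
    calc Real.log (b / a) ≤ b / a - 1 := Real.log_le_sub_one_of_pos (div_pos (ha0.trans_le h3) ha0)
      _ = (b - a) / a := by field_simp
      _ ≤ ‖y - x‖ / (‖x‖ / 2) := div_le_div₀ (norm_nonneg _) h4 (half_pos hx0) h1
  rw [Real.norm_eq_abs]
  rcases le_total ‖x‖ ‖y‖ with h | h
  · rw [abs_sub_comm]
    exact (abs_logCutoff_sub_le hx0 h).trans (hlog _ _ (by linarith) h (by linarith))
  · exact (abs_logCutoff_sub_le (by linarith) h).trans (hlog _ _ hy0.le h (by linarith))

theorem fderiv_logCutoff_eq_zero {k : ℕ} (hk : 1 ≤ k) {x : Euc m} (hx : ‖x‖ < (2 ^ k)⁻¹ ∨ 1 < ‖x‖) :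
    fderiv ℝ (logCutoff (m := m) k) x = 0 := by
  rcases hx with hx | hx
  · have : logCutoff (m := m) k =ᶠ[𝓝 x] fun _ ↦ 1 := by
      filter_upwards [(isOpen_lt continuous_norm continuous_const).mem_nhds hx] with y hy
        using logCutoff_eq_one hk (le_of_lt hy)
    rw [this.fderiv_eq, fderiv_fun_const, Pi.zero_apply]
  · have : logCutoff (m := m) k =ᶠ[𝓝 x] fun _ ↦ 0 := by
      filter_upwards [(isOpen_lt continuous_const continuous_norm).mem_nhds hx] with y hy
        using logCutoff_eq_zero (le_of_lt hy)
    rw [this.fderiv_eq, fderiv_fun_const, Pi.zero_apply]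

/-- On the annulus the integrand is of order `(k log 2) ^ (-m) ‖x‖ ^ (-m)`, the borderline case of
the shell count; elsewhere it vanishes, except possibly on negligible spheres already included in
the annulus. -/
theorem exists_lintegral_fderiv_logCutoff_le (m : ℕ) (hm : 1 ≤ m) : ∃ C : ℝ≥0∞, C < ⊤ ∧ ∀ k : ℕ, 1 ≤
    k →
    ∫⁻ x, ‖fderiv ℝ (logCutoff (m := m) k) x‖ₑ ^ (m : ℝ)
      ≤ C * (ENNReal.ofReal ((k * Real.log 2) ^ (-m : ℝ)) * (k + 1)) := by
  obtain ⟨C, hC, h⟩ := exists_lintegral_log_le m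
  have h2 : 0 < Real.log 2 := Real.log_pos (by norm_num)
  refine ⟨ENNReal.ofReal (2 ^ (m : ℝ)) * C, ENNReal.mul_lt_top ENNReal.ofReal_lt_top hC, fun k hk ↦
      ?_⟩
  set S : Set (Euc m) := {y | ((2 : ℝ) ^ k)⁻¹ ≤ dist 0 y ∧ dist 0 y ≤ 1}
  have hS : MeasurableSet S :=
    (measurableSet_le measurable_const (measurable_const.dist measurable_id)).inter
      (measurableSet_le (measurable_const.dist measurable_id) measurable_const)
  have hk0 : (0 : ℝ) < k := by exact_mod_cast hk
  have hle : ∀ x : Euc m, ‖fderiv ℝ (logCutoff (m := m) k) x‖ₑ ^ (m : ℝ) ≤ S.indicator (fun y ↦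
      ENNReal.ofReal ((2 / (k * Real.log 2)) ^ (m : ℝ)) * edist 0 y ^ (-(m : ℝ))) x := by
    intro x
    by_cases hx : x ∈ S
    · rw [indicator_of_mem hx]
      have hx0 : 0 < ‖x‖ := by
        have := hx.1
        rw [dist_zero_left] at this
        exact lt_of_lt_of_le (by positivity) this
      rw [edist_dist, dist_zero_left, ← ofReal_norm, ENNReal.ofReal_rpow_of_pos hx0,
        ← ENNReal.ofReal_mul (by positivity), ENNReal.ofReal_rpow_of_nonneg (norm_nonneg _) (by
            positivity),
        Real.rpow_neg hx0.le, ← Real.inv_rpow hx0.le, ← Real.mul_rpow (by positivity) (by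
            positivity)]
      exact ENNReal.ofReal_le_ofReal (Real.rpow_le_rpow (norm_nonneg _)
        (norm_fderiv_logCutoff_le (norm_pos_iff.1 hx0)) (by positivity))
    · rw [fderiv_logCutoff_eq_zero hk]
      · rw [enorm_eq_nnnorm, nnnorm_zero, ENNReal.coe_zero, ENNReal.zero_rpow_of_pos (by
            exact_mod_cast hm)]
        exact zero_le
      · simp only [S, dist_zero_left, mem_ofPred_eq, not_and_or, not_le] at hx
        exact hx
  refine (lintegral_mono hle).trans ?_
  rw [lintegral_indicator hS, lintegral_const_mul' _ _ ENNReal.ofReal_ne_top]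
  refine (mul_le_mul' le_rfl (h 0 k)).trans (le_of_eq ?_)
  rw [Real.div_rpow (by norm_num) (by positivity), div_eq_mul_inv, ENNReal.ofReal_mul (by
      positivity),
    Real.rpow_neg (by positivity)]
  ring

/-- The sequence behaves like `k ^ (1 - p)`. The requirement `p > 1` is the source of the
exceptional case `s = p = m = 1`. -/
theorem tendsto_ofReal_rpow_neg_mul {p : ℝ} (hp : 1 < p) :
    Filter.Tendsto (fun k : ℕ ↦ ENNReal.ofReal ((k * Real.log 2) ^ (-p)) * (k + 1)) Filter.atTop (𝓝
        0) := by
  have h2 : 0 < Real.log 2 := Real.log_pos (by norm_num)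
  have h1 : Filter.Tendsto (fun k : ℕ ↦ 2 / Real.log 2 * ((k : ℝ) * Real.log 2) ^ (-(p - 1)))
      Filter.atTop (𝓝 (2 / Real.log 2 * 0)) :=
    ((tendsto_rpow_neg_atTop (by linarith)).comp
      (tendsto_natCast_atTop_atTop.atTop_mul_const h2)).const_mul _
  rw [mul_zero] at h1
  have h3 := ENNReal.tendsto_ofReal h1
  rw [ENNReal.ofReal_zero] at h3
  refine tendsto_of_tendsto_of_tendsto_of_le_of_le' tendsto_const_nhds h3 (.of_forall fun _ ↦
      zero_le) ?_
  filter_upwards [Filter.eventually_ge_atTop 1] with k hk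
  have hk0 : (1 : ℝ) ≤ k := by exact_mod_cast hk
  have e : ((k : ℝ≥0∞) + 1) = ENNReal.ofReal (k + 1) := by
    rw [ENNReal.ofReal_add (by positivity) zero_le_one, ENNReal.ofReal_natCast, ENNReal.ofReal_one]
  rw [e, ← ENNReal.ofReal_mul (by positivity)]
  refine ENNReal.ofReal_le_ofReal ?_
  have hkl : 0 < (k : ℝ) * Real.log 2 := by positivity
  rw [show -(p - 1) = -p + 1 by ring, Real.rpow_add hkl, Real.rpow_one]
  have : 2 / Real.log 2 * (((k : ℝ) * Real.log 2) ^ (-p) * (k * Real.log 2)) =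
      ((k : ℝ) * Real.log 2) ^ (-p) * (2 * k) := by field_simp
  rw [this]
  gcongr
  linarith

/-- In the critical case `p > 1` is automatic outside the exception: if `s = 1` then `p = m`, and `p
= 1` would give `m = 1`; if `s < 1` then `p > m ≥ 1`. -/
theorem exists_cutoffEnergy_logCutoff_le (hm : 1 ≤ m) {s p : ℝ} (hs : 0 < s) (hs1 : s ≤ 1) (hp : 1 ≤
    p)
    (hsp : s * p = m) (hne : ¬(s = 1 ∧ p = 1 ∧ m = 1)) {ε : ℝ≥0∞} (hε : ε ≠ 0) :
    ∃ k : ℕ, 1 ≤ k ∧ cutoffEnergy s p (logCutoff (m := m) k) ≤ ε := by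
  have hm1 : (1 : ℝ) ≤ m := by exact_mod_cast hm
  have key : 1 < p ∧ ∃ C : ℝ≥0∞, C < ⊤ ∧ ∀ k : ℕ, 1 ≤ k → cutoffEnergy s p (logCutoff (m := m) k)
      ≤ C * (ENNReal.ofReal ((k * Real.log 2) ^ (-p)) * (k + 1)) := by
    unfold cutoffEnergy
    split_ifs with h
    · subst h
      rw [one_mul] at hsp
      refine ⟨lt_of_le_of_ne hp fun h ↦ hne ⟨rfl, h.symm, ?_⟩, ?_⟩
      · exact_mod_cast (hsp.symm.trans h.symm)
      · rw [hsp]; exact exists_lintegral_fderiv_logCutoff_le m hm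
    · have : s < 1 := lt_of_le_of_ne hs1 h
      have hmp : (m : ℝ) < p := by rw [← hsp]; nlinarith
      rw [hsp]
      exact ⟨by linarith, exists_gagEnergy_logCutoff_le hm hmp⟩
  obtain ⟨hp1, C, hC, h⟩ := key
  have hlim := ENNReal.Tendsto.const_mul (a := C) (tendsto_ofReal_rpow_neg_mul hp1) (.inr hC.ne)
  rw [mul_zero] at hlim
  obtain ⟨k, hk1, hk⟩ := ((hlim.eventually (gt_mem_nhds (pos_iff_ne_zero.2 hε))).and
    (Filter.eventually_ge_atTop 1)).exists
  exact ⟨k, hk, (h k hk).trans hk1.le⟩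

end

/-! ### Transitions between constants -/

section
variable {m ν : ℕ}

/-- There is a map equal to `b` on a ball of radius `r`, to `b'` outside the ball of radius `R`, and
whose energy is at most `ε`. -/
def HasTransition {N : Type*} [EMetricSpace N] [MeasurableSpace N] (m : ℕ) (ι : N → Euc ν)
    (s p : ℝ) (b b' : N) (ε : ℝ≥0∞) (r R : ℝ) : Prop :=
  ∃ t : Euc m → N, Measurable t ∧ (∀ x ∈ Metric.closedBall (0 : Euc m) r, t x = b) ∧
    (∀ x ∉ Metric.closedBall (0 : Euc m) R, t x = b') ∧ eucEnergy ι s p t univ ≤ ε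

variable {N : Type*} [EMetricSpace N] [MeasurableSpace N] {ι : N → Euc ν} {s p : ℝ}

theorem HasTransition.mono {b b' : N} {ε ε' : ℝ≥0∞} {r r' R R' : ℝ}
    (h : HasTransition m ι s p b b' ε r R) (hε : ε ≤ ε') (hr : r' ≤ r) (hR : R ≤ R') :
    HasTransition m ι s p b b' ε' r' R' := by
  obtain ⟨t, ht, h1, h2, h3⟩ := h
  exact ⟨t, ht, fun x hx ↦ h1 x (Metric.closedBall_subset_closedBall hr hx),
    fun x hx ↦ h2 x fun hx' ↦ hx (Metric.closedBall_subset_closedBall hR hx'), h3.trans hε⟩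

variable [BorelSpace N]

/-- The path `γ` is run through by a cutoff rescaled to radius `ρ`; scaling contributes the factor
`ρ ^ (m - sp)`. -/
theorem hasTransition_of_cutoff (hp : 0 ≤ p) (hι : s = 1 → LipschitzWith 1 ι) {η L : ℝ≥0}
    {γ : ℝ → N} (hγ : LipschitzWith η γ) {θ : Euc m → ℝ} (hθ : LipschitzWith L θ) {r R ρ : ℝ} (hρ :
        0 < ρ)
    (h1 : ∀ x, ‖x‖ ≤ r → θ x = 1) (h0 : ∀ x, R ≤ ‖x‖ → θ x = 0) :
    HasTransition m ι s p (γ 1) (γ 0)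
      (ENNReal.ofReal (ρ ^ (m - s * p)) * ((η : ℝ≥0∞) ^ p * cutoffEnergy s p θ)) (ρ * r) (ρ * R) :=
          by
  have hnorm : ∀ x : Euc m, ‖similarity 0 ρ⁻¹ x‖ = ρ⁻¹ * ‖x‖ := fun x ↦ by
    rw [similarity, zero_add, norm_smul, Real.norm_of_nonneg (by positivity)]
  refine ⟨(γ ∘ θ) ∘ similarity 0 ρ⁻¹, ((hγ.comp hθ).continuous.comp
    (continuous_similarity _ _)).measurable, fun x hx ↦ ?_, fun x hx ↦ ?_, ?_⟩
  · refine congrArg γ (h1 _ ?_)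
    rw [hnorm, inv_mul_le_iff₀ hρ]
    exact mem_closedBall_zero_iff.1 hx
  · refine congrArg γ (h0 _ ?_)
    rw [hnorm, le_inv_mul_iff₀ hρ]
    exact (not_le.1 (mt mem_closedBall_zero_iff.2 hx)).le
  · have h := eucEnergy_comp_similarity ι s hp (γ ∘ θ) isOpen_univ 0 (inv_pos.2 hρ)
    rw [preimage_univ] at h
    rw [h, Real.inv_rpow hρ.le, ← Real.rpow_neg hρ.le, neg_sub]
    exact mul_le_mul' le_rfl (eucEnergy_comp_cutoff_le hp hι hγ hθ)

/-- Constants joined by a Lipschitz path admit transitions, when the dimension is not subcritical. -/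
theorem exists_hasTransition_of_lipschitz (hm : 1 ≤ m) (hs : 0 < s) (hs1 : s ≤ 1) (hp : 1 ≤ p)
    (hι : s = 1 → LipschitzWith 1 ι) (hsp : s * p ≤ m) (hne : ¬(s = 1 ∧ p = 1 ∧ m = 1)) {η : ℝ≥0}
    {γ : ℝ → N} (hγ : LipschitzWith η γ) {ε : ℝ≥0∞} (hε : ε ≠ 0) {R : ℝ} (hR : 0 < R) :
    ∃ r, 0 < r ∧ r ≤ R ∧ HasTransition m ι s p (γ 1) (γ 0) ε r R := by
  have hp0 : 0 ≤ p := by linarith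
  have hη : (η : ℝ≥0∞) ^ p ≠ ⊤ := ENNReal.rpow_ne_top_of_nonneg hp0 ENNReal.coe_ne_top
  rcases hsp.lt_or_eq with hlt | heq
  -- For `sp < m` the factor `ρ ^ (m - sp)` tends to `0`, and any cutoff becomes cheap when
  -- concentrated.
  · set A := (η : ℝ≥0∞) ^ p * cutoffEnergy s p (linearCutoff (m := m))
    have hA : A ≠ ⊤ := ENNReal.mul_ne_top hη (cutoffEnergy_linearCutoff_lt_top hm hs hs1 hp).ne
    have hlim : Filter.Tendsto (fun ρ : ℝ ↦ ENNReal.ofReal (ρ ^ (m - s * p)) * A) (𝓝[>] 0) (𝓝 0) :=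
        by
      have h1 : Filter.Tendsto (fun ρ : ℝ ↦ ENNReal.ofReal (ρ ^ (m - s * p))) (𝓝[>] 0) (𝓝 0) := by
        have := (Real.continuousAt_rpow_const 0 ((m : ℝ) - s * p) (.inr (by linarith))).tendsto
        rw [Real.zero_rpow (by linarith)] at this
        simpa using ENNReal.tendsto_ofReal (this.mono_left (nhdsWithin_le_nhds (s := Ioi 0)))
      simpa using ENNReal.Tendsto.mul_const h1 (.inr hA)
    obtain ⟨ρ, h1, h2⟩ := ((hlim.eventually (gt_mem_nhds (pos_iff_ne_zero.2 hε))).and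
      (Ioo_mem_nhdsGT (half_pos hR))).exists
    refine ⟨ρ, h2.1, by linarith [h2.2], ?_⟩
    have := hasTransition_of_cutoff hp0 hι hγ (lipschitzWith_linearCutoff (m := m)) h2.1
      (r := 1) (R := 2) (fun x ↦ linearCutoff_eq_one) (fun x ↦ linearCutoff_eq_zero)
    exact this.mono h1.le (by simp) (by linarith [h2.2])
  -- For `sp = m` the energy is scale invariant, and smallness comes from the logarithmic profile.
  · obtain ⟨ε', hε', hle⟩ : ∃ ε' : ℝ≥0∞, ε' ≠ 0 ∧ (η : ℝ≥0∞) ^ p * ε' ≤ ε := by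
      refine ⟨ε / (η : ℝ≥0∞) ^ p, ?_, ENNReal.mul_div_le⟩
      exact (ENNReal.div_pos hε hη).ne'
    obtain ⟨k, hk, hkε⟩ := exists_cutoffEnergy_logCutoff_le hm hs hs1 hp heq hne hε'
    obtain ⟨L, hL⟩ := lipschitzWith_logCutoff (m := m) k
    refine ⟨R * (2 ^ k)⁻¹, by positivity, ?_, ?_⟩
    · exact mul_le_of_le_one_right hR.le (inv_le_one_of_one_le₀ (one_le_pow₀ (by norm_num)))
    have := hasTransition_of_cutoff hp0 hι hγ hL hR
      (r := (2 ^ k)⁻¹) (R := 1) (fun x ↦ logCutoff_eq_one hk) (fun x ↦ logCutoff_eq_zero)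
    refine this.mono ?_ le_rfl (by simp)
    rw [heq, sub_self, Real.rpow_zero, ENNReal.ofReal_one, one_mul]
    exact (mul_le_mul' le_rfl hkε).trans hle

/-- The transition from `a` to `b` is inserted in the plateau where the other one equals `b`. -/
theorem HasTransition.trans [SecondCountableTopology N] (hm : 1 ≤ m) (hp : 1 ≤ p) {a b c : N}
    {ε ε' : ℝ≥0∞} {r R R' : ℝ} (h1 : HasTransition m ι s p a b ε r R)
    (h2 : HasTransition m ι s p b c ε' R R') (hr : 0 < R) (hR : r ≤ R) (hR1 : R ≤ 1) (hRR : R ≤ R')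
        :
    HasTransition m ι s p a c (3 ^ p * (ε' + ε)) r R' := by
  obtain ⟨t, ht, t1, t2, t3⟩ := h1
  obtain ⟨t', ht', t1', t2', t3'⟩ := h2
  have hd : Pairwise (Function.onFun Disjoint fun _ : Unit ↦ Metric.closedBall (0 : Euc m) R) :=
    fun i j hij ↦ (hij (Subsingleton.elim i j)).elim
  refine ⟨glue t' (fun _ : Unit ↦ Metric.closedBall (0 : Euc m) R) (fun _ ↦ t), ?_,
    fun x hx ↦ ?_, fun x hx ↦ ?_, ?_⟩
  · exact measurable_glue hd (fun _ ↦ Metric.isClosed_closedBall.measurableSet) ht' fun _ ↦ ht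
  · rw [glue_of_mem (i := ()) hd (Metric.closedBall_subset_closedBall hR hx), t1 x hx]
  · rw [glue_of_notMem fun _ hx' ↦ hx (Metric.closedBall_subset_closedBall hRR hx'), t2' x hx]
  · have := eucEnergy_glue_le hm ι s hp (c := fun _ : Unit ↦ (0 : Euc m)) (r := fun _ ↦ R) (b := fun
        _ ↦ b)
      (fun _ ↦ hr) (fun _ ↦ hR1) hd (by simpa using measure_closedBall_lt_top.ne) ht' (fun _ ↦ ht)
      (fun _ x hx ↦ t1' x hx) (fun _ x hx ↦ t2 x hx)
    refine this.trans (mul_le_mul' le_rfl (add_le_add t3' ?_))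
    simpa using t3

end

/-! ### Transitions towards a common constant -/

section
variable {m ν : ℕ} {s p : ℝ}

/-- Nearby constants admit transitions between any pair of concentric balls. -/
theorem eventually_hasTransition (n : ℕ) {N : Type*} [EMetricSpace N]
    [ChartedSpace (Euc n) N] [IsManifold (𝓡 n) ∞ N]
    [RiemannianBundle (fun x : N ↦ TangentSpace (𝓡 n) x)]
    [IsContMDiffRiemannianBundle (𝓡 n) ∞ (Euc n) (fun x : N ↦ TangentSpace (𝓡 n) x)]
    [IsRiemannianManifold (𝓡 n) N] [MeasurableSpace N] [BorelSpace N] {ι : N → Euc ν}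
    (hm : 1 ≤ m) (hs : 0 < s) (hs1 : s ≤ 1) (hp : 1 ≤ p)
    (hι : s = 1 → LipschitzWith 1 ι) (b' : N) {ε : ℝ≥0∞} (hε : ε ≠ 0) {R : ℝ} (hR : 0 < R) :
    ∀ᶠ b in 𝓝 b', HasTransition m ι s p b b' ε (R / 2) R := by
  have hp0 : 0 < p := by linarith
  set A := ENNReal.ofReal ((R / 2) ^ (m - s * p))
  set B := cutoffEnergy s p (linearCutoff (m := m))
  have hB : B ≠ ⊤ := (cutoffEnergy_linearCutoff_lt_top hm hs hs1 hp).ne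
  -- Here smallness comes from the length of the path, at a fixed scale `R / 2` and with the linear
  -- cutoff; this works for every sign of `m - sp`.
  obtain ⟨η, hη, hle⟩ : ∃ η : ℝ≥0, 0 < η ∧ A * ((η : ℝ≥0∞) ^ p * B) < ε := by
    have hlim : Filter.Tendsto (fun η : ℝ≥0 ↦ A * ((η : ℝ≥0∞) ^ p * B)) (𝓝[>] 0) (𝓝 0) := by
      have h1 : Filter.Tendsto (fun η : ℝ≥0 ↦ (η : ℝ≥0∞) ^ p) (𝓝[>] 0) (𝓝 0) := by
        have h := (ENNReal.continuous_rpow_const (y := p)).tendsto 0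
        rw [ENNReal.zero_rpow_of_pos hp0] at h
        exact h.comp (ENNReal.tendsto_coe.2 nhdsWithin_le_nhds)
      have h2 := ENNReal.Tendsto.mul_const (b := B) h1 (.inr hB)
      simpa using ENNReal.Tendsto.const_mul (a := A) h2 (.inr ENNReal.ofReal_ne_top)
    obtain ⟨η, h1, h2⟩ := ((hlim.eventually (gt_mem_nhds (pos_iff_ne_zero.2 hε))).and
      self_mem_nhdsWithin).exists
    exact ⟨η, h2, h1⟩
  filter_upwards [eventually_exists_lipschitz_path n b' hη] with b hb
  obtain ⟨γ, hγ, rfl, rfl⟩ := hb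
  have := hasTransition_of_cutoff hp0.le hι hγ (lipschitzWith_linearCutoff (m := m)) (half_pos hR)
    (r := 1) (R := 2) (fun x ↦ linearCutoff_eq_one) (fun x ↦ linearCutoff_eq_zero)
  exact this.mono hle.le (by simp) (by linarith)

/-- Any two constants admit transitions, when the dimension is not subcritical. -/
theorem exists_hasTransition (n : ℕ) {N : Type*} [EMetricSpace N]
    [ChartedSpace (Euc n) N] [IsManifold (𝓡 n) ∞ N]
    [RiemannianBundle (fun x : N ↦ TangentSpace (𝓡 n) x)]
    [IsContMDiffRiemannianBundle (𝓡 n) ∞ (Euc n) (fun x : N ↦ TangentSpace (𝓡 n) x)]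
    [IsRiemannianManifold (𝓡 n) N] [MeasurableSpace N] [BorelSpace N]
    {ι : N → Euc ν} [SecondCountableTopology N] [ConnectedSpace N] (hm : 1 ≤ m) (hs : 0 < s)
    (hs1 : s ≤ 1) (hp : 1 ≤ p) (hι : s = 1 → LipschitzWith 1 ι) (hsp : s * p ≤ m)
    (hne : ¬(s = 1 ∧ p = 1 ∧ m = 1)) (b b' : N) {ε : ℝ≥0∞} (hε : ε ≠ 0) {R : ℝ} (hR : 0 < R) :
    ∃ r, 0 < r ∧ r ≤ R ∧ HasTransition m ι s p b b' ε r R := by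
  suffices h : ∀ ε : ℝ≥0∞, ε ≠ 0 → ∀ R : ℝ, 0 < R →
      ∃ r, 0 < r ∧ r ≤ R ∧ HasTransition m ι s p b b' ε r R from h ε hε R hR
  -- The relation "cheap transitions exist at all scales" is transitive and holds in both directions
  -- between close points, so by connectedness it holds everywhere.
  refine PreconnectedSpace.induction₂' (α := N) (fun b b' ↦ ∀ ε : ℝ≥0∞, ε ≠ 0 → ∀ R : ℝ, 0 < R →
      ∃ r, 0 < r ∧ r ≤ R ∧ HasTransition m ι s p b b' ε r R) (fun b' ↦ ?_) ⟨fun a b c h1 h2 ε hε R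
          hR ↦ ?_⟩ b b'
  · filter_upwards [eventually_exists_lipschitz_path n b' one_pos] with b hb
    obtain ⟨γ, hγ, rfl, rfl⟩ := hb
    refine ⟨fun ε hε R hR ↦ ?_, fun ε hε R hR ↦
      exists_hasTransition_of_lipschitz hm hs hs1 hp hι hsp hne hγ hε hR⟩
    have h1 : LipschitzWith 1 (fun t : ℝ ↦ 1 - t) := by
      simpa using (LipschitzWith.const (1 : ℝ)).sub LipschitzWith.id
    have h2 : LipschitzWith 1 (fun t : ℝ ↦ γ (1 - t)) := by
      have := hγ.comp h1
      rwa [one_mul] at this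
    simpa using exists_hasTransition_of_lipschitz hm hs hs1 hp hι hsp hne h2 hε hR
  · have h3 : (3 : ℝ≥0∞) ^ p ≠ ⊤ := ENNReal.rpow_ne_top_of_nonneg (by linarith) (by norm_num)
    have hε' : ε / 3 ^ p / 2 ≠ 0 := (ENNReal.half_pos (ENNReal.div_pos hε h3).ne').ne'
    -- The outer transition is chosen first; its plateau radius `r'`, at most `1` as gluing
    -- requires, is then the outer radius prescribed for the inner one.
    obtain ⟨r', hr', hrR', H'⟩ := h2 _ hε' (min R 1) (lt_min hR one_pos)
    obtain ⟨r, hr, hrR, H⟩ := h1 _ hε' r' hr'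
    have hle := le_min_iff.1 hrR'
    refine ⟨r, hr, hrR.trans hle.1, (H.trans hm hp (H'.mono le_rfl le_rfl (min_le_left _ _)) hr' hrR
      hle.2 hle.1).mono ?_ le_rfl le_rfl⟩
    rw [ENNReal.add_halves]
    exact ENNReal.mul_div_le

/-- For every sequence of constants there is a constant towards which transitions exist
frequently. -/
theorem exists_frequently_hasTransition (n : ℕ) {N : Type*} [EMetricSpace N]
    [ChartedSpace (Euc n) N] [IsManifold (𝓡 n) ∞ N]
    [RiemannianBundle (fun x : N ↦ TangentSpace (𝓡 n) x)]
    [IsContMDiffRiemannianBundle (𝓡 n) ∞ (Euc n) (fun x : N ↦ TangentSpace (𝓡 n) x)]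
    [IsRiemannianManifold (𝓡 n) N] [MeasurableSpace N] [BorelSpace N]
    {ι : N → Euc ν} [SecondCountableTopology N] [ConnectedSpace N] (hm : 1 ≤ m)
    (hs : 0 < s) (hs1 : s ≤ 1) (hp : 1 ≤ p) (hι : s = 1 → LipschitzWith 1 ι)
    (hN : (m < s * p ∨ (s = 1 ∧ p = 1 ∧ m = 1)) → CompactSpace N) (b : ℕ → N) :
    ∃ b' : N, ∀ ε : ℝ≥0∞, ε ≠ 0 → ∀ R : ℝ, 0 < R → ∃ᶠ k in Filter.atTop, ∃ r, 0 < r ∧ r ≤ R ∧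
      (m < s * p → r = R / 2) ∧ HasTransition m ι s p (b k) b' ε r R := by
  by_cases h : m < s * p ∨ (s = 1 ∧ p = 1 ∧ m = 1)
  · have := hN h
    obtain ⟨b', -, hb'⟩ := isCompact_univ.exists_mapClusterPt (f := Filter.atTop) (u := b) (by simp)
    refine ⟨b', fun ε hε R hR ↦ ?_⟩
    refine (hb'.frequently (eventually_hasTransition n hm hs hs1 hp hι b' hε hR)).mono fun k hk ↦ ?_
    exact ⟨R / 2, half_pos hR, by linarith, fun _ ↦ rfl, hk⟩
  -- Otherwise any constant can be reached from any other, and any target will do.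
  · rw [not_or] at h
    refine ⟨b 0, fun ε hε R hR ↦ Filter.Frequently.of_forall fun k ↦ ?_⟩
    obtain ⟨r, h1, h2, h3⟩ := exists_hasTransition n hm hs hs1 hp hι (not_lt.1 h.1) h.2 (b k) (b 0)
      hε hR
    exact ⟨r, h1, h2, fun h' ↦ (h.1 h').elim, h3⟩

end

/-! ### Maps violating a linear energy bound -/

section
variable {m ν κ : ℕ} {N : Type*} [EMetricSpace N] {F : Type*} [EMetricSpace F]

/-- The Hilbert–Schmidt and operator norms are comparable, so it suffices to refute the failure of
the bound for the operator norm energies. The enlarged constant both absorbs the comparison factor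
and strengthens the smallness condition. -/
theorem exists_sobolevEnergy_bound_of_eucEnergy (hm : 1 ≤ m) {ιN : N → Euc ν} {ιF : F → Euc κ}
    {s p r q : ℝ} (hp : 0 ≤ p) (hq : 0 ≤ q) {f : N → F} {P : Prop} {V : Set (Euc m → N)}
    (h : ∃ C : ℝ≥0, 0 < C ∧ ∀ u ∈ V, (P ∨ eucEnergy ιN s p u (Metric.ball 0 1) ≤ (C : ℝ≥0∞)⁻¹) →
      eucEnergy ιF r q (f ∘ u) (Metric.ball 0 1) ≤ C * eucEnergy ιN s p u (Metric.ball 0 1)) :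
    ∃ C : ℝ≥0, 0 < C ∧ ∀ u ∈ V, (P ∨ sobolevEnergy m ιN s p u (Metric.ball 0 1) ≤ (C : ℝ≥0∞)⁻¹) →
      sobolevEnergy m ιF r q (f ∘ u) (Metric.ball 0 1) ≤ C * sobolevEnergy m ιN s p u (Metric.ball 0
          1) := by
  obtain ⟨C, hC, h⟩ := h
  obtain ⟨K, hK, hKle⟩ := exists_sobolevEnergy_le m hm hq
  refine ⟨max C (K * C), lt_max_of_lt_left hC, fun u hu hcond ↦ ?_⟩
  have hE := eucEnergy_le_sobolevEnergy ιN s hp u (Metric.ball 0 1)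
  have hcond' : P ∨ eucEnergy ιN s p u (Metric.ball 0 1) ≤ (C : ℝ≥0∞)⁻¹ :=
    hcond.imp id fun h' ↦ hE.trans (h'.trans
      (ENNReal.inv_le_inv.2 (ENNReal.coe_le_coe.2 (le_max_left _ _))))
  calc sobolevEnergy m ιF r q (f ∘ u) (Metric.ball 0 1)
      ≤ K * (C * sobolevEnergy m ιN s p u (Metric.ball 0 1)) :=
        (hKle κ F ιF r (f ∘ u) _ Metric.isOpen_ball).trans
          (mul_le_mul' le_rfl ((h u hu hcond').trans (mul_le_mul' le_rfl hE)))
    _ ≤ _ := by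
      rw [← mul_assoc, ← ENNReal.coe_mul]
      exact mul_le_mul' (ENNReal.coe_le_coe.2 (le_max_right _ _)) le_rfl

theorem preimage_similarity_ball (c : Euc m) {ρ : ℝ} (hρ : 0 < ρ) (R : ℝ) :
    similarity c ρ ⁻¹' Metric.ball c (ρ * R) = Metric.ball 0 R := by
  ext x
  rw [mem_preimage, mem_ball_iff_norm, mem_ball_zero_iff, similarity, add_sub_cancel_left,
      norm_smul,
    Real.norm_of_nonneg hρ.le, mul_lt_mul_iff_right₀ hρ]

/-- The inverse of `similarity c ρ`. -/
noncomputable abbrev similarityInv (c : Euc m) (ρ : ℝ) : Euc m → Euc m :=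
  similarity (-(ρ⁻¹ • c)) ρ⁻¹

theorem norm_similarityInv (c : Euc m) {ρ : ℝ} (hρ : 0 < ρ) (x : Euc m) :
    ‖similarityInv c ρ x‖ = ρ⁻¹ * ‖x - c‖ := by
  have : similarityInv c ρ x = ρ⁻¹ • (x - c) := by
    rw [similarityInv, similarity, smul_sub]; abel
  rw [this, norm_smul, Real.norm_of_nonneg (by positivity)]

theorem preimage_similarityInv_ball (c : Euc m) {ρ : ℝ} (hρ : 0 < ρ) (R : ℝ) :
    similarityInv c ρ ⁻¹' Metric.ball 0 R = Metric.ball c (ρ * R) := by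
  ext x
  rw [mem_preimage, mem_ball_zero_iff, mem_ball_iff_norm, norm_similarityInv c hρ, inv_mul_lt_iff₀
      hρ]

theorem preimage_similarityInv_closedBall (c : Euc m) {ρ : ℝ} (hρ : 0 < ρ) (R : ℝ) :
    similarityInv c ρ ⁻¹' Metric.closedBall 0 R = Metric.closedBall c (ρ * R) := by
  ext x
  rw [mem_preimage, mem_closedBall_zero_iff, mem_closedBall_iff_norm, norm_similarityInv c hρ,
    inv_mul_le_iff₀ hρ]

theorem eucEnergy_comp_similarityInv (ι : N → Euc ν) (s : ℝ) {p : ℝ} (hp : 0 ≤ p) (u : Euc m → N)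
    {A : Set (Euc m)} (hA : IsOpen A) (c : Euc m) {ρ : ℝ} (hρ : 0 < ρ) :
    eucEnergy ι s p (u ∘ similarityInv c ρ) (similarityInv c ρ ⁻¹' A)
      = ENNReal.ofReal (ρ ^ (m - s * p)) * eucEnergy ι s p u A := by
  rw [similarityInv, eucEnergy_comp_similarity ι s hp u hA _ (inv_pos.2 hρ), Real.inv_rpow hρ.le,
    ← Real.rpow_neg hρ.le, neg_sub]

theorem eucEnergy_const (ι : N → Euc ν) (s : ℝ) {p : ℝ} (hp : 0 < p) (b : N) (A : Set (Euc m)) :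
    eucEnergy ι s p (fun _ ↦ b) A = 0 := by
  unfold eucEnergy
  split_ifs
  · refine le_antisymm (((hasWeakDerivOn_const (ι b) A).gradEnergy_le p).trans_eq ?_) zero_le
    rw [lintegral_congr (g := fun _ ↦ 0), lintegral_zero]
    intro x
    rw [enorm_eq_nnnorm, nnnorm_zero, ENNReal.coe_zero, ENNReal.zero_rpow_of_pos hp]
  · simp [gagEnergy, gagKernel, ENNReal.zero_rpow_of_pos hp]

variable [MeasurableSpace N] [BorelSpace N] [SecondCountableTopology N]
  [MeasurableSpace F] [BorelSpace F] [SecondCountableTopology F]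

/-- If a linear energy bound fails for every constant, it fails for maps which are constant
outside a ball. -/
theorem exists_bad_map (hm : 1 ≤ m) {ιN : N → Euc ν} {ιF : F → Euc κ} {s p r q : ℝ} (hs : 0 < s)
    (hp : 1 ≤ p) (hq : 1 ≤ q) (hι : s = 1 → Continuous ιN) (hrq : r * q = s * p) {f : N → F}
    (hf : Measurable f)
    (hbad : ¬ ∃ C : ℝ≥0, 0 < C ∧ ∀ u : Euc m → N, AEMeasurable u (volume.restrict (Metric.ball 0 1))
        →
      (s * p < m ∨ eucEnergy ιN s p u (Metric.ball 0 1) ≤ (C : ℝ≥0∞)⁻¹) →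
      eucEnergy ιF r q (f ∘ u) (Metric.ball 0 1) ≤ C * eucEnergy ιN s p u (Metric.ball 0 1))
    {Λ : ℝ} (hΛ : 0 < Λ) :
    ∃ (v : Euc m → N) (b : N) (e : ℝ), 0 < e ∧ Measurable v ∧
      (∀ x ∉ Metric.closedBall (0 : Euc m) 16, v x = b) ∧ eucEnergy ιN s p v univ ≤ ENNReal.ofReal e
          ∧
      ENNReal.ofReal (Λ * e) ≤ eucEnergy ιF r q (f ∘ v) (Metric.ball 0 1) ∧ (m ≤ s * p → e ≤ 1 / Λ)
          := by
  obtain ⟨C₀, hC₀, hopen⟩ := exists_eucEnergy_opening m hm ιN hs hp hι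
  have hp0 : 0 ≤ p := by linarith
  have hq0 : 0 ≤ q := by linarith
  push Not at hbad
  lift C₀ to ℝ≥0 using hC₀.ne
  -- Opening multiplies the energy by at most `C₀`, so a ratio exceeding `Λ (C₀ + 1)` leaves at
  -- least `Λ` afterwards; the `1` keeps the constant positive.
  set C : ℝ≥0 := Λ.toNNReal * (C₀ + 1)
  have hΛ' : 0 < Λ.toNNReal := Real.toNNReal_pos.2 hΛ
  obtain ⟨u₀, hu₀, hcond₀, hlt₀⟩ := hbad C (by positivity)
  obtain ⟨u, hu, hae⟩ : ∃ u : Euc m → N, Measurable u ∧ u₀ =ᵐ[volume.restrict (Metric.ball 0 1)] u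
      :=
    ⟨hu₀.mk, hu₀.measurable_mk, hu₀.ae_eq_mk⟩
  have hB : MeasurableSet (Metric.ball (0 : Euc m) 1) := measurableSet_ball
  rw [eucEnergy_congr_ae ιN s p hB hae] at hcond₀ hlt₀
  rw [eucEnergy_congr_ae ιF r q hB (hae.fun_comp f)] at hlt₀
  change _ < eucEnergy ιF r q (f ∘ u) _ at hlt₀
  -- Opening requires finite energy on a ball larger than the one where the map is preserved. By
  -- monotone convergence the strict inequality persists for the image on a smaller ball of radius
  -- `ρ`, and dilation makes this the unit ball inside the ball of radius `ρ⁻¹ > 1`.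
  obtain ⟨ρ, hρ0, hρ1, hlt⟩ : ∃ ρ : ℝ, 0 < ρ ∧ ρ < 1 ∧ C * eucEnergy ιN s p u (Metric.ball 0 1)
      < eucEnergy ιF r q (f ∘ u) (Metric.ball 0 ρ) := by
    have hmono : Monotone fun n : ℕ ↦ 1 - 1 / ((n : ℝ) + 2) := by
      intro a b hab
      have : (a : ℝ) ≤ b := by exact_mod_cast hab
      simp only
      gcongr
    have hU : ⋃ n : ℕ, Metric.ball (0 : Euc m) (1 - 1 / ((n : ℝ) + 2)) = Metric.ball 0 1 := by
      refine subset_antisymm (iUnion_subset fun n ↦ Metric.ball_subset_ball ?_) fun x hx ↦ ?_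
      · have : (0 : ℝ) < 1 / ((n : ℝ) + 2) := by positivity
        linarith
      · rw [mem_ball_zero_iff] at hx
        obtain ⟨n, hn⟩ := exists_nat_gt (1 / (1 - ‖x‖))
        refine mem_iUnion.2 ⟨n, mem_ball_zero_iff.2 ?_⟩
        have h1 : 1 / ((n : ℝ) + 2) < 1 - ‖x‖ := by
          rw [div_lt_comm₀ (by positivity) (by linarith)]
          linarith
        linarith
    by_contra! hcon
    refine hlt₀.not_ge ?_
    rw [← hU]
    refine eucEnergy_iUnion_le ιF r q (hf.comp hu) (fun a b hab ↦ Metric.ball_subset_ball (hmono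
        hab))
      (fun n ↦ Metric.isOpen_ball) (hU ▸ hlt₀.trans_le le_top) fun n ↦ ?_
    rw [hU]
    refine hcon _ ?_ ?_
    · have : 1 / ((n : ℝ) + 2) < 1 := by
        rw [div_lt_one (by positivity)]; linarith [(Nat.cast_nonneg n : (0 : ℝ) ≤ n)]
      linarith
    · have : (0 : ℝ) < 1 / ((n : ℝ) + 2) := by positivity
      linarith
  set E := eucEnergy ιN s p u (Metric.ball 0 1)
  have hCE : C * E < ⊤ := hlt.trans_le le_top
  have hE : E < ⊤ := by
    by_contra! h
    rw [top_le_iff.1 h, ENNReal.mul_top (by simpa using (by positivity : C ≠ 0))] at hCE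
    exact hCE.ne rfl
  set D := ENNReal.ofReal (ρ ^ (s * p - m))
  have hD0 : D ≠ 0 := by simpa [D] using Real.rpow_pos_of_pos hρ0 _
  set u₁ := u ∘ similarity 0 ρ
  have e1 : eucEnergy ιN s p u₁ (Metric.ball 0 ρ⁻¹) = D * E := by
    rw [← preimage_similarity_ball 0 hρ0, mul_inv_cancel₀ hρ0.ne']
    exact eucEnergy_comp_similarity ιN s hp0 u Metric.isOpen_ball 0 hρ0
  have e2 : eucEnergy ιF r q (f ∘ u₁) (Metric.ball 0 1) = D * eucEnergy ιF r q (f ∘ u) (Metric.ball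
      0 ρ) := by
    rw [← preimage_similarity_ball 0 hρ0, mul_one]
    refine (eucEnergy_comp_similarity ιF r hq0 (f ∘ u) Metric.isOpen_ball 0 hρ0).trans ?_
    rw [hrq]
  have hDE : D * E < ⊤ := ENNReal.mul_lt_top ENNReal.ofReal_lt_top hE
  obtain ⟨v, b, hv, hvu, hvb, hvE⟩ := hopen u₁ (hu.comp (continuous_similarity 0 ρ).measurable) ρ⁻¹
    (one_lt_inv₀ hρ0 |>.2 hρ1) (e1 ▸ hDE)
  have e3 : eucEnergy ιF r q (f ∘ v) (Metric.ball 0 1) = eucEnergy ιF r q (f ∘ u₁) (Metric.ball 0 1)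
      := by
    refine eucEnergy_congr_ae ιF r q hB ?_
    filter_upwards [ae_restrict_mem hB] with x hx
    exact congrArg f (hvu x (Metric.ball_subset_closedBall hx))
  set G := eucEnergy ιF r q (f ∘ v) (Metric.ball 0 1)
  set X := D * E
  rw [e1] at hvE
  have hG : C * X < G := by
    rw [e3, e2, mul_left_comm]
    exact ENNReal.mul_lt_mul_right hD0 ENNReal.ofReal_ne_top hlt
  have hC : (C : ℝ≥0∞) = ENNReal.ofReal Λ * (C₀ + 1) := by
    simp [C, ENNReal.ofReal]
  have hΛ0 : ENNReal.ofReal Λ ≠ 0 := by simpa using hΛ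
  have hXG : C₀ * X ≤ G / ENNReal.ofReal Λ := by
    rw [ENNReal.le_div_iff_mul_le (.inl hΛ0) (.inl ENNReal.ofReal_ne_top)]
    refine le_trans ?_ hG.le
    rw [hC, mul_comm, ← mul_assoc]
    exact mul_le_mul' (mul_le_mul' le_rfl le_self_add) le_rfl
  have hG0 : G ≠ 0 := (zero_le.trans_lt hG).ne'
  -- The number `e` replaces the energy of `v`, which might be `0`: it must be positive, finite,
  -- above the energy, and at most the energy of the image divided by `Λ`. For `m ≤ sp` the value
  -- `min G 1 / Λ` also gives `e ≤ 1 / Λ`, thanks to the smallness condition on the bad maps and to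
  -- `D ≤ 1`.
  suffices h : ∃ e : ℝ≥0∞, e ≠ 0 ∧ e ≠ ⊤ ∧ C₀ * X ≤ e ∧ e ≤ G / ENNReal.ofReal Λ ∧
      (m ≤ s * p → e ≤ (ENNReal.ofReal Λ)⁻¹) by
    obtain ⟨e, he0, het, h1, h2, h3⟩ := h
    refine ⟨v, b, e.toReal, ENNReal.toReal_pos he0 het, hv, hvb, ?_, ?_, fun hσ ↦ ?_⟩
    · rw [ENNReal.ofReal_toReal het]; exact hvE.trans h1
    · rw [ENNReal.ofReal_mul hΛ.le, ENNReal.ofReal_toReal het]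
      exact (mul_le_mul' le_rfl h2).trans ENNReal.mul_div_le
    · have := ENNReal.toReal_mono (by simpa using hΛ) (h3 hσ)
      rwa [ENNReal.toReal_inv, ENNReal.toReal_ofReal hΛ.le, ← one_div] at this
  by_cases hσ : m ≤ s * p
  · refine ⟨min G 1 / ENNReal.ofReal Λ, (ENNReal.div_pos (by simp [hG0]) ENNReal.ofReal_ne_top).ne',
      ENNReal.div_ne_top (by simp) hΛ0, ?_, ?_, fun _ ↦ ?_⟩
    · have hX1 : C₀ * X ≤ 1 / ENNReal.ofReal Λ := by
        have hEC : E ≤ (C : ℝ≥0∞)⁻¹ := hcond₀.resolve_left (not_lt.2 hσ)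
        have hD1 : D ≤ 1 := by
          refine ENNReal.ofReal_le_one.2 (Real.rpow_le_one hρ0.le hρ1.le (by linarith))
        have hXC : X ≤ (C : ℝ≥0∞)⁻¹ := (mul_le_mul' hD1 hEC).trans_eq (one_mul _)
        rw [ENNReal.le_div_iff_mul_le (.inl hΛ0) (.inl ENNReal.ofReal_ne_top)]
        calc C₀ * X * ENNReal.ofReal Λ ≤ C * (C : ℝ≥0∞)⁻¹ := by
              rw [mul_right_comm, hC, mul_comm (ENNReal.ofReal Λ), ← hC.trans (mul_comm _ _)]
              refine mul_le_mul' ?_ hXC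
              rw [hC, mul_comm]
              exact mul_le_mul' le_rfl le_self_add
          _ ≤ 1 := ENNReal.mul_inv_le_one _
      rcases le_total G 1 with h | h
      · rwa [min_eq_left h]
      · rwa [min_eq_right h]
    · exact ENNReal.div_le_div_right (min_le_left _ _) _
    · rw [← one_div]; exact ENNReal.div_le_div_right (min_le_right _ _) _
  · by_cases hGt : G = ⊤
    · refine ⟨C₀ * X + 1, by simp, ENNReal.add_ne_top.2 ⟨ENNReal.mul_ne_top ENNReal.coe_ne_top
          hDE.ne,
        by simp⟩, le_self_add, ?_, fun h ↦ (hσ h).elim⟩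
      rw [hGt, ENNReal.top_div_of_ne_top ENNReal.ofReal_ne_top]
      exact le_top
    · exact ⟨G / ENNReal.ofReal Λ, (ENNReal.div_pos hG0 ENNReal.ofReal_ne_top).ne',
        ENNReal.div_ne_top hGt hΛ0, hXG, le_rfl, fun h ↦ (hσ h).elim⟩

end

/-! ### Replication of maps -/

section
variable {m ν κ : ℕ}

/-- The points of a cubic lattice of mesh `d`. -/
noncomputable def latticePoint (d : ℝ) {k : ℕ} (i : Fin m → Fin k) : Euc m :=
  WithLp.toLp 2 fun j ↦ d * (i j : ℝ)

theorem norm_latticePoint_le {d : ℝ} (hd : 0 ≤ d) {k : ℕ} (hm : 1 ≤ m) (i : Fin m → Fin k) :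
    ‖latticePoint d i‖ ≤ m * (d * (k - 1)) := by
  have hm1 : (1 : ℝ) ≤ m := by exact_mod_cast hm
  have hk : ∀ j, (i j : ℝ) ≤ k - 1 := fun j ↦ by
    have : ((i j : ℕ) : ℝ) + 1 ≤ k := by exact_mod_cast (i j).2
    linarith
  have hk0 : (0 : ℝ) ≤ k - 1 := (Nat.cast_nonneg _).trans (hk ⟨0, hm⟩)
  refine (pow_le_pow_iff_left₀ (norm_nonneg _) (by positivity) two_ne_zero).1 ?_
  rw [EuclideanSpace.norm_sq_eq]
  have h : ∀ j ∈ Finset.univ, ‖latticePoint d i j‖ ^ 2 ≤ (d * (k - 1)) ^ 2 := fun j _ ↦ by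
    have : latticePoint d i j = d * (i j : ℝ) := rfl
    rw [this, Real.norm_of_nonneg (by positivity)]
    gcongr
    exact hk j
  refine (Finset.sum_le_sum h).trans ?_
  rw [Finset.sum_const, Finset.card_univ, Fintype.card_fin, nsmul_eq_mul, mul_pow (m : ℝ)]
  refine mul_le_mul_of_nonneg_right ?_ (sq_nonneg (d * (k - 1)))
  nlinarith

theorem le_dist_latticePoint {d : ℝ} (hd : 0 ≤ d) {k : ℕ} {i j : Fin m → Fin k} (h : i ≠ j) :
    d ≤ dist (latticePoint d i) (latticePoint d j) := by
  obtain ⟨l, hl⟩ := Function.ne_iff.1 h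
  have h1 : ‖(latticePoint d i - latticePoint d j) l‖ ≤ ‖latticePoint d i - latticePoint d j‖ :=
    PiLp.norm_apply_le _ l
  rw [dist_eq_norm]
  refine le_trans ?_ h1
  have e : (latticePoint d i - latticePoint d j) l = d * (((i l : ℤ) - (j l : ℤ) : ℤ) : ℝ) := by
    push_cast
    rw [mul_sub]; rfl
  rw [e, norm_mul, Real.norm_of_nonneg hd, Real.norm_eq_abs, ← Int.cast_abs]
  refine le_mul_of_one_le_right hd ?_
  have : ((i l : ℤ) - (j l : ℤ)) ≠ 0 := by
    intro h0
    exact hl (Fin.ext (by omega))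
  exact_mod_cast Int.one_le_abs this

variable {N : Type*} [EMetricSpace N] {F : Type*} [EMetricSpace F]
  [MeasurableSpace N] [BorelSpace N] [SecondCountableTopology N]

/-- A map which is constant outside a ball can be replicated `k ^ m` times in a ball. -/
theorem exists_copies (hm : 1 ≤ m) {ιN : N → Euc ν} {ιF : F → Euc κ} {s p r q : ℝ}
    (hp : 1 ≤ p) (hq : 1 ≤ q) (hrq : r * q = s * p) (f : N → F) {v : Euc m → N}
    {b : N} (hv : Measurable v) (hvb : ∀ x ∉ Metric.closedBall (0 : Euc m) 16, v x = b) {R : ℝ}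
    (hR : 0 < R) (hR1 : R ≤ 1) {k : ℕ} (hk : 1 ≤ k) :
    ∃ w : Euc m → N, Measurable w ∧ (∀ x ∉ Metric.closedBall (0 : Euc m) R, w x = b) ∧
      eucEnergy ιN s p w univ ≤
        3 ^ p * (ENNReal.ofReal ((R / (48 * m)) ^ (m - s * p) * k ^ (s * p)) * eucEnergy ιN s p v
            univ) ∧
      ENNReal.ofReal ((R / (48 * m)) ^ (m - s * p) * k ^ (s * p)) * eucEnergy ιF r q (f ∘ v)
          (Metric.ball 0 1)
        ≤ eucEnergy ιF r q (f ∘ w) (Metric.ball 0 R) := by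
  have hm1 : (1 : ℝ) ≤ m := by exact_mod_cast hm
  have hk1 : (1 : ℝ) ≤ k := by exact_mod_cast hk
  -- The copies live in balls of radius `16ρ = d / 3` about the points of a lattice of mesh `d = R /
  -- (mk)`: these balls are disjoint, and the farthest lattice point is at distance at most `R - md`
  -- from the origin.
  set ρ : ℝ := R / (48 * m) / k
  have hρ : 0 < ρ := by positivity
  have hρ16 : ρ * 16 = R / (m * k) / 3 := by simp only [ρ]; field_simp; norm_num
  set d : ℝ := R / (m * k)
  have hd0 : 0 < d := by positivity
  have hmd : m * (d * (k - 1)) + d / 3 ≤ R := by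
    have e : m * (d * (k - 1)) = R - m * d := by simp only [d]; field_simp
    rw [e]; nlinarith
  set c : (Fin m → Fin k) → Euc m := latticePoint d
  set w₀ : (Fin m → Fin k) → Euc m → N := fun i ↦ v ∘ similarityInv (c i) ρ
  have hsub : ∀ i, Metric.closedBall (c i) (ρ * 16) ⊆ Metric.closedBall 0 R := fun i ↦ by
    refine Metric.closedBall_subset_closedBall' ?_
    rw [dist_zero_right, hρ16]
    linarith [norm_latticePoint_le hd0.le hm i]
  have hdisj : Pairwise (Function.onFun Disjoint fun i ↦ Metric.closedBall (c i) (ρ * 16)) := by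
    intro i j hij
    refine Metric.closedBall_disjoint_closedBall ?_
    rw [hρ16]
    linarith [le_dist_latticePoint hd0.le hij]
  -- There are `k ^ m` copies, each scaled by `ρ ^ (m - sp)` with `ρ` proportional to `1 / k`, so
  -- the total grows like `k ^ (sp)`.
  have hsum : ∀ a : ℝ≥0∞, ∑' _ : Fin m → Fin k, ENNReal.ofReal (ρ ^ (m - s * p)) * a =
      ENNReal.ofReal ((R / (48 * m)) ^ (m - s * p) * k ^ (s * p)) * a := fun a ↦ by
    rw [tsum_fintype, Finset.sum_const, Finset.card_univ, Fintype.card_fun, Fintype.card_fin,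
      Fintype.card_fin, nsmul_eq_mul, ← mul_assoc]
    congr 1
    rw [← ENNReal.ofReal_natCast, ← ENNReal.ofReal_mul (by positivity),
      Real.div_rpow (by positivity) (by positivity), Real.rpow_sub (by positivity) _ (s * p),
      Real.rpow_natCast]
    congr 1
    push_cast
    have : (0 : ℝ) < k ^ (s * p) := by positivity
    rw [Real.rpow_sub (by positivity) (m : ℝ), Real.rpow_natCast]
    field_simp
  have hw₀ : ∀ i, Measurable (w₀ i) := fun i ↦ hv.comp (continuous_similarity _ _).measurable
  have hr1 : ρ * 16 ≤ 1 := by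
    rw [hρ16]
    have : d ≤ R := by
      refine div_le_self hR.le ?_
      nlinarith
    linarith
  have hw₀b : ∀ i, ∀ x ∉ Metric.closedBall (c i) (ρ * 16), w₀ i x = b := fun i x hx ↦ by
    refine hvb _ ?_
    rwa [← mem_preimage, preimage_similarityInv_closedBall _ hρ]
  refine ⟨glue (fun _ ↦ b) (fun i ↦ Metric.closedBall (c i) (ρ * 16)) w₀,
    measurable_glue hdisj (fun _ ↦ Metric.isClosed_closedBall.measurableSet) measurable_const hw₀,
    fun x hx ↦ ?_, ?_, ?_⟩
  · rw [glue_of_notMem fun i hi ↦ hx (hsub i hi)]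
  · have h := eucEnergy_glue_le hm ιN s hp (t := fun _ ↦ b) (c := c) (r := fun _ ↦ ρ * 16) (b := fun
        _ ↦ b)
      (fun _ ↦ by positivity) (fun _ ↦ hr1) hdisj
      (by rw [tsum_fintype]; exact (ENNReal.sum_lt_top.2 fun i _ ↦ measure_closedBall_lt_top).ne)
      measurable_const hw₀ (fun _ _ _ ↦ rfl) hw₀b
    refine h.trans (mul_le_mul' le_rfl ?_)
    rw [eucEnergy_const ιN s (by linarith), zero_add, ← hsum]
    refine ENNReal.tsum_le_tsum fun i ↦ le_of_eq ?_
    have := eucEnergy_comp_similarityInv ιN s (by linarith : 0 ≤ p) v isOpen_univ (c i) hρ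
    rwa [preimage_univ] at this
  · rw [← hsum]
    have hball : ∀ i, Metric.ball (c i) (ρ * 1) ⊆ Metric.closedBall (c i) (ρ * 16) := fun i ↦
      Metric.ball_subset_closedBall.trans (Metric.closedBall_subset_closedBall (by linarith))
    have hball' : ∀ i, Metric.ball (c i) (ρ * 1) ⊆ Metric.ball 0 R := fun i ↦ by
      refine Metric.ball_subset_ball' ?_
      rw [dist_zero_right]
      have := norm_latticePoint_le hd0.le hm i
      linarith
    refine le_trans (ENNReal.tsum_le_tsum fun i ↦ le_of_eq ?_) (tsum_eucEnergy_le ιF r q _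
      (B := fun i ↦ Metric.ball (c i) (ρ * 1)) (fun _ ↦ measurableSet_ball)
      (fun i j hij ↦ (hdisj hij).mono (hball i) (hball j)) hball')
    have h1 := eucEnergy_comp_similarityInv ιF r (by linarith : 0 ≤ q) (f ∘ v) Metric.isOpen_ball (c
        i) hρ
      (A := Metric.ball 0 1)
    rw [preimage_similarityInv_ball _ hρ, hrq] at h1
    rw [← h1]
    refine eucEnergy_congr_ae ιF r q measurableSet_ball ?_
    filter_upwards [ae_restrict_mem measurableSet_ball] with x hx
    simp only [Function.comp_apply]
    rw [glue_of_mem hdisj (hball i hx)]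
    rfl

/-- The integer part `k` of `(η / a) ^ (1 / σ) ≥ 1` satisfies `k + 1 ≤ 2k`, which costs at most the
factor `2 ^ σ`. -/
theorem exists_nat_rpow_mul_le {σ a η : ℝ} (hσ : 0 < σ) (ha : 0 < a) (haη : a ≤ η) :
    ∃ k : ℕ, 1 ≤ k ∧ k ^ σ * a ≤ η ∧ η ≤ 2 ^ σ * (k ^ σ * a) := by
  have hη : 0 < η := ha.trans_le haη
  set y := (η / a) ^ σ⁻¹
  have hy : 1 ≤ y := Real.one_le_rpow ((one_le_div ha).2 haη) (inv_pos.2 hσ).le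
  have hyσ : y ^ σ = η / a := Real.rpow_inv_rpow (by positivity) hσ.ne'
  have hk1 : 1 ≤ ⌊y⌋₊ := Nat.one_le_floor_iff _ |>.2 hy
  have hk1' : (1 : ℝ) ≤ ⌊y⌋₊ := by exact_mod_cast hk1
  refine ⟨⌊y⌋₊, hk1, ?_, ?_⟩
  · rw [← le_div_iff₀ ha, ← hyσ]
    exact Real.rpow_le_rpow (by positivity) (Nat.floor_le (by positivity)) hσ.le
  · rw [← mul_assoc, ← Real.mul_rpow (by positivity) (by positivity), ← div_le_iff₀ ha, ← hyσ]
    exact Real.rpow_le_rpow (by positivity) (by linarith [Nat.lt_floor_add_one y]) hσ.le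

/-- A map whose energy is much smaller than the energy of its image under `f` yields, by
replication, a map of prescribed energy. -/
theorem exists_block (hm : 1 ≤ m) {ιN : N → Euc ν} {ιF : F → Euc κ} {s p r q : ℝ} (hs : 0 < s)
    (hp : 1 ≤ p) (hq : 1 ≤ q) (hrq : r * q = s * p) (f : N → F) {v : Euc m → N}
    {b : N} (hv : Measurable v) (hvb : ∀ x ∉ Metric.closedBall (0 : Euc m) 16, v x = b) {e Λ η : ℝ}
    (he : 0 < e) (hΛ : 0 < Λ) (hvE : eucEnergy ιN s p v univ ≤ ENNReal.ofReal e)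
    (hvG : ENNReal.ofReal (Λ * e) ≤ eucEnergy ιF r q (f ∘ v) (Metric.ball 0 1)) {R : ℝ}
    (hR : 0 < R) (hR1 : R ≤ 1) (hη : 3 ^ p * (R / (48 * m)) ^ (m - s * p) * e ≤ η)
    (hΛη : 3 ^ p * 2 ^ (s * p) ≤ Λ * η) :
    ∃ w : Euc m → N, Measurable w ∧ (∀ x ∉ Metric.closedBall (0 : Euc m) R, w x = b) ∧
      eucEnergy ιN s p w univ ≤ ENNReal.ofReal η ∧ 1 ≤ eucEnergy ιF r q (f ∘ w) (Metric.ball 0 R) :=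
          by
  have hm0 : (0 : ℝ) < m := by exact_mod_cast hm
  set B := (R / (48 * m)) ^ (m - s * p)
  have hB : 0 < B := by positivity
  have h3 : (0 : ℝ) < 3 ^ p := by positivity
  -- The number of copies brings the energy bound up to `η`, within a factor `2 ^ (sp)`. The energy
  -- of the image is then at least `Λη / (3 ^ p * 2 ^ (sp))`, which is at least `1`.
  obtain ⟨k, hk, hk1, hk2⟩ := exists_nat_rpow_mul_le (σ := s * p) (by positivity)
    (by positivity : 0 < 3 ^ p * B * e) hη
  obtain ⟨w, hw, hwb, hwE, hwG⟩ := exists_copies (ιN := ιN) (ιF := ιF) hm hp hq hrq f hv hvb hR hR1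
      hk
  refine ⟨w, hw, hwb, hwE.trans ?_, le_trans ?_ hwG⟩
  · refine (mul_le_mul' le_rfl (mul_le_mul' le_rfl hvE)).trans ?_
    rw [← ENNReal.ofReal_ofNat 3, ENNReal.ofReal_rpow_of_pos (by norm_num),
      ← ENNReal.ofReal_mul (by positivity), ← ENNReal.ofReal_mul (by positivity)]
    refine ENNReal.ofReal_le_ofReal (le_trans (le_of_eq ?_) hk1)
    ring
  · refine le_trans ?_ (mul_le_mul' le_rfl hvG)
    rw [← ENNReal.ofReal_mul (by positivity), ENNReal.one_le_ofReal]
    have h1 : Λ * η ≤ Λ * (2 ^ (s * p) * (k ^ (s * p) * (3 ^ p * B * e))) :=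
      mul_le_mul_of_nonneg_left hk2 hΛ.le
    have h2 : 0 < (3 : ℝ) ^ p * 2 ^ (s * p) := by positivity
    refine le_of_mul_le_mul_left ?_ h2
    rw [mul_one]
    refine (hΛη.trans h1).trans_eq ?_
    ring

end

/-! ### Maps of finite energy with images of infinite energy -/

section
variable {m ν κ : ℕ}

/-- If a linear energy bound fails, there are maps of arbitrarily small energy, constant outside an
arbitrarily small ball, whose image under `f` has energy at least `1`. -/
theorem exists_blocks (hm : 1 ≤ m) (n : ℕ) {N : Type*} [EMetricSpace N]
    [ChartedSpace (Euc n) N] [IsManifold (𝓡 n) ∞ N]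
    [RiemannianBundle (fun x : N ↦ TangentSpace (𝓡 n) x)]
    [IsContMDiffRiemannianBundle (𝓡 n) ∞ (Euc n) (fun x : N ↦ TangentSpace (𝓡 n) x)]
    [IsRiemannianManifold (𝓡 n) N] [SecondCountableTopology N] [ConnectedSpace N]
    [MeasurableSpace N] [BorelSpace N] {F : Type*} [EMetricSpace F]
    [MeasurableSpace F] [BorelSpace F] [SecondCountableTopology F]
    {ιN : N → Euc ν} {ιF : F → Euc κ} {s p r q : ℝ} (hs : 0 < s) (hs1 : s ≤ 1)
    (hp : 1 ≤ p) (hq : 1 ≤ q) (hι : s = 1 → LipschitzWith 1 ιN) (hrq : r * q = s * p)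
    (hN : (m < s * p ∨ (s = 1 ∧ p = 1 ∧ m = 1)) → CompactSpace N) {f : N → F} (hf : Measurable f)
    (hbad : ¬ ∃ C : ℝ≥0, 0 < C ∧ ∀ u : Euc m → N, AEMeasurable u (volume.restrict (Metric.ball 0 1))
        →
      (s * p < m ∨ eucEnergy ιN s p u (Metric.ball 0 1) ≤ (C : ℝ≥0∞)⁻¹) →
      eucEnergy ιF r q (f ∘ u) (Metric.ball 0 1) ≤ C * eucEnergy ιN s p u (Metric.ball 0 1)) :
    ∃ b : N, ∀ ε : ℝ, 0 < ε → ∀ R : ℝ, 0 < R → R ≤ 1 → ∃ z : Euc m → N, Measurable z ∧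
      (∀ x ∉ Metric.closedBall (0 : Euc m) R, z x = b) ∧ eucEnergy ιN s p z univ ≤ ENNReal.ofReal ε
          ∧
      1 ≤ eucEnergy ιF r q (f ∘ z) (Metric.ball 0 R) := by
  have hm0 : (0 : ℝ) < m := by exact_mod_cast hm
  have h3 : (0 : ℝ) < 3 ^ p := by positivity
  have hv : ∀ j : ℕ, _ := fun j ↦ exists_bad_map hm hs hp hq (fun h ↦ (hι h).continuous) hrq hf hbad
    (by positivity : 0 < (j : ℝ) + 1)
  choose v b e he hv hvb hvE hvG heΛ using hv
  obtain ⟨b', hb'⟩ := exists_frequently_hasTransition n hm hs hs1 hp hι hN b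
  refine ⟨b', fun ε hε R hR hR1 ↦ ?_⟩
  -- Two pieces of energy at most `η`, the transition and the replicated bad map, are glued at the
  -- cost of a factor `3 ^ p`.
  set η := ε / (2 * 3 ^ p)
  have hη : 0 < η := by positivity
  set A := 3 ^ p * (R / 2 / (48 * m)) ^ (m - s * p)
  obtain ⟨j, ⟨ρ, hρ, hρR, hρ2, t, ht, ht1, ht2, htE⟩, hj⟩ :=
    ((hb' (ENNReal.ofReal η) (by simpa using hη) R hR).and_eventually
      (Filter.eventually_ge_atTop ⌈(3 ^ p * 2 ^ (s * p) + A) / η⌉₊)).exists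
  have hj' : (3 ^ p * 2 ^ (s * p) + A) / η ≤ j := (Nat.le_ceil _).trans (by exact_mod_cast hj)
  rw [div_le_iff₀ hη] at hj'
  have hA : 0 < A := by positivity
  have h2 : (0 : ℝ) < 3 ^ p * 2 ^ (s * p) := by positivity
  obtain ⟨ρ', hρ', hρρ, hρ'η⟩ : ∃ ρ', 0 < ρ' ∧ ρ' ≤ ρ ∧
      3 ^ p * (ρ' / (48 * m)) ^ (m - s * p) * e j ≤ η := by
    -- A single copy must already have energy at most `η`. For `m ≤ sp` shrinking does not help, but
    -- `e j ≤ 1 / (j + 1)` does; the scale factor equals `A` because `ρ = R / 2` if `sp > m`, and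
    -- the exponent is `0` if `sp = m`. For `sp < m` there is no such bound on `e j`, and a smaller
    -- radius is used.
    by_cases hσ : (m : ℝ) ≤ s * p
    · refine ⟨ρ, hρ, le_rfl, ?_⟩
      have e1 : 3 ^ p * (ρ / (48 * m)) ^ (m - s * p) = A := by
        rcases hσ.eq_or_lt with h | h
        · simp only [A, ← h, sub_self, Real.rpow_zero]
        · rw [hρ2 h]
      rw [e1]
      refine (mul_le_mul_of_nonneg_left (heΛ j hσ) hA.le).trans ?_
      rw [mul_one_div, div_le_iff₀ (by positivity)]
      linarith
    · rw [not_le] at hσ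
      have hlim : Filter.Tendsto (fun ρ' : ℝ ↦ 3 ^ p * (ρ' / (48 * m)) ^ (m - s * p) * e j) (𝓝[>] 0)
          (𝓝 (3 ^ p * ((0 : ℝ) / (48 * m)) ^ (m - s * p) * e j)) := by
        refine Filter.Tendsto.mono_left ?_ nhdsWithin_le_nhds
        have : Continuous fun ρ' : ℝ ↦ 3 ^ p * (ρ' / (48 * m)) ^ (m - s * p) * e j := by
          refine (continuous_const.mul ?_).mul continuous_const
          exact (continuous_id.div_const _).rpow_const fun _ ↦ .inr (by linarith)
        exact this.tendsto 0
      rw [zero_div, Real.zero_rpow (by linarith), mul_zero, zero_mul] at hlim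
      obtain ⟨ρ', h1, h2⟩ := ((hlim.eventually (gt_mem_nhds hη)).and (Ioo_mem_nhdsGT hρ)).exists
      exact ⟨ρ', h2.1, h2.2.le, h1.le⟩
  obtain ⟨w, hw, hwb, hwE, hwG⟩ := exists_block (ιN := ιN) (ιF := ιF) hm hs hp hq hrq f (hv j) (hvb
      j)
    (he j) (by positivity : 0 < (j : ℝ) + 1) (hvE j) (hvG j) hρ' (by linarith) hρ'η (by linarith)
  have hd : Pairwise (Function.onFun Disjoint fun _ : Unit ↦ Metric.closedBall (0 : Euc m) ρ') :=
    fun i j hij ↦ (hij (Subsingleton.elim i j)).elim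
  refine ⟨glue t (fun _ : Unit ↦ Metric.closedBall (0 : Euc m) ρ') (fun _ ↦ w),
    measurable_glue hd (fun _ ↦ Metric.isClosed_closedBall.measurableSet) ht fun _ ↦ hw,
    fun x hx ↦ ?_, ?_, ?_⟩
  · rw [glue_of_notMem fun _ hx' ↦ hx (Metric.closedBall_subset_closedBall (hρρ.trans hρR) hx'), ht2
        x hx]
  · have := eucEnergy_glue_le hm ιN s hp (c := fun _ : Unit ↦ (0 : Euc m)) (r := fun _ ↦ ρ')
      (b := fun _ ↦ b j) (fun _ ↦ hρ') (fun _ ↦ by linarith) hd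
      (by simpa using measure_closedBall_lt_top.ne) ht (fun _ ↦ hw)
      (fun _ x hx ↦ ht1 x (Metric.closedBall_subset_closedBall hρρ hx)) (fun _ x hx ↦ hwb x hx)
    refine this.trans ?_
    rw [tsum_fintype, Finset.univ_unique, Finset.sum_singleton]
    refine (mul_le_mul' le_rfl (add_le_add htE hwE)).trans ?_
    rw [← ENNReal.ofReal_ofNat 3, ENNReal.ofReal_rpow_of_pos (by norm_num),
      ← ENNReal.ofReal_add hη.le hη.le, ← ENNReal.ofReal_mul h3.le]
    refine ENNReal.ofReal_le_ofReal (le_of_eq ?_)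
    simp only [η]
    field_simp
    ring
  · refine hwG.trans ?_
    refine le_trans (le_of_eq ?_) (eucEnergy_mono ιF r q _ (Metric.ball_subset_ball (hρρ.trans
        hρR)))
    refine eucEnergy_congr_ae ιF r q measurableSet_ball ?_
    filter_upwards [ae_restrict_mem measurableSet_ball] with x hx
    simp only [Function.comp_apply]
    rw [glue_of_mem (i := ()) hd (Metric.ball_subset_closedBall hx)]

/-- A sequence of disjoint balls in a given ball. -/
theorem exists_disjoint_balls (hm : 1 ≤ m) {δ : ℝ} (hδ : 0 < δ) :
    ∃ (c : ℕ → Euc m) (R : ℕ → ℝ), (∀ j, 0 < R j) ∧ (∀ j, R j ≤ δ) ∧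
      (∀ j, Metric.closedBall (c j) (R j) ⊆ Metric.ball 0 δ) ∧
      Pairwise (Function.onFun Disjoint fun j ↦ Metric.closedBall (c j) (R j)) := by
  set w : Euc m := EuclideanSpace.single ⟨0, hm⟩ 1
  have hw : ‖w‖ = 1 := by simp [w]
  -- The centres lie on a ray at dyadic distances `a j` from the origin, with radii `a j / 4`. For
  -- `i < j` one has `a j ≤ a i / 2`, so the centres are at least `a i / 2` apart, more than the sum
  -- of the radii.
  set a : ℕ → ℝ := fun j ↦ δ * (1 / 2) ^ (j + 1)
  have ha : ∀ j, 0 < a j := fun j ↦ by positivity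
  have ha1 : ∀ j, a j ≤ δ / 2 := fun j ↦ by
    have : ((1 : ℝ) / 2) ^ j ≤ 1 := pow_le_one₀ (by norm_num) (by norm_num)
    simp only [a, pow_succ]
    nlinarith
  have hlt : ∀ i j, i < j → a j ≤ a i / 2 := fun i j hij ↦ by
    have : ((1 : ℝ) / 2) ^ (j + 1) ≤ (1 / 2) ^ (i + 1 + 1) :=
      pow_le_pow_of_le_one (by norm_num) (by norm_num) (by omega)
    have h2 := mul_le_mul_of_nonneg_left this hδ.le
    simp only [a]
    rw [pow_succ _ (i + 1)] at h2
    linarith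
  have hdist : ∀ i j, i < j → a i / 4 + a j / 4 < dist (a i • w) (a j • w) := fun i j hij ↦ by
    rw [dist_eq_norm, ← sub_smul, norm_smul, hw, mul_one, Real.norm_of_nonneg]
    · linarith [hlt i j hij, ha i]
    · linarith [hlt i j hij, ha i]
  refine ⟨fun j ↦ a j • w, fun j ↦ a j / 4, fun j ↦ by have := ha j; positivity,
    fun j ↦ by linarith [ha1 j], fun j x hx ↦ ?_, fun i j hij ↦ ?_⟩
  · rw [mem_closedBall_iff_norm] at hx
    rw [mem_ball_zero_iff]
    have h1 : ‖a j • w‖ = a j := by rw [norm_smul, hw, mul_one, Real.norm_of_nonneg (ha j).le]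
    have h2 := norm_le_norm_sub_add x (a j • w)
    linarith [ha1 j, ha j]
  · refine Metric.closedBall_disjoint_closedBall ?_
    rcases lt_or_gt_of_ne hij with h | h
    · exact hdist i j h
    · rw [dist_comm, add_comm]; exact hdist j i h

/-- If there are maps of arbitrarily small energy, constant outside small balls, whose
images have energy at least `1`, then there is a map of finite energy whose image has infinite
energy. -/
theorem exists_infinite_of_blocks (hm : 1 ≤ m) {N : Type*} [EMetricSpace N]
    [SecondCountableTopology N] [MeasurableSpace N] [BorelSpace N] {F : Type*} [EMetricSpace F]
    {ιN : N → Euc ν} {ιF : F → Euc κ} {s p r q : ℝ} (hp : 1 ≤ p) (hq : 1 ≤ q) {f : N → F} {b : N}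
    (h : ∀ ε : ℝ, 0 < ε → ∀ R : ℝ, 0 < R → R ≤ 1 → ∃ z : Euc m → N, Measurable z ∧
      (∀ x ∉ Metric.closedBall (0 : Euc m) R, z x = b) ∧ eucEnergy ιN s p z univ ≤ ENNReal.ofReal ε
          ∧
      1 ≤ eucEnergy ιF r q (f ∘ z) (Metric.ball 0 R)) (x₀ : Euc m) {δ : ℝ} (hδ : 0 < δ) :
    ∃ u : Euc m → N, Measurable u ∧ (∀ x ∉ Metric.ball x₀ δ, u x = b) ∧
      eucEnergy ιN s p u univ < ⊤ ∧ eucEnergy ιF r q (f ∘ u) (Metric.ball x₀ δ) = ⊤ := by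
  have hδ' : 0 < min δ 1 := lt_min hδ one_pos
  obtain ⟨c₀, R, hR, hRδ, hsub₀, hdisj₀⟩ := exists_disjoint_balls hm hδ'
  set c : ℕ → Euc m := fun j ↦ c₀ j + x₀
  have hmem : ∀ j x, x ∈ Metric.closedBall (c j) (R j) ↔ x - x₀ ∈ Metric.closedBall (c₀ j) (R j) :=
      by
    intro j x
    rw [mem_closedBall_iff_norm, mem_closedBall_iff_norm]
    simp only [c]
    rw [sub_sub, add_comm]
  have hsub : ∀ j, Metric.closedBall (c j) (R j) ⊆ Metric.ball x₀ δ := fun j x hx ↦ by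
    have := hsub₀ j ((hmem j x).1 hx)
    rw [mem_ball_zero_iff] at this
    rw [mem_ball_iff_norm]
    exact this.trans_le (min_le_left _ _)
  have hdisj : Pairwise (Function.onFun Disjoint fun j ↦ Metric.closedBall (c j) (R j)) := by
    intro i j hij
    refine disjoint_left.2 fun x hx hx' ↦ ?_
    exact disjoint_left.1 (hdisj₀ hij) ((hmem i x).1 hx) ((hmem j x).1 hx')
  -- The energies `2 ^ (-j)` have a finite sum, whereas each image contributes at least `1`.
  have hz : ∀ j : ℕ, _ := fun j ↦ h ((1 / 2) ^ j) (by positivity) (R j) (hR j)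
    ((hRδ j).trans (min_le_right _ _))
  choose z hz hzb hzE hzG using hz
  set u : ℕ → Euc m → N := fun j ↦ z j ∘ similarityInv (c j) 1
  have hu : ∀ j, Measurable (u j) := fun j ↦ (hz j).comp (continuous_similarity _ _).measurable
  have hub : ∀ j, ∀ x ∉ Metric.closedBall (c j) (R j), u j x = b := fun j x hx ↦ by
    refine hzb j _ ?_
    rwa [← mem_preimage, preimage_similarityInv_closedBall _ one_pos, one_mul]
  have hball : ∀ j, Metric.ball (c j) (R j) ⊆ Metric.closedBall (c j) (R j) := fun j ↦
    Metric.ball_subset_closedBall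
  have hmeas : ∀ j, MeasurableSet (Metric.closedBall (c j) (R j)) := fun j ↦
    Metric.isClosed_closedBall.measurableSet
  refine ⟨glue (fun _ ↦ b) (fun j ↦ Metric.closedBall (c j) (R j)) u,
    measurable_glue hdisj hmeas measurable_const hu, fun x hx ↦ ?_, ?_, ?_⟩
  · rw [glue_of_notMem fun i hi ↦ hx (hsub i hi)]
  · have hV : ∑' j, volume (Metric.closedBall (c j) (R j)) ≠ ⊤ := by
      rw [← measure_iUnion hdisj hmeas]
      exact ((measure_mono (iUnion_subset hsub)).trans_lt measure_ball_lt_top).ne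
    refine (eucEnergy_glue_le hm ιN s hp (b := fun _ ↦ b) hR
      (fun j ↦ (hRδ j).trans (min_le_right _ _)) hdisj hV measurable_const hu (fun _ _ _ ↦ rfl)
          hub).trans_lt ?_
    refine ENNReal.mul_lt_top (ENNReal.rpow_lt_top_of_nonneg (by linarith) (by norm_num)) ?_
    rw [eucEnergy_const ιN s (by linarith), zero_add]
    have hle : ∀ j, eucEnergy ιN s p (u j) univ ≤ ENNReal.ofReal ((1 / 2) ^ j) := fun j ↦ by
      have := eucEnergy_comp_similarityInv ιN s (by linarith : 0 ≤ p) (z j) isOpen_univ (c j)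
          one_pos
      rw [preimage_univ, Real.one_rpow, ENNReal.ofReal_one, one_mul] at this
      exact this.trans_le (hzE j)
    refine (ENNReal.tsum_le_tsum hle).trans_lt ?_
    rw [← ENNReal.ofReal_tsum_of_nonneg (fun j ↦ by positivity) summable_geometric_two]
    exact ENNReal.ofReal_lt_top
  · refine top_le_iff.1 (le_trans ?_ (tsum_eucEnergy_le ιF r q _
      (B := fun j ↦ Metric.ball (c j) (R j)) (fun _ ↦ measurableSet_ball)
      (fun i j hij ↦ (hdisj hij).mono (hball i) (hball j)) fun j ↦ (hball j).trans (hsub j)))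
    rw [← ENNReal.tsum_const_eq_top_of_ne_zero (α := ℕ) one_ne_zero]
    refine ENNReal.tsum_le_tsum fun j ↦ (hzG j).trans (le_of_eq ?_)
    have h1 := eucEnergy_comp_similarityInv ιF r (by linarith : 0 ≤ q) (f ∘ z j) Metric.isOpen_ball
        (c j)
      one_pos (A := Metric.ball 0 (R j))
    rw [preimage_similarityInv_ball _ one_pos, Real.one_rpow, ENNReal.ofReal_one, one_mul, one_mul]
        at h1
    rw [← h1]
    refine eucEnergy_congr_ae ιF r q measurableSet_ball ?_
    filter_upwards [ae_restrict_mem measurableSet_ball] with x hx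
    simp only [Function.comp_apply]
    rw [glue_of_mem hdisj (hball j hx)]
    rfl

end

/-! ### Charts of Riemannian manifolds -/

/-- Measures are compared through the globally measurable inverse `ψ`. Neither `e` nor `f` need be
measurable, which allows densities of weak derivatives on the manifold about which nothing is known.
-/
theorem setLIntegral_comp_le_of_image {X Y : Type*} [MeasurableSpace X] [MeasurableSpace Y]
    {μ : Measure X} {ν : Measure Y} {e : X → Y} {ψ : Y → X} {V : Set X} {W : Set Y} {C : ℝ≥0∞}
    (hψ : Measurable ψ) (hW : MeasurableSet W) (hψe : ∀ x ∈ V, ψ (e x) = x)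
    (heψ : ∀ y ∈ W, e (ψ y) = y) (he : MapsTo e V W)
    (h : ∀ A ⊆ V, μ A ≤ C * ν (e '' A)) (f : Y → ℝ≥0∞) :
    ∫⁻ x in V, f (e x) ∂μ ≤ C * ∫⁻ y in W, f y ∂ν := by
  have hle : μ.restrict V ≤ C • (ν.restrict W).map ψ := by
    refine Measure.le_iff.2 fun A hA ↦ ?_
    rw [Measure.restrict_apply hA, Measure.smul_apply, Measure.map_apply hψ hA,
      Measure.restrict_apply (hψ hA), smul_eq_mul]
    refine (h _ inter_subset_right).trans (mul_le_mul' le_rfl (measure_mono ?_))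
    rintro _ ⟨x, ⟨hxA, hxV⟩, rfl⟩
    exact ⟨by rwa [mem_preimage, hψe x hxV], he hxV⟩
  refine (lintegral_mono' hle le_rfl).trans ?_
  rw [lintegral_smul_measure, smul_eq_mul]
  refine mul_le_mul' le_rfl ((lintegral_map_le _ ψ).trans_eq ?_)
  exact setLIntegral_congr_fun hW fun y hy ↦ congrArg f (heψ y hy)

section
variable {m : ℕ} {M : Type*} [EMetricSpace M] [ChartedSpace (Euc m) M]

/-- The points whose image in the chart at `x₀` lies in the ball of radius `ρ` about that of `x₀`. -/
def chartBall (m : ℕ) {M : Type*} [EMetricSpace M] [ChartedSpace (Euc m) M] (x₀ : M) (ρ : ℝ) : Set M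
    :=
  (chartAt (Euc m) x₀).source ∩ chartAt (Euc m) x₀ ⁻¹' Metric.ball (chartAt (Euc m) x₀ x₀) ρ

theorem isOpen_chartBall (x₀ : M) (ρ : ℝ) : IsOpen (chartBall m x₀ ρ) :=
  (chartAt (Euc m) x₀).isOpen_inter_preimage Metric.isOpen_ball

theorem mem_chartBall_self (x₀ : M) {ρ : ℝ} (h : 0 < ρ) : x₀ ∈ chartBall m x₀ ρ :=
  ⟨mem_chart_source _ _, Metric.mem_ball_self h⟩

variable [RiemannianBundle (fun x : M ↦ TangentSpace (𝓡 m) x)]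

/-- On the ball of radius `ρ`, the chart at `x₀` and its inverse have derivatives bounded by `C` and
are
`C`-Lipschitz. -/
structure IsLipschitzChartBall (x₀ : M) (C : ℝ≥0) (ρ : ℝ) : Prop where
  one_le : 1 ≤ C
  pos : 0 < ρ
  subset_target : Metric.ball (chartAt (Euc m) x₀ x₀) ρ ⊆ (chartAt (Euc m) x₀).target
  lipschitzOnWith : LipschitzOnWith C (chartAt (Euc m) x₀) (chartBall m x₀ ρ)
  lipschitzOnWith_symm : LipschitzOnWith C (chartAt (Euc m) x₀).symm
    (Metric.ball (chartAt (Euc m) x₀ x₀) ρ)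
  mfderiv_le : ∀ x ∈ chartBall m x₀ ρ, ∀ v : TangentSpace (𝓡 m) x,
    ‖mfderiv (𝓡 m) (𝓡 m) (chartAt (Euc m) x₀) x v‖ₑ ≤ C * ‖v‖ₑ
  mfderiv_symm_le : ∀ y ∈ Metric.ball (chartAt (Euc m) x₀ x₀) ρ, ∀ v : TangentSpace (𝓡 m) y,
    ‖mfderiv (𝓡 m) (𝓡 m) (chartAt (Euc m) x₀).symm y v‖ₑ ≤ C * ‖v‖ₑ

theorem IsLipschitzChartBall.symm_mem {x₀ : M} {C : ℝ≥0} {ρ : ℝ}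
    (h : IsLipschitzChartBall (m := m) x₀ C ρ) {y : Euc m} (hy : y ∈ Metric.ball (chartAt (Euc m) x₀
        x₀) ρ) :
    (chartAt (Euc m) x₀).symm y ∈ chartBall m x₀ ρ := by
  refine ⟨(chartAt (Euc m) x₀).map_target (h.subset_target hy), ?_⟩
  rwa [mem_preimage, (chartAt (Euc m) x₀).right_inv (h.subset_target hy)]

variable [MeasurableSpace M] [BorelSpace M]

theorem riemannianVolume_image_le {X Y : Type*} [EMetricSpace X] [MeasurableSpace X] [BorelSpace X]
    [EMetricSpace Y] [MeasurableSpace Y] [BorelSpace Y] (m : ℕ) {K : ℝ≥0} {f : X → Y} {s : Set X}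
    (hf : LipschitzOnWith K f s) :
    riemannianVolume m Y (f '' s) ≤ (K : ℝ≥0∞) ^ m * riemannianVolume m X s := by
  simp only [riemannianVolume, Measure.smul_apply, smul_eq_mul]
  rw [mul_left_comm]
  refine mul_le_mul' le_rfl ((hf.hausdorffMeasure_image_le m.cast_nonneg).trans_eq ?_)
  rw [ENNReal.rpow_natCast]

theorem IsLipschitzChartBall.setLIntegral_comp_chart_le {x₀ : M} {C : ℝ≥0} {ρ : ℝ}
    (h : IsLipschitzChartBall (m := m) x₀ C ρ) (f : Euc m → ℝ≥0∞) :
    ∫⁻ x in chartBall m x₀ ρ, f (chartAt (Euc m) x₀ x) ∂(riemannianVolume m M) ≤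
      (C : ℝ≥0∞) ^ m * ∫⁻ y in Metric.ball (chartAt (Euc m) x₀ x₀) ρ, f y := by
  classical
  set φ : OpenPartialHomeomorph M (Euc m) := chartAt (Euc m) x₀
  have hB : MeasurableSet (Metric.ball (φ x₀) ρ) := measurableSet_ball
  refine setLIntegral_comp_le_of_image (ψ := (Metric.ball (φ x₀) ρ).piecewise φ.symm fun _ ↦ x₀)
    ?_ hB (fun x hx ↦ ?_) (fun y hy ↦ ?_) (fun x hx ↦ hx.2)
    (fun A hA ↦ ?_) f
  · exact (φ.continuousOn_symm.mono h.subset_target).measurable_piecewise continuousOn_const hB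
  · exact (piecewise_eq_of_mem (Metric.ball (φ x₀) ρ) _ _ hx.2).trans (φ.left_inv hx.1)
  · rw [piecewise_eq_of_mem _ _ _ hy, φ.right_inv (h.subset_target hy)]
  · rw [← riemannianVolume_euc]
    have e : φ.symm '' (φ '' A) = A := φ.symm_image_image_of_subset_source (hA.trans
        inter_subset_left)
    conv_lhs => rw [← e]
    exact riemannianVolume_image_le m (h.lipschitzOnWith_symm.mono (image_subset_iff.2 fun x hx ↦
        (hA hx).2))

theorem IsLipschitzChartBall.setLIntegral_comp_symm_le {x₀ : M} {C : ℝ≥0} {ρ : ℝ}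
    (h : IsLipschitzChartBall (m := m) x₀ C ρ) (f : M → ℝ≥0∞) :
    ∫⁻ y in Metric.ball (chartAt (Euc m) x₀ x₀) ρ, f ((chartAt (Euc m) x₀).symm y) ≤
      (C : ℝ≥0∞) ^ m * ∫⁻ x in chartBall m x₀ ρ, f x ∂(riemannianVolume m M) := by
  classical
  set φ : OpenPartialHomeomorph M (Euc m) := chartAt (Euc m) x₀
  have hU : MeasurableSet (chartBall m x₀ ρ) := (isOpen_chartBall x₀ ρ).measurableSet
  refine setLIntegral_comp_le_of_image (ψ := (chartBall m x₀ ρ).piecewise φ fun _ ↦ φ x₀)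
    ?_ hU (fun y hy ↦ ?_) (fun x hx ↦ ?_) (fun y hy ↦ h.symm_mem hy)
    (fun A hA ↦ ?_) f
  · refine ContinuousOn.measurable_piecewise (s := chartBall m x₀ ρ) ?_ continuousOn_const hU
    exact φ.continuousOn.mono fun x hx ↦ hx.1
  · exact (if_pos (h.symm_mem hy)).trans (φ.right_inv (h.subset_target hy))
  · exact (congrArg φ.symm (if_pos hx)).trans (φ.left_inv hx.1)
  · rw [← riemannianVolume_euc]
    have e : φ '' (φ.symm '' A) = A := φ.image_symm_image_of_subset_target (hA.trans
        h.subset_target)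
    conv_lhs => rw [← e]
    exact riemannianVolume_image_le m (h.lipschitzOnWith.mono (image_subset_iff.2 fun x hx ↦
        h.symm_mem (hA hx)))

theorem IsLipschitzChartBall.riemannianVolume_lt_top {x₀ : M} {C : ℝ≥0} {ρ : ℝ}
    (h : IsLipschitzChartBall (m := m) x₀ C ρ) : riemannianVolume m M (chartBall m x₀ ρ) < ⊤ := by
  have := h.setLIntegral_comp_chart_le 1
  simp only [Pi.one_apply, setLIntegral_one] at this
  exact this.trans_lt (ENNReal.mul_lt_top (ENNReal.pow_lt_top ENNReal.coe_lt_top)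
      measure_ball_lt_top)

end

theorem exists_isLipschitzChartBall {m : ℕ} {M : Type*} [EMetricSpace M] [ChartedSpace (Euc m) M]
    [IsManifold (𝓡 m) ∞ M] [RiemannianBundle (fun x : M ↦ TangentSpace (𝓡 m) x)]
    [IsContMDiffRiemannianBundle (𝓡 m) ∞ (Euc m) (fun x : M ↦ TangentSpace (𝓡 m) x)]
    [IsRiemannianManifold (𝓡 m) M] (x₀ : M) :
    ∃ (C : ℝ≥0) (ρ : ℝ), IsLipschitzChartBall (m := m) x₀ C ρ := by
  obtain ⟨C₁, δ₁, hδ₁, h₁⟩ := exists_edist_chartAt_le (m := m) x₀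
  obtain ⟨C₂, δ₂, hδ₂, hT, h₂⟩ := exists_edist_chartAt_symm_le (m := m) x₀
  obtain ⟨C₃, h₃⟩ := eventually_enorm_mfderiv_chartAt_le (m := m) x₀
  obtain ⟨C₄, h₄⟩ := eventually_enorm_mfderiv_chartAt_symm_le (m := m) x₀
  set φ : OpenPartialHomeomorph M (Euc m) := chartAt (Euc m) x₀
  have hx₀ : x₀ ∈ φ.source := mem_chart_source _ x₀
  have hc : Filter.Tendsto φ.symm (𝓝 (φ x₀)) (𝓝 x₀) := by
    simpa [φ.left_inv hx₀] using (φ.continuousAt_symm (φ.map_source hx₀)).tendsto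
  have h₅ := hc.eventually (h₃.and (Metric.eball_mem_nhds x₀ (ENNReal.ofReal_pos.2 hδ₁)))
  obtain ⟨δ, hδ, hsub⟩ := Metric.mem_nhds_iff.1 (h₄.and h₅)
  have hU : ∀ x ∈ chartBall m x₀ (min δ δ₂), (∀ v : TangentSpace (𝓡 m) x,
      ‖mfderiv (𝓡 m) (𝓡 m) φ x v‖ₑ ≤ C₃ * ‖v‖ₑ) ∧ x ∈ Metric.eball x₀ (ENNReal.ofReal δ₁) := by
    intro x hx
    have := (hsub (Metric.ball_subset_ball (min_le_left _ _) hx.2)).2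
    rwa [φ.left_inv hx.1] at this
  set C := max 1 (max (max C₁ C₂) (max C₃ C₄))
  have hle : ∀ {K : ℝ≥0} (_ : K ≤ C) (a : ℝ≥0∞), (K : ℝ≥0∞) * a ≤ C * a := fun h a ↦
    mul_le_mul' (ENNReal.coe_le_coe.2 h) le_rfl
  refine ⟨C, min δ δ₂, le_max_left _ _, lt_min hδ hδ₂, (Metric.ball_subset_ball (min_le_right _
      _)).trans hT,
    fun x hx y hy ↦ ?_, fun x hx y hy ↦ ?_, fun x hx v ↦ ?_, fun y hy v ↦ ?_⟩
  · exact (h₁ x (hU x hx).2 y (hU y hy).2).trans (hle (le_max_of_le_right <| le_max_of_le_left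
        (le_max_left _ _)) _)
  · exact (h₂ x (Metric.ball_subset_ball (min_le_right _ _) hx) y
      (Metric.ball_subset_ball (min_le_right _ _) hy)).trans (hle (le_max_of_le_right <|
          le_max_of_le_left (le_max_right _ _)) _)
  · exact ((hU x hx).1 v).trans (hle (le_max_of_le_right <| le_max_of_le_right (le_max_left _ _)) _)
  · exact ((hsub (Metric.ball_subset_ball (min_le_left _ _) hy)).1 v).trans
      (hle (le_max_of_le_right <| le_max_of_le_right (le_max_right _ _)) _)

theorem isFiniteMeasure_riemannianVolume (m : ℕ) {M : Type*} [EMetricSpace M] [ChartedSpace (Euc m)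
    M]
    [IsManifold (𝓡 m) ∞ M] [RiemannianBundle (fun x : M ↦ TangentSpace (𝓡 m) x)]
    [IsContMDiffRiemannianBundle (𝓡 m) ∞ (Euc m) (fun x : M ↦ TangentSpace (𝓡 m) x)]
    [IsRiemannianManifold (𝓡 m) M] [MeasurableSpace M] [BorelSpace M] [CompactSpace M] :
    IsFiniteMeasure (riemannianVolume m M) := by
  have : IsLocallyFiniteMeasure (riemannianVolume m M) := by
    refine ⟨fun x ↦ ?_⟩
    obtain ⟨C, ρ, h⟩ := exists_isLipschitzChartBall (m := m) x
    exact ⟨_, (isOpen_chartBall x ρ).mem_nhds (mem_chartBall_self x h.pos),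
        h.riemannianVolume_lt_top⟩
  exact ⟨isCompact_univ.measure_lt_top⟩

/-! ### Transplantation of maps: fractional energies -/

theorem ENNReal.div_rpow_le_of_le_mul {a d e : ℝ≥0∞} {K : ℝ≥0} (hK : K ≠ 0) (h : e ≤ K * d) {α : ℝ}
    (hα : 0 ≤ α) : a / d ^ α ≤ (K : ℝ≥0∞) ^ α * (a / e ^ α) := by
  have hK0 : (K : ℝ≥0∞) ^ α ≠ 0 := by
    rw [← ENNReal.coe_rpow_of_nonneg _ hα]
    exact ENNReal.coe_ne_zero.2 (NNReal.rpow_pos (pos_iff_ne_zero.2 hK)).ne'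
  have hKt : (K : ℝ≥0∞) ^ α ≠ ⊤ := ENNReal.rpow_ne_top_of_nonneg hα ENNReal.coe_ne_top
  calc a / d ^ α = (K : ℝ≥0∞) ^ α * (a / ((K : ℝ≥0∞) ^ α * d ^ α)) := by
        rw [div_eq_mul_inv, div_eq_mul_inv, ENNReal.mul_inv (.inl hK0) (.inl hKt), mul_left_comm,
          ← mul_assoc ((K : ℝ≥0∞) ^ α), ENNReal.mul_inv_cancel hK0 hKt, one_mul]
    _ ≤ _ := by
        refine mul_le_mul' le_rfl (ENNReal.div_le_div_left ?_ _)
        rw [← ENNReal.mul_rpow_of_nonneg _ _ hα]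
        exact ENNReal.rpow_le_rpow h hα

section
variable {m : ℕ} {M : Type*} [EMetricSpace M] [ChartedSpace (Euc m) M] {N : Type*}

open Classical in
/-- The map equal to `u` in the chart at `x₀` near `x₀` and to `b` elsewhere. -/
noncomputable def transplant (x₀ : M) (ρ : ℝ) (b : N) (u : Euc m → N) (x : M) : N :=
  if x ∈ chartBall m x₀ ρ then u (chartAt (Euc m) x₀ x) else b

theorem transplant_of_mem {x₀ : M} {ρ : ℝ} {b : N} {u : Euc m → N} {x : M}
    (hx : x ∈ chartBall m x₀ ρ) : transplant x₀ ρ b u x = u (chartAt (Euc m) x₀ x) := if_pos hx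

theorem transplant_of_notMem {x₀ : M} {ρ : ℝ} {b : N} {u : Euc m → N} {x : M}
    (hx : x ∉ chartBall m x₀ ρ) : transplant x₀ ρ b u x = b := if_neg hx

theorem comp_transplant {N' : Type*} (f : N → N') (x₀ : M) (ρ : ℝ) (b : N) (u : Euc m → N) :
    f ∘ transplant x₀ ρ b u = transplant x₀ ρ (f b) (f ∘ u) := by
  ext x
  simp only [transplant, Function.comp_apply, apply_ite f]

theorem measurable_transplant [MeasurableSpace M] [BorelSpace M] [MeasurableSpace N] (x₀ : M) (ρ :
    ℝ)
    (b : N) {u : Euc m → N} (hu : Measurable u) : Measurable (transplant x₀ ρ b u) := by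
  classical
  have hU : MeasurableSet (chartBall m x₀ ρ) := (isOpen_chartBall x₀ ρ).measurableSet
  have hg : Measurable ((chartBall m x₀ ρ).piecewise (chartAt (Euc m) x₀) fun _ ↦ chartAt (Euc m) x₀
      x₀) := by
    refine ContinuousOn.measurable_piecewise (s := chartBall m x₀ ρ) ?_ continuousOn_const hU
    exact (chartAt (Euc m) x₀).continuousOn.mono fun x hx ↦ hx.1
  have e : transplant x₀ ρ b u = (chartBall m x₀ ρ).piecewise
      (u ∘ (chartBall m x₀ ρ).piecewise (chartAt (Euc m) x₀) fun _ ↦ chartAt (Euc m) x₀ x₀) (fun _ ↦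
          b) := by
    ext x
    by_cases hx : x ∈ chartBall m x₀ ρ
    · rw [transplant_of_mem hx]
      exact ((if_pos hx).trans (congrArg u (if_pos hx))).symm
    · rw [transplant_of_notMem hx]
      exact (if_neg hx).symm
  rw [e]
  exact Measurable.piecewise hU (hu.comp hg) measurable_const

theorem transplant_eq_of_notMem_image {x₀ : M} {ρ ρ' : ℝ} {b : N} {u : Euc m → N}
    (hu : ∀ y ∉ Metric.closedBall (chartAt (Euc m) x₀ x₀) ρ', u y = b) {x : M}
    (hx : x ∉ (chartAt (Euc m) x₀).symm '' Metric.closedBall (chartAt (Euc m) x₀ x₀) ρ') :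
    transplant x₀ ρ b u x = b := by
  by_cases h : x ∈ chartBall m x₀ ρ
  · rw [transplant_of_mem h]
    refine hu _ fun hy ↦ hx ⟨_, hy, (chartAt (Euc m) x₀).left_inv h.1⟩
  · exact transplant_of_notMem h

variable [RiemannianBundle (fun x : M ↦ TangentSpace (𝓡 m) x)]

theorem IsLipschitzChartBall.isCompact_image {x₀ : M} {C : ℝ≥0} {ρ ρ' : ℝ}
    (h : IsLipschitzChartBall (m := m) x₀ C ρ) (hρ : ρ' < ρ) :
    IsCompact ((chartAt (Euc m) x₀).symm '' Metric.closedBall (chartAt (Euc m) x₀ x₀) ρ') :=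
  (isCompact_closedBall _ _).image_of_continuousOn ((chartAt (Euc m) x₀).continuousOn_symm.mono
    ((Metric.closedBall_subset_ball hρ).trans h.subset_target))

theorem IsLipschitzChartBall.image_subset {x₀ : M} {C : ℝ≥0} {ρ ρ' : ℝ}
    (h : IsLipschitzChartBall (m := m) x₀ C ρ) (hρ : ρ' < ρ) :
    (chartAt (Euc m) x₀).symm '' Metric.closedBall (chartAt (Euc m) x₀ x₀) ρ' ⊆ chartBall m x₀ ρ :=
  image_subset_iff.2 fun _ hy ↦ h.symm_mem (Metric.closedBall_subset_ball hρ hy)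

theorem IsLipschitzChartBall.transplant_symm {x₀ : M} {C : ℝ≥0} {ρ : ℝ}
    (h : IsLipschitzChartBall (m := m) x₀ C ρ) {b : N} {u : Euc m → N} {y : Euc m}
    (hy : y ∈ Metric.ball (chartAt (Euc m) x₀ x₀) ρ) :
    transplant x₀ ρ b u ((chartAt (Euc m) x₀).symm y) = u y := by
  rw [transplant_of_mem (h.symm_mem hy), (chartAt (Euc m) x₀).right_inv (h.subset_target hy)]

variable [MeasurableSpace M] [BorelSpace M] [EMetricSpace N]

/-- A transplanted map has finite fractional energy. -/
theorem IsLipschitzChartBall.gagliardoEnergy_transplant_lt_top [IsFiniteMeasure (riemannianVolume m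
    M)]
    [MeasurableSpace N] [BorelSpace N] [SecondCountableTopology N] (hm : 1 ≤ m) {x₀ : M} {C : ℝ≥0}
        {ρ ρ' : ℝ}
    (h : IsLipschitzChartBall (m := m) x₀ C ρ) (hρ : ρ' < ρ) {s p : ℝ} (hs : 0 < s) (hp : 1 ≤ p) {b
        : N}
    {u : Euc m → N} (hum : Measurable u) (hu : ∀ y ∉ Metric.closedBall (chartAt (Euc m) x₀ x₀) ρ', u
        y = b)
    (hE : gagEnergy (s * p) p u univ < ⊤) :
    gagliardoEnergy m s p (transplant x₀ ρ b u) (univ : Set M) < ⊤ := by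
  set φ := chartAt (Euc m) x₀
  set μ := riemannianVolume m M
  set U : Set M := chartBall m x₀ ρ
  set B := Metric.ball (φ x₀) ρ
  set uM : M → N := transplant x₀ ρ b u
  have hp0 : 0 < p := by linarith
  have hσ : 0 < s * p := by positivity
  set α : ℝ := m + s * p
  have hα : 0 ≤ α := by positivity
  have hU : MeasurableSet U := (isOpen_chartBall x₀ ρ).measurableSet
  have hC0 : C ≠ 0 := (zero_lt_one.trans_le h.one_le).ne'
  have huM : Measurable uM := measurable_transplant x₀ ρ b hum
  -- The map differs from `b` only on a compact subset of `U`, which is at positive distance from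
  -- the complement of `U`.
  obtain ⟨d, hd, hdist⟩ := Metric.exists_pos_forall_lt_edist (h.isCompact_image hρ)
    (isOpen_chartBall x₀ ρ).isClosed_compl (disjoint_compl_right_iff_subset.2 (h.image_subset hρ))
  set w : M → ℝ≥0∞ := fun x ↦ edist (uM x) b ^ p
  have hw : Measurable w := (huM.edist measurable_const).pow_const _
  set a : ℝ≥0∞ := ((d : ℝ≥0∞) ^ α)⁻¹
  have ha : a ≠ ⊤ := by
    rw [ENNReal.inv_ne_top, ← ENNReal.coe_rpow_of_nonneg _ hα]
    exact ENNReal.coe_ne_zero.2 (NNReal.rpow_pos hd).ne'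
  set T : M → M → ℝ≥0∞ := fun x y ↦ U.indicator (fun x ↦ U.indicator
    (fun y ↦ (C : ℝ≥0∞) ^ α * gagKernel (s * p) p u (φ x) (φ y)) y) x
  -- Two points of `U` are compared in the chart. If only `x` lies in `U`, either the values agree
  -- or the distance exceeds `d`, so the interaction is at most `a * w x`. Two points off `U` do not
  -- interact.
  have hk : ∀ x y, edist (uM x) (uM y) ^ p / edist x y ^ α ≤ T x y + (a * w x + a * w y) := by
    have h0 : (0 : ℝ≥0∞) ^ p = 0 := ENNReal.zero_rpow_of_pos hp0
    have hfar : ∀ x y, x ∈ U → y ∉ U → edist (uM x) (uM y) ^ p / edist x y ^ α ≤ a * w x := by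
      intro x y hx hy
      have e : uM y = b := transplant_of_notMem hy
      rw [e]
      by_cases hxK : x ∈ φ.symm '' Metric.closedBall (φ x₀) ρ'
      · rw [div_eq_mul_inv, mul_comm]
        exact mul_le_mul' (ENNReal.inv_le_inv.2 (ENNReal.rpow_le_rpow (hdist x hxK y hy).le hα))
            le_rfl
      · have e' : uM x = b := transplant_eq_of_notMem_image hu hxK
        rw [e', edist_self, h0, ENNReal.zero_div]
        exact zero_le
    intro x y
    by_cases hx : x ∈ U
    · by_cases hy : y ∈ U
      · refine le_trans ?_ le_self_add
        simp only [T]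
        rw [indicator_of_mem hx, indicator_of_mem hy]
        have e1 : uM x = u (φ x) := transplant_of_mem hx
        have e2 : uM y = u (φ y) := transplant_of_mem hy
        rw [e1, e2]
        exact ENNReal.div_rpow_le_of_le_mul hC0 (h.lipschitzOnWith hx hy) hα
      · exact (hfar x y hx hy).trans (le_self_add.trans le_add_self)
    · by_cases hy : y ∈ U
      · rw [edist_comm (uM x), edist_comm x]
        exact (hfar y x hy hx).trans (le_add_self.trans le_add_self)
      · have e1 : uM x = b := transplant_of_notMem hx
        have e2 : uM y = b := transplant_of_notMem hy
        rw [e1, e2, edist_self, h0, ENNReal.zero_div]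
        exact zero_le
  -- The fractional Poincaré inequality in the chart; together with the finiteness of the total
  -- measure it disposes of the interactions across the boundary of `U`.
  have hwint : ∫⁻ x, w x ∂μ < ⊤ := by
    obtain ⟨K, hK, hle⟩ := exists_lintegral_edist_const_le (N := N) m hm (s * p) p hσ h.pos
    have e : ∀ x, w x ≤ U.indicator (fun x ↦ edist (u (φ x)) b ^ p) x := by
      intro x
      by_cases hx : x ∈ U
      · rw [indicator_of_mem hx]
        have e1 : uM x = u (φ x) := transplant_of_mem hx
        exact (congrArg (fun z ↦ edist z b ^ p) e1).le
      · have e1 : uM x = b := transplant_of_notMem hx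
        simp only [w]
        rw [e1, edist_self, ENNReal.zero_rpow_of_pos hp0]
        exact zero_le
    refine (lintegral_mono e).trans_lt ?_
    rw [lintegral_indicator hU]
    refine (h.setLIntegral_comp_chart_le (fun y ↦ edist (u y) b ^ p)).trans_lt
      (ENNReal.mul_lt_top (ENNReal.pow_lt_top ENNReal.coe_lt_top) ?_)
    refine (lintegral_mono_set Metric.ball_subset_closedBall).trans_lt ((hle u (φ x₀) b
      fun y hy ↦ hu y fun hy' ↦ hy (Metric.closedBall_subset_closedBall hρ.le hy')).trans_lt ?_)
    exact ENNReal.mul_lt_top hK ((gagEnergy_mono _ p u (subset_univ _)).trans_lt hE)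
  have hT : ∫⁻ x, ∫⁻ y, T x y ∂μ ∂μ < ⊤ := by
    have hCt : (C : ℝ≥0∞) ^ α < ⊤ := ENNReal.rpow_lt_top_of_nonneg hα ENNReal.coe_ne_top
    have hCm : (C : ℝ≥0∞) ^ m < ⊤ := ENNReal.pow_lt_top ENNReal.coe_lt_top
    have e : ∀ x, ∫⁻ y, T x y ∂μ ≤ U.indicator (fun x ↦ (C : ℝ≥0∞) ^ α * ((C : ℝ≥0∞) ^ m *
        ∫⁻ z in B, gagKernel (s * p) p u (φ x) z)) x := by
      intro x
      by_cases hx : x ∈ U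
      · simp only [T]
        simp_rw [indicator_of_mem hx]
        rw [lintegral_indicator hU, lintegral_const_mul' _ _ hCt.ne]
        exact mul_le_mul' le_rfl (h.setLIntegral_comp_chart_le (gagKernel (s * p) p u (φ x)))
      · simp only [T]
        simp_rw [indicator_of_notMem hx]
        rw [lintegral_zero]
    refine (lintegral_mono e).trans_lt ?_
    rw [lintegral_indicator hU]
    refine (h.setLIntegral_comp_chart_le (fun z' ↦ (C : ℝ≥0∞) ^ α * ((C : ℝ≥0∞) ^ m *
        ∫⁻ z in B, gagKernel (s * p) p u z' z))).trans_lt (ENNReal.mul_lt_top hCm ?_)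
    rw [lintegral_const_mul' _ _ hCt.ne, lintegral_const_mul' _ _ hCm.ne]
    exact ENNReal.mul_lt_top hCt (ENNReal.mul_lt_top hCm
      ((gagEnergy_mono _ p u (subset_univ B)).trans_lt hE))
  have hfin : a * ∫⁻ x, w x ∂μ < ⊤ := ENNReal.mul_lt_top ha.lt_top hwint
  rw [gagliardoEnergy, Measure.restrict_univ]
  calc ∫⁻ x, ∫⁻ y, edist (uM x) (uM y) ^ p / edist x y ^ α ∂μ ∂μ
      ≤ ∫⁻ x, ((∫⁻ y, T x y ∂μ) + (a * w x * μ univ + a * ∫⁻ y, w y ∂μ)) ∂μ := by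
        refine lintegral_mono fun x ↦ (lintegral_mono (hk x)).trans (le_of_eq ?_)
        have hm1 : Measurable fun y ↦ a * w x + a * w y := measurable_const.add (hw.const_mul a)
        rw [lintegral_add_right _ hm1,
          lintegral_add_left measurable_const, lintegral_const, lintegral_const_mul a hw]
    _ = (∫⁻ x, ∫⁻ y, T x y ∂μ ∂μ) + ((a * ∫⁻ x, w x ∂μ) * μ univ + (a * ∫⁻ y, w y ∂μ) * μ univ) :=
        by
        have hm2 : Measurable fun x ↦ a * w x * μ univ + a * ∫⁻ y, w y ∂μ :=
          ((hw.const_mul a).mul_const _).add measurable_const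
        rw [lintegral_add_right _ hm2,
          lintegral_add_right _ measurable_const, lintegral_const, lintegral_mul_const _
              (hw.const_mul a),
          lintegral_const_mul a hw]
    _ < ⊤ := ENNReal.add_lt_top.2 ⟨hT, ENNReal.add_lt_top.2
        ⟨ENNReal.mul_lt_top hfin (measure_lt_top μ _), ENNReal.mul_lt_top hfin (measure_lt_top μ
            _)⟩⟩

/-- The fractional energy in a chart is controlled by the fractional energy on the manifold. -/
theorem IsLipschitzChartBall.gagEnergy_le_transplant {x₀ : M} {C : ℝ≥0} {ρ : ℝ}
    (h : IsLipschitzChartBall (m := m) x₀ C ρ) {s p : ℝ} (hsp : 0 ≤ s * p) (b : N) (u : Euc m → N) :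
    gagEnergy (s * p) p u (Metric.ball (chartAt (Euc m) x₀ x₀) ρ) ≤
      (C : ℝ≥0∞) ^ ((m : ℝ) + s * p) * ((C : ℝ≥0∞) ^ m * ((C : ℝ≥0∞) ^ m *
        gagliardoEnergy m s p (transplant x₀ ρ b u) (univ : Set M))) := by
  set φ := chartAt (Euc m) x₀
  set μ := riemannianVolume m M
  set U : Set M := chartBall m x₀ ρ
  set B := Metric.ball (φ x₀) ρ
  set uM : M → N := transplant x₀ ρ b u
  have hα : 0 ≤ (m : ℝ) + s * p := by positivity
  have hCt : (C : ℝ≥0∞) ^ ((m : ℝ) + s * p) ≠ ⊤ := ENNReal.rpow_ne_top_of_nonneg hα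
      ENNReal.coe_ne_top
  have hCm : (C : ℝ≥0∞) ^ m ≠ ⊤ := (ENNReal.pow_lt_top ENNReal.coe_lt_top).ne
  have hC0 : C ≠ 0 := (zero_lt_one.trans_le h.one_le).ne'
  set k : M → M → ℝ≥0∞ := fun x y ↦ edist (uM x) (uM y) ^ p / edist x y ^ ((m : ℝ) + s * p)
  have hk : ∀ y ∈ B, ∀ z ∈ B, gagKernel (s * p) p u y z ≤
      (C : ℝ≥0∞) ^ ((m : ℝ) + s * p) * k (φ.symm y) (φ.symm z) := by
    intro y hy z hz
    have e1 : uM (φ.symm y) = u y := h.transplant_symm hy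
    have e2 : uM (φ.symm z) = u z := h.transplant_symm hz
    simp only [k, gagKernel]
    rw [e1, e2]
    exact ENNReal.div_rpow_le_of_le_mul hC0 (h.lipschitzOnWith_symm hy hz) hα
  calc gagEnergy (s * p) p u B
      ≤ ∫⁻ y in B, (C : ℝ≥0∞) ^ ((m : ℝ) + s * p) * ((C : ℝ≥0∞) ^ m * ∫⁻ x in U, k (φ.symm y) x ∂μ)
          := by
        refine setLIntegral_mono' measurableSet_ball fun y hy ↦ ?_
        refine (setLIntegral_mono' measurableSet_ball (hk y hy)).trans ?_
        rw [lintegral_const_mul' _ _ hCt]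
        exact mul_le_mul' le_rfl (h.setLIntegral_comp_symm_le (k (φ.symm y)))
    _ ≤ (C : ℝ≥0∞) ^ ((m : ℝ) + s * p) * ((C : ℝ≥0∞) ^ m * ((C : ℝ≥0∞) ^ m *
          ∫⁻ x' in U, ∫⁻ x in U, k x' x ∂μ ∂μ)) := by
        rw [lintegral_const_mul' _ _ hCt, lintegral_const_mul' _ _ hCm]
        exact mul_le_mul' le_rfl (mul_le_mul' le_rfl
          (h.setLIntegral_comp_symm_le fun x' ↦ ∫⁻ x in U, k x' x ∂μ))
    _ ≤ _ := by
        refine mul_le_mul' le_rfl (mul_le_mul' le_rfl (mul_le_mul' le_rfl ?_))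
        exact lintegral_mono' (Measure.restrict_mono (subset_univ U) le_rfl) fun x' ↦
          lintegral_mono_set (subset_univ U)

end

/-! ### Transplantation of maps: first-order energies -/

section
variable {m ν : ℕ}

/-- The chain rule for weak derivatives, locally under a `C¹` diffeomorphism. -/
theorem HasWeakDerivOn.exists_comp_diffeo {h : Euc m → Euc ν} {H : Euc m → Euc m →L[ℝ] Euc ν}
    (hh : HasWeakDerivOn h H univ) (hhm : StronglyMeasurable h) (hHm : StronglyMeasurable H)
    {R S : Euc m → Euc m} {V K : Set (Euc m)} {y₀ : Euc m} (hV : V ∈ 𝓝 y₀) (hR : ContDiffAt ℝ 1 R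
        y₀)
    (hS : ContDiffAt ℝ 1 S (R y₀)) (hSR : ∀ y ∈ V, S (R y) = y) (hK : IsCompact K) (hRK : MapsTo R V
        K) :
    ∃ O, IsOpen O ∧ y₀ ∈ O ∧ O ⊆ V ∧
      HasWeakDerivOn (fun y ↦ h (R y)) (fun y ↦ (H (R y)).comp (fderiv ℝ R y)) O := by
  obtain ⟨W, hW, hWK, hcomp⟩ := hh.exists_comp_lipschitz isOpen_univ hK (subset_univ _) hhm hHm
  obtain ⟨K₁, s, hs, hR1⟩ := hR.exists_lipschitzOnWith
  obtain ⟨K₂, t, ht, hS2⟩ := hS.exists_lipschitzOnWith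
  obtain ⟨ε, hε, hsub⟩ := Metric.mem_nhds_iff.1
    (Filter.inter_mem (Filter.inter_mem hs hV) (hR.continuousAt.preimage_mem_nhds ht))
  set O := Metric.ball y₀ ε
  -- The chain rule is available for globally Lipschitz maps, hence an extension of `R` from the
  -- small ball.
  obtain ⟨T, hT, hRT⟩ := (hR1.mono fun y hy ↦ (hsub hy).1.1 : LipschitzOnWith K₁ R
      O).extend_finite_dimension
  -- Here no exceptional set of maps arises: the Lipschitz inverse `S` bounds the integral of `W ∘
  -- R` by that of `W` over `K`.
  have hw := hcomp T _ O hT Metric.isOpen_ball fun Q hQ _ ↦ by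
    refine (setLIntegral_comp_le_of_lipschitz_leftInvOn (S := S) (s := Q) (t := t ∩ K)
      hT.continuous.measurable (fun y hy ↦ ?_) (hS2.mono inter_subset_left) (fun y hy ↦ ?_)
          hW).trans_lt ?_
    · rw [← hRT (hQ hy)]
      exact ⟨(hsub (hQ hy)).2, hRK (hsub (hQ hy)).1.2⟩
    · rw [← hRT (hQ hy)]
      exact hSR y (hsub (hQ hy)).1.2
    · exact ENNReal.mul_lt_top (ENNReal.pow_lt_top ENNReal.coe_lt_top)
        ((lintegral_mono_set inter_subset_right).trans_lt hWK)
  refine ⟨O, Metric.isOpen_ball, Metric.mem_ball_self hε, fun y hy ↦ (hsub hy).1.2,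
    hw.congr_ae measurableSet_ball ?_ ?_⟩
  · filter_upwards [ae_restrict_mem measurableSet_ball] with y hy
    rw [hRT hy]
  · filter_upwards [ae_restrict_mem measurableSet_ball] with y hy
    have e : R =ᶠ[𝓝 y] T := by
      filter_upwards [Metric.isOpen_ball.mem_nhds hy] with z hz using hRT hz
    rw [e.fderiv_eq, hRT hy]

/-- The weak derivative of a map which is constant outside a ball may be taken strongly measurable,
and
zero outside this ball. -/
theorem exists_hasWeakDerivOn_eq_zero {p : ℝ} {h : Euc m → Euc ν} (hE : gradEnergy p h univ < ⊤)
    {c : Euc m} {r : ℝ} {β : Euc ν} (hβ : ∀ y ∉ Metric.closedBall c r, h y = β) :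
    ∃ H, HasWeakDerivOn h H univ ∧ StronglyMeasurable H ∧ (∀ y ∉ Metric.closedBall c r, H y = 0) ∧
      ∫⁻ y, ‖H y‖ₑ ^ p < ⊤ := by
  obtain ⟨H₀, hH₀⟩ := exists_hasWeakDerivOn_of_gradEnergy_lt_top hE
  have hm₀ : AEStronglyMeasurable H₀ volume := by
    have := hH₀.2.1.aestronglyMeasurable
    rwa [Measure.restrict_univ] at this
  have hQ : IsClosed (Metric.closedBall c r) := Metric.isClosed_closedBall
  set H := (Metric.closedBall c r).indicator (hm₀.mk H₀)
  have hae : H₀ =ᵐ[volume] H := by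
    filter_upwards [hm₀.ae_eq_mk, hH₀.ae_eq_zero_of_const hQ.isOpen_compl hβ] with y h1 h2
    by_cases hy : y ∈ Metric.closedBall c r
    · rw [h1]; exact (indicator_of_mem hy _).symm
    · rw [h2 hy]; exact (indicator_of_notMem hy _).symm
  have hH : HasWeakDerivOn h H univ := hH₀.congr_ae MeasurableSet.univ .rfl (by rwa
      [Measure.restrict_univ])
  refine ⟨H, hH, hm₀.stronglyMeasurable_mk.indicator hQ.measurableSet,
    fun y hy ↦ indicator_of_notMem hy _, ?_⟩
  have := hH.gradEnergy_eq isOpen_univ p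
  rw [Measure.restrict_univ] at this
  rwa [← this]

variable {M : Type*} [EMetricSpace M] [ChartedSpace (Euc m) M]
  [RiemannianBundle (fun x : M ↦ TangentSpace (𝓡 m) x)]

theorem enorm_comp_le_hilbertSchmidtNorm {x : M} (G : TangentSpace (𝓡 m) x →L[ℝ] Euc ν)
    (D : Euc m →L[ℝ] TangentSpace (𝓡 m) x) {C : ℝ≥0} (hD : ∀ v, ‖D v‖ₑ ≤ C * ‖v‖ₑ) :
    ‖G.comp D‖ₑ ≤ C * ENNReal.ofReal (hilbertSchmidtNorm G) := by
  have h0 := hilbertSchmidtNorm_nonneg G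
  rw [← ENNReal.ofReal_coe_nnreal, ← ENNReal.ofReal_mul C.coe_nonneg]
  refine enorm_clm_le (mul_nonneg C.coe_nonneg h0) fun v ↦ ?_
  have h1 : ‖D v‖ ≤ C * ‖v‖ := by
    have := hD v
    rw [← ofReal_norm, ← ofReal_norm, ← ENNReal.ofReal_coe_nnreal, ← ENNReal.ofReal_mul
        C.coe_nonneg] at this
    exact (ENNReal.ofReal_le_ofReal_iff (mul_nonneg C.coe_nonneg (norm_nonneg v))).1 this
  calc ‖G.comp D v‖ ≤ hilbertSchmidtNorm G * ‖D v‖ := norm_le_hilbertSchmidtNorm_mul G (D v)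
    _ ≤ hilbertSchmidtNorm G * (C * ‖v‖) := mul_le_mul_of_nonneg_left h1 h0
    _ = _ := by ring

theorem hilbertSchmidtNorm_comp_le {x : M} (H : Euc m →L[ℝ] Euc ν)
    (D : TangentSpace (𝓡 m) x →L[ℝ] Euc m) {C : ℝ≥0} (hD : ∀ v, ‖D v‖ₑ ≤ C * ‖v‖ₑ) :
    ENNReal.ofReal (hilbertSchmidtNorm (H.comp D)) ≤ ENNReal.ofReal (√m * C) * ‖H‖ₑ := by
  rw [← ofReal_norm, ← ENNReal.ofReal_mul (by positivity)]
  refine ENNReal.ofReal_le_ofReal ((hilbertSchmidtNorm_le _ (c := C * ‖H‖) (by positivity) fun v ↦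
      ?_).trans_eq
    (mul_assoc _ _ _).symm)
  have h1 : ‖D v‖ ≤ C * ‖v‖ := by
    have := hD v
    rw [← ofReal_norm, ← ofReal_norm, ← ENNReal.ofReal_coe_nnreal, ← ENNReal.ofReal_mul
        C.coe_nonneg] at this
    exact (ENNReal.ofReal_le_ofReal_iff (mul_nonneg C.coe_nonneg (norm_nonneg v))).1 this
  calc ‖H.comp D v‖ ≤ ‖H‖ * ‖D v‖ := H.le_opNorm (D v)
    _ ≤ ‖H‖ * (C * ‖v‖) := mul_le_mul_of_nonneg_left h1 (norm_nonneg _)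
    _ = _ := by ring

/-- The derivative of the inverse of the chart at `x₀`. -/
noncomputable def chartSymmDeriv (x₀ : M) (y : Euc m) :
    Euc m →L[ℝ] TangentSpace (𝓡 m) ((chartAt (Euc m) x₀).symm y) :=
  mfderiv (𝓡 m) (𝓡 m) (chartAt (Euc m) x₀).symm y

/-- The derivative of the chart at `x₀`. -/
noncomputable def chartDeriv (x₀ : M) (x : M) : TangentSpace (𝓡 m) x →L[ℝ] Euc m :=
  mfderiv (𝓡 m) (𝓡 m) (chartAt (Euc m) x₀) x

theorem IsLipschitzChartBall.enorm_chartSymmDeriv_le {x₀ : M} {C : ℝ≥0} {ρ : ℝ}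
    (h : IsLipschitzChartBall (m := m) x₀ C ρ) {y : Euc m} (hy : y ∈ Metric.ball (chartAt (Euc m) x₀
        x₀) ρ)
    (v : Euc m) : ‖chartSymmDeriv x₀ y v‖ₑ ≤ C * ‖v‖ₑ :=
  (h.mfderiv_symm_le y hy v).trans_eq (congrArg _ (enorm_tangentSpace_euc y v))

theorem IsLipschitzChartBall.enorm_chartDeriv_le {x₀ : M} {C : ℝ≥0} {ρ : ℝ}
    (h : IsLipschitzChartBall (m := m) x₀ C ρ) {x : M} (hx : x ∈ chartBall m x₀ ρ)
    (v : TangentSpace (𝓡 m) x) : ‖chartDeriv x₀ x v‖ₑ ≤ C * ‖v‖ₑ :=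
  (enorm_tangentSpace_euc _ _).symm.trans_le (h.mfderiv_le x hx v)

variable [MeasurableSpace M] [BorelSpace M]

/-- The first-order energy in a chart is finite if the first-order energy on the manifold is. -/
theorem IsLipschitzChartBall.gradEnergy_lt_top_of_transplant {x₀ : M} {C : ℝ≥0} {ρ : ℝ}
    (h : IsLipschitzChartBall (m := m) x₀ C ρ) {p : ℝ} (hp : 0 ≤ p) {β : Euc ν} {u : Euc m → Euc ν}
    (hE : dirichletEnergy (m := m) p (transplant x₀ ρ β u) (univ : Set M) < ⊤) :
    gradEnergy p u (Metric.ball (chartAt (Euc m) x₀ x₀) ρ) < ⊤ := by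
  simp only [dirichletEnergy, iInf_lt_iff] at hE
  obtain ⟨G, hG, hlt⟩ := hE
  rw [Measure.restrict_univ] at hlt
  have hw := HasWeakDerivOn.mono (hG x₀) (Ω' := Metric.ball (chartAt (Euc m) x₀ x₀) ρ)
    (subset_inter h.subset_target (subset_univ _))
  have hw' : HasWeakDerivOn u
      (fun y ↦ (G ((chartAt (Euc m) x₀).symm y)).comp (chartSymmDeriv x₀ y))
      (Metric.ball (chartAt (Euc m) x₀ x₀) ρ) := hw.congr_ae measurableSet_ball (by
    filter_upwards [ae_restrict_mem measurableSet_ball] with y hy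
    exact h.transplant_symm hy) .rfl
  refine (hw'.gradEnergy_le p).trans_lt ?_
  have hCp : (C : ℝ≥0∞) ^ p < ⊤ := ENNReal.rpow_lt_top_of_nonneg hp ENNReal.coe_ne_top
  have hle : ∀ y ∈ Metric.ball (chartAt (Euc m) x₀ x₀) ρ,
      ‖(G ((chartAt (Euc m) x₀).symm y)).comp (chartSymmDeriv x₀ y)‖ₑ ^ p ≤
      (C : ℝ≥0∞) ^ p * ENNReal.ofReal (hilbertSchmidtNorm (G ((chartAt (Euc m) x₀).symm y)) ^ p) :=
          by
    intro y hy
    rw [← ENNReal.ofReal_rpow_of_nonneg (hilbertSchmidtNorm_nonneg _) hp, ←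
        ENNReal.mul_rpow_of_nonneg _ _ hp]
    exact ENNReal.rpow_le_rpow (enorm_comp_le_hilbertSchmidtNorm _ _ (h.enorm_chartSymmDeriv_le hy))
        hp
  refine (setLIntegral_mono' measurableSet_ball hle).trans_lt ?_
  rw [lintegral_const_mul' _ _ hCp.ne]
  refine ENNReal.mul_lt_top hCp ((h.setLIntegral_comp_symm_le fun x ↦
    ENNReal.ofReal (hilbertSchmidtNorm (G x) ^ p)).trans_lt ?_)
  exact ENNReal.mul_lt_top (ENNReal.pow_lt_top ENNReal.coe_lt_top)
    ((setLIntegral_le_lintegral _ _).trans_lt hlt)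

end

/-! ### Weak derivatives of transplanted maps -/

section
variable {m ν : ℕ} {M : Type*} [EMetricSpace M] [ChartedSpace (Euc m) M]

open Classical in
/-- The derivative of the map transplanted from a map with derivative `H` to the manifold. -/
noncomputable def transplantDeriv (x₀ : M) (ρ : ℝ) (H : Euc m → Euc m →L[ℝ] Euc ν) (x : M) :
    TangentSpace (𝓡 m) x →L[ℝ] Euc ν :=
  if x ∈ chartBall m x₀ ρ then (H (chartAt (Euc m) x₀ x)).comp (chartDeriv x₀ x) else 0

theorem transplantDeriv_eq_zero {x₀ : M} {ρ ρ' : ℝ} {H : Euc m → Euc m →L[ℝ] Euc ν}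
    (hH : ∀ y ∉ Metric.closedBall (chartAt (Euc m) x₀ x₀) ρ', H y = 0) {x : M}
    (hx : x ∉ (chartAt (Euc m) x₀).symm '' Metric.closedBall (chartAt (Euc m) x₀ x₀) ρ') :
    transplantDeriv x₀ ρ H x = 0 := by
  by_cases h : x ∈ chartBall m x₀ ρ
  · refine (if_pos h).trans ?_
    rw [hH _ fun hy ↦ hx ⟨_, hy, (chartAt (Euc m) x₀).left_inv h.1⟩]
    exact ContinuousLinearMap.zero_comp _
  · exact if_neg h

variable [IsManifold (𝓡 m) ∞ M]

theorem contMDiffAt_chartAt_of_mem {x₀ x : M} (hx : x ∈ (chartAt (Euc m) x₀).source) :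
    ContMDiffAt (𝓡 m) (𝓡 m) 1 (chartAt (Euc m) x₀) x :=
  (contMDiffOn_chart (n := 1)).contMDiffAt ((chartAt (Euc m) x₀).open_source.mem_nhds hx)

theorem contMDiffAt_chartAt_symm_of_mem {x₀ : M} {y : Euc m} (hy : y ∈ (chartAt (Euc m) x₀).target)
    :
    ContMDiffAt (𝓡 m) (𝓡 m) 1 (chartAt (Euc m) x₀).symm y :=
  (contMDiffOn_chart_symm (n := 1)).contMDiffAt ((chartAt (Euc m) x₀).open_target.mem_nhds hy)

theorem contDiffAt_transition {x₀ x₁ : M} {y : Euc m} (hy : y ∈ (chartAt (Euc m) x₁).target)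
    (hy' : (chartAt (Euc m) x₁).symm y ∈ (chartAt (Euc m) x₀).source) :
    ContDiffAt ℝ 1 (chartAt (Euc m) x₀ ∘ (chartAt (Euc m) x₁).symm) y :=
  ((contMDiffAt_chartAt_of_mem hy').comp y (contMDiffAt_chartAt_symm_of_mem hy)).contDiffAt

theorem fderiv_transition {x₀ x₁ : M} {y : Euc m} (hy : y ∈ (chartAt (Euc m) x₁).target)
    (hy' : (chartAt (Euc m) x₁).symm y ∈ (chartAt (Euc m) x₀).source) :
    fderiv ℝ (chartAt (Euc m) x₀ ∘ (chartAt (Euc m) x₁).symm) y =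
      (chartDeriv x₀ ((chartAt (Euc m) x₁).symm y)).comp (chartSymmDeriv x₁ y) := by
  rw [← mfderiv_eq_fderiv]
  exact mfderiv_comp y ((contMDiffAt_chartAt_of_mem hy').mdifferentiableAt one_ne_zero)
    ((contMDiffAt_chartAt_symm_of_mem hy).mdifferentiableAt one_ne_zero)

variable [RiemannianBundle (fun x : M ↦ TangentSpace (𝓡 m) x)]

/-- The weak derivative of a transplanted map. -/
theorem IsLipschitzChartBall.hasWeakMDerivOn_transplant {x₀ : M} {C : ℝ≥0} {ρ ρ' : ℝ}
    (h : IsLipschitzChartBall (m := m) x₀ C ρ) (hρ : ρ' < ρ) {u : Euc m → Euc ν}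
    {H : Euc m → Euc m →L[ℝ] Euc ν} {β : Euc ν} (huH : HasWeakDerivOn u H univ)
    (hu : StronglyMeasurable u) (hH : StronglyMeasurable H)
    (hub : ∀ y ∉ Metric.closedBall (chartAt (Euc m) x₀ x₀) ρ', u y = β)
    (hH0 : ∀ y ∉ Metric.closedBall (chartAt (Euc m) x₀ x₀) ρ', H y = 0) :
    HasWeakMDerivOn (transplant x₀ ρ β u) (transplantDeriv x₀ ρ H) (univ : Set M) := by
  intro x₁
  have hΩ : IsOpen ((chartAt (Euc m) x₁).target ∩ (chartAt (Euc m) x₁).symm ⁻¹' univ) := by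
    rw [preimage_univ, inter_univ]; exact (chartAt (Euc m) x₁).open_target
  refine HasWeakDerivOn.of_local (fun y hy ↦ ?_) hΩ
  have hV : IsOpen ((chartAt (Euc m) x₁).target ∩ (chartAt (Euc m) x₁).symm ⁻¹' chartBall m x₀ ρ) :=
    (chartAt (Euc m) x₁).isOpen_inter_preimage_symm (isOpen_chartBall x₀ ρ)
  -- Inside the chart ball the transition map is a local `C¹` diffeomorphism and the chain rule
  -- applies. Any other point lies off the compact image `K`, in an open set where the map is
  -- constant.
  by_cases hyU : (chartAt (Euc m) x₁).symm y ∈ chartBall m x₀ ρ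
  · have hS : ContDiffAt ℝ 1 (chartAt (Euc m) x₁ ∘ (chartAt (Euc m) x₀).symm)
        ((chartAt (Euc m) x₀ ∘ (chartAt (Euc m) x₁).symm) y) := by
      refine contDiffAt_transition ((chartAt (Euc m) x₀).map_source hyU.1) ?_
      rw [Function.comp_apply, (chartAt (Euc m) x₀).left_inv hyU.1]
      exact (chartAt (Euc m) x₁).map_target hy.1
    obtain ⟨O, hO, hyO, hOV, hw⟩ := huH.exists_comp_diffeo hu hH (hV.mem_nhds ⟨hy.1, hyU⟩)
      (contDiffAt_transition hy.1 hyU.1) hS (fun z hz ↦ by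
        rw [Function.comp_apply, Function.comp_apply, (chartAt (Euc m) x₀).left_inv hz.2.1,
          (chartAt (Euc m) x₁).right_inv hz.1])
      (isCompact_closedBall (chartAt (Euc m) x₀ x₀) ρ) (fun z hz ↦ Metric.ball_subset_closedBall
          hz.2.2)
    refine ⟨O, hO, hyO, (hw.mono inter_subset_left).congr_ae (hO.inter hΩ).measurableSet ?_ ?_⟩
    · filter_upwards [ae_restrict_mem (hO.inter hΩ).measurableSet] with z hz
      exact (transplant_of_mem (hOV hz.1).2).symm
    · filter_upwards [ae_restrict_mem (hO.inter hΩ).measurableSet] with z hz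
      have hzU := (hOV hz.1).2
      have e1 : transplantDeriv x₀ ρ H ((chartAt (Euc m) x₁).symm z) =
        (H (chartAt (Euc m) x₀ ((chartAt (Euc m) x₁).symm z))).comp
          (chartDeriv x₀ ((chartAt (Euc m) x₁).symm z)) := if_pos hzU
      have e2 := fderiv_transition (hOV hz.1).1 hzU.1
      refine (congrArg (H (chartAt (Euc m) x₀ ((chartAt (Euc m) x₁).symm z))).comp e2).trans ?_
      exact (congrArg (fun L : TangentSpace (𝓡 m) ((chartAt (Euc m) x₁).symm z) →L[ℝ] Euc ν ↦
        L.comp (chartSymmDeriv x₁ z)) e1).symm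
  · set K := (chartAt (Euc m) x₀).symm '' Metric.closedBall (chartAt (Euc m) x₀ x₀) ρ'
    have hKc : IsOpen Kᶜ := (h.isCompact_image hρ).isClosed.isOpen_compl
    have hO : IsOpen ((chartAt (Euc m) x₁).target ∩ (chartAt (Euc m) x₁).symm ⁻¹' Kᶜ) :=
      (chartAt (Euc m) x₁).isOpen_inter_preimage_symm hKc
    refine ⟨_, hO, ⟨hy.1, fun hyK ↦ hyU (h.image_subset hρ hyK)⟩,
      (hasWeakDerivOn_const β _).congr_ae (hO.inter hΩ).measurableSet ?_ ?_⟩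
    · filter_upwards [ae_restrict_mem (hO.inter hΩ).measurableSet] with z hz
      exact (transplant_eq_of_notMem_image hub hz.1.2).symm
    · filter_upwards [ae_restrict_mem (hO.inter hΩ).measurableSet] with z hz
      have e1 := transplantDeriv_eq_zero (ρ := ρ) hH0 hz.1.2
      exact ((congrArg (fun L : TangentSpace (𝓡 m) ((chartAt (Euc m) x₁).symm z) →L[ℝ] Euc ν ↦
        L.comp (chartSymmDeriv x₁ z)) e1).trans (ContinuousLinearMap.zero_comp _)).symm

variable [MeasurableSpace M] [BorelSpace M]

/-- A transplanted map has finite first-order energy. -/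
theorem IsLipschitzChartBall.dirichletEnergy_transplant_lt_top {x₀ : M} {C : ℝ≥0} {ρ ρ' : ℝ}
    (h : IsLipschitzChartBall (m := m) x₀ C ρ) (hρ : ρ' < ρ) {p : ℝ} (hp : 1 ≤ p) {u : Euc m → Euc
        ν}
    {β : Euc ν} (hu : StronglyMeasurable u)
    (hub : ∀ y ∉ Metric.closedBall (chartAt (Euc m) x₀ x₀) ρ', u y = β) (hE : gradEnergy p u univ <
        ⊤) :
    dirichletEnergy (m := m) p (transplant x₀ ρ β u) (univ : Set M) < ⊤ := by
  obtain ⟨H, huH, hH, hH0, hlt⟩ := exists_hasWeakDerivOn_eq_zero hE hub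
  have hp0 : 0 ≤ p := by linarith
  have hG : dirichletEnergy (m := m) p (transplant x₀ ρ β u) (univ : Set M) ≤
      ∫⁻ x in univ, ENNReal.ofReal (hilbertSchmidtNorm (transplantDeriv x₀ ρ H x) ^ p)
        ∂(riemannianVolume m M) := by
    unfold dirichletEnergy
    exact iInf₂_le (transplantDeriv x₀ ρ H) (h.hasWeakMDerivOn_transplant hρ huH hu hH hub hH0)
  refine hG.trans_lt ?_
  rw [Measure.restrict_univ]
  have hA : ENNReal.ofReal (√m * C) ^ p < ⊤ := ENNReal.rpow_lt_top_of_nonneg hp0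
      ENNReal.ofReal_ne_top
  have hle : ∀ x : M, ENNReal.ofReal (hilbertSchmidtNorm (transplantDeriv x₀ ρ H x) ^ p) ≤
      (chartBall m x₀ ρ).indicator
        (fun x ↦ ENNReal.ofReal (√m * C) ^ p * ‖H (chartAt (Euc m) x₀ x)‖ₑ ^ p) x := by
    intro x
    rw [← ENNReal.ofReal_rpow_of_nonneg (hilbertSchmidtNorm_nonneg _) hp0]
    by_cases hx : x ∈ chartBall m x₀ ρ
    · rw [indicator_of_mem hx, ← ENNReal.mul_rpow_of_nonneg _ _ hp0]
      have e : transplantDeriv x₀ ρ H x = (H (chartAt (Euc m) x₀ x)).comp (chartDeriv x₀ x) :=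
          if_pos hx
      rw [e]
      exact ENNReal.rpow_le_rpow (hilbertSchmidtNorm_comp_le _ _ (h.enorm_chartDeriv_le hx)) hp0
    · have e : transplantDeriv x₀ ρ H x = 0 := if_neg hx
      have h0 : hilbertSchmidtNorm (transplantDeriv x₀ ρ H x) ≤ 0 := by
        rw [e]
        refine (hilbertSchmidtNorm_le _ le_rfl fun v ↦ ?_).trans_eq (mul_zero _)
        simp
      rw [ENNReal.ofReal_eq_zero.2 h0, ENNReal.zero_rpow_of_pos (by linarith)]
      exact zero_le
  refine (lintegral_mono hle).trans_lt ?_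
  rw [lintegral_indicator (isOpen_chartBall x₀ ρ).measurableSet, lintegral_const_mul' _ _ hA.ne]
  refine ENNReal.mul_lt_top hA ((h.setLIntegral_comp_chart_le fun y ↦ ‖H y‖ₑ ^ p).trans_lt ?_)
  exact ENNReal.mul_lt_top (ENNReal.pow_lt_top ENNReal.coe_lt_top)
    ((setLIntegral_le_lintegral _ _).trans_lt hlt)

end

/-! ### Transfer of the counterexample to a compact manifold -/

section
variable {m ν κ : ℕ} {N : Type*} [EMetricSpace N] [MeasurableSpace N] [BorelSpace N]
  [SecondCountableTopology N] {F : Type*} [EMetricSpace F] [MeasurableSpace F]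

/-- If maps of finite energy on `ℝ^m`, constant outside arbitrarily small balls, have images of
infinite
energy, then so does some map on a given compact manifold. -/
theorem exists_memSobolev_comp_notMem (hm : 1 ≤ m) (M : Type*) [EMetricSpace M] [ChartedSpace (Euc
    m) M]
    [IsManifold (𝓡 m) ∞ M] [RiemannianBundle (fun x : M ↦ TangentSpace (𝓡 m) x)]
    [IsContMDiffRiemannianBundle (𝓡 m) ∞ (Euc m) (fun x : M ↦ TangentSpace (𝓡 m) x)]
    [IsRiemannianManifold (𝓡 m) M] [MeasurableSpace M] [BorelSpace M] [CompactSpace M] [Nonempty M]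
    {ιN : N → Euc ν} {ιF : F → Euc κ} {s p r q : ℝ} (hs : 0 < s) (hr : 0 < r) (hp : 1 ≤ p) (hq : 1 ≤
        q)
    (hι : s = 1 → Continuous ιN) {f : N → F} {b : N}
    (h : ∀ (x₀ : Euc m) {δ : ℝ}, 0 < δ → ∃ u : Euc m → N, Measurable u ∧ (∀ x ∉ Metric.ball x₀ δ, u
        x = b) ∧
      eucEnergy ιN s p u univ < ⊤ ∧ eucEnergy ιF r q (f ∘ u) (Metric.ball x₀ δ) = ⊤) :
    ∃ u : M → N, MemSobolev m ιN s p u ∧ ¬ MemSobolev m ιF r q (f ∘ u) := by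
  obtain ⟨x₀⟩ := ‹Nonempty M›
  have := isFiniteMeasure_riemannianVolume m (M := M)
  obtain ⟨C, ρ, hρ⟩ := exists_isLipschitzChartBall (m := m) x₀
  -- Half the radius keeps the set where `u ≠ b` compactly inside the chart ball, so that the
  -- extension by `b` creates no singularity at its boundary.
  obtain ⟨u, hu, hub, hE, hG⟩ := h (chartAt (Euc m) x₀ x₀) (half_pos hρ.pos)
  have hub' : ∀ y ∉ Metric.closedBall (chartAt (Euc m) x₀ x₀) (ρ / 2), u y = b := fun y hy ↦
    hub y fun hy' ↦ hy (Metric.ball_subset_closedBall hy')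
  have hρ2 : ρ / 2 < ρ := half_lt_self hρ.pos
  refine ⟨transplant x₀ ρ b u, ⟨(measurable_transplant x₀ ρ b hu).aemeasurable, ?_⟩, fun hmem ↦ ?_⟩
  · by_cases hs1 : s = 1
    · subst hs1
      rw [eucEnergy_one] at hE
      rw [sobolevEnergy, if_pos rfl]
      refine (congrArg (dirichletEnergy (m := m) p · (univ : Set M)) (comp_transplant ιN x₀ ρ b
          u)).trans_lt ?_
      exact hρ.dirichletEnergy_transplant_lt_top hρ2 hp ((hι rfl).measurable.comp
          hu).stronglyMeasurable
        (fun y hy ↦ congrArg ιN (hub' y hy)) hE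
    · rw [eucEnergy_of_ne ιN hs1] at hE
      rw [sobolevEnergy, if_neg hs1]
      exact hρ.gagliardoEnergy_transplant_lt_top hm hρ2 hs hp hu hub' hE
  · have hlt := hmem.2
    have hG' : eucEnergy ιF r q (f ∘ u) (Metric.ball (chartAt (Euc m) x₀ x₀) ρ) = ⊤ :=
      top_le_iff.1 (hG.symm.trans_le (eucEnergy_mono ιF r q _ (Metric.ball_subset_ball hρ2.le)))
    rw [comp_transplant] at hlt
    refine hG'.not_lt ?_
    by_cases hr1 : r = 1
    · subst hr1
      rw [sobolevEnergy, if_pos rfl] at hlt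
      rw [eucEnergy_one]
      refine hρ.gradEnergy_lt_top_of_transplant (by linarith) (β := ιF (f b)) (lt_of_eq_of_lt ?_
          hlt)
      exact congrArg (dirichletEnergy (m := m) q · (univ : Set M)) (comp_transplant ιF x₀ ρ (f b) (f
          ∘ u)).symm
    · rw [sobolevEnergy, if_neg hr1] at hlt
      rw [eucEnergy_of_ne ιF hr1]
      refine (hρ.gagEnergy_le_transplant (by positivity) (f b) (f ∘ u)).trans_lt ?_
      exact ENNReal.mul_lt_top (ENNReal.rpow_lt_top_of_nonneg (by positivity) ENNReal.coe_ne_top)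
        (ENNReal.mul_lt_top (ENNReal.pow_lt_top ENNReal.coe_lt_top)
          (ENNReal.mul_lt_top (ENNReal.pow_lt_top ENNReal.coe_lt_top) hlt))

end

theorem mainTheorem7 (m n k ν κ : ℕ) (s r p q : ℝ)
    (hm : 1 ≤ m) (hs : 0 < s) (hs1 : s ≤ 1) (hr : 0 < r) (hr1 : r ≤ 1) (hp : 1 ≤ p) (hq : 1 ≤ q)
    -- the connected Riemannian manifold `N`
    (N : Type*) [EMetricSpace N] [ChartedSpace (Euc n) N] [IsManifold (𝓡 n) ∞ N]
    [RiemannianBundle (fun x : N ↦ TangentSpace (𝓡 n) x)]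
    [IsContMDiffRiemannianBundle (𝓡 n) ∞ (Euc n) (fun x : N ↦ TangentSpace (𝓡 n) x)]
    [IsRiemannianManifold (𝓡 n) N] [SecondCountableTopology N]
    [MeasurableSpace N] [BorelSpace N] [ConnectedSpace N]
    -- the Riemannian manifold `F`
    (F : Type*) [EMetricSpace F] [ChartedSpace (Euc k) F] [IsManifold (𝓡 k) ∞ F]
    [RiemannianBundle (fun x : F ↦ TangentSpace (𝓡 k) x)]
    [IsContMDiffRiemannianBundle (𝓡 k) ∞ (Euc k) (fun x : F ↦ TangentSpace (𝓡 k) x)]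
    [IsRiemannianManifold (𝓡 k) F] [SecondCountableTopology F]
    [MeasurableSpace F] [BorelSpace F]
    -- the isometric embeddings through which first-order energies are defined
    (ιN : N → Euc ν) (hιN : s = 1 → IsRiemannianEmbedding (n := n) ιN)
    (ιF : F → Euc κ) (hιF : r = 1 → IsRiemannianEmbedding (n := k) ιF)
    (hN : (m < s * p ∨ (s = 1 ∧ p = 1 ∧ m = 1)) → CompactSpace N)
    (hrq : r * q = s * p)
    (f : N → F) (hf : Measurable f)
    -- `f ∘ u ∈ W^{r,q}(M, F)` for every `u ∈ W^{s,p}(M, N)`, with `M = ℝ^m` or `M` compact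
    (hact : (∀ u : Euc m → N, MemSobolev m ιN s p u → MemSobolev m ιF r q (f ∘ u)) ∨
      ∃ (M : Type*) (_ : EMetricSpace M) (_ : ChartedSpace (Euc m) M)
        (_ : IsManifold (𝓡 m) ∞ M)
        (_ : RiemannianBundle (fun x : M ↦ TangentSpace (𝓡 m) x))
        (_ : IsContMDiffRiemannianBundle (𝓡 m) ∞ (Euc m) (fun x : M ↦ TangentSpace (𝓡 m) x))
        (_ : IsRiemannianManifold (𝓡 m) M) (_ : MeasurableSpace M) (_ : BorelSpace M)
        (_ : CompactSpace M) (_ : Nonempty M),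
        ∀ u : M → N, MemSobolev m ιN s p u → MemSobolev m ιF r q (f ∘ u)) :
    ∃ C : ℝ≥0, 0 < C ∧ ∀ u : Euc m → N,
      AEMeasurable u (volume.restrict (Metric.ball 0 1)) →
      (s * p < m ∨ sobolevEnergy m ιN s p u (Metric.ball 0 1) ≤ (C : ℝ≥0∞)⁻¹) →
      sobolevEnergy m ιF r q (f ∘ u) (Metric.ball 0 1)
        ≤ C * sobolevEnergy m ιN s p u (Metric.ball 0 1) := by
  by_contra hcon
  have hp0 : 0 ≤ p := by linarith
  have hq0 : 0 ≤ q := by linarith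
  have hbad := mt (exists_sobolevEnergy_bound_of_eucEnergy (ιN := ιN) (ιF := ιF) (s := s) (r := r)
    (f := f) (P := s * p < m) (V := {u | AEMeasurable u (volume.restrict (Metric.ball 0 1))})
    hm hp0 hq0) hcon
  have hιN1 : s = 1 → LipschitzWith 1 ιN := fun h ↦ (hιN h).lipschitzWith
  obtain ⟨b, hb⟩ := exists_blocks hm n hs hs1 hp hq hιN1 hrq hN hf hbad
  -- The centre and radius remain free: on `ℝ^m` any ball will do, whereas on a manifold the
  -- counterexample must fit in a chart.
  have key := fun (x₀ : Euc m) {δ : ℝ} (hδ : 0 < δ) ↦ exists_infinite_of_blocks hm hp hq hb x₀ hδ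
  rcases hact with hact | ⟨M, _, _, _, _, _, _, _, _, _, _, hact⟩
  · obtain ⟨u, hu, -, hE, hG⟩ := key 0 one_pos
    obtain ⟨K, -, hK⟩ := exists_sobolevEnergy_le m hm hp0
    have hmem := hact u ⟨hu.aemeasurable,
      (hK ν N ιN s u univ isOpen_univ).trans_lt (ENNReal.mul_lt_top ENNReal.coe_lt_top hE)⟩
    refine hG.not_lt (lt_of_le_of_lt ?_ hmem.2)
    exact (eucEnergy_mono ιF r q _ (subset_univ _)).trans (eucEnergy_le_sobolevEnergy ιF r hq0 _ _)
  · obtain ⟨u, hu, hfu⟩ := exists_memSobolev_comp_notMem hm M hs hr hp hq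
      (fun h ↦ (hιN1 h).continuous) key
    exact hfu (hact u hu)
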